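/- Let $(M,g_{ab})$ be a spacetime: a connected, Hausdorff, second countable smooth 4-manifold with a smooth Lorentzian metric of signature $(+,-,-,-)$ and Levi-Civita connection $\nabla$. Let $F_{ab}$ be a smooth antisymmetric tensor field on $M$, and let $\gamma$ be a smooth timelike curve defined on a nondegenerate interval $I$, parametrized by arc length, with unit tangent $u^a$. We assume that $\gamma$ is simple (injective, or a simple closed curve traversed once) and that preimages in $I$ of compact subsets of $M$ are compact, so that in particular $\delta_\gamma$, given by $\delta_\gamma\{f\}=\int_I f(\gamma(s))\,ds$, is a distribution on $M$. A smooth symmetric field $T^{ab}$ satisfies the dominant energy condition if, at each point, $T^{ab}\xi_a\eta_b\ge 0$ for all co-oriented causal vectors $\xi^a,\eta^a$. A tensor $x_{ab}$ at a point satisfies the dual energy condition if it is a (possibly empty) sum of symmetrized outer products of co-oriented causal covectors; it is generic if $T^{ab}x_{ab}>0$ for every nonzero $T^{ab}$ at that point satisfying the dominant energy condition. A smooth field $T^{ab}$ or $J^a$ acts as a distribution on smooth compactly supported test fields $x_{ab}$, respectively $y_a$, by $\int_M T^{ab}x_{ab}\,dV_g$ and $\int_M J^a y_a\,dV_g$.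 A collection of fields $T^{ab}$ tracks $\gamma$ if, for every test field $x_{ab}$ that satisfies the dual energy condition in a neighborhood of $\gamma$ and is generic at some point of $\gamma$, some $T^{ab}$ in the collection satisfies $\int_M T^{ab}x_{ab}\,dV_g>0$. Let $\mathcal C$ be a collection of pairs $(T^{ab},J^a)$ of smooth fields on $M$ such that each $T^{ab}$ is symmetric and satisfies the dominant energy condition, each $J^a$ satisfies $\nabla_aJ^a=0$, and each pair satisfies $\nabla_bT^{ab}=F^a{}_bJ^b$, where $F^a{}_b=g^{an}F_{nb}$. Let $\kappa\ge 0$ bound the charge-to-mass ratio of $\mathcal C$: $|J^at_a|\le\kappa\,T^{ab}t_at_b$ for every pair in $\mathcal C$ and every unit timelike vector $t^a$ at every point. Suppose that the collection of all $T^{ab}$ occurring in $\mathcal C$ tracks $\gamma$. Then there is a number $\kappa'$ with $|\kappa'|\le\kappa$ such that: (1) some sequence of pairs $(\overset{n}{T}{}^{ab},\overset{n}{J}{}^a)$, each a positive multiple of an element of $\mathcal C$ (the same factor for both members of the pair), converges in the sense of distributions to $(u^au^b\delta_\gamma,\ \kappa'u^a\delta_\gamma)$; (2) $\gamma$ is a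 Lorentz force curve with charge-to-mass ratio $\kappa'$, that is, $u^n\nabla_nu^a=\kappa'F^a{}_bu^b$ along $\gamma$. -/

import Mathlib

open Set Filter MeasureTheory
open scoped Manifold ContDiff Topology

noncomputable section

namespace Spacetime

/-- The model space of a four-dimensional manifold. -/
abbrev E4 : Type := EuclideanSpace ℝ (Fin 4)

/-- The `i`-th standard basis vector of the model space. -/
def stdVec (i : Fin 4) : E4 := EuclideanSpace.single i (1 : ℝ)

/-- The `i`-th standard coordinate on the model space. -/
def stdCovec (i : Fin 4) : E4 →L[ℝ] ℝ := EuclideanSpace.proj i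

/-- The `i`-th partial derivative at `y` of a function on the model space. -/
def pd (i : Fin 4) (f : E4 → ℝ) (y : E4) : ℝ := fderiv ℝ f y (stdVec i)

section Tensors

variable (M : Type*) [TopologicalSpace M] [ChartedSpace E4 M]

/-- Vector fields `J^a`. -/
abbrev VecField := ∀ p : M, TangentSpace (𝓡 4) p

/-- Covector fields `y_a`. -/
abbrev CovField := ∀ p : M, TangentSpace (𝓡 4) p →L[ℝ] ℝ

/-- Covariant tensor fields `x_{ab}` of rank two: bilinear forms on the tangent spaces. -/
abbrev CovTensor :=
  ∀ p : M, TangentSpace (𝓡 4) p →L[ℝ] TangentSpace (𝓡 4) p →L[ℝ] ℝ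

/-- Contravariant tensor fields `T^{ab}` of rank two: bilinear forms on the cotangent spaces. -/
abbrev ContraTensor :=
  ∀ p : M, (TangentSpace (𝓡 4) p →L[ℝ] ℝ) →L[ℝ] (TangentSpace (𝓡 4) p →L[ℝ] ℝ) →L[ℝ] ℝ

end Tensors

section Components

variable {M : Type*} [TopologicalSpace M] [ChartedSpace E4 M]

/-- The coordinate vector `∂/∂y^i` of the chart `e`, at the point with coordinates `y`. -/
def frame (e : OpenPartialHomeomorph M E4) (y : E4) (i : Fin 4) :
    TangentSpace (𝓡 4) (e.symm y) :=
  mfderiv (𝓡 4) (𝓡 4) e.symm y (stdVec i)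

/-- The coordinate covector `dy^i` of the chart `e`, at the point with coordinates `y`. -/
def coframe (e : OpenPartialHomeomorph M E4) (y : E4) (i : Fin 4) :
    TangentSpace (𝓡 4) (e.symm y) →L[ℝ] ℝ :=
  (stdCovec i).comp (mfderiv (𝓡 4) (𝓡 4) e (e.symm y))

/-- Components `J^i` in a chart. -/
def vecComp (J : VecField M) (e : OpenPartialHomeomorph M E4) (i : Fin 4) (y : E4) : ℝ :=
  coframe e y i (J (e.symm y))

/-- Components `y_i` in a chart. -/
def covComp (w : CovField M) (e : OpenPartialHomeomorph M E4) (i : Fin 4) (y : E4) : ℝ :=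
  w (e.symm y) (frame e y i)

/-- Components `x_{ij}` in a chart. -/
def cov2Comp (x : CovTensor M) (e : OpenPartialHomeomorph M E4) (i j : Fin 4) (y : E4) : ℝ :=
  x (e.symm y) (frame e y i) (frame e y j)

/-- Components `T^{ij}` in a chart. -/
def contra2Comp (T : ContraTensor M) (e : OpenPartialHomeomorph M E4) (i j : Fin 4) (y : E4) : ℝ :=
  T (e.symm y) (coframe e y i) (coframe e y j)

/-! A tensor field is smooth if its components in every chart of the atlas are smooth. -/

def SmoothVec (J : VecField M) : Prop :=
  ∀ e ∈ atlas E4 M, ∀ i, ContDiffOn ℝ ∞ (vecComp J e i) e.target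

def SmoothCov (w : CovField M) : Prop :=
  ∀ e ∈ atlas E4 M, ∀ i, ContDiffOn ℝ ∞ (covComp w e i) e.target

def SmoothCov2 (x : CovTensor M) : Prop :=
  ∀ e ∈ atlas E4 M, ∀ i j, ContDiffOn ℝ ∞ (cov2Comp x e i j) e.target

def SmoothContra2 (T : ContraTensor M) : Prop :=
  ∀ e ∈ atlas E4 M, ∀ i j, ContDiffOn ℝ ∞ (contra2Comp T e i j) e.target

/-- Test fields `x_{ab}`: smooth, of compact support. -/
def IsTestCov2 (x : CovTensor M) : Prop :=
  SmoothCov2 x ∧ ∃ K : Set M, IsCompact K ∧ ∀ p, p ∉ K → x p = 0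

/-- Test fields `y_a`: smooth, of compact support. -/
def IsTestCov (w : CovField M) : Prop :=
  SmoothCov w ∧ ∃ K : Set M, IsCompact K ∧ ∀ p, p ∉ K → w p = 0

/-- The full contraction `T^{ab} x_{ab}` of tensors at `p`.  The tangent space at `p` is, as a
vector space, the model space, and the sum runs over the standard basis and its dual basis; the
value is the same for every other basis. -/
def contract {p : M}
    (T : (TangentSpace (𝓡 4) p →L[ℝ] ℝ) →L[ℝ] (TangentSpace (𝓡 4) p →L[ℝ] ℝ) →L[ℝ] ℝ)
    (x : TangentSpace (𝓡 4) p →L[ℝ] TangentSpace (𝓡 4) p →L[ℝ] ℝ) : ℝ :=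
  ∑ i : Fin 4, ∑ j : Fin 4, T (stdCovec i) (stdCovec j) * x (stdVec i) (stdVec j)

end Components

/-- A smooth Lorentzian metric, of signature `(+,-,-,-)`. -/
structure LorentzMetric (M : Type*) [TopologicalSpace M] [ChartedSpace E4 M] where
  /-- the metric tensor `g_{ab}` -/
  val : CovTensor M
  symm : ∀ p v w, val p v w = val p w v
  signature : ∀ p, ∃ b : Module.Basis (Fin 4) ℝ (TangentSpace (𝓡 4) p), ∀ i j,
    val p (b i) (b j) = if i = j then (if i = 0 then 1 else -1) else 0
  smooth : SmoothCov2 val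

section Geometry

variable {M : Type*} [TopologicalSpace M] [ChartedSpace E4 M] (g : LorentzMetric M)

/-- The matrix `g_{ij}` of the metric in a chart. -/
def metricMatrix (e : OpenPartialHomeomorph M E4) (y : E4) : Matrix (Fin 4) (Fin 4) ℝ :=
  Matrix.of fun i j => cov2Comp g.val e i j y

/-- The matrix `g^{ij}` of the inverse metric in a chart. -/
def invMetric (e : OpenPartialHomeomorph M E4) (y : E4) : Matrix (Fin 4) (Fin 4) ℝ :=
  (metricMatrix g e y)⁻¹

/-- The Christoffel symbols `Γ^i_{jk}` of the Levi-Civita connection in a chart. -/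
def christoffel (e : OpenPartialHomeomorph M E4) (i j k : Fin 4) (y : E4) : ℝ :=
  (1 / 2) * ∑ l, invMetric g e y i l *
    (pd j (cov2Comp g.val e l k) y + pd k (cov2Comp g.val e l j) y
      - pd l (cov2Comp g.val e j k) y)

/-- The divergence `∇_a J^a` in a chart. -/
def divVec (J : VecField M) (e : OpenPartialHomeomorph M E4) (y : E4) : ℝ :=
  ∑ i, (pd i (vecComp J e i) y + ∑ j, christoffel g e i i j y * vecComp J e j y)

/-- The `i`-th component of the divergence `∇_b T^{ab}` in a chart. -/
def divTensor (T : ContraTensor M) (e : OpenPartialHomeomorph M E4) (i : Fin 4) (y : E4) : ℝ :=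
  ∑ j, (pd j (contra2Comp T e i j) y
    + ∑ k, (christoffel g e i j k y * contra2Comp T e k j y
      + christoffel g e j j k y * contra2Comp T e i k y))

/-- The components `F^i_k = g^{il} F_{lk}` in a chart. -/
def mixedComp (F : CovTensor M) (e : OpenPartialHomeomorph M E4) (i k : Fin 4) (y : E4) : ℝ :=
  ∑ l, invMetric g e y i l * cov2Comp F e l k y

/-- `∇_a J^a = 0` -/
def IsDivFree (J : VecField M) : Prop :=
  ∀ e ∈ atlas E4 M, ∀ y ∈ e.target, divVec g J e y = 0

/-- `∇_b T^{ab} = F^a_b J^b` -/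
def SatisfiesForceLaw (F : CovTensor M) (T : ContraTensor M) (J : VecField M) : Prop :=
  ∀ e ∈ atlas E4 M, ∀ y ∈ e.target, ∀ i,
    divTensor g T e i y = ∑ k, mixedComp g F e i k y * vecComp J e k y

/-- The vectors `v` and `w` at `p` are causal (timelike or null), nonzero and co-oriented: they lie
on the same side as some common timelike vector. -/
def CoOriented (p : M) (v w : TangentSpace (𝓡 4) p) : Prop :=
  0 ≤ g.val p v v ∧ 0 ≤ g.val p w w ∧
    ∃ t : TangentSpace (𝓡 4) p, 0 < g.val p t t ∧ 0 < g.val p t v ∧ 0 < g.val p t w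

/-- The dominant energy condition at `p` for a symmetric tensor `T^{ab}`:
`T^{ab} ξ_a η_b ≥ 0` for all co-oriented causal vectors `ξ^a`, `η^a`. -/
def DominantAt (p : M)
    (T : (TangentSpace (𝓡 4) p →L[ℝ] ℝ) →L[ℝ] (TangentSpace (𝓡 4) p →L[ℝ] ℝ) →L[ℝ] ℝ) :
    Prop :=
  (∀ ξ η, T ξ η = T η ξ) ∧ ∀ v w, CoOriented g p v w → 0 ≤ T (g.val p v) (g.val p w)

/-- The dual energy condition at `p`: `x_{ab}` is a (finite, possibly empty) sum of symmetrized
outer products of co-oriented causal covectors. -/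
def DualEnergyAt (p : M) (x : TangentSpace (𝓡 4) p →L[ℝ] TangentSpace (𝓡 4) p →L[ℝ] ℝ) :
    Prop :=
  ∃ (n : ℕ) (v w : Fin n → TangentSpace (𝓡 4) p), (∀ i, CoOriented g p (v i) (w i)) ∧
    ∀ a b, x a b = ∑ i, (g.val p (v i) a * g.val p (w i) b + g.val p (w i) a * g.val p (v i) b) / 2

/-- `x_{ab}` is generic at `p`: `T^{ab} x_{ab} > 0` for every nonzero `T^{ab}` at `p` satisfying
the dominant energy condition. -/
def GenericAt (p : M) (x : TangentSpace (𝓡 4) p →L[ℝ] TangentSpace (𝓡 4) p →L[ℝ] ℝ) : Prop :=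
  ∀ T, DominantAt g p T → T ≠ 0 → 0 < contract T x

/-- The velocity of a curve. -/
def velocity (γ : ℝ → M) (s : ℝ) : TangentSpace (𝓡 4) (γ s) :=
  mfderiv 𝓘(ℝ, ℝ) (𝓡 4) γ s (1 : ℝ)

/-- `γ`, restricted to the nondegenerate interval `I`, is a smooth timelike curve parametrized by
arc length (proper time), properly embedded in the spacetime: either it is injective on `I`, or it
is a simple closed curve traversed once; and it meets compact sets in compact parameter sets.
Smoothness on an interval with end points means smoothness on a larger open set. -/
structure IsTimelikeCurve (γ : ℝ → M) (I : Set ℝ) : Prop where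
  interval : I.OrdConnected
  nontrivial : I.Nontrivial
  smooth : ∃ U : Set ℝ, IsOpen U ∧ I ⊆ U ∧ ContMDiffOn 𝓘(ℝ, ℝ) (𝓡 4) ∞ γ U
  unit_speed : ∀ s ∈ I, g.val (γ s) (velocity γ s) (velocity γ s) = 1
  simple : InjOn γ I ∨
    ∃ a b : ℝ, a < b ∧ I = Icc a b ∧ Function.Periodic γ (b - a) ∧ InjOn γ (Ico a b)
  proper : ∀ K : Set M, IsCompact K → IsCompact (I ∩ γ ⁻¹' K)

/-- The coordinates of a curve in a chart. -/
def curveCoord (γ : ℝ → M) (e : OpenPartialHomeomorph M E4) (i : Fin 4) (s : ℝ) : ℝ :=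
  stdCovec i (e (γ s))

/-- The curve satisfies `u^n ∇_n u^a = κ F^a_b u^b`: it is a Lorentz force curve with
charge-to-mass ratio `κ`. -/
def IsLorentzForceCurve (F : CovTensor M) (κ : ℝ) (γ : ℝ → M) (I : Set ℝ) : Prop :=
  ∀ e ∈ atlas E4 M, ∀ s ∈ I, γ s ∈ e.source → ∀ i,
    deriv (deriv (curveCoord γ e i)) s
      + ∑ j, ∑ k, christoffel g e i j k (e (γ s))
          * deriv (curveCoord γ e j) s * deriv (curveCoord γ e k) s
      = κ * ∑ k, mixedComp g F e i k (e (γ s)) * deriv (curveCoord γ e k) s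

/-- The number `κ` bounds the charge-to-mass ratio of the collection `C`: `|J^a t_a| ≤ κ T^{ab} t_a t_b`
for every unit timelike `t^a` at every point. -/
def BoundsChargeToMass (κ : ℝ) (C : Set (ContraTensor M × VecField M)) : Prop :=
  ∀ P ∈ C, ∀ (p : M) (t : TangentSpace (𝓡 4) p), g.val p t t = 1 →
    |g.val p t (P.2 p)| ≤ κ * P.1 p (g.val p t) (g.val p t)

end Geometry

section Integration

variable {M : Type*} [TopologicalSpace M] [ChartedSpace E4 M]

theorem exists_chart_cover [SecondCountableTopology M] [Nonempty M] :
    ∃ c : ℕ → M, (⋃ n, (chartAt E4 (c n)).source) = univ := by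
  obtain ⟨s, hs, hU⟩ := TopologicalSpace.countable_cover_nhds
    (f := fun x : M => (chartAt E4 x).source) (fun x => chart_source_mem_nhds E4 x)
  have hne : s.Nonempty := by
    rcases s.eq_empty_or_nonempty with h | h
    · simp [h] at hU
      exact absurd hU.symm (Set.empty_ne_univ).symm
    · exact h
  obtain ⟨c, rfl⟩ := hs.exists_eq_range hne
  exact ⟨c, by simpa using hU⟩

variable [MeasurableSpace M] (g : LorentzMetric M)

/-- The measure `√|det g_{ij}| dy` of a chart, as a measure on the manifold, carried by the domain
of the chart. -/
def chartVolume (e : OpenPartialHomeomorph M E4) : Measure M :=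
  Measure.map e.symm (((volume : Measure E4).restrict e.target).withDensity
    fun y => ENNReal.ofReal (Real.sqrt |(metricMatrix g e y).det|))

/-- The volume measure of the metric.  On the domain of every chart it is `√|det g_{ij}| dy`; it is
obtained by cutting the manifold into countably many disjoint pieces, each in the domain of a chart,
and by the change of variables formula it does not depend on how this is done. -/
def volumeMeasure [SecondCountableTopology M] [Nonempty M] : Measure M :=
  Measure.sum fun n : ℕ =>
    (chartVolume g (chartAt E4 ((exists_chart_cover (M := M)).choose n))).restrict
      (disjointed (fun m => (chartAt E4 ((exists_chart_cover (M := M)).choose m)).source) n)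

variable [SecondCountableTopology M] [Nonempty M]

/-- The action `∫ T^{ab} x_{ab}` of a tensor field, as a distribution, on a test field. -/
def tensorAction (T : ContraTensor M) (x : CovTensor M) : ℝ :=
  ∫ p, contract (T p) (x p) ∂(volumeMeasure g)

/-- The action `∫ J^a y_a` of a vector field, as a distribution, on a test field. -/
def vecAction (J : VecField M) (w : CovField M) : ℝ :=
  ∫ p, w p (J p) ∂(volumeMeasure g)

/-- The action of the distribution `u^a u^b δ_γ` on the test field `x_{ab}`. -/
def tensorDelta (γ : ℝ → M) (I : Set ℝ) (x : CovTensor M) : ℝ :=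
  ∫ s in I, x (γ s) (velocity γ s) (velocity γ s)

/-- The action of the distribution `u^a δ_γ` on the test field `y_a`. -/
def vecDelta (γ : ℝ → M) (I : Set ℝ) (w : CovField M) : ℝ :=
  ∫ s in I, w (γ s) (velocity γ s)

/-- The collection `C` of tensor fields `T^{ab}` tracks the curve: for every test field `x_{ab}`
that satisfies the dual energy condition in a neighborhood of the curve and is generic at some point
of it, some member of `C` acts on `x_{ab}` with a positive value. -/
def Tracks (C : Set (ContraTensor M)) (γ : ℝ → M) (I : Set ℝ) : Prop :=
  ∀ x : CovTensor M, IsTestCov2 x →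
    (∃ O : Set M, IsOpen O ∧ γ '' I ⊆ O ∧ ∀ p ∈ O, DualEnergyAt g p (x p)) →
    (∃ s ∈ I, GenericAt g (γ s) (x (γ s))) →
    ∃ T ∈ C, 0 < tensorAction g T x

/-- The sequence of pairs of fields converges, in the sense of distributions, to
`(u^a u^b δ_γ, κ u^a δ_γ)`. -/
def ConvergesToCharge (S : ℕ → ContraTensor M × VecField M) (κ : ℝ) (γ : ℝ → M) (I : Set ℝ) :
    Prop :=
  (∀ x : CovTensor M, IsTestCov2 x →
    Tendsto (fun n => tensorAction g (S n).1 x) atTop (𝓝 (tensorDelta γ I x))) ∧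
  (∀ w : CovField M, IsTestCov w →
    Tendsto (fun n => vecAction g (S n).2 w) atTop (𝓝 (κ * vecDelta γ I w)))

end Integration

end Spacetime

end

/-!
The proof studies the functionals `x ↦ ∫ T x`, `w ↦ ∫ J w` defined by the pairs of the collection
(`IsMatter` collects their properties), and shows that a suitably normalized sequence of them can
only converge to a charged point particle on `γ`.

*Concentration.*  Fix a test field `Φ = ψ ℓ ⊗ ℓ` with `ℓ` timelike, supported near a point of `γ`,
and nonnegative test fields `Ψ₀, Ψ₁, …` that exhaust `M \ γ`.  The field `Φ - n (Ψ₀ + ⋯ + Ψₙ)` has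
the dual energy condition near `γ` and is generic at a point of `γ`, so tracking provides a pair on
which it is positive.  Scaled to have value one on `Φ`, these pairs tend to zero off `γ`
(`exists_concentrating_sequence`).

*Bounds.*  The dominant energy condition and the bound `κ` make the value of a tensor on `ℓ ⊗ ℓ`,
`ℓ` timelike, control all components of `T` and of `J` (`exists_energyMatrix_bound`), so that
suitable nonnegative test fields dominate the matter on a given compact set (`exists_dominating`,
`IsMatter.exists_le_of_dominates`).  Testing the force law against `f(τ) χ dτ`, with `f` growing
fast, gives an energy estimate (`exists_energy_estimate`) that carries bounds along the curve
(`CurveChart.exists_propagation`).  As the curve is connected and the pairs tend to zero off it,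
the sequence is bounded on every test field (`IsTimelikeCurve.boundedNear_everywhere`).

*Structure of the limits.*  Hence the sequence has a limit along each ultrafilter, and this limit is
of order zero, vanishes off `γ` and obeys the force law and the conservation of charge.  A
distribution `N` of order zero carried by a curve with `div N = 0` annihilates `φ h` for `h`
vanishing on the curve, hence is tangent to the curve with a constant coefficient; the same argument
applies to `L` with `div L = -F N`, whose coefficient is constant since the curve has unit speed and
`F` is antisymmetric; near an end point both coefficients vanish (`curve_structure`).  Thus the
limit is `(m u u δ, q u δ)` near each point, with `m ∇_u u = q F u` (`exists_isPointMatter`).  By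
connectedness `m` and `q` are constant along `γ`, and `|q| ≤ κ m` (`IsMatter.exists_mass_charge`).

*Convergence.*  The normalization on `Φ` fixes `m > 0`, and the same `m` serves for all ultrafilters.
The value of `q` is fixed by passing to a subsequence on which the currents converge on one test
field that detects `γ`.  Along this subsequence all ultrafilter limits agree, so that it converges
(`exists_subseq_tendsto`); dividing by `m` gives the theorem with `κ' = q / m`.  The Lorentz force
law with ratio `q / m` is the one found for the limit.
-/

open Set Filter MeasureTheory
open scoped Manifold ContDiff Topology

noncomputable section

namespace Spacetime

set_option linter.unusedSectionVars false

/-! ### Calculus in the charts of the atlas -/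

section ChartCalculus

variable {M : Type*} [TopologicalSpace M] [ChartedSpace E4 M]

/-- The differential at `p` of a chart, as a linear map between copies of the model space. -/
def chartD (e : OpenPartialHomeomorph M E4) (p : M) : E4 →L[ℝ] E4 :=
  mfderiv (𝓡 4) (𝓡 4) e p

/-- The differential at `e p` of the inverse of a chart. -/
def chartDinv (e : OpenPartialHomeomorph M E4) (p : M) : E4 →L[ℝ] E4 :=
  mfderiv (𝓡 4) (𝓡 4) e.symm (e p)

variable {e e' : OpenPartialHomeomorph M E4}

theorem stdCovec_apply (i : Fin 4) (v : E4) : stdCovec i v = v i := rfl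

theorem stdVec_apply (i j : Fin 4) : stdVec i j = if j = i then 1 else 0 := by
  simp [stdVec]

theorem sum_stdVec (v : E4) : ∑ i, v i • stdVec i = v := by
  ext j
  simp [stdVec_apply]

theorem sum_swap_pairs (f : Fin 4 → Fin 4 → Fin 4 → Fin 4 → ℝ) :
    ∑ k, ∑ l, ∑ i, ∑ j, f k l i j = ∑ i, ∑ j, ∑ k, ∑ l, f k l i j := by
  have h : ∀ k, ∑ l, ∑ i, ∑ j, f k l i j = ∑ i, ∑ j, ∑ l, f k l i j := by
    intro k
    rw [Finset.sum_comm]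
    exact Finset.sum_congr rfl fun i _ => Finset.sum_comm
  simp_rw [h]
  rw [Finset.sum_comm]
  exact Finset.sum_congr rfl fun i _ => Finset.sum_comm

theorem sum_stdCovec (α : E4 →L[ℝ] ℝ) : ∑ i, α (stdVec i) • stdCovec i = α := by
  ext v
  conv_rhs => rw [← sum_stdVec v]
  simp [stdCovec_apply, mul_comm]

variable [IsManifold (𝓡 4) ∞ M]

theorem mdifferentiable_chart (he : e ∈ atlas E4 M) : e.MDifferentiable (𝓡 4) (𝓡 4) := by
  have : IsManifold (𝓡 4) 1 M := IsManifold.of_le (n := ∞) (by simp)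
  exact mdifferentiable_of_mem_atlas he

theorem chartDinv_comp_chartD (he : e ∈ atlas E4 M) {p : M} (hp : p ∈ e.source) :
    (chartDinv e p).comp (chartD e p) = ContinuousLinearMap.id ℝ E4 :=
  (mdifferentiable_chart he).symm_comp_deriv hp

theorem chartD_comp_chartDinv (he : e ∈ atlas E4 M) {p : M} (hp : p ∈ e.source) :
    (chartD e p).comp (chartDinv e p) = ContinuousLinearMap.id ℝ E4 := by
  have h := (mdifferentiable_chart he).comp_symm_deriv (e.map_source hp)
  unfold chartD chartDinv
  rw [e.left_inv hp] at h
  exact h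

theorem chartDinv_chartD (he : e ∈ atlas E4 M) {p : M} (hp : p ∈ e.source) (v : E4) :
    chartDinv e p (chartD e p v) = v := by
  simpa using congrArg (fun L : E4 →L[ℝ] E4 => L v) (chartDinv_comp_chartD he hp)

theorem chartD_chartDinv (he : e ∈ atlas E4 M) {p : M} (hp : p ∈ e.source) (v : E4) :
    chartD e p (chartDinv e p v) = v := by
  simpa using congrArg (fun L : E4 →L[ℝ] E4 => L v) (chartD_comp_chartDinv he hp)

theorem chart_trans_contDiffOn (he : e ∈ atlas E4 M) (he' : e' ∈ atlas E4 M) :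
    ContDiffOn ℝ ∞ (e' ∘ e.symm) (e.symm.trans e').source := by
  have h := (contDiffGroupoid ∞ (𝓡 4)).compatible he he'
  have h1 := (mem_groupoid_of_pregroupoid.1 h).1
  have h2 : ContDiffOn ℝ ∞ _ _ := h1
  simpa using h2

theorem chartD_trans (he : e ∈ atlas E4 M) (he' : e' ∈ atlas E4 M) {p : M}
    (hp : p ∈ e.source) (hp' : p ∈ e'.source) :
    chartD e' p = (fderiv ℝ (e' ∘ e.symm) (e p)).comp (chartD e p) := by
  have h1 : MDifferentiableAt (𝓡 4) (𝓡 4) e p := (mdifferentiable_chart he).mdifferentiableAt hp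
  have h2 : DifferentiableAt ℝ (e' ∘ e.symm) (e p) := by
    have hopen := (e.symm.trans e').open_source
    have hmem : e p ∈ (e.symm.trans e').source := by simp [hp, hp']
    exact ((chart_trans_contDiffOn he he').differentiableOn (by simp)).differentiableAt
      (hopen.mem_nhds hmem)
  have h3 := mfderiv_comp p (I := 𝓡 4) (I' := 𝓡 4) (I'' := 𝓡 4) h2.mdifferentiableAt h1
  rw [mfderiv_eq_fderiv] at h3
  refine Eq.trans ?_ h3
  apply Filter.EventuallyEq.mfderiv_eq
  filter_upwards [e.open_source.mem_nhds hp] with q hq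
  simp [e.left_inv hq]


/-! ### Components of tensors -/

theorem vecComp_chart (J : VecField M) (i : Fin 4) {p : M} (hp : p ∈ e.source) :
    vecComp J e i (e p) = chartD e p (J p) i :=
  congrArg (fun q => (chartD e q (J q) : E4) i) (e.left_inv hp)

theorem covComp_chart (w : CovField M) (i : Fin 4) {p : M} (hp : p ∈ e.source) :
    covComp w e i (e p) = w p (chartDinv e p (stdVec i)) :=
  congrArg (fun q => (w q : E4 →L[ℝ] ℝ) (chartDinv e p (stdVec i))) (e.left_inv hp)

theorem cov2Comp_chart (x : CovTensor M) (i j : Fin 4) {p : M} (hp : p ∈ e.source) :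
    cov2Comp x e i j (e p) = x p (chartDinv e p (stdVec i)) (chartDinv e p (stdVec j)) :=
  congrArg (fun q => (x q : E4 →L[ℝ] E4 →L[ℝ] ℝ) (chartDinv e p (stdVec i))
    (chartDinv e p (stdVec j))) (e.left_inv hp)

/-- The coordinate covector `dy^i` at `p`. -/
def dcoord (e : OpenPartialHomeomorph M E4) (p : M) (i : Fin 4) : E4 →L[ℝ] ℝ :=
  (stdCovec i).comp (chartD e p)

theorem dcoord_apply (p : M) (i : Fin 4) (v : E4) : dcoord e p i v = chartD e p v i := rfl

theorem contra2Comp_chart (T : ContraTensor M) (i j : Fin 4) {p : M} (hp : p ∈ e.source) :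
    contra2Comp T e i j (e p) = T p (dcoord e p i) (dcoord e p j) :=
  congrArg (fun q => (T q : (E4 →L[ℝ] ℝ) →L[ℝ] (E4 →L[ℝ] ℝ) →L[ℝ] ℝ) (dcoord e q i)
    (dcoord e q j)) (e.left_inv hp)

theorem sum_dcoord_smul (he : e ∈ atlas E4 M) {p : M} (hp : p ∈ e.source) (v : E4) :
    ∑ i, dcoord e p i v • chartDinv e p (stdVec i) = v := by
  have h := congrArg (chartDinv e p) (sum_stdVec (chartD e p v))
  rw [chartDinv_chartD he hp, map_sum] at h
  simpa [dcoord_apply] using h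

theorem dcoord_chartDinv (he : e ∈ atlas E4 M) {p : M} (hp : p ∈ e.source) (i j : Fin 4) :
    dcoord e p i (chartDinv e p (stdVec j)) = if i = j then 1 else 0 := by
  rw [dcoord_apply, chartD_chartDinv he hp, stdVec_apply]

theorem sum_covector_smul_dcoord (he : e ∈ atlas E4 M) {p : M} (hp : p ∈ e.source)
    (α : E4 →L[ℝ] ℝ) : ∑ i, α (chartDinv e p (stdVec i)) • dcoord e p i = α := by
  ext v
  conv_rhs => rw [← sum_dcoord_smul he hp v]
  simp [mul_comm]

/-- A covariant tensor in terms of its components in a chart. -/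
theorem cov2_apply_eq_sum (he : e ∈ atlas E4 M) {p : M} (hp : p ∈ e.source) (x : CovTensor M)
    (v w : E4) :
    x p v w = ∑ i, ∑ j, cov2Comp x e i j (e p) * (chartD e p v i * chartD e p w j) := by
  simp only [cov2Comp_chart _ _ _ hp]
  have key : ∀ B : E4 →L[ℝ] E4 →L[ℝ] ℝ, ∀ v w : E4, B v w = ∑ i, ∑ j,
      B (chartDinv e p (stdVec i)) (chartDinv e p (stdVec j))
        * (chartD e p v i * chartD e p w j) := by
    intro B v w
    conv_lhs => rw [← sum_dcoord_smul he hp v, ← sum_dcoord_smul he hp w]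
    simp only [map_sum, map_smul, _root_.sum_apply, _root_.smul_apply, smul_eq_mul,
      Finset.mul_sum, dcoord_apply]
    rw [Finset.sum_comm]
    exact Finset.sum_congr rfl fun i _ => Finset.sum_congr rfl fun j _ => by ring
  exact key (x p) v w

/-- A contraction may be computed from the components in any chart. -/
theorem contract_eq_sum (he : e ∈ atlas E4 M) (T : ContraTensor M) (x : CovTensor M) {p : M}
    (hp : p ∈ e.source) :
    contract (T p) (x p) = ∑ i, ∑ j, contra2Comp T e i j (e p) * cov2Comp x e i j (e p) := by
  have key : ∀ (T : (E4 →L[ℝ] ℝ) →L[ℝ] (E4 →L[ℝ] ℝ) →L[ℝ] ℝ) (x : E4 →L[ℝ] E4 →L[ℝ] ℝ),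
      ∑ k, ∑ l, T (stdCovec k) (stdCovec l) * x (stdVec k) (stdVec l) =
      ∑ i, ∑ j, T (dcoord e p i) (dcoord e p j) *
        x (chartDinv e p (stdVec i)) (chartDinv e p (stdVec j)) := by
    intro T x
    have h1 : ∀ k l, x (stdVec k) (stdVec l) = ∑ i, ∑ j, dcoord e p i (stdVec k) *
        (dcoord e p j (stdVec l) * x (chartDinv e p (stdVec i)) (chartDinv e p (stdVec j))) := by
      intro k l
      conv_lhs => rw [← sum_dcoord_smul he hp (stdVec k), ← sum_dcoord_smul he hp (stdVec l)]
      simp only [map_sum, map_smul, _root_.sum_apply, _root_.smul_apply,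
        smul_eq_mul, Finset.mul_sum]
      rw [Finset.sum_comm]
      refine Finset.sum_congr rfl fun i _ => Finset.sum_congr rfl fun j _ => by ring
    have h2 : ∀ i j, T (dcoord e p i) (dcoord e p j) = ∑ k, ∑ l, dcoord e p i (stdVec k) *
        (dcoord e p j (stdVec l) * T (stdCovec k) (stdCovec l)) := by
      intro i j
      conv_lhs => rw [← sum_stdCovec (dcoord e p i), ← sum_stdCovec (dcoord e p j)]
      simp only [map_sum, map_smul, _root_.sum_apply, _root_.smul_apply,
        smul_eq_mul, Finset.mul_sum]
      rw [Finset.sum_comm]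
      refine Finset.sum_congr rfl fun i _ => Finset.sum_congr rfl fun j _ => by ring
    calc _ = ∑ k, ∑ l, ∑ i, ∑ j, T (stdCovec k) (stdCovec l) * (dcoord e p i (stdVec k) *
        (dcoord e p j (stdVec l) * x (chartDinv e p (stdVec i)) (chartDinv e p (stdVec j)))) := by
          simp only [h1, Finset.mul_sum]
      _ = ∑ i, ∑ j, ∑ k, ∑ l, T (stdCovec k) (stdCovec l) * (dcoord e p i (stdVec k) *
        (dcoord e p j (stdVec l) * x (chartDinv e p (stdVec i)) (chartDinv e p (stdVec j)))) := by
          exact sum_swap_pairs _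
      _ = _ := by
          simp only [h2, Finset.sum_mul]
          refine Finset.sum_congr rfl fun i _ => Finset.sum_congr rfl fun j _ =>
            Finset.sum_congr rfl fun k _ => Finset.sum_congr rfl fun l _ => by ring
  simp only [contra2Comp_chart _ _ _ hp, cov2Comp_chart _ _ _ hp]
  exact key (T p) (x p)

theorem pairing_eq_sum (he : e ∈ atlas E4 M) (w : CovField M) (J : VecField M) {p : M}
    (hp : p ∈ e.source) :
    w p (J p) = ∑ i, covComp w e i (e p) * vecComp J e i (e p) := by
  simp only [covComp_chart _ _ hp, vecComp_chart _ _ hp]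
  have key : ∀ (α : E4 →L[ℝ] ℝ) (v : E4),
      α v = ∑ i, α (chartDinv e p (stdVec i)) * chartD e p v i := by
    intro α v
    conv_lhs => rw [← sum_dcoord_smul he hp v]
    simp [dcoord_apply, mul_comm]
  exact key (w p) (J p)

end ChartCalculus

/-! ### Test functions and elementary test fields -/

/-- A test function on the open set `Ω` of a normed space: smooth, with compact support in `Ω`. -/
structure IsTestFun {E : Type*} [NormedAddCommGroup E] [NormedSpace ℝ E] (Ω : Set E)
    (φ : E → ℝ) : Prop where
  smooth : ContDiff ℝ ∞ φ
  compact : HasCompactSupport φ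
  subset : tsupport φ ⊆ Ω

namespace IsTestFun

variable {E : Type*} [NormedAddCommGroup E] [NormedSpace ℝ E] {Ω Ω' : Set E} {φ ψ : E → ℝ}

theorem mono (h : IsTestFun Ω φ) (hΩ : Ω ⊆ Ω') : IsTestFun Ω' φ :=
  ⟨h.smooth, h.compact, h.subset.trans hΩ⟩

theorem zero : IsTestFun Ω (fun _ : E => (0 : ℝ)) :=
  ⟨contDiff_const, HasCompactSupport.zero, by
    have : tsupport (fun _ : E => (0 : ℝ)) = ∅ := by
      rw [tsupport_eq_empty_iff]; rfl
    simp [this]⟩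

theorem add (h : IsTestFun Ω φ) (h' : IsTestFun Ω ψ) : IsTestFun Ω (fun y => φ y + ψ y) :=
  ⟨h.smooth.add h'.smooth, h.compact.add h'.compact,
    (tsupport_add φ ψ).trans (union_subset h.subset h'.subset)⟩

theorem mul_left {f : E → ℝ} (hf : ContDiff ℝ ∞ f) (h : IsTestFun Ω φ) :
    IsTestFun Ω (fun y => f y * φ y) :=
  ⟨hf.mul h.smooth, h.compact.mul_left, (tsupport_mul_subset_right (f := f)).trans h.subset⟩

theorem mul_right {f : E → ℝ} (hf : ContDiff ℝ ∞ f) (h : IsTestFun Ω φ) :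
    IsTestFun Ω (fun y => φ y * f y) :=
  ⟨h.smooth.mul hf, h.compact.mul_right, (tsupport_mul_subset_left (g := f)).trans h.subset⟩

theorem const_mul (r : ℝ) (h : IsTestFun Ω φ) : IsTestFun Ω (fun y => r * φ y) :=
  h.mul_left contDiff_const

theorem neg (h : IsTestFun Ω φ) : IsTestFun Ω (fun y => -φ y) := by
  simpa using h.const_mul (-1)

theorem sub (h : IsTestFun Ω φ) (h' : IsTestFun Ω ψ) : IsTestFun Ω (fun y => φ y - ψ y) := by
  simpa [sub_eq_add_neg] using h.add h'.neg

theorem sum {ι : Type*} (s : Finset ι) {f : ι → E → ℝ} (h : ∀ i ∈ s, IsTestFun Ω (f i)) :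
    IsTestFun Ω (fun y => ∑ i ∈ s, f i y) := by
  classical
  induction s using Finset.induction_on with
  | empty => simpa using zero
  | insert a s ha ih =>
    simp only [Finset.sum_insert ha]
    exact (h a (by simp)).add (ih fun i hi => h i (by simp [hi]))

theorem fderiv_apply (h : IsTestFun Ω φ) (v : E) : IsTestFun Ω (fun y => fderiv ℝ φ y v) := by
  refine ⟨(h.smooth.fderiv_right (m := ∞) (by simp)).clm_apply contDiff_const, ?_, ?_⟩
  · exact (h.compact.fderiv (𝕜 := ℝ)).comp_left (g := fun L : E →L[ℝ] ℝ => L v) (by simp)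
  · refine Subset.trans ?_ ((tsupport_fderiv_subset ℝ (f := φ)).trans h.subset)
    exact closure_mono fun y hy h0 => hy (by simp [h0])

theorem apply_eq_zero (h : IsTestFun Ω φ) {y : E} (hy : y ∉ Ω) : φ y = 0 :=
  image_eq_zero_of_notMem_tsupport fun h' => hy (h.subset h')

/-- A function that is smooth on `Ω` becomes globally smooth when multiplied by a test function. -/
theorem contDiffOn_mul {f : E → ℝ} (hΩ : IsOpen Ω) (hf : ContDiffOn ℝ ∞ f Ω)
    (h : IsTestFun Ω φ) : IsTestFun Ω (fun y => f y * φ y) := by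
  refine ⟨?_, h.compact.mul_left, (tsupport_mul_subset_right (f := f)).trans h.subset⟩
  rw [contDiff_iff_contDiffAt]
  intro y
  by_cases hy : y ∈ Ω
  · exact (hf.contDiffAt (hΩ.mem_nhds hy)).mul h.smooth.contDiffAt
  · have hy' : y ∉ tsupport φ := fun h' => hy (h.subset h')
    have : (fun y => f y * φ y) =ᶠ[𝓝 y] fun _ => 0 := by
      filter_upwards [(isClosed_tsupport φ).isOpen_compl.mem_nhds hy'] with z hz
      rw [image_eq_zero_of_notMem_tsupport hz, mul_zero]
    exact contDiffAt_const.congr_of_eventuallyEq this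

end IsTestFun

/-- Around every compact subset of an open set of the model space there is a test function which
equals one in a neighbourhood of the compact set and takes its values in `[0,1]`. -/
theorem exists_testFun_eq_one {E : Type*} [NormedAddCommGroup E] [NormedSpace ℝ E]
    [FiniteDimensional ℝ E] {K Ω : Set E} (hK : IsCompact K) (hΩ : IsOpen Ω) (hKΩ : K ⊆ Ω) :
    ∃ χ : E → ℝ, IsTestFun Ω χ ∧ (∀ y, 0 ≤ χ y) ∧ (∀ y, χ y ≤ 1) ∧
      ∃ W, IsOpen W ∧ K ⊆ W ∧ ∀ y ∈ W, χ y = 1 := by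
  obtain ⟨L, hL, hKL, hLΩ⟩ := exists_compact_between hK hΩ hKΩ
  obtain ⟨L', hL', hLL', hLΩ'⟩ := exists_compact_between hL hΩ hLΩ
  obtain ⟨f, hf1, hf0, hfI⟩ := exists_contMDiffMap_zero_one_of_isClosed 𝓘(ℝ, E) (n := (⊤ : ℕ∞))
    (s := (interior L')ᶜ) (t := L) isOpen_interior.isClosed_compl hL.isClosed (by
      rw [Set.disjoint_left]; intro y hy hy'; exact hy (hLL' hy'))
  have hsub : tsupport (f : E → ℝ) ⊆ L' := by
    refine closure_minimal ?_ hL'.isClosed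
    intro y hy
    by_contra hn
    exact hy (hf1 fun h => hn (interior_subset h))
  refine ⟨f, ⟨f.contMDiff.contDiff, ?_, hsub.trans hLΩ'⟩, fun y => (hfI y).1, fun y => (hfI y).2,
    interior L, isOpen_interior, hKL, fun y hy => hf0 (interior_subset hy)⟩
  exact hL'.of_isClosed_subset (isClosed_tsupport _) hsub

section Elementary

variable {M : Type*} [TopologicalSpace M] [ChartedSpace E4 M]
  {e e' : OpenPartialHomeomorph M E4} {φ ψ : E4 → ℝ}

/-! The instances of an additive group and a module on the space of tensors at a point and on the
space of tensor fields are spelled out, because the general search for them is slow. -/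

instance covTensorFiberAddCommMonoid (p : M) :
    AddCommMonoid (TangentSpace (𝓡 4) p →L[ℝ] TangentSpace (𝓡 4) p →L[ℝ] ℝ) :=
  ContinuousLinearMap.addCommMonoid

instance covTensorFiberAddCommGroup (p : M) :
    AddCommGroup (TangentSpace (𝓡 4) p →L[ℝ] TangentSpace (𝓡 4) p →L[ℝ] ℝ) :=
  ContinuousLinearMap.addCommGroup

instance covTensorFiberModule (p : M) :
    Module ℝ (TangentSpace (𝓡 4) p →L[ℝ] TangentSpace (𝓡 4) p →L[ℝ] ℝ) :=
  ContinuousLinearMap.module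

instance covTensorAddCommMonoid : AddCommMonoid (CovTensor M) := Pi.addCommMonoid

/-- A function of the coordinates of a chart, as a function on the manifold, extended by zero. -/
def chartExt (e : OpenPartialHomeomorph M E4) (φ : E4 → ℝ) : M → ℝ :=
  e.source.indicator fun p => φ (e p)

theorem chartExt_of_mem {p : M} (hp : p ∈ e.source) : chartExt e φ p = φ (e p) :=
  indicator_of_mem hp _

theorem chartExt_of_notMem {p : M} (hp : p ∉ e.source) : chartExt e φ p = 0 :=
  indicator_of_notMem hp _

theorem chartExt_add (p : M) :
    chartExt e (fun y => φ y + ψ y) p = chartExt e φ p + chartExt e ψ p := by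
  by_cases hp : p ∈ e.source
  · simp [chartExt_of_mem hp]
  · simp [chartExt_of_notMem hp]

theorem chartExt_const_mul (r : ℝ) (p : M) :
    chartExt e (fun y => r * φ y) p = r * chartExt e φ p := by
  by_cases hp : p ∈ e.source
  · simp [chartExt_of_mem hp]
  · simp [chartExt_of_notMem hp]

/-- The compact set that carries the extension of a test function. -/
theorem isCompact_symm_image_tsupport (h : IsTestFun e.target φ) :
    IsCompact (e.symm '' tsupport φ) :=
  h.compact.isCompact.image_of_continuousOn (e.continuousOn_symm.mono h.subset)

theorem symm_image_subset_source (h : IsTestFun e.target φ) :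
    e.symm '' tsupport φ ⊆ e.source := by
  rintro _ ⟨y, hy, rfl⟩
  exact e.map_target (h.subset hy)

theorem chartExt_eq_zero {p : M} (hp : p ∉ e.symm '' tsupport φ) : chartExt e φ p = 0 := by
  by_cases hs : p ∈ e.source
  · rw [chartExt_of_mem hs]
    refine image_eq_zero_of_notMem_tsupport fun h => hp ⟨e p, h, e.left_inv hs⟩
  · exact chartExt_of_notMem hs

/-- The elementary tensor field `φ dy^i ⊗ dy^j`. -/
def elemTensor (e : OpenPartialHomeomorph M E4) (i j : Fin 4) (φ : E4 → ℝ) : CovTensor M :=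
  fun p => chartExt e φ p • (dcoord e p i).smulRight (dcoord e p j)

/-- The elementary covector field `φ dy^i`. -/
def elemCov (e : OpenPartialHomeomorph M E4) (i : Fin 4) (φ : E4 → ℝ) : CovField M :=
  fun p => chartExt e φ p • dcoord e p i

theorem elemTensor_apply (i j : Fin 4) (p : M) (v w : E4) :
    elemTensor e i j φ p v w = chartExt e φ p * (chartD e p v i * chartD e p w j) := rfl

theorem elemCov_apply (i : Fin 4) (p : M) (v : E4) :
    elemCov e i φ p v = chartExt e φ p * chartD e p v i := rfl

variable [IsManifold (𝓡 4) ∞ M]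

theorem chartD_frame (he : e ∈ atlas E4 M) (he' : e' ∈ atlas E4 M) {p : M} (hp : p ∈ e.source)
    (hp' : p ∈ e'.source) (k i : Fin 4) :
    chartD e p (chartDinv e' p (stdVec k)) i
      = fderiv ℝ (fun y => (e (e'.symm y)) i) (e' p) (stdVec k) := by
  have hmem : e' p ∈ (e'.symm.trans e).source := by simp [hp, hp']
  have hd : DifferentiableAt ℝ (e ∘ e'.symm) (e' p) :=
    ((chart_trans_contDiffOn he' he).differentiableOn (by simp)).differentiableAt
      ((e'.symm.trans e).open_source.mem_nhds hmem)
  rw [chartD_trans he' he hp' hp]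
  simp only [ContinuousLinearMap.comp_apply, chartD_chartDinv he' hp']
  have h2 := ((EuclideanSpace.proj (𝕜 := ℝ) i : E4 →L[ℝ] ℝ).hasFDerivAt.comp (e' p)
    hd.hasFDerivAt).fderiv
  have h3 : fderiv ℝ (fun y => (e (e'.symm y)) i) (e' p) = _ := h2
  rw [h3]; rfl

theorem contDiffOn_transition_partial (he : e ∈ atlas E4 M) (he' : e' ∈ atlas E4 M)
    (k i : Fin 4) :
    ContDiffOn ℝ ∞ (fun y => fderiv ℝ (fun y => (e (e'.symm y)) i) y (stdVec k))
      (e'.symm.trans e).source := by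
  have h1 : ContDiffOn ℝ ∞ (fun y => (e (e'.symm y)) i) (e'.symm.trans e).source :=
    (EuclideanSpace.proj (𝕜 := ℝ) i : E4 →L[ℝ] ℝ).contDiff.comp_contDiffOn
      (chart_trans_contDiffOn he' he)
  exact (h1.fderiv_of_isOpen (e'.symm.trans e).open_source (by simp)).clm_apply contDiffOn_const

theorem contDiffOn_chartExt_mul [T2Space M] (he : e ∈ atlas E4 M) (he' : e' ∈ atlas E4 M)
    (h : IsTestFun e.target φ) {f : E4 → ℝ} (hf : ContDiffOn ℝ ∞ f (e'.symm.trans e).source) :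
    ContDiffOn ℝ ∞ (fun y => chartExt e φ (e'.symm y) * f y) e'.target := by
  intro y hy
  refine ContDiffAt.contDiffWithinAt ?_
  by_cases hp : e'.symm y ∈ e.source
  · have hmem : y ∈ (e'.symm.trans e).source := by simp [hp, hy]
    have hn := (e'.symm.trans e).open_source.mem_nhds hmem
    have h1 : ContDiffAt ℝ ∞ (fun y => φ (e (e'.symm y)) * f y) y :=
      (h.smooth.contDiffAt.comp y ((chart_trans_contDiffOn he' he).contDiffAt hn)).mul
        (hf.contDiffAt hn)
    refine h1.congr_of_eventuallyEq ?_
    filter_upwards [hn] with z hz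
    have hz' : e'.symm z ∈ e.source := by simpa using hz.2
    rw [chartExt_of_mem hz']
  · have hc : IsOpen (e.symm '' tsupport φ)ᶜ :=
      (isCompact_symm_image_tsupport h).isClosed.isOpen_compl
    have hy' : e'.symm y ∈ (e.symm '' tsupport φ)ᶜ := fun h' =>
      hp (symm_image_subset_source h h')
    have hn : ∀ᶠ z in 𝓝 y, e'.symm z ∈ (e.symm '' tsupport φ)ᶜ :=
      (e'.continuousAt_symm hy).eventually (hc.mem_nhds hy')
    refine (contDiffAt_const (c := (0 : ℝ))).congr_of_eventuallyEq ?_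
    filter_upwards [hn] with z hz
    rw [chartExt_eq_zero hz, zero_mul]

theorem isTestCov2_elemTensor [T2Space M] (he : e ∈ atlas E4 M) (i j : Fin 4)
    (h : IsTestFun e.target φ) : IsTestCov2 (elemTensor e i j φ) := by
  refine ⟨fun e' he' k l => ?_, e.symm '' tsupport φ, isCompact_symm_image_tsupport h,
    fun p hp => ?_⟩
  · have hf := (contDiffOn_transition_partial he he' k i).mul
      (contDiffOn_transition_partial he he' l j)
    refine (contDiffOn_chartExt_mul he he' h hf).congr fun y hy => ?_
    have hp' : e'.symm y ∈ e'.source := e'.map_target hy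
    have h1 := cov2Comp_chart (elemTensor e i j φ) k l hp'
    rw [e'.right_inv hy] at h1
    rw [h1]
    refine (elemTensor_apply i j _ _ _).trans ?_
    by_cases hp : e'.symm y ∈ e.source
    · rw [chartD_frame he he' hp hp', chartD_frame he he' hp hp', e'.right_inv hy]
    · rw [chartExt_of_notMem hp, zero_mul, zero_mul]
  · refine ContinuousLinearMap.ext fun v => ContinuousLinearMap.ext fun w => ?_
    refine (elemTensor_apply i j p v w).trans ?_
    rw [chartExt_eq_zero hp, zero_mul]
    rfl

theorem isTestCov_elemCov [T2Space M] (he : e ∈ atlas E4 M) (i : Fin 4)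
    (h : IsTestFun e.target φ) : IsTestCov (elemCov e i φ) := by
  refine ⟨fun e' he' k => ?_, e.symm '' tsupport φ, isCompact_symm_image_tsupport h,
    fun p hp => ?_⟩
  · refine (contDiffOn_chartExt_mul he he' h
      (contDiffOn_transition_partial he he' k i)).congr fun y hy => ?_
    have hp' : e'.symm y ∈ e'.source := e'.map_target hy
    have h1 := covComp_chart (elemCov e i φ) k hp'
    rw [e'.right_inv hy] at h1
    rw [h1]
    refine (elemCov_apply i _ _).trans ?_
    by_cases hp : e'.symm y ∈ e.source
    · rw [chartD_frame he he' hp hp', e'.right_inv hy]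
    · rw [chartExt_of_notMem hp, zero_mul, zero_mul]
  · have h0 : chartExt e φ p • dcoord e p i = 0 := by
      rw [chartExt_eq_zero hp, zero_smul]
    exact h0

/-! ### Operations on test fields, and their decomposition into elementary ones -/

theorem SmoothCov2.add {x y : CovTensor M} (hx : SmoothCov2 x) (hy : SmoothCov2 y) :
    SmoothCov2 (x + y) := fun e he i j => (hx e he i j).add (hy e he i j)

theorem SmoothCov2.const_smul {x : CovTensor M} (r : ℝ) (hx : SmoothCov2 x) :
    SmoothCov2 (r • x) := fun e he i j => (contDiffOn_const (c := r)).mul (hx e he i j)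

theorem SmoothCov.add {x y : CovField M} (hx : SmoothCov x) (hy : SmoothCov y) :
    SmoothCov (x + y) := fun e he i => (hx e he i).add (hy e he i)

theorem SmoothCov.const_smul {x : CovField M} (r : ℝ) (hx : SmoothCov x) :
    SmoothCov (r • x) := fun e he i => (contDiffOn_const (c := r)).mul (hx e he i)

theorem IsTestCov2.add {x y : CovTensor M} (hx : IsTestCov2 x) (hy : IsTestCov2 y) :
    IsTestCov2 (x + y) := by
  obtain ⟨hx, K, hK, hxK⟩ := hx
  obtain ⟨hy, L, hL, hyL⟩ := hy
  refine ⟨hx.add hy, K ∪ L, hK.union hL, fun p hp => ?_⟩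
  rw [mem_union, not_or] at hp
  rw [Pi.add_apply, hxK p hp.1, hyL p hp.2]
  exact add_zero (0 : TangentSpace (𝓡 4) p →L[ℝ] TangentSpace (𝓡 4) p →L[ℝ] ℝ)

theorem IsTestCov2.const_smul {x : CovTensor M} (r : ℝ) (hx : IsTestCov2 x) :
    IsTestCov2 (r • x) := by
  obtain ⟨hx, K, hK, hxK⟩ := hx
  refine ⟨hx.const_smul r, K, hK, fun p hp => ?_⟩
  rw [Pi.smul_apply, hxK p hp]
  exact ContinuousLinearMap.ext fun v => ContinuousLinearMap.ext fun w => mul_zero r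

theorem IsTestCov.add {x y : CovField M} (hx : IsTestCov x) (hy : IsTestCov y) :
    IsTestCov (x + y) := by
  obtain ⟨hx, K, hK, hxK⟩ := hx
  obtain ⟨hy, L, hL, hyL⟩ := hy
  refine ⟨hx.add hy, K ∪ L, hK.union hL, fun p hp => ?_⟩
  rw [mem_union, not_or] at hp
  rw [Pi.add_apply, hxK p hp.1, hyL p hp.2]
  exact add_zero (0 : TangentSpace (𝓡 4) p →L[ℝ] ℝ)

theorem IsTestCov.const_smul {x : CovField M} (r : ℝ) (hx : IsTestCov x) :
    IsTestCov (r • x) := by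
  obtain ⟨hx, K, hK, hxK⟩ := hx
  refine ⟨hx.const_smul r, K, hK, fun p hp => ?_⟩
  rw [Pi.smul_apply, hxK p hp]
  exact smul_zero (A := TangentSpace (𝓡 4) p →L[ℝ] ℝ) r

theorem IsTestCov2.zero : IsTestCov2 (0 : CovTensor M) :=
  ⟨fun _ _ _ _ => contDiffOn_const (c := (0 : ℝ)), ∅, isCompact_empty, fun _ _ => rfl⟩

theorem IsTestCov.zero : IsTestCov (0 : CovField M) :=
  ⟨fun _ _ _ => contDiffOn_const (c := (0 : ℝ)), ∅, isCompact_empty, fun _ _ => rfl⟩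

theorem IsTestCov2.sum {ι : Type*} (s : Finset ι) {x : ι → CovTensor M}
    (h : ∀ i ∈ s, IsTestCov2 (x i)) : IsTestCov2 (∑ i ∈ s, x i) :=
  Finset.sum_induction _ _ (fun _ _ => IsTestCov2.add) IsTestCov2.zero h

theorem IsTestCov.sum {ι : Type*} (s : Finset ι) {x : ι → CovField M}
    (h : ∀ i ∈ s, IsTestCov (x i)) : IsTestCov (∑ i ∈ s, x i) :=
  Finset.sum_induction _ _ (fun _ _ => IsTestCov.add) IsTestCov.zero h

theorem contDiffOn_comp_symm (he : e ∈ atlas E4 M) {ρ : M → ℝ}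
    (hρ : ContMDiff (𝓡 4) 𝓘(ℝ, ℝ) ∞ ρ) : ContDiffOn ℝ ∞ (fun y => ρ (e.symm y)) e.target := by
  have h := contMDiffOn_symm_of_mem_maximalAtlas (I := 𝓡 4) (n := ∞)
    (IsManifold.subset_maximalAtlas he)
  exact (hρ.comp_contMDiffOn h).contDiffOn

theorem SmoothCov2.mul {ρ : M → ℝ} (hρ : ContMDiff (𝓡 4) 𝓘(ℝ, ℝ) ∞ ρ) {x : CovTensor M}
    (hx : SmoothCov2 x) : SmoothCov2 fun p => ρ p • x p :=
  fun e he i j => (contDiffOn_comp_symm he hρ).mul (hx e he i j)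

theorem SmoothCov.mul {ρ : M → ℝ} (hρ : ContMDiff (𝓡 4) 𝓘(ℝ, ℝ) ∞ ρ) {x : CovField M}
    (hx : SmoothCov x) : SmoothCov fun p => ρ p • x p :=
  fun e he i => (contDiffOn_comp_symm he hρ).mul (hx e he i)

/-- Components in a chart, extended by zero outside of its range. -/
def extComp (e : OpenPartialHomeomorph M E4) (f : E4 → ℝ) : E4 → ℝ := e.target.indicator f

theorem isTestFun_extComp [T2Space M] {K : Set M} (hK : IsCompact K) (hKe : K ⊆ e.source)
    {f : E4 → ℝ} (hf : ContDiffOn ℝ ∞ f e.target) (h0 : ∀ y ∈ e.target, e.symm y ∉ K → f y = 0) :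
    IsTestFun e.target (extComp e f) ∧ tsupport (extComp e f) ⊆ e '' K := by
  have hKc : IsCompact (e '' K) := hK.image_of_continuousOn (e.continuousOn.mono hKe)
  have hKt : e '' K ⊆ e.target := by
    rintro _ ⟨p, hp, rfl⟩; exact e.map_source (hKe hp)
  have hzero : ∀ y, y ∉ e '' K → extComp e f y = 0 := by
    intro y hy
    by_cases hyt : y ∈ e.target
    · rw [extComp, indicator_of_mem hyt]
      exact h0 y hyt fun h => hy ⟨_, h, e.right_inv hyt⟩
    · exact indicator_of_notMem hyt _
  have hsub : tsupport (extComp e f) ⊆ e '' K :=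
    closure_minimal (fun y hy => by_contra fun hn => hy (hzero y hn)) hKc.isClosed
  refine ⟨⟨?_, hKc.of_isClosed_subset (isClosed_tsupport _) hsub, hsub.trans hKt⟩, hsub⟩
  rw [contDiff_iff_contDiffAt]
  intro y
  by_cases hy : y ∈ e.target
  · refine (hf.contDiffAt (e.open_target.mem_nhds hy)).congr_of_eventuallyEq ?_
    filter_upwards [e.open_target.mem_nhds hy] with z hz
    exact indicator_of_mem hz _
  · refine (contDiffAt_const (c := (0 : ℝ))).congr_of_eventuallyEq ?_
    filter_upwards [hKc.isClosed.isOpen_compl.mem_nhds fun h => hy (hKt h)] with z hz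
    exact hzero z hz

theorem eq_sum_elemTensor (he : e ∈ atlas E4 M) {x : CovTensor M}
    (hx0 : ∀ p, p ∉ e.source → x p = 0) :
    x = ∑ i, ∑ j, elemTensor e i j (extComp e (cov2Comp x e i j)) := by
  funext p
  refine ContinuousLinearMap.ext fun v => ContinuousLinearMap.ext fun w => ?_
  simp only [Finset.sum_apply]
  rw [show (∑ i, ∑ j, elemTensor e i j (extComp e (cov2Comp x e i j)) p) v w
    = ∑ i, ∑ j, elemTensor e i j (extComp e (cov2Comp x e i j)) p v w by
      simp only [_root_.sum_apply]]
  by_cases hp : p ∈ e.source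
  · have h1 : ∀ i j, elemTensor e i j (extComp e (cov2Comp x e i j)) p v w
        = cov2Comp x e i j (e p) * (chartD e p v i * chartD e p w j) := by
      intro i j
      refine (elemTensor_apply i j p v w).trans ?_
      rw [chartExt_of_mem hp, extComp, indicator_of_mem (e.map_source hp)]
    simp only [h1]
    exact cov2_apply_eq_sum he hp x v w
  · have h1 : ∀ i j, elemTensor e i j (extComp e (cov2Comp x e i j)) p v w = 0 := by
      intro i j
      refine (elemTensor_apply i j p v w).trans ?_
      rw [chartExt_of_notMem hp, zero_mul]
    simp only [h1, hx0 p hp]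
    simp

theorem eq_sum_elemCov (he : e ∈ atlas E4 M) {w : CovField M}
    (hw0 : ∀ p, p ∉ e.source → w p = 0) :
    w = ∑ i, elemCov e i (extComp e (covComp w e i)) := by
  funext p
  refine ContinuousLinearMap.ext fun v => ?_
  simp only [Finset.sum_apply]
  rw [show (∑ i, elemCov e i (extComp e (covComp w e i)) p) v
    = ∑ i, elemCov e i (extComp e (covComp w e i)) p v by
      simp only [_root_.sum_apply]]
  by_cases hp : p ∈ e.source
  · have h1 : ∀ i, elemCov e i (extComp e (covComp w e i)) p v
        = w p (chartDinv e p (stdVec i)) * chartD e p v i := by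
      intro i
      refine (elemCov_apply i p v).trans ?_
      rw [chartExt_of_mem hp, extComp, indicator_of_mem (e.map_source hp), covComp_chart _ _ hp]
    simp only [h1]
    have key : ∀ B : E4 →L[ℝ] ℝ, ∀ v : E4, B v = ∑ i,
        B (chartDinv e p (stdVec i)) * chartD e p v i := by
      intro B v
      conv_lhs => rw [← sum_dcoord_smul he hp v]
      simp [dcoord_apply, mul_comm]
    exact key (w p) v
  · have h1 : ∀ i, elemCov e i (extComp e (covComp w e i)) p v = 0 := by
      intro i
      refine (elemCov_apply i p v).trans ?_
      rw [chartExt_of_notMem hp, zero_mul]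
    simp only [h1, hw0 p hp]
    simp

end Elementary

/-! ### The metric in a chart -/

section MetricChart

/-- Jacobi's formula: the derivative of a determinant in terms of the adjugate matrix. -/
theorem hasFDerivAt_det {E : Type*} [NormedAddCommGroup E] [NormedSpace ℝ E]
    {A : E → Matrix (Fin 4) (Fin 4) ℝ} {A' : Fin 4 → Fin 4 → E →L[ℝ] ℝ} {y : E}
    (h : ∀ i j, HasFDerivAt (fun z => A z i j) (A' i j) y) :
    HasFDerivAt (fun z => (A z).det)
      (∑ i, ∑ k, (A y).adjugate i k • A' k i) y := by
  have h1 : HasFDerivAt (fun z => ∑ σ : Equiv.Perm (Fin 4),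
      ((Equiv.Perm.sign σ : ℤ) : ℝ) * ∏ i, A z (σ i) i)
      (∑ σ : Equiv.Perm (Fin 4), ((Equiv.Perm.sign σ : ℤ) : ℝ) •
        ∑ i, (∏ j ∈ Finset.univ.erase i, A y (σ j) j) • A' (σ i) i) y := by
    refine HasFDerivAt.fun_sum fun σ _ => HasFDerivAt.const_mul ?_ _
    exact HasFDerivAt.finsetProd fun i _ => h (σ i) i
  simp only [← Matrix.det_apply'] at h1
  convert h1 using 1
  ext v
  simp only [_root_.sum_apply, _root_.smul_apply, smul_eq_mul, Finset.mul_sum]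
  rw [Finset.sum_comm (s := (Finset.univ : Finset (Equiv.Perm (Fin 4))))]
  refine Finset.sum_congr rfl fun i _ => ?_
  have h2 : ∑ k, (A y).adjugate i k * A' k i v
      = ((A y).updateCol i fun k => A' k i v).det := by
    rw [← Matrix.cramer_apply, Matrix.cramer_eq_adjugate_mulVec]
    rfl
  rw [h2, Matrix.det_apply']
  refine Finset.sum_congr rfl fun σ _ => ?_
  congr 1
  rw [← Finset.mul_prod_erase _ _ (Finset.mem_univ i), Matrix.updateCol_self, mul_comm]
  congr 1
  exact Finset.prod_congr rfl fun j hj => Matrix.updateCol_ne (Finset.ne_of_mem_erase hj)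

theorem contDiffOn_det {E : Type*} [NormedAddCommGroup E] [NormedSpace ℝ E] {s : Set E}
    {A : E → Matrix (Fin 4) (Fin 4) ℝ} (h : ∀ i j, ContDiffOn ℝ ∞ (fun z => A z i j) s) :
    ContDiffOn ℝ ∞ (fun z => (A z).det) s := by
  simp only [Matrix.det_apply']
  exact ContDiffOn.sum fun σ _ => contDiffOn_const.mul (contDiffOn_prod fun i _ => h (σ i) i)

theorem contDiffOn_matrix_inv {E : Type*} [NormedAddCommGroup E] [NormedSpace ℝ E] {s : Set E}
    {A : E → Matrix (Fin 4) (Fin 4) ℝ} (h : ∀ i j, ContDiffOn ℝ ∞ (fun z => A z i j) s)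
    (h0 : ∀ z ∈ s, (A z).det ≠ 0) (i j : Fin 4) :
    ContDiffOn ℝ ∞ (fun z => (A z)⁻¹ i j) s := by
  have h1 : ∀ z, (A z)⁻¹ i j = (A z).det⁻¹ * (A z).adjugate i j := by
    intro z
    rw [Matrix.inv_def, Ring.inverse_eq_inv']
    rfl
  simp only [h1]
  refine ((contDiffOn_det h).inv h0).mul ?_
  simp only [Matrix.adjugate_apply]
  refine contDiffOn_det fun k l => ?_
  by_cases hk : k = j
  · subst hk
    simp only [Matrix.updateRow_self]
    exact contDiffOn_const
  · simp only [Matrix.updateRow_ne hk]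
    exact h k l

variable {M : Type*} [TopologicalSpace M] [ChartedSpace E4 M] [IsManifold (𝓡 4) ∞ M] (g : LorentzMetric M)
  {e e' : OpenPartialHomeomorph M E4}

theorem LorentzMetric.nondegenerate (p : M) {v : TangentSpace (𝓡 4) p}
    (h : ∀ w, g.val p v w = 0) : v = 0 := by
  obtain ⟨b, hb⟩ := g.signature p
  refine b.ext_elem fun i => ?_
  have h1 := h (b i)
  rw [← b.sum_repr v] at h1
  simp only [map_sum, map_smul, _root_.sum_apply, _root_.smul_apply, smul_eq_mul, hb] at h1
  simp only [mul_ite, mul_zero, Finset.sum_ite_eq', Finset.mem_univ, if_true] at h1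
  split_ifs at h1 <;> simpa using h1

theorem metricMatrix_chart (i j : Fin 4) {p : M} (hp : p ∈ e.source) :
    metricMatrix g e (e p) i j
      = g.val p (chartDinv e p (stdVec i)) (chartDinv e p (stdVec j)) :=
  cov2Comp_chart g.val i j hp

theorem metricMatrix_symm (y : E4) (i j : Fin 4) :
    metricMatrix g e y i j = metricMatrix g e y j i :=
  g.symm _ _ _

/-- The scalar product in terms of components. -/
theorem metric_eq_sum (he : e ∈ atlas E4 M) {p : M} (hp : p ∈ e.source)
    (v w : E4) :
    g.val p v w = ∑ i, ∑ j, metricMatrix g e (e p) i j * (chartD e p v i * chartD e p w j) :=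
  cov2_apply_eq_sum he hp g.val v w

theorem metricMatrix_det_ne_zero (he : e ∈ atlas E4 M) {y : E4} (hy : y ∈ e.target) :
    (metricMatrix g e y).det ≠ 0 := by
  intro h0
  obtain ⟨v, hv, hv0⟩ := Matrix.exists_vecMul_eq_zero_iff.2 h0
  have hp : e.symm y ∈ e.source := e.map_target hy
  set p := e.symm y with hpdef
  have hyp : y = e p := (e.right_inv hy).symm
  set V : E4 := WithLp.toLp 2 v with hV
  have h1 : chartDinv e p V = (0 : E4) := by
    refine g.nondegenerate p fun w => ?_
    refine (metric_eq_sum g he hp (chartDinv e p V) w).trans ?_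
    rw [← hyp]
    simp only [chartD_chartDinv he hp]
    rw [Finset.sum_comm]
    have h2 : ∀ j, ∑ i, metricMatrix g e y i j * (V i * chartD e p w j) = 0 := by
      intro j
      have h3 : ∑ i, v i * metricMatrix g e y i j = 0 := congrFun hv0 j
      calc _ = (∑ i, v i * metricMatrix g e y i j) * chartD e p w j := by
            rw [Finset.sum_mul]
            exact Finset.sum_congr rfl fun i _ => by simp only [hV]; ring
        _ = 0 := by rw [h3, zero_mul]
    simp [h2]
  have h2 := congrArg (chartD e p) h1
  rw [chartD_chartDinv he hp, map_zero] at h2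
  exact hv (by simpa [hV] using congrArg WithLp.ofLp h2)

theorem contDiffOn_metricMatrix (he : e ∈ atlas E4 M) (i j : Fin 4) :
    ContDiffOn ℝ ∞ (fun y => metricMatrix g e y i j) e.target := g.smooth e he i j

theorem contDiffOn_invMetric (he : e ∈ atlas E4 M) (i j : Fin 4) :
    ContDiffOn ℝ ∞ (fun y => invMetric g e y i j) e.target :=
  contDiffOn_matrix_inv (contDiffOn_metricMatrix g he)
    (fun _ hy => metricMatrix_det_ne_zero g he hy) i j

theorem contDiffOn_pd {f : E4 → ℝ} {s : Set E4} (hs : IsOpen s) (hf : ContDiffOn ℝ ∞ f s)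
    (i : Fin 4) : ContDiffOn ℝ ∞ (pd i f) s :=
  (hf.fderiv_of_isOpen hs (by simp)).clm_apply contDiffOn_const

theorem contDiffOn_christoffel (he : e ∈ atlas E4 M) (i j k : Fin 4) :
    ContDiffOn ℝ ∞ (christoffel g e i j k) e.target := by
  have hp := fun a b c => contDiffOn_pd e.open_target (g.smooth e he a b) c
  exact contDiffOn_const.mul (ContDiffOn.sum fun l _ =>
    (contDiffOn_invMetric g he i l).mul (((hp l k j).add (hp l j k)).sub (hp j k l)))

theorem contDiffOn_mixedComp {F : CovTensor M} (hF : SmoothCov2 F) (he : e ∈ atlas E4 M)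
    (i k : Fin 4) : ContDiffOn ℝ ∞ (mixedComp g F e i k) e.target :=
  ContDiffOn.sum fun l _ => (contDiffOn_invMetric g he i l).mul (hF e he l k)

theorem sum_mul_invMetric (he : e ∈ atlas E4 M) {y : E4} (hy : y ∈ e.target) (i k : Fin 4) :
    ∑ l, metricMatrix g e y i l * invMetric g e y l k = if i = k then 1 else 0 := by
  have h := Matrix.mul_nonsing_inv (metricMatrix g e y)
    (isUnit_iff_ne_zero.2 (metricMatrix_det_ne_zero g he hy))
  have h2 := congrFun (congrFun h i) k
  rwa [Matrix.mul_apply, Matrix.one_apply] at h2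

theorem invMetric_symm (y : E4) (i j : Fin 4) :
    invMetric g e y i j = invMetric g e y j i := by
  have h : (metricMatrix g e y).transpose = metricMatrix g e y := by
    ext a b; exact metricMatrix_symm g y b a
  have h2 := Matrix.transpose_nonsing_inv (metricMatrix g e y)
  rw [h] at h2
  exact (congrFun (congrFun h2 j) i)

/-- The density `√|det g_{ij}|` of the volume of the metric in a chart. -/
def density (e : OpenPartialHomeomorph M E4) (y : E4) : ℝ :=
  Real.sqrt |(metricMatrix g e y).det|

theorem density_pos (he : e ∈ atlas E4 M) {y : E4} (hy : y ∈ e.target) : 0 < density g e y :=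
  Real.sqrt_pos.2 (abs_pos.2 (metricMatrix_det_ne_zero g he hy))

theorem contDiffOn_density (he : e ∈ atlas E4 M) : ContDiffOn ℝ ∞ (density g e) e.target := by
  intro y hy
  have h0 := metricMatrix_det_ne_zero g he hy
  have h1 := contDiffOn_det (contDiffOn_metricMatrix g he) y hy
  refine ContDiffWithinAt.sqrt ?_ (abs_pos.2 h0).ne'
  exact (contDiffAt_abs h0).comp_contDiffWithinAt y h1

theorem sum_christoffel_trace (e : OpenPartialHomeomorph M E4) (j : Fin 4) (y : E4) :
    ∑ k, christoffel g e k k j y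
      = (1 / 2) * ∑ k, ∑ l, invMetric g e y k l * pd j (cov2Comp g.val e l k) y := by
  simp only [christoffel, ← Finset.mul_sum]
  congr 1
  have h1 : ∑ k, ∑ l, invMetric g e y k l * pd k (cov2Comp g.val e l j) y
      = ∑ k, ∑ l, invMetric g e y k l * pd l (cov2Comp g.val e k j) y := by
    rw [Finset.sum_comm]
    refine Finset.sum_congr rfl fun k _ => Finset.sum_congr rfl fun l _ => ?_
    rw [invMetric_symm]
  calc _ = ∑ k, ∑ l, invMetric g e y k l * pd k (cov2Comp g.val e l j) y
      + ∑ k, ∑ l, invMetric g e y k l * pd j (cov2Comp g.val e l k) y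
      - ∑ k, ∑ l, invMetric g e y k l * pd l (cov2Comp g.val e k j) y := by
        simp only [← Finset.sum_add_distrib, ← Finset.sum_sub_distrib]
        exact Finset.sum_congr rfl fun k _ => Finset.sum_congr rfl fun l _ => by ring
    _ = _ := by rw [h1]; ring

/-- The logarithmic derivative of the volume density is the trace of the Christoffel symbols. -/
theorem pd_density (he : e ∈ atlas E4 M) {y : E4} (hy : y ∈ e.target) (j : Fin 4) :
    pd j (density g e) y = density g e y * ∑ k, christoffel g e k k j y := by
  have h0 := metricMatrix_det_ne_zero g he hy
  have hd : ∀ a b, HasFDerivAt (fun z => metricMatrix g e z a b)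
      (fderiv ℝ (cov2Comp g.val e a b) y) y := fun a b =>
    (((g.smooth e he a b).differentiableOn (by simp)).differentiableAt
      (e.open_target.mem_nhds hy)).hasFDerivAt
  have h1 := hasFDerivAt_det hd
  have habs : HasDerivAt (fun t : ℝ => |t|) (SignType.sign (metricMatrix g e y).det : ℝ)
      (metricMatrix g e y).det := hasDerivAt_abs h0
  have h2 := habs.comp_hasFDerivAt y h1
  have h3 := (h2.sqrt (abs_pos.2 h0).ne').fderiv
  have h4 : pd j (density g e) y = _ := congrArg (fun L : E4 →L[ℝ] ℝ => L (stdVec j)) h3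
  rw [h4, sum_christoffel_trace]
  have h5 : ∀ i k, (metricMatrix g e y).adjugate i k
      = (metricMatrix g e y).det * invMetric g e y i k := by
    intro i k
    rw [invMetric, Matrix.inv_def, Ring.inverse_eq_inv', Matrix.smul_apply, smul_eq_mul,
      mul_inv_cancel_left₀ h0]
  simp only [h5, _root_.smul_apply, _root_.sum_apply, smul_eq_mul, Function.comp_apply]
  have h6 : ∑ i, ∑ k, (metricMatrix g e y).det * invMetric g e y i k
      * fderiv ℝ (cov2Comp g.val e k i) y (stdVec j) = (metricMatrix g e y).det *
      ∑ k, ∑ l, invMetric g e y k l * pd j (cov2Comp g.val e l k) y := by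
    simp only [Finset.mul_sum, pd, mul_assoc]
  rw [h6]
  set S := ∑ k, ∑ l, invMetric g e y k l * pd j (cov2Comp g.val e l k) y
  have h7 : (SignType.sign (metricMatrix g e y).det : ℝ) * (metricMatrix g e y).det
      = |(metricMatrix g e y).det| := sign_mul_self _
  have hs : density g e y * density g e y = |(metricMatrix g e y).det| :=
    Real.mul_self_sqrt (abs_nonneg _)
  have hpos := density_pos g he hy
  rw [show Real.sqrt |(metricMatrix g e y).det| = density g e y from rfl]
  field_simp
  rw [pow_two, hs, ← h7]

end MetricChart

/-! ### The volume measure in a chart -/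

section Volume

variable {M : Type*} [TopologicalSpace M] [ChartedSpace E4 M] [IsManifold (𝓡 4) ∞ M]
  (g : LorentzMetric M) {e e' : OpenPartialHomeomorph M E4}

theorem density_transition (he : e ∈ atlas E4 M) (he' : e' ∈ atlas E4 M) {p : M}
    (hp : p ∈ e.source) (hp' : p ∈ e'.source) :
    density g e (e p) = |(fderiv ℝ (e' ∘ e.symm) (e p)).det| * density g e' (e' p) := by
  set A := fderiv ℝ (e' ∘ e.symm) (e p) with hA
  set b := (EuclideanSpace.basisFun (Fin 4) ℝ).toBasis
  have hdet : A.det = (LinearMap.toMatrix b b (A : E4 →ₗ[ℝ] E4)).det := by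
    rw [LinearMap.det_toMatrix]
    try rfl
  have hB : ∀ k i, LinearMap.toMatrix b b (A : E4 →ₗ[ℝ] E4) k i = A (stdVec i) k := by
    intro k i
    rw [LinearMap.toMatrix_apply]
    simp [b, stdVec]
  have hD : ∀ i, chartD e' p (chartDinv e p (stdVec i)) = A (stdVec i) := by
    intro i
    rw [chartD_trans he he' hp hp']
    simp only [ContinuousLinearMap.comp_apply, chartD_chartDinv he hp]
    rfl
  have hG : metricMatrix g e (e p) = (LinearMap.toMatrix b b (A : E4 →ₗ[ℝ] E4)).transpose
      * metricMatrix g e' (e' p) * LinearMap.toMatrix b b (A : E4 →ₗ[ℝ] E4) := by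
    ext i j
    rw [metricMatrix_chart g i j hp, Matrix.mul_apply]
    refine (metric_eq_sum g he' hp' _ _).trans ?_
    simp only [Matrix.mul_apply, Matrix.transpose_apply, hB, hD, Finset.sum_mul]
    rw [Finset.sum_comm]
    exact Finset.sum_congr rfl fun k _ => Finset.sum_congr rfl fun l _ => by ring
  rw [density, density, hG, Matrix.det_mul, Matrix.det_mul, Matrix.det_transpose, ← hdet]
  rw [show A.det * (metricMatrix g e' (e' p)).det * A.det
    = A.det ^ 2 * (metricMatrix g e' (e' p)).det by ring, abs_mul, abs_pow,
    Real.sqrt_mul (by positivity), Real.sqrt_sq (abs_nonneg _)]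

variable [MeasurableSpace M] [BorelSpace M]

theorem measurableSet_chart_preimage (e : OpenPartialHomeomorph M E4) {A : Set M}
    (hA : MeasurableSet A) : MeasurableSet (e.target ∩ e.symm ⁻¹' A) := by
  have hc : Continuous (e.target.domRestrict e.symm) :=
    continuousOn_iff_continuous_domRestrict.1 e.continuousOn_symm
  have h := MeasurableSet.subtype_image e.open_target.measurableSet (hc.measurable hA)
  convert h using 1
  ext y
  simp [and_comm]

theorem aemeasurable_density (he : e ∈ atlas E4 M) :
    AEMeasurable (density g e) ((volume : Measure E4).restrict e.target) :=
  (contDiffOn_density g he).continuousOn.aemeasurable e.open_target.measurableSet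

theorem aemeasurable_symm (e : OpenPartialHomeomorph M E4) :
    AEMeasurable e.symm ((volume : Measure E4).restrict e.target) := by
  have hm : ∀ A : Set M, MeasurableSet A → MeasurableSet (e.target ∩ e.symm ⁻¹' A) :=
    fun A hA => measurableSet_chart_preimage e hA
  by_cases hne : e.target = ∅
  · simp [hne]
  obtain ⟨y0, hy0⟩ := Set.nonempty_iff_ne_empty.2 hne
  classical
  refine ⟨e.target.piecewise e.symm fun _ => e.symm y0, ?_, ?_⟩
  · intro A hA
    rw [Set.piecewise_preimage]
    have : MeasurableSet (e.target ∩ e.symm ⁻¹' A ∪ ((fun _ : E4 => e.symm y0) ⁻¹' A) \ e.target) :=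
      (hm A hA).union ((measurable_const hA).diff e.open_target.measurableSet)
    rw [inter_comm] at this
    exact this
  · filter_upwards [ae_restrict_mem e.open_target.measurableSet] with y hy
    rw [Set.piecewise_eq_of_mem _ _ _ hy]

theorem chartVolume_apply (e : OpenPartialHomeomorph M E4) {A : Set M} (hA : MeasurableSet A) :
    chartVolume g e A = ∫⁻ y in e.target ∩ e.symm ⁻¹' A, ENNReal.ofReal (density g e y) := by
  have hac : ((volume : Measure E4).restrict e.target).withDensity
      (fun y => ENNReal.ofReal (Real.sqrt |(metricMatrix g e y).det|))
      ≪ (volume : Measure E4).restrict e.target := withDensity_absolutelyContinuous _ _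
  have hB := measurableSet_chart_preimage e hA
  rw [chartVolume, Measure.map_apply_of_aemeasurable ((aemeasurable_symm e).mono_ac hac) hA]
  have hcarry : (((volume : Measure E4).restrict e.target).withDensity
      (fun y => ENNReal.ofReal (Real.sqrt |(metricMatrix g e y).det|))) e.targetᶜ = 0 :=
    hac (by simp [Measure.restrict_apply e.open_target.measurableSet.compl])
  rw [← measure_inter_conull' (t := e.target) (measure_mono_null (sdiff_subset_compl _ _) hcarry),
    inter_comm, withDensity_apply _ hB, Measure.restrict_restrict hB,
    inter_assoc, inter_comm _ e.target, ← inter_assoc, inter_self]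
  rfl

theorem chartVolume_eq_of_subset (he : e ∈ atlas E4 M) (he' : e' ∈ atlas E4 M) {A : Set M}
    (hA : MeasurableSet A) (hAe : A ⊆ e.source) (hAe' : A ⊆ e'.source) :
    chartVolume g e A = chartVolume g e' A := by
  rw [chartVolume_apply g e hA, chartVolume_apply g e' hA]
  set s := e.target ∩ e.symm ⁻¹' A with hs
  have hss : s ⊆ (e.symm.trans e').source := fun y hy => by
    simp [hy.1, hAe' hy.2]
  have himg : (e' ∘ e.symm) '' s = e'.target ∩ e'.symm ⁻¹' A := by
    ext z
    constructor
    · rintro ⟨y, hy, rfl⟩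
      refine ⟨e'.map_source (hAe' hy.2), ?_⟩
      simp only [mem_preimage, Function.comp_apply, e'.left_inv (hAe' hy.2)]
      exact hy.2
    · rintro ⟨hz, hzA⟩
      refine ⟨e (e'.symm z), ⟨e.map_source (hAe hzA), ?_⟩, ?_⟩
      · simp only [mem_preimage, e.left_inv (hAe hzA)]
        exact hzA
      · simp [e.left_inv (hAe hzA), e'.right_inv hz]
  have hinj : InjOn (e' ∘ e.symm) s := by
    intro y hy z hz h
    exact e.symm.injOn hy.1 hz.1 (e'.injOn (hAe' hy.2) (hAe' hz.2) h)
  have hder : ∀ y ∈ s, HasFDerivWithinAt (e' ∘ e.symm) (fderiv ℝ (e' ∘ e.symm) y) s y := by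
    intro y hy
    exact (((chart_trans_contDiffOn he he').differentiableOn (by simp)).differentiableAt
      ((e.symm.trans e').open_source.mem_nhds (hss hy))).hasFDerivAt.hasFDerivWithinAt
  rw [← himg, lintegral_image_eq_lintegral_abs_det_fderiv_mul volume
    (measurableSet_chart_preimage e hA) hder hinj]
  refine setLIntegral_congr_fun (measurableSet_chart_preimage e hA) fun y hy => ?_
  have h := density_transition g he he' (hAe hy.2) (hAe' hy.2)
  rw [e.right_inv hy.1] at h
  simp only [Function.comp_apply]
  rw [h, ENNReal.ofReal_mul (abs_nonneg _)]

variable [SecondCountableTopology M] [Nonempty M]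

theorem volumeMeasure_restrict_source (he : e ∈ atlas E4 M) :
    (volumeMeasure g).restrict e.source = chartVolume g e := by
  have hcarry : chartVolume g e e.sourceᶜ = 0 := by
    rw [chartVolume_apply g e e.open_source.measurableSet.compl]
    have : e.target ∩ e.symm ⁻¹' e.sourceᶜ = ∅ := by
      ext y; simp only [mem_inter_iff, mem_preimage, mem_compl_iff, mem_empty_iff_false, iff_false,
        not_and, not_not]
      exact fun hy => e.map_target hy
    rw [this]
    simp
  ext A hA
  rw [Measure.restrict_apply hA]
  set c := fun n => chartAt E4 ((exists_chart_cover (M := M)).choose n) with hc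
  have hcov : (⋃ n, (c n).source) = univ := (exists_chart_cover (M := M)).choose_spec
  set D := disjointed fun n => (c n).source with hD
  have hDm : ∀ n, MeasurableSet (D n) := fun n =>
    MeasurableSet.disjointed (fun m => (c m).open_source.measurableSet) n
  have hAm : MeasurableSet (A ∩ e.source) := hA.inter e.open_source.measurableSet
  rw [volumeMeasure, Measure.sum_apply _ hAm]
  have h1 : ∀ n, ((chartVolume g (c n)).restrict (D n)) (A ∩ e.source)
      = chartVolume g e (A ∩ e.source ∩ D n) := by
    intro n
    rw [Measure.restrict_apply hAm]
    exact chartVolume_eq_of_subset g (chart_mem_atlas E4 _) he (hAm.inter (hDm n))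
      (fun p hp => disjointed_subset _ n hp.2) (fun p hp => hp.1.2)
  refine (tsum_congr h1).trans ?_
  rw [← measure_iUnion (fun m n hmn => ?_) fun n => hAm.inter (hDm n)]
  · rw [← inter_iUnion, hD, iUnion_disjointed, hcov, inter_univ]
    exact measure_inter_conull' (measure_mono_null (sdiff_subset_compl _ _) hcarry)
  · exact (disjoint_disjointed _ hmn).mono inter_subset_right inter_subset_right

variable [T2Space M] {φ : E4 → ℝ}

theorem continuous_chartExt (h : IsTestFun e.target φ) : Continuous (chartExt e φ) := by
  rw [continuous_iff_continuousAt]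
  intro p
  by_cases hp : p ∈ e.source
  · have h1 : ContinuousAt (fun q => φ (e q)) p :=
      h.smooth.continuous.continuousAt.comp (e.continuousAt hp)
    refine h1.congr ?_
    filter_upwards [e.open_source.mem_nhds hp] with q hq
    rw [chartExt_of_mem hq]
  · have hc : IsOpen (e.symm '' tsupport φ)ᶜ :=
      (isCompact_symm_image_tsupport h).isClosed.isOpen_compl
    have hp' : p ∈ (e.symm '' tsupport φ)ᶜ := fun h' => hp (symm_image_subset_source h h')
    refine (continuousAt_const (y := (0 : ℝ))).congr ?_
    filter_upwards [hc.mem_nhds hp'] with q hq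
    rw [chartExt_eq_zero hq]

theorem integral_chartExt (he : e ∈ atlas E4 M) (h : IsTestFun e.target φ) :
    Integrable (chartExt e φ) (volumeMeasure g) ∧
    ∫ p, chartExt e φ p ∂(volumeMeasure g) = ∫ y, density g e y * φ y := by
  have hcont := continuous_chartExt h
  have hd : AEMeasurable (fun y => ENNReal.ofReal (Real.sqrt |(metricMatrix g e y).det|))
      ((volume : Measure E4).restrict e.target) := (aemeasurable_density g he).ennreal_ofReal
  have hlt : ∀ᵐ y ∂((volume : Measure E4).restrict e.target),
      ENNReal.ofReal (Real.sqrt |(metricMatrix g e y).det|) < ⊤ :=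
    Eventually.of_forall fun _ => ENNReal.ofReal_lt_top
  have hsymm := (aemeasurable_symm e).mono_ac (withDensity_absolutelyContinuous
    ((volume : Measure E4).restrict e.target)
    fun y => ENNReal.ofReal (Real.sqrt |(metricMatrix g e y).det|))
  have hdφ : IsTestFun e.target (fun y => density g e y * φ y) :=
    h.contDiffOn_mul e.open_target (contDiffOn_density g he)
  have hdens : ∀ y ∈ e.target, (ENNReal.ofReal (Real.sqrt |(metricMatrix g e y).det|)).toReal
      • chartExt e φ (e.symm y) = density g e y * φ y := by
    intro y hy
    rw [ENNReal.toReal_ofReal (Real.sqrt_nonneg _), chartExt_of_mem (e.map_target hy),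
      e.right_inv hy]
    rfl
  have hint : Integrable (fun y => density g e y * φ y) :=
    hdφ.smooth.continuous.integrable_of_hasCompactSupport hdφ.compact
  have hmeas : AEStronglyMeasurable (chartExt e φ) (chartVolume g e) := by
    exact hcont.measurable.aestronglyMeasurable
  constructor
  · rw [← integrableOn_iff_integrable_of_support_subset (s := e.source)
      (fun p hp => by_contra fun hn => hp (chartExt_of_notMem hn)), IntegrableOn,
      volumeMeasure_restrict_source g he]
    refine (integrable_map_measure hmeas hsymm).2 ?_
    rw [integrable_withDensity_iff_integrable_smul₀' hd hlt]
    refine (hint.integrableOn (s := e.target)).congr ?_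
    filter_upwards [ae_restrict_mem e.open_target.measurableSet] with y hy
    exact (hdens y hy).symm
  · rw [← setIntegral_eq_integral_of_forall_compl_eq_zero (s := e.source)
      (fun p hp => chartExt_of_notMem hp), volumeMeasure_restrict_source g he]
    refine (integral_map hsymm hmeas).trans ?_
    rw [integral_withDensity_eq_integral_toReal_smul₀ hd hlt,
      setIntegral_congr_fun e.open_target.measurableSet hdens]
    exact setIntegral_eq_integral_of_forall_compl_eq_zero fun y hy => hdφ.apply_eq_zero hy

end Volume

/-! ### Partition of test fields, and linearity of the action of a smooth field -/

section Actions

variable {M : Type*} [TopologicalSpace M] [ChartedSpace E4 M] [IsManifold (𝓡 4) ∞ M]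
  [T2Space M] [SecondCountableTopology M] {e e' : OpenPartialHomeomorph M E4} {φ : E4 → ℝ}

theorem exists_finite_partition {K : Set M} (hK : IsCompact K) {V : M → Set M}
    (hV : ∀ p, IsOpen (V p)) (hpV : ∀ p, p ∈ V p) :
    ∃ (t : Finset M) (ρ : M → M → ℝ), (∀ p, ContMDiff (𝓡 4) 𝓘(ℝ, ℝ) ∞ (ρ p)) ∧
      (∀ p, tsupport (ρ p) ⊆ V p) ∧ ∀ q ∈ K, ∑ p ∈ t, ρ p q = 1 := by
  have : LocallyCompactSpace M := ChartedSpace.locallyCompactSpace E4 M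
  obtain ⟨t, ht⟩ := hK.elim_finite_subcover V hV fun p _ => mem_iUnion.2 ⟨p, hpV p⟩
  obtain ⟨f, hf⟩ := SmoothPartitionOfUnity.exists_isSubordinate (𝓡 4) hK.isClosed
    (fun p : t => V p) (fun p => hV p) (fun q hq => by
      obtain ⟨p, hp, hq'⟩ := mem_iUnion₂.1 (ht hq)
      exact mem_iUnion.2 ⟨⟨p, hp⟩, hq'⟩)
  classical
  refine ⟨t, fun p => if h : p ∈ t then f ⟨p, h⟩ else 0, fun p => ?_, fun p => ?_, fun q hq => ?_⟩
  · by_cases h : p ∈ t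
    · simp only [h, dif_pos]
      exact (f ⟨p, h⟩).contMDiff
    · simp only [h, dif_neg, not_false_iff]
      exact contMDiff_const
  · by_cases h : p ∈ t
    · simp only [h, dif_pos]
      exact hf ⟨p, h⟩
    · simp only [h, dif_neg, not_false_iff]
      rw [tsupport_eq_empty_iff.2 rfl]
      exact empty_subset _
  · have h1 := f.sum_eq_one hq
    rw [finsum_eq_sum_of_fintype] at h1
    rw [← h1, ← Finset.sum_coe_sort t]
    exact Finset.sum_congr rfl fun p _ => by simp

/-- A property of test tensors that is stable under sums holds for all of them if it holds locally:
for those with support in small open sets. -/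
theorem IsTestCov2.local_induction {P : CovTensor M → Prop} (h0 : P 0)
    (hadd : ∀ x y, IsTestCov2 x → IsTestCov2 y → P x → P y → P (x + y))
    (hloc : ∀ p : M, ∃ V : Set M, IsOpen V ∧ p ∈ V ∧ ∀ x, SmoothCov2 x → ∀ K, IsCompact K →
      K ⊆ V → (∀ q, q ∉ K → x q = 0) → P x) (x : CovTensor M) (hx : IsTestCov2 x) : P x := by
  choose V hV hpV hP using hloc
  obtain ⟨hxs, K, hK, hx0⟩ := hx
  obtain ⟨t, ρ, hρ, hρV, hsum⟩ := exists_finite_partition hK hV hpV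
  have hcomp : ∀ p q, q ∉ K ∩ tsupport (ρ p) → ρ p q • x q = 0 := by
    intro p q hq
    by_cases hqK : q ∈ K
    · have : ρ p q = 0 := image_eq_zero_of_notMem_tsupport fun h => hq ⟨hqK, h⟩
      rw [this]
      exact ContinuousLinearMap.ext fun v => ContinuousLinearMap.ext fun w => zero_mul _
    · rw [hx0 q hqK]
      exact ContinuousLinearMap.ext fun v => ContinuousLinearMap.ext fun w => mul_zero _
  have hKc : ∀ p, IsCompact (K ∩ tsupport (ρ p)) := fun p => hK.inter_right (isClosed_tsupport _)
  have hx : x = ∑ p ∈ t, fun q => ρ p q • x q := by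
    funext q
    rw [Finset.sum_apply]
    refine ContinuousLinearMap.ext fun v => ContinuousLinearMap.ext fun w => ?_
    have h1 : (∑ p ∈ t, ρ p q • x q) v w = (∑ p ∈ t, ρ p q) * x q v w := by
      simp only [_root_.sum_apply, Finset.sum_mul]
      rfl
    rw [h1]
    by_cases hqK : q ∈ K
    · rw [hsum q hqK, one_mul]
    · rw [hx0 q hqK]
      exact (mul_zero _).symm
  rw [hx]
  refine (Finset.sum_induction _ (fun y => IsTestCov2 y ∧ P y) (fun y z hy hz =>
    ⟨hy.1.add hz.1, hadd y z hy.1 hz.1 hy.2 hz.2⟩) ⟨IsTestCov2.zero, h0⟩ fun p _ => ?_).2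
  exact ⟨⟨hxs.mul (hρ p), _, hKc p, hcomp p⟩, hP p _ (hxs.mul (hρ p)) _ (hKc p)
    (fun q hq => hρV p hq.2) (hcomp p)⟩

theorem IsTestCov.local_induction {P : CovField M → Prop} (h0 : P 0)
    (hadd : ∀ x y, IsTestCov x → IsTestCov y → P x → P y → P (x + y))
    (hloc : ∀ p : M, ∃ V : Set M, IsOpen V ∧ p ∈ V ∧ ∀ x, SmoothCov x → ∀ K, IsCompact K →
      K ⊆ V → (∀ q, q ∉ K → x q = 0) → P x) (x : CovField M) (hx : IsTestCov x) : P x := by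
  choose V hV hpV hP using hloc
  obtain ⟨hxs, K, hK, hx0⟩ := hx
  obtain ⟨t, ρ, hρ, hρV, hsum⟩ := exists_finite_partition hK hV hpV
  have hcomp : ∀ p q, q ∉ K ∩ tsupport (ρ p) → ρ p q • x q = 0 := by
    intro p q hq
    by_cases hqK : q ∈ K
    · have : ρ p q = 0 := image_eq_zero_of_notMem_tsupport fun h => hq ⟨hqK, h⟩
      rw [this]
      exact ContinuousLinearMap.ext fun v => zero_mul _
    · rw [hx0 q hqK]
      exact ContinuousLinearMap.ext fun v => mul_zero _
  have hKc : ∀ p, IsCompact (K ∩ tsupport (ρ p)) := fun p => hK.inter_right (isClosed_tsupport _)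
  have hx : x = ∑ p ∈ t, fun q => ρ p q • x q := by
    funext q
    rw [Finset.sum_apply]
    refine ContinuousLinearMap.ext fun v => ?_
    have h1 : (∑ p ∈ t, ρ p q • x q) v = (∑ p ∈ t, ρ p q) * x q v := by
      simp only [_root_.sum_apply, Finset.sum_mul]
      rfl
    rw [h1]
    by_cases hqK : q ∈ K
    · rw [hsum q hqK, one_mul]
    · rw [hx0 q hqK]
      exact (mul_zero _).symm
  rw [hx]
  refine (Finset.sum_induction _ (fun y => IsTestCov y ∧ P y) (fun y z hy hz =>
    ⟨hy.1.add hz.1, hadd y z hy.1 hz.1 hy.2 hz.2⟩) ⟨IsTestCov.zero, h0⟩ fun p _ => ?_).2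
  exact ⟨⟨hxs.mul (hρ p), _, hKc p, hcomp p⟩, hP p _ (hxs.mul (hρ p)) _ (hKc p)
    (fun q hq => hρV p hq.2) (hcomp p)⟩

/-- To prove an additive property of all test tensors it suffices to treat elementary ones. -/
theorem IsTestCov2.elem_induction {P : CovTensor M → Prop} (h0 : P 0)
    (hadd : ∀ x y, IsTestCov2 x → IsTestCov2 y → P x → P y → P (x + y))
    (helem : ∀ e ∈ atlas E4 M, ∀ i j φ, IsTestFun e.target φ → P (elemTensor e i j φ))
    (x : CovTensor M) (hx : IsTestCov2 x) : P x := by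
  refine IsTestCov2.local_induction h0 hadd (fun p => ⟨(chartAt E4 p).source,
    (chartAt E4 p).open_source, mem_chart_source E4 p, fun x hx K hK hKs hx0 => ?_⟩) x hx
  have he := chart_mem_atlas E4 p
  rw [eq_sum_elemTensor he fun q hq => hx0 q fun h => hq (hKs h)]
  have hφ : ∀ i j, IsTestFun (chartAt E4 p).target (extComp (chartAt E4 p)
      (cov2Comp x (chartAt E4 p) i j)) := fun i j =>
    (isTestFun_extComp hK hKs (hx _ he i j) fun y _ hyK => by
      rw [cov2Comp, hx0 _ hyK]; rfl).1
  refine (Finset.sum_induction _ (fun y => IsTestCov2 y ∧ P y) (fun y z hy hz =>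
    ⟨hy.1.add hz.1, hadd y z hy.1 hz.1 hy.2 hz.2⟩) ⟨IsTestCov2.zero, h0⟩ fun i _ => ?_).2
  refine Finset.sum_induction _ (fun y => IsTestCov2 y ∧ P y) (fun y z hy hz =>
    ⟨hy.1.add hz.1, hadd y z hy.1 hz.1 hy.2 hz.2⟩) ⟨IsTestCov2.zero, h0⟩ fun j _ => ?_
  exact ⟨isTestCov2_elemTensor he i j (hφ i j), helem _ he i j _ (hφ i j)⟩

theorem IsTestCov.elem_induction {P : CovField M → Prop} (h0 : P 0)
    (hadd : ∀ x y, IsTestCov x → IsTestCov y → P x → P y → P (x + y))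
    (helem : ∀ e ∈ atlas E4 M, ∀ i φ, IsTestFun e.target φ → P (elemCov e i φ))
    (x : CovField M) (hx : IsTestCov x) : P x := by
  refine IsTestCov.local_induction h0 hadd (fun p => ⟨(chartAt E4 p).source,
    (chartAt E4 p).open_source, mem_chart_source E4 p, fun x hx K hK hKs hx0 => ?_⟩) x hx
  have he := chart_mem_atlas E4 p
  rw [eq_sum_elemCov he fun q hq => hx0 q fun h => hq (hKs h)]
  have hφ : ∀ i, IsTestFun (chartAt E4 p).target (extComp (chartAt E4 p)
      (covComp x (chartAt E4 p) i)) := fun i =>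
    (isTestFun_extComp hK hKs (hx _ he i) fun y _ hyK => by
      rw [covComp, hx0 _ hyK]; rfl).1
  refine (Finset.sum_induction _ (fun y => IsTestCov y ∧ P y) (fun y z hy hz =>
    ⟨hy.1.add hz.1, hadd y z hy.1 hz.1 hy.2 hz.2⟩) ⟨IsTestCov.zero, h0⟩ fun i _ => ?_).2
  exact ⟨isTestCov_elemCov he i (hφ i), helem _ he i _ (hφ i)⟩

theorem contract_elemTensor (he : e ∈ atlas E4 M) (T : ContraTensor M) (i j : Fin 4) (p : M) :
    contract (T p) (elemTensor e i j φ p)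
      = chartExt e (fun y => contra2Comp T e i j y * φ y) p := by
  by_cases hp : p ∈ e.source
  · rw [contract_eq_sum he T _ hp, chartExt_of_mem hp]
    have h1 : ∀ k l, cov2Comp (elemTensor e i j φ) e k l (e p)
        = φ (e p) * ((if i = k then 1 else 0) * (if j = l then 1 else 0)) := by
      intro k l
      rw [cov2Comp_chart _ _ _ hp]
      refine (elemTensor_apply i j p _ _).trans ?_
      rw [chartExt_of_mem hp, ← dcoord_apply, ← dcoord_apply, dcoord_chartDinv he hp,
        dcoord_chartDinv he hp]
    simp only [h1]
    rw [Finset.sum_eq_single i, Finset.sum_eq_single j]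
    · simp
    · intro l _ hl; simp [hl.symm]
    · simp
    · intro k _ hk
      exact Finset.sum_eq_zero fun l _ => by simp [hk.symm]
    · simp
  · rw [chartExt_of_notMem hp]
    have h1 : ∀ v w, elemTensor e i j φ p v w = 0 := by
      intro v w
      refine (elemTensor_apply i j p _ _).trans ?_
      rw [chartExt_of_notMem hp, zero_mul]
    exact Finset.sum_eq_zero fun k _ => Finset.sum_eq_zero fun l _ => by
      exact (congrArg _ (h1 _ _)).trans (mul_zero _)

theorem pairing_elemCov (J : VecField M) (i : Fin 4) (p : M) :
    elemCov e i φ p (J p) = chartExt e (fun y => vecComp J e i y * φ y) p := by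
  by_cases hp : p ∈ e.source
  · rw [chartExt_of_mem hp, vecComp_chart _ _ hp]
    refine (elemCov_apply i p _).trans ?_
    rw [chartExt_of_mem hp, mul_comm]
  · rw [chartExt_of_notMem hp]
    refine (elemCov_apply i p _).trans ?_
    rw [chartExt_of_notMem hp, zero_mul]

theorem contract_add_right {p : M} (T : (TangentSpace (𝓡 4) p →L[ℝ] ℝ) →L[ℝ]
    (TangentSpace (𝓡 4) p →L[ℝ] ℝ) →L[ℝ] ℝ)
    (x y : TangentSpace (𝓡 4) p →L[ℝ] TangentSpace (𝓡 4) p →L[ℝ] ℝ) :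
    contract T (x + y) = contract T x + contract T y := by
  simp only [contract, ← Finset.sum_add_distrib]
  exact Finset.sum_congr rfl fun i _ => Finset.sum_congr rfl fun j _ => mul_add _ _ _

theorem contract_smul_right {p : M} (T : (TangentSpace (𝓡 4) p →L[ℝ] ℝ) →L[ℝ]
    (TangentSpace (𝓡 4) p →L[ℝ] ℝ) →L[ℝ] ℝ) (r : ℝ)
    (x : TangentSpace (𝓡 4) p →L[ℝ] TangentSpace (𝓡 4) p →L[ℝ] ℝ) :
    contract T (r • x) = r * contract T x := by
  simp only [contract, Finset.mul_sum]
  exact Finset.sum_congr rfl fun i _ => Finset.sum_congr rfl fun j _ => mul_left_comm _ _ _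

theorem contract_smul_left {p : M} (T : (TangentSpace (𝓡 4) p →L[ℝ] ℝ) →L[ℝ]
    (TangentSpace (𝓡 4) p →L[ℝ] ℝ) →L[ℝ] ℝ) (r : ℝ)
    (x : TangentSpace (𝓡 4) p →L[ℝ] TangentSpace (𝓡 4) p →L[ℝ] ℝ) :
    contract (r • T) x = r * contract T x := by
  simp only [contract, Finset.mul_sum]
  exact Finset.sum_congr rfl fun i _ => Finset.sum_congr rfl fun j _ => mul_assoc _ _ _

theorem contract_zero_right {p : M} (T : (TangentSpace (𝓡 4) p →L[ℝ] ℝ) →L[ℝ]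
    (TangentSpace (𝓡 4) p →L[ℝ] ℝ) →L[ℝ] ℝ) : contract T 0 = 0 := by
  exact Finset.sum_eq_zero fun k _ => Finset.sum_eq_zero fun l _ => mul_zero _

variable [MeasurableSpace M] [BorelSpace M] [Nonempty M] (g : LorentzMetric M)

theorem integrable_contract {T : ContraTensor M} (hT : SmoothContra2 T) {x : CovTensor M}
    (hx : IsTestCov2 x) : Integrable (fun p => contract (T p) (x p)) (volumeMeasure g) := by
  refine IsTestCov2.elem_induction (P := fun x =>
    Integrable (fun p => contract (T p) (x p)) (volumeMeasure g)) ?_ ?_ ?_ x hx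
  · have : (fun p => contract (T p) ((0 : CovTensor M) p)) = fun _ => (0 : ℝ) :=
      funext fun p => contract_zero_right (T p)
    rw [this]
    exact integrable_zero _ _ _
  · intro x y _ _ hx hy
    refine (hx.add hy).congr (Eventually.of_forall fun p => ?_)
    exact (contract_add_right _ _ _).symm
  · intro e he i j φ hφ
    simp only [contract_elemTensor he]
    exact (integral_chartExt g he (hφ.contDiffOn_mul e.open_target (hT e he i j))).1

theorem integrable_pairing {J : VecField M} (hJ : SmoothVec J) {w : CovField M}
    (hw : IsTestCov w) : Integrable (fun p => w p (J p)) (volumeMeasure g) := by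
  refine IsTestCov.elem_induction (P := fun w =>
    Integrable (fun p => w p (J p)) (volumeMeasure g)) ?_ ?_ ?_ w hw
  · exact integrable_zero _ _ _
  · intro x y _ _ hx hy
    exact hx.add hy
  · intro e he i φ hφ
    simp only [pairing_elemCov]
    exact (integral_chartExt g he (hφ.contDiffOn_mul e.open_target (hJ e he i))).1

theorem tensorAction_add {T : ContraTensor M} (hT : SmoothContra2 T) {x y : CovTensor M}
    (hx : IsTestCov2 x) (hy : IsTestCov2 y) :
    tensorAction g T (x + y) = tensorAction g T x + tensorAction g T y := by
  rw [tensorAction, tensorAction, tensorAction,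
    ← integral_add (integrable_contract g hT hx) (integrable_contract g hT hy)]
  exact integral_congr_ae (Eventually.of_forall fun p => contract_add_right _ _ _)

theorem tensorAction_const_smul (T : ContraTensor M) (r : ℝ) (x : CovTensor M) :
    tensorAction g T (r • x) = r * tensorAction g T x := by
  rw [tensorAction, tensorAction, ← integral_const_mul]
  exact integral_congr_ae (Eventually.of_forall fun p => contract_smul_right _ _ _)

theorem tensorAction_smul_left (T : ContraTensor M) (r : ℝ) (x : CovTensor M) :
    tensorAction g (r • T) x = r * tensorAction g T x := by
  rw [tensorAction, tensorAction, ← integral_const_mul]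
  exact integral_congr_ae (Eventually.of_forall fun p => contract_smul_left _ _ _)

theorem vecAction_add {J : VecField M} (hJ : SmoothVec J) {x y : CovField M}
    (hx : IsTestCov x) (hy : IsTestCov y) :
    vecAction g J (x + y) = vecAction g J x + vecAction g J y := by
  rw [vecAction, vecAction, vecAction,
    ← integral_add (integrable_pairing g hJ hx) (integrable_pairing g hJ hy)]
  rfl

theorem vecAction_const_smul (J : VecField M) (r : ℝ) (x : CovField M) :
    vecAction g J (r • x) = r * vecAction g J x := by
  rw [vecAction, vecAction, ← integral_const_mul]
  rfl

theorem vecAction_smul_left (J : VecField M) (r : ℝ) (x : CovField M) :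
    vecAction g (r • J) x = r * vecAction g J x := by
  rw [vecAction, vecAction, ← integral_const_mul]
  exact integral_congr_ae (Eventually.of_forall fun p => map_smul (x p) r (J p))

theorem tensorAction_elemTensor {T : ContraTensor M} (hT : SmoothContra2 T)
    (he : e ∈ atlas E4 M) (i j : Fin 4) (hφ : IsTestFun e.target φ) :
    tensorAction g T (elemTensor e i j φ)
      = ∫ y, density g e y * (contra2Comp T e i j y * φ y) := by
  rw [tensorAction]
  simp only [contract_elemTensor he]
  exact (integral_chartExt g he (hφ.contDiffOn_mul e.open_target (hT e he i j))).2

theorem vecAction_elemCov {J : VecField M} (hJ : SmoothVec J)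
    (he : e ∈ atlas E4 M) (i : Fin 4) (hφ : IsTestFun e.target φ) :
    vecAction g J (elemCov e i φ) = ∫ y, density g e y * (vecComp J e i y * φ y) := by
  rw [vecAction]
  simp only [pairing_elemCov]
  exact (integral_chartExt g he (hφ.contDiffOn_mul e.open_target (hJ e he i))).2

end Actions

/-! ### Conservation laws, integrated against test fields -/

section Conservation

theorem integral_pd_eq_zero {Ω : Set E4} {ψ : E4 → ℝ} (h : IsTestFun Ω ψ) (i : Fin 4) :
    ∫ y, pd i ψ y = 0 := by
  have h1 := h.fderiv_apply (stdVec i)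
  have hi : Integrable ψ := h.smooth.continuous.integrable_of_hasCompactSupport h.compact
  have hi1 : Integrable (fun y => fderiv ℝ ψ y (stdVec i)) :=
    h1.smooth.continuous.integrable_of_hasCompactSupport h1.compact
  have := integral_mul_fderiv_eq_neg_fderiv_mul_of_integrable (μ := (volume : Measure E4))
    (f := fun _ : E4 => (1 : ℝ)) (g := ψ) (v := stdVec i) (by simp) (by simpa using hi1)
    (by simpa using hi) (fun _ _ => differentiableAt_const _)
    (fun _ _ => h.smooth.differentiable (by simp) _)
  simpa [pd] using this

variable {M : Type*} [TopologicalSpace M] [ChartedSpace E4 M] [IsManifold (𝓡 4) ∞ M]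
  [T2Space M] [SecondCountableTopology M] [MeasurableSpace M] [BorelSpace M] [Nonempty M]
  (g : LorentzMetric M) {e : OpenPartialHomeomorph M E4} {φ : E4 → ℝ}

theorem IsTestFun.integrable {Ω : Set E4} {ψ : E4 → ℝ} (h : IsTestFun Ω ψ) :
    Integrable ψ :=
  h.smooth.continuous.integrable_of_hasCompactSupport h.compact

theorem IsTestFun.pd {Ω : Set E4} {ψ : E4 → ℝ} (h : IsTestFun Ω ψ) (i : Fin 4) :
    IsTestFun Ω (pd i ψ) := h.fderiv_apply (stdVec i)

theorem pd_mul {f h : E4 → ℝ} {y : E4} (hf : DifferentiableAt ℝ f y)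
    (hh : DifferentiableAt ℝ h y) (i : Fin 4) :
    pd i (fun z => f z * h z) y = f y * pd i h y + pd i f y * h y := by
  rw [pd, fderiv_fun_mul hf hh]
  simp only [_root_.add_apply, _root_.smul_apply, smul_eq_mul, pd]
  ring

/-- `∫ J^a ∇_a φ = 0` for a divergence-free current. -/
theorem sum_vecAction_pd {J : VecField M} (hJ : SmoothVec J) (hdiv : IsDivFree g J)
    (he : e ∈ atlas E4 M) (hφ : IsTestFun e.target φ) :
    ∑ i, vecAction g J (elemCov e i (pd i φ)) = 0 := by
  have hρ := contDiffOn_density g he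
  have hρJ := fun i => hρ.mul (hJ e he i)
  have h1 : ∀ i, ∫ y, pd i (fun y => density g e y * vecComp J e i y * φ y) y = 0 :=
    fun i => integral_pd_eq_zero (hφ.contDiffOn_mul e.open_target (hρJ i)) i
  have h2 : ∀ i, IsTestFun e.target fun y => density g e y * (vecComp J e i y * pd i φ y) :=
    fun i => ((hφ.pd i).contDiffOn_mul e.open_target (hJ e he i)).contDiffOn_mul e.open_target hρ
  have h3 : ∑ i, ∫ y, pd i (fun y => density g e y * vecComp J e i y * φ y) y = 0 := by
    simp [h1]
  rw [← integral_finsetSum _ fun i _ =>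
    ((hφ.contDiffOn_mul e.open_target (hρJ i)).pd i).integrable] at h3
  simp only [vecAction_elemCov g hJ he _ (hφ.pd _)]
  rw [← integral_finsetSum _ fun i _ => (h2 i).integrable, ← h3]
  refine integral_congr_ae (Eventually.of_forall fun y => ?_)
  simp only
  by_cases hy : y ∈ e.target
  · have hn := e.open_target.mem_nhds hy
    have hd : DifferentiableAt ℝ (density g e) y :=
      (hρ.contDiffAt hn).differentiableAt (by simp)
    have hJd : ∀ i, DifferentiableAt ℝ (vecComp J e i) y := fun i =>
      ((hJ e he i).contDiffAt hn).differentiableAt (by simp)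
    have hφd : DifferentiableAt ℝ φ y := hφ.smooth.contDiffAt.differentiableAt (by simp)
    have h4 : ∀ i, pd i (fun y => density g e y * vecComp J e i y * φ y) y
        = density g e y * (vecComp J e i y * pd i φ y) + density g e y * φ y *
          (pd i (vecComp J e i) y + ∑ k, christoffel g e k k i y * vecComp J e i y) := by
      intro i
      rw [pd_mul (f := fun y => density g e y * vecComp J e i y) (hd.mul (hJd i)) hφd,
        pd_mul hd (hJd i), pd_density g he hy, ← Finset.sum_mul]
      ring
    simp only [h4]
    rw [Finset.sum_add_distrib, ← Finset.mul_sum (a := density g e y * φ y)]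
    have h5 := hdiv e he y hy
    rw [divVec] at h5
    have h6 : ∑ i, (pd i (vecComp J e i) y + ∑ k, christoffel g e k k i y * vecComp J e i y)
        = ∑ i, (pd i (vecComp J e i) y + ∑ j, christoffel g e i i j y * vecComp J e j y) := by
      rw [Finset.sum_add_distrib, Finset.sum_add_distrib]
      rw [Finset.sum_comm (f := fun i k => christoffel g e k k i y * vecComp J e i y)]
    rw [h6, h5, mul_zero, add_zero]
  · rw [Finset.sum_eq_zero fun i _ => (h2 i).apply_eq_zero hy, Finset.sum_eq_zero fun i _ =>
      ((hφ.contDiffOn_mul e.open_target (hρJ i)).pd i).apply_eq_zero hy]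

/-- The force law integrated against the test covector `φ dy^i`: this is
`∫ T^{ab} ∇_b y_a = - ∫ F^a_b J^b y_a` written in a chart. -/
theorem sum_tensorAction_pd {F : CovTensor M} (hF : SmoothCov2 F) {T : ContraTensor M}
    {J : VecField M} (hT : SmoothContra2 T) (hJ : SmoothVec J) (hforce : SatisfiesForceLaw g F T J)
    (he : e ∈ atlas E4 M) (hφ : IsTestFun e.target φ) (i : Fin 4) :
    ∑ j, tensorAction g T (elemTensor e i j (pd j φ))
      - ∑ k, ∑ j, tensorAction g T (elemTensor e k j fun y => christoffel g e i j k y * φ y)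
      = -∑ k, vecAction g J (elemCov e k fun y => mixedComp g F e i k y * φ y) := by
  have hρ := contDiffOn_density g he
  have ho := e.open_target
  have hρT := fun j => hρ.mul (hT e he i j)
  have hΓφ := fun k j => hφ.contDiffOn_mul ho (contDiffOn_christoffel g he i j k)
  have hFφ := fun k => hφ.contDiffOn_mul ho (contDiffOn_mixedComp g hF he i k)
  have t0 := fun j => (hφ.contDiffOn_mul ho (hρT j)).pd j
  have t1 := fun j => ((hφ.pd j).contDiffOn_mul ho (hT e he i j)).contDiffOn_mul ho hρ
  have t2 := fun k j => ((hΓφ k j).contDiffOn_mul ho (hT e he k j)).contDiffOn_mul ho hρ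
  have t3 := fun k => ((hFφ k).contDiffOn_mul ho (hJ e he k)).contDiffOn_mul ho hρ
  have h3 : ∑ j, ∫ y, pd j (fun y => density g e y * contra2Comp T e i j y * φ y) y = 0 :=
    Finset.sum_eq_zero fun j _ => integral_pd_eq_zero (hφ.contDiffOn_mul ho (hρT j)) j
  rw [← integral_finsetSum _ fun j _ => (t0 j).integrable] at h3
  simp only [tensorAction_elemTensor g hT he _ _ (hφ.pd _),
    tensorAction_elemTensor g hT he _ _ (hΓφ _ _), vecAction_elemCov g hJ he _ (hFφ _)]
  rw [← integral_finsetSum _ fun j _ => (t1 j).integrable]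
  have e2 : ∑ k, ∑ j, ∫ y, density g e y * (contra2Comp T e k j y *
      (christoffel g e i j k y * φ y)) = ∫ y, ∑ k, ∑ j, density g e y * (contra2Comp T e k j y *
      (christoffel g e i j k y * φ y)) := by
    rw [integral_finsetSum _ fun k _ => integrable_finsetSum _ fun j _ => (t2 k j).integrable]
    exact Finset.sum_congr rfl fun k _ =>
      (integral_finsetSum _ fun j _ => (t2 k j).integrable).symm
  have i1 : Integrable fun y => ∑ j, density g e y * (contra2Comp T e i j y * pd j φ y) :=
    integrable_finsetSum _ fun j _ => (t1 j).integrable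
  have i2 : Integrable fun y => ∑ k, ∑ j, density g e y * (contra2Comp T e k j y *
      (christoffel g e i j k y * φ y)) :=
    integrable_finsetSum _ fun k _ => integrable_finsetSum _ fun j _ => (t2 k j).integrable
  have i3 : Integrable fun y => ∑ k, density g e y * (vecComp J e k y *
      (mixedComp g F e i k y * φ y)) := integrable_finsetSum _ fun k _ => (t3 k).integrable
  have i12 : Integrable fun y => ∑ j, density g e y * (contra2Comp T e i j y * pd j φ y)
      - ∑ k, ∑ j, density g e y * (contra2Comp T e k j y * (christoffel g e i j k y * φ y)) :=
    i1.sub i2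
  rw [e2, ← integral_finsetSum _ fun k _ => (t3 k).integrable, eq_neg_iff_add_eq_zero,
    ← integral_sub i1 i2, ← integral_add i12 i3, ← h3]
  refine integral_congr_ae (Eventually.of_forall fun y => ?_)
  simp only
  by_cases hy : y ∈ e.target
  · have hn := e.open_target.mem_nhds hy
    have hd : DifferentiableAt ℝ (density g e) y :=
      (hρ.contDiffAt hn).differentiableAt (by simp)
    have hTd : ∀ j, DifferentiableAt ℝ (contra2Comp T e i j) y := fun j =>
      ((hT e he i j).contDiffAt hn).differentiableAt (by simp)
    have hφd : DifferentiableAt ℝ φ y := hφ.smooth.contDiffAt.differentiableAt (by simp)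
    have h4 : ∀ j, pd j (fun y => density g e y * contra2Comp T e i j y * φ y) y
        = density g e y * (contra2Comp T e i j y * pd j φ y) + density g e y * φ y *
          (pd j (contra2Comp T e i j) y
            + ∑ k, christoffel g e k k j y * contra2Comp T e i j y) := by
      intro j
      rw [pd_mul (f := fun y => density g e y * contra2Comp T e i j y) (hd.mul (hTd j)) hφd,
        pd_mul hd (hTd j), pd_density g he hy, ← Finset.sum_mul]
      ring
    simp only [h4]
    rw [Finset.sum_add_distrib, ← Finset.mul_sum (a := density g e y * φ y)]
    have h5 := hforce e he y hy i
    rw [divTensor] at h5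
    have h7 : ∑ k, ∑ j, density g e y * (contra2Comp T e k j y * (christoffel g e i j k y * φ y))
        = density g e y * φ y * ∑ j, ∑ k, christoffel g e i j k y * contra2Comp T e k j y := by
      rw [Finset.sum_comm]
      simp only [Finset.mul_sum]
      exact Finset.sum_congr rfl fun j _ => Finset.sum_congr rfl fun k _ => by ring
    have h8 : ∑ k, density g e y * (vecComp J e k y * (mixedComp g F e i k y * φ y))
        = density g e y * φ y * ∑ k, mixedComp g F e i k y * vecComp J e k y := by
      rw [Finset.mul_sum]
      exact Finset.sum_congr rfl fun k _ => by ring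
    have h9 : ∑ j, (pd j (contra2Comp T e i j) y
        + ∑ k, christoffel g e k k j y * contra2Comp T e i j y)
        = ∑ j, (pd j (contra2Comp T e i j) y + ∑ k, (christoffel g e i j k y * contra2Comp T e k j y
          + christoffel g e j j k y * contra2Comp T e i k y))
          - ∑ j, ∑ k, christoffel g e i j k y * contra2Comp T e k j y := by
      simp only [Finset.sum_add_distrib]
      rw [Finset.sum_comm (f := fun j k => christoffel g e k k j y * contra2Comp T e i j y)]
      ring
    rw [h7, h8, h9, h5]
    ring
  · rw [Finset.sum_eq_zero fun j _ => (t1 j).apply_eq_zero hy, Finset.sum_eq_zero fun k _ =>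
      Finset.sum_eq_zero fun j _ => (t2 k j).apply_eq_zero hy,
      Finset.sum_eq_zero fun k _ => (t3 k).apply_eq_zero hy,
      Finset.sum_eq_zero fun j _ => (t0 j).apply_eq_zero hy]
    ring

end Conservation

/-! ### Distributions of order zero carried by a curve -/

section CurveFunctionals

/-- Locally finite functionals on the test functions of `Ω` that vanish off the set `S`: linear,
bounded by the supremum norm on each compact subset, and zero on test functions whose support does
not meet `S`. -/
structure IsLocalMeasure (Ω S : Set E4) (l : (E4 → ℝ) → ℝ) : Prop where
  add : ∀ φ ψ, IsTestFun Ω φ → IsTestFun Ω ψ → l (fun y => φ y + ψ y) = l φ + l ψ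
  smul : ∀ (r : ℝ) φ, IsTestFun Ω φ → l (fun y => r * φ y) = r * l φ
  bound : ∀ K, IsCompact K → K ⊆ Ω → ∃ B, ∀ φ, IsTestFun Ω φ → tsupport φ ⊆ K →
    ∀ ε, (∀ y, |φ y| ≤ ε) → |l φ| ≤ B * ε
  supp : ∀ φ, IsTestFun Ω φ → Disjoint (tsupport φ) S → l φ = 0

/-- Linear functionals on the test functions of `Ω` that depend only on the values of the test
function on `S`. -/
structure IsCurveFunctional {E : Type*} [NormedAddCommGroup E] [NormedSpace ℝ E] (Ω S : Set E)
    (l : (E → ℝ) → ℝ) : Prop where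
  add : ∀ φ ψ, IsTestFun Ω φ → IsTestFun Ω ψ → l (fun y => φ y + ψ y) = l φ + l ψ
  smul : ∀ (r : ℝ) φ, IsTestFun Ω φ → l (fun y => r * φ y) = r * l φ
  ext : ∀ φ ψ, IsTestFun Ω φ → IsTestFun Ω ψ → EqOn φ ψ S → l φ = l ψ

namespace IsCurveFunctional

variable {E : Type*} [NormedAddCommGroup E] [NormedSpace ℝ E] {Ω S : Set E} {l : (E → ℝ) → ℝ}

theorem zero (hl : IsCurveFunctional Ω S l) : l (fun _ => 0) = 0 := by
  simpa using hl.smul 0 _ IsTestFun.zero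

theorem eq_zero (hl : IsCurveFunctional Ω S l) {φ : E → ℝ} (hφ : IsTestFun Ω φ)
    (h : ∀ y ∈ S, φ y = 0) : l φ = 0 :=
  (hl.ext φ _ hφ IsTestFun.zero h).trans hl.zero

theorem sub (hl : IsCurveFunctional Ω S l) {φ ψ : E → ℝ} (hφ : IsTestFun Ω φ)
    (hψ : IsTestFun Ω ψ) : l (fun y => φ y - ψ y) = l φ - l ψ := by
  have h1 := hl.add φ _ hφ (hψ.const_mul (-1))
  rw [hl.smul (-1) ψ hψ] at h1
  rw [show (fun y => φ y - ψ y) = fun y => φ y + -1 * ψ y from funext fun y => by ring, h1]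
  ring

theorem sum (hl : IsCurveFunctional Ω S l) {ι : Type*} (s : Finset ι) {φ : ι → E → ℝ}
    (h : ∀ i ∈ s, IsTestFun Ω (φ i)) : l (fun y => ∑ i ∈ s, φ i y) = ∑ i ∈ s, l (φ i) := by
  classical
  induction s using Finset.induction_on with
  | empty => simpa using hl.zero
  | insert a s ha ih =>
    simp only [Finset.sum_insert ha]
    rw [hl.add _ _ (h a (by simp)) (IsTestFun.sum s fun i hi => h i (by simp [hi])),
      ih fun i hi => h i (by simp [hi])]

/-- A sum of curve functionals, weighted by smooth functions. -/
theorem sum_mul {ι : Type*} (s : Finset ι) {l : ι → (E → ℝ) → ℝ} {f : ι → E → ℝ}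
    (hl : ∀ i, IsCurveFunctional Ω S (l i)) (hf : ∀ i, ContDiff ℝ ∞ (f i)) :
    IsCurveFunctional Ω S fun φ => ∑ i ∈ s, l i fun y => φ y * f i y := by
  refine ⟨fun φ ψ hφ hψ => ?_, fun r φ hφ => ?_, fun φ ψ hφ hψ h => ?_⟩
  · rw [← Finset.sum_add_distrib]
    refine Finset.sum_congr rfl fun i _ => ?_
    rw [← (hl i).add _ _ (hφ.mul_right (hf i)) (hψ.mul_right (hf i))]
    simp only [add_mul]
  · rw [Finset.mul_sum]
    refine Finset.sum_congr rfl fun i _ => ?_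
    rw [← (hl i).smul _ _ (hφ.mul_right (hf i))]
    simp only [mul_assoc]
  · refine Finset.sum_congr rfl fun i _ => ?_
    refine (hl i).ext _ _ (hφ.mul_right (hf i)) (hψ.mul_right (hf i)) fun y hy => ?_
    simp only [h hy]

end IsCurveFunctional

theorem exists_smooth_cutoff : ∃ β : ℝ → ℝ, ContDiff ℝ ∞ β ∧ (∀ t, 0 ≤ β t) ∧ (∀ t, β t ≤ 1) ∧
    (∀ t, 1 ≤ |t| → β t = 0) ∧ ∃ r > 0, ∀ t, |t| < r → β t = 1 := by
  obtain ⟨β, hβ, h0, h1, W, hW, hKW, hW1⟩ := exists_testFun_eq_one (E := ℝ) (K := {0})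
    (Ω := Ioo (-1) 1) isCompact_singleton isOpen_Ioo (by simp)
  obtain ⟨r, hr, hrW⟩ := Metric.isOpen_iff.1 hW 0 (hKW rfl)
  refine ⟨β, hβ.smooth, h0, h1, fun t ht => hβ.apply_eq_zero fun h => ?_, r, hr, fun t ht =>
    hW1 t (hrW ?_)⟩
  · exact absurd (abs_lt.2 h) (not_lt.2 ht)
  · simpa using ht

/-- A functional of order zero that vanishes off `S` only depends on the values of the test function
on `S`: a test function that vanishes on `S` is uniformly small near `S`. -/
theorem IsLocalMeasure.isCurveFunctional {Ω S : Set E4} {l : (E4 → ℝ) → ℝ}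
    (hl : IsLocalMeasure Ω S l) : IsCurveFunctional Ω S l := by
  have key : ∀ ψ, IsTestFun Ω ψ → (∀ y ∈ S, ψ y = 0) → l ψ = 0 := by
    intro ψ hψ hS
    obtain ⟨β, hβ, hβ0, hβ1, hβz, r, hr, hβr⟩ := exists_smooth_cutoff
    obtain ⟨B, hB⟩ := hl.bound _ hψ.compact.isCompact hψ.subset
    have hsmall : ∀ ε > 0, |l ψ| ≤ B * ε := by
      intro ε hε
      have hs : ContDiff ℝ ∞ fun y => β (ψ y / ε) := hβ.comp (hψ.smooth.div_const ε)
      have h1 : IsTestFun Ω fun y => β (ψ y / ε) * ψ y := hψ.mul_left hs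
      have h2 : IsTestFun Ω fun y => (1 - β (ψ y / ε)) * ψ y :=
        hψ.mul_left (contDiff_const.sub hs)
      have hsplit : l ψ = l (fun y => β (ψ y / ε) * ψ y)
          + l (fun y => (1 - β (ψ y / ε)) * ψ y) := by
        rw [← hl.add _ _ h1 h2]
        congr 1
        funext y
        ring
      have h3 : l (fun y => (1 - β (ψ y / ε)) * ψ y) = 0 := by
        refine hl.supp _ h2 (Set.disjoint_left.2 fun y hy hyS => ?_)
        have hc : ContinuousAt (fun y => |ψ y / ε|) y :=
          (hψ.smooth.continuous.div_const ε).abs.continuousAt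
        have hev : ∀ᶠ z in 𝓝 y, |ψ z / ε| < r :=
          hc.eventually_lt continuousAt_const (by simpa [hS y hyS] using hr)
        exact notMem_tsupport_iff_eventuallyEq.2 (hev.mono fun z hz => by simp [hβr _ hz]) hy
      rw [hsplit, h3, add_zero]
      refine hB _ h1 (tsupport_mul_subset_right (f := fun y => β (ψ y / ε))) ε fun y => ?_
      rw [abs_mul, abs_of_nonneg (hβ0 _)]
      by_cases h : 1 ≤ |ψ y / ε|
      · rw [hβz _ h, zero_mul]; exact hε.le
      · rw [not_le, abs_div, abs_of_pos hε, div_lt_one hε] at h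
        calc β (ψ y / ε) * |ψ y| ≤ 1 * |ψ y| := by gcongr; exact hβ1 _
          _ ≤ ε := by rw [one_mul]; exact h.le
    have h0 : |l ψ| ≤ 0 := by
      have ht : Tendsto (fun ε : ℝ => B * ε) (𝓝[>] 0) (𝓝 0) := by
        have : Tendsto (fun ε : ℝ => B * ε) (𝓝 0) (𝓝 (B * 0)) :=
          (continuous_const.mul continuous_id).tendsto _
        rw [mul_zero] at this
        exact this.mono_left nhdsWithin_le_nhds
      exact ge_of_tendsto ht (eventually_mem_nhdsWithin.mono fun ε hε => hsmall ε hε)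
    exact abs_eq_zero.1 (le_antisymm h0 (abs_nonneg _))
  refine ⟨hl.add, hl.smul, fun φ ψ hφ hψ h => ?_⟩
  have h1 := key _ (hφ.sub hψ) fun y hy => sub_eq_zero.2 (h hy)
  have h2 := hl.add _ _ (hφ.sub hψ) hψ
  rw [h1, zero_add] at h2
  rw [← h2]
  congr 1
  funext y
  ring

/-! ### Functionals on an interval -/

/-- A test function on an interval with vanishing integral is the derivative of a test function. -/
theorem exists_primitive_testFun {a b : ℝ} {h : ℝ → ℝ} (hh : IsTestFun (Ioo a b) h)
    (h0 : ∫ s, h s = 0) : ∃ H, IsTestFun (Ioo a b) H ∧ deriv H = h := by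
  by_cases hne : (tsupport h).Nonempty
  swap
  · rw [not_nonempty_iff_eq_empty, tsupport_eq_empty_iff] at hne
    exact ⟨_, IsTestFun.zero, by rw [hne]; funext s; simp⟩
  obtain ⟨c, hc, hcl⟩ := hh.compact.isCompact.exists_isLeast hne
  obtain ⟨d, hd, hdl⟩ := hh.compact.isCompact.exists_isGreatest hne
  have hz : ∀ s, s ∉ Icc c d → h s = 0 := fun s hs =>
    image_eq_zero_of_notMem_tsupport fun h' => hs ⟨hcl h', hdl h'⟩
  have hcont := hh.smooth.continuous
  have hderiv : ∀ s, HasDerivAt (fun s => ∫ t in c..s, h t) (h s) s := fun s =>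
    intervalIntegral.integral_hasDerivAt_right (hcont.intervalIntegrable _ _)
      (hcont.stronglyMeasurableAtFilter _ _) hcont.continuousAt
  have hd' : deriv (fun s => ∫ t in c..s, h t) = h := funext fun s => (hderiv s).deriv
  have hHz : ∀ s, s ∉ Icc c d → ∫ t in c..s, h t = 0 := by
    intro s hs
    rcases lt_or_ge s c with h1 | h1
    · rw [intervalIntegral.integral_symm, intervalIntegral.integral_of_le h1.le,
        integral_Ioc_eq_integral_Ioo, setIntegral_eq_zero_of_forall_eq_zero fun t ht =>
          hz t fun h' => absurd h'.1 (not_le.2 ht.2), neg_zero]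
    · have h2 : d < s := by
        by_contra hn
        exact hs ⟨h1, not_lt.1 hn⟩
      have h3 : ∀ t, t ∉ Icc c s → h t = 0 := fun t ht => hz t fun h' =>
        ht ⟨h'.1, h'.2.trans h2.le⟩
      rw [intervalIntegral.integral_of_le h1, ← integral_Icc_eq_integral_Ioc,
        setIntegral_eq_integral_of_forall_compl_eq_zero h3, h0]
  have hsub : tsupport (fun s => ∫ t in c..s, h t) ⊆ Icc c d :=
    closure_minimal (fun s hs => by_contra fun hn => hs (hHz s hn)) isClosed_Icc
  refine ⟨fun s => ∫ t in c..s, h t, ⟨?_,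
    isCompact_Icc.of_isClosed_subset (isClosed_tsupport _) hsub, hsub.trans ?_⟩, hd'⟩
  · rw [contDiff_infty_iff_deriv, hd']
    exact ⟨fun s => (hderiv s).differentiableAt, hh.smooth⟩
  · have h1 := hh.subset hc
    have h2 := hh.subset hd
    exact Icc_subset_Ioo h1.1 h2.2

theorem exists_testFun_integral_one {a b : ℝ} (hab : a < b) :
    ∃ ρ, IsTestFun (Ioo a b) ρ ∧ (∀ s, 0 ≤ ρ s) ∧ 0 < ρ ((a + b) / 2) ∧ ∫ s, ρ s = 1 := by
  have hmid : (a + b) / 2 ∈ Ioo a b := ⟨by linarith, by linarith⟩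
  obtain ⟨χ, hχ, h0, -, W, -, hKW, hW1⟩ := exists_testFun_eq_one (E := ℝ)
    (K := {(a + b) / 2}) (Ω := Ioo a b) isCompact_singleton isOpen_Ioo (by simpa using hmid)
  have hm1 : χ ((a + b) / 2) = 1 := hW1 _ (hKW rfl)
  have hpos : 0 < ∫ s, χ s :=
    hχ.smooth.continuous.integral_pos_of_hasCompactSupport_nonneg_nonzero hχ.compact h0
      (x := (a + b) / 2) (by rw [hm1]; exact one_ne_zero)
  refine ⟨fun s => (∫ s, χ s)⁻¹ * χ s, hχ.const_mul _, fun s =>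
    mul_nonneg (inv_nonneg.2 hpos.le) (h0 s), ?_, ?_⟩
  · simp only [hm1]; positivity
  · rw [integral_const_mul, inv_mul_cancel₀ hpos.ne']

/-- A linear functional on an interval that annihilates derivatives is a multiple of the
integral. -/
theorem exists_eq_const_mul_integral {a b : ℝ} (hab : a < b) {S : Set ℝ} {l : (ℝ → ℝ) → ℝ}
    (hl : IsCurveFunctional (Ioo a b) S l)
    (hderiv : ∀ f, IsTestFun (Ioo a b) f → l (deriv f) = 0) :
    ∃ m : ℝ, ∀ f, IsTestFun (Ioo a b) f → l f = m * ∫ s, f s := by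
  obtain ⟨ρ, hρ, -, -, hρ1⟩ := exists_testFun_integral_one hab
  refine ⟨l ρ, fun f hf => ?_⟩
  have hi : ∀ {f : ℝ → ℝ}, IsTestFun (Ioo a b) f → Integrable f := fun hf =>
    hf.smooth.continuous.integrable_of_hasCompactSupport hf.compact
  have hg : IsTestFun (Ioo a b) fun s => f s - (∫ s, f s) * ρ s := hf.sub (hρ.const_mul _)
  obtain ⟨H, hH, hHd⟩ := exists_primitive_testFun hg (by
    rw [integral_sub (hi hf) ((hi hρ).const_mul _), integral_const_mul, hρ1]; ring)
  have h1 := hderiv H hH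
  rw [hHd, hl.sub hf (hρ.const_mul _), hl.smul _ _ hρ] at h1
  linarith

/-- The fundamental lemma of the calculus of variations, for a continuous function. -/
theorem eq_zero_of_integral_testFun_eq_zero {a b : ℝ} {f : ℝ → ℝ} (hf : ContinuousOn f (Ioo a b))
    (h : ∀ g, IsTestFun (Ioo a b) g → ∫ s, g s * f s = 0) {s : ℝ} (hs : s ∈ Ioo a b) :
    f s = 0 := by
  have h1 := isOpen_Ioo.ae_eq_zero_of_integral_contDiff_smul_eq_zero (μ := volume)
    (hf.locallyIntegrableOn measurableSet_Ioo) fun g hg hgc hgs => h g ⟨hg, hgc, hgs⟩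
  by_contra hne
  have hopen : IsOpen (Ioo a b ∩ f ⁻¹' {0}ᶜ) :=
    hf.isOpen_inter_preimage isOpen_Ioo isOpen_compl_singleton
  have hpos := hopen.measure_pos volume ⟨s, hs, hne⟩
  have hz : volume (Ioo a b ∩ f ⁻¹' {0}ᶜ) = 0 := by
    refine measure_mono_null ?_ (ae_iff.1 h1)
    intro t ht h'
    exact ht.2 (h' ht.1)
  exact hpos.ne' hz

end CurveFunctionals

/-! ### The structure of a conserved pair of distributions carried by a curve -/

section CurveStructure

variable {Ω : Set E4} {c : ℝ → E4} {τ : E4 → ℝ} {s0 δ : ℝ} {A : Set ℝ}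

/-- The components of the velocity of a curve in the model space. -/
def vel (c : ℝ → E4) (i : Fin 4) (s : ℝ) : ℝ := deriv (fun s => c s i) s

theorem contDiff_coord (hc : ContDiff ℝ ∞ c) (i : Fin 4) : ContDiff ℝ ∞ fun s => c s i :=
  (EuclideanSpace.proj (𝕜 := ℝ) i : E4 →L[ℝ] ℝ).contDiff.comp hc

theorem contDiff_vel (hc : ContDiff ℝ ∞ c) (i : Fin 4) : ContDiff ℝ ∞ (vel c i) :=
  (contDiff_infty_iff_deriv.1 (contDiff_coord hc i)).2

theorem contDiff_pd {f : E4 → ℝ} (hf : ContDiff ℝ ∞ f) (i : Fin 4) : ContDiff ℝ ∞ (pd i f) :=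
  (hf.fderiv_right (m := ∞) (by simp)).clm_apply contDiff_const

theorem pd_comp {f : ℝ → ℝ} {τ : E4 → ℝ} {y : E4} (hf : DifferentiableAt ℝ f (τ y))
    (hτ : DifferentiableAt ℝ τ y) (k : Fin 4) :
    pd k (fun y => f (τ y)) y = deriv f (τ y) * pd k τ y := by
  have h := (hf.hasDerivAt.comp_hasFDerivAt y hτ.hasFDerivAt).fderiv
  have h2 : pd k (fun y => f (τ y)) y = _ := congrArg (fun L : E4 →L[ℝ] ℝ => L (stdVec k)) h
  rw [h2]
  rfl

theorem hasDerivAt_comp_curve {f : E4 → ℝ} {s : ℝ} (hf : DifferentiableAt ℝ f (c s))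
    (hc : DifferentiableAt ℝ c s) :
    HasDerivAt (fun s => f (c s)) (∑ j, pd j f (c s) * vel c j s) s := by
  have h := hf.hasFDerivAt.comp_hasDerivAt s hc.hasDerivAt
  have hv : ∀ j, vel c j s = deriv c s j := fun j =>
    ((EuclideanSpace.proj (𝕜 := ℝ) j : E4 →L[ℝ] ℝ).hasFDerivAt.comp_hasDerivAt s
      hc.hasDerivAt).deriv
  have h2 : fderiv ℝ f (c s) (deriv c s) = ∑ j, pd j f (c s) * vel c j s := by
    conv_lhs => rw [← sum_stdVec (deriv c s), map_sum]
    simp only [map_smul, smul_eq_mul, hv, pd, mul_comm]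
  rw [← h2]
  exact h

theorem sum_pd_mul_vel (hc : ContDiff ℝ ∞ c) (hτ : ContDiff ℝ ∞ τ)
    (hτc : ∀ s ∈ Ioo (s0 - δ) (s0 + δ), τ (c s) = s) {s : ℝ} (hs : s ∈ Ioo (s0 - δ) (s0 + δ)) :
    ∑ j, pd j τ (c s) * vel c j s = 1 := by
  have h1 := hasDerivAt_comp_curve (hτ.differentiable (by simp) (c s))
    (hc.differentiable (by simp) s)
  have h2 : HasDerivAt (fun s => τ (c s)) 1 s := by
    refine (hasDerivAt_id s).congr_of_eventuallyEq ?_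
    filter_upwards [isOpen_Ioo.mem_nhds hs] with t ht
    exact hτc t ht
  exact h1.unique h2

/-- If the divergence of a family of functionals carried by a curve is again carried by the curve,
then the family is tangent to the curve. -/
theorem tangent_of_divergence (hc : ContDiff ℝ ∞ c) (hτ : ContDiff ℝ ∞ τ)
    (hA : A ⊆ Ioo (s0 - δ) (s0 + δ)) (hτc : ∀ s ∈ Ioo (s0 - δ) (s0 + δ), τ (c s) = s)
    {l : Fin 4 → (E4 → ℝ) → ℝ} (hl : ∀ k, IsCurveFunctional Ω (c '' A) (l k))
    (hdiv : ∀ ψ, IsTestFun Ω ψ → (∀ s ∈ A, ψ (c s) = 0) → ∑ j, l j (pd j ψ) = 0)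
    (i : Fin 4) {φ : E4 → ℝ} (hφ : IsTestFun Ω φ) :
    l i φ = ∑ k, l k fun y => φ y * (vel c i (τ y) * pd k τ y) := by
  -- a function vanishing on the curve
  have hh : ContDiff ℝ ∞ fun y : E4 => y i - c (τ y) i :=
    (EuclideanSpace.proj (𝕜 := ℝ) i : E4 →L[ℝ] ℝ).contDiff.sub ((contDiff_coord hc i).comp hτ)
  have hv : ContDiff ℝ ∞ fun y : E4 => vel c i (τ y) := (contDiff_vel hc i).comp hτ
  have hzero : ∀ s ∈ A, (c s) i - c (τ (c s)) i = 0 := fun s hs => by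
    rw [hτc s (hA hs), sub_self]
  have h1 := hdiv (fun y => (y i - c (τ y) i) * φ y) (hφ.mul_left hh) fun s hs => by
    simp only [hzero s hs, zero_mul]
  have hpdh : ∀ k y, pd k (fun y : E4 => y i - c (τ y) i) y
      = (if i = k then 1 else 0) - vel c i (τ y) * pd k τ y := by
    intro k y
    have hd1 : DifferentiableAt ℝ (fun y : E4 => y i) y :=
      (EuclideanSpace.proj (𝕜 := ℝ) i : E4 →L[ℝ] ℝ).differentiableAt
    have hd2 : DifferentiableAt ℝ (fun y : E4 => c (τ y) i) y :=
      ((contDiff_coord hc i).comp hτ).differentiable (by simp) y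
    have e1 : pd k (fun y : E4 => y i) y = if i = k then 1 else 0 := by
      have : fderiv ℝ (fun y : E4 => y i) y = (EuclideanSpace.proj (𝕜 := ℝ) i : E4 →L[ℝ] ℝ) :=
        (EuclideanSpace.proj (𝕜 := ℝ) i : E4 →L[ℝ] ℝ).fderiv
      rw [pd, this, ← stdVec_apply]
      rfl
    have e2 : pd k (fun y : E4 => c (τ y) i) y = vel c i (τ y) * pd k τ y :=
      pd_comp (f := fun s => c s i) ((contDiff_coord hc i).differentiable (by simp) _)
        (hτ.differentiable (by simp) y) k
    rw [← e1, ← e2, pd, fderiv_fun_sub hd1 hd2]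
    rfl
  have hpt : ∀ k, IsTestFun Ω fun y => φ y * (vel c i (τ y) * pd k τ y) := fun k =>
    hφ.mul_right (hv.mul (contDiff_pd hτ k))
  have h2 : ∀ k, l k (pd k fun y => (y i - c (τ y) i) * φ y)
      = (if i = k then l k φ else 0) - l k fun y => φ y * (vel c i (τ y) * pd k τ y) := by
    intro k
    have hsplit : (if i = k then l k φ else 0) - l k (fun y => φ y * (vel c i (τ y) * pd k τ y))
        = l k fun y => (if i = k then 1 else 0) * φ y - φ y * (vel c i (τ y) * pd k τ y) := by
      rw [(hl k).sub (hφ.const_mul _) (hpt k), (hl k).smul _ _ hφ]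
      split_ifs <;> simp
    rw [hsplit]
    refine (hl k).ext _ _ ((hφ.mul_left hh).fderiv_apply _)
      ((hφ.const_mul _).sub (hpt k)) ?_
    rintro _ ⟨s, hs, rfl⟩
    rw [pd_mul (hh.differentiable (by simp) _) (hφ.smooth.differentiable (by simp) _), hpdh,
      hzero s hs]
    ring
  simp only [h2, Finset.sum_sub_distrib, Finset.sum_ite_eq, Finset.mem_univ, if_true] at h1
  linarith


theorem integral_mul_deriv_testFun {a b : ℝ} {f u : ℝ → ℝ} (hf : IsTestFun (Ioo a b) f)
    (hu : ContDiff ℝ ∞ u) : ∫ s, deriv f s * u s = -∫ s, f s * deriv u s := by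
  have h1 : IsTestFun (Ioo a b) fun s => f s * u s := hf.mul_right hu
  have hd : ∀ s, HasDerivAt (fun s => f s * u s) (deriv f s * u s + f s * deriv u s) s := fun s =>
    (hf.smooth.differentiable (by simp) s).hasDerivAt.mul
      (hu.differentiable (by simp) s).hasDerivAt
  have hf' : IsTestFun (Ioo a b) (deriv f) := hf.fderiv_apply 1
  have hi : ∀ {f : ℝ → ℝ}, IsTestFun (Ioo a b) f → Integrable f := fun hf =>
    hf.smooth.continuous.integrable_of_hasCompactSupport hf.compact
  have i1 := hi (hf'.mul_right hu)
  have i2 := hi (hf.mul_right (contDiff_infty_iff_deriv.1 hu).2)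
  have h2 := integral_eq_zero_of_hasDerivAt_of_integrable hd (i1.add i2) (hi h1)
  rw [integral_add i1 i2] at h2
  linarith

/-- Let `L` and `N` be functionals carried by a curve `c`, with `L` symmetric, `div N = 0` and
`div L = -F N`.  Then near a parameter value `s0` both are given by integration along the curve,
`L = m u u δ` and `N = q u δ`, with constants `m` and `q`, and the curve satisfies
`m (u' + Γ u u) = q F u`.  Here `A` is the set of those parameter values that carry the
functionals; if it lies on one side of `s0`, then `m = q = 0`.  The functions `w i` are the
components of a covector field along the curve with `w u = 1`, `u^a u^b ∇_a w_b = 0` and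
`F^a_b u^b w_a = 0`. -/
theorem curve_structure (hΩ : IsOpen Ω) (hc : ContDiff ℝ ∞ c) (hτ : ContDiff ℝ ∞ τ) (hδ : 0 < δ)
    (hc0 : c s0 ∈ Ω) (hτc : ∀ s ∈ Ioo (s0 - δ) (s0 + δ), τ (c s) = s)
    (hA : A ⊆ Ioo (s0 - δ) (s0 + δ))
    {Γ : Fin 4 → Fin 4 → Fin 4 → E4 → ℝ} (hΓ : ∀ i j k, ContDiffOn ℝ ∞ (Γ i j k) Ω)
    {F : Fin 4 → Fin 4 → E4 → ℝ} (hF : ∀ i k, ContDiffOn ℝ ∞ (F i k) Ω)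
    {w : Fin 4 → ℝ → ℝ} (hw : ∀ i, ContDiffOn ℝ ∞ (w i) (c ⁻¹' Ω))
    (hwu : ∀ s ∈ A, c s ∈ Ω → ∑ i, w i s * vel c i s = 1)
    (hwΓ : ∀ s ∈ A, c s ∈ Ω → ∑ i, deriv (w i) s * vel c i s
      = ∑ i, (∑ k, ∑ j, Γ i j k (c s) * (vel c k s * vel c j s)) * w i s)
    (hwF : ∀ s ∈ A, c s ∈ Ω → ∑ i, (∑ k, F i k (c s) * vel c k s) * w i s = 0)
    {L : Fin 4 → Fin 4 → (E4 → ℝ) → ℝ} {N : Fin 4 → (E4 → ℝ) → ℝ}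
    (hL : ∀ i j, IsCurveFunctional Ω (c '' A) (L i j)) (hN : ∀ i, IsCurveFunctional Ω (c '' A) (N i))
    (hsymm : ∀ i j φ, IsTestFun Ω φ → L i j φ = L j i φ)
    (hforce : ∀ φ, IsTestFun Ω φ → ∀ i, ∑ j, L i j (pd j φ)
      - ∑ k, ∑ j, L k j (fun y => Γ i j k y * φ y) = -∑ k, N k fun y => F i k y * φ y)
    (hcharge : ∀ φ, IsTestFun Ω φ → ∑ i, N i (pd i φ) = 0) :
    ∃ δ' > 0, ∃ V, IsOpen V ∧ c s0 ∈ V ∧ ∃ m q : ℝ,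
      (∀ φ, IsTestFun Ω φ → tsupport φ ⊆ V →
        (∀ i j, L i j φ = m * ∫ s in Ioo (s0 - δ') (s0 + δ'), φ (c s) * (vel c i s * vel c j s)) ∧
        ∀ i, N i φ = q * ∫ s in Ioo (s0 - δ') (s0 + δ'), φ (c s) * vel c i s) ∧
      δ' < δ ∧ (∀ s ∈ Ioo (s0 - δ) (s0 + δ), c s ∈ V → s ∈ Ioo (s0 - δ') (s0 + δ')) ∧
      (∀ i, m * (deriv (vel c i) s0 + ∑ k, ∑ j, Γ i j k (c s0) * (vel c k s0 * vel c j s0))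
        = q * ∑ k, F i k (c s0) * vel c k s0) ∧
      (((∀ s ∈ A, s ≤ s0) ∨ ∀ s ∈ A, s0 ≤ s) → m = 0 ∧ q = 0) := by
  have hu := fun i => contDiff_vel hc i
  have huτ : ∀ i, ContDiff ℝ ∞ fun y => vel c i (τ y) := fun i => (hu i).comp hτ
  have hpτ := fun k => contDiff_pd hτ k
  have hs0 : s0 ∈ Ioo (s0 - δ) (s0 + δ) := ⟨by linarith, by linarith⟩
  -- the two functionals that are tangent to the curve
  set P : (E4 → ℝ) → ℝ := fun φ => ∑ p : Fin 4 × Fin 4,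
    L p.1 p.2 fun y => φ y * (pd p.1 τ y * pd p.2 τ y) with hP
  set Q : (E4 → ℝ) → ℝ := fun φ => ∑ k, N k fun y => φ y * pd k τ y with hQ
  have hPf : IsCurveFunctional Ω (c '' A) P :=
    IsCurveFunctional.sum_mul _ (fun p => hL p.1 p.2) fun p => (hpτ p.1).mul (hpτ p.2)
  have hQf : IsCurveFunctional Ω (c '' A) Q := IsCurveFunctional.sum_mul _ hN hpτ
  have hNQ : ∀ i φ, IsTestFun Ω φ → N i φ = Q fun y => φ y * vel c i (τ y) := by
    intro i φ hφ
    rw [tangent_of_divergence hc hτ hA hτc hN (fun ψ hψ _ => hcharge ψ hψ) i hφ]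
    simp only [hQ, mul_assoc]
  have hLdiv : ∀ i ψ, IsTestFun Ω ψ → (∀ s ∈ A, ψ (c s) = 0) → ∑ j, L i j (pd j ψ) = 0 := by
    intro i ψ hψ h0
    have h1 := hforce ψ hψ i
    have h2 : ∑ k, ∑ j, L k j (fun y => Γ i j k y * ψ y) = 0 :=
      Finset.sum_eq_zero fun k _ => Finset.sum_eq_zero fun j _ =>
        (hL k j).eq_zero (hψ.contDiffOn_mul hΩ (hΓ i j k)) (by
          rintro _ ⟨s, hs, rfl⟩; rw [h0 s hs, mul_zero])
    have h3 : ∑ k, N k (fun y => F i k y * ψ y) = 0 :=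
      Finset.sum_eq_zero fun k _ => (hN k).eq_zero (hψ.contDiffOn_mul hΩ (hF i k)) (by
          rintro _ ⟨s, hs, rfl⟩; rw [h0 s hs, mul_zero])
    rw [h2, h3] at h1
    linarith
  have hLP : ∀ i j φ, IsTestFun Ω φ →
      L i j φ = P fun y => φ y * (vel c i (τ y) * vel c j (τ y)) := by
    intro i j φ hφ
    rw [tangent_of_divergence hc hτ hA hτc (hL i) (hLdiv i) j hφ]
    have h1 : ∀ k, L i k (fun y => φ y * (vel c j (τ y) * pd k τ y))
        = ∑ l, L k l fun y => φ y * (vel c i (τ y) * vel c j (τ y)) * (pd k τ y * pd l τ y) := by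
      intro k
      have hφ' := hφ.mul_right ((huτ j).mul (hpτ k))
      have e1 : L i k (fun y => φ y * (vel c j (τ y) * pd k τ y))
          = L k i (fun y => φ y * (vel c j (τ y) * pd k τ y)) := hsymm i k _ hφ'
      rw [e1, tangent_of_divergence hc hτ hA hτc (hL k) (hLdiv k) i hφ']
      refine Finset.sum_congr rfl fun l _ => ?_
      congr 1
      funext y
      ring
    simp only [h1, hP]
    rw [Fintype.sum_prod_type]
  -- a cut-off function and a small interval
  obtain ⟨χ, hχ, -, -, W, hW, hKW, hW1⟩ := exists_testFun_eq_one (K := {c s0}) isCompact_singleton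
    hΩ (by simpa using hc0)
  have hWΩ : W ⊆ Ω := fun y hy => by_contra fun hn => by
    have := hW1 y hy
    rw [hχ.apply_eq_zero hn] at this
    exact zero_ne_one this
  obtain ⟨δ₁, hδ₁, hδ₁δ, hδ₁W⟩ : ∃ δ₁ > 0, δ₁ ≤ δ ∧ ∀ s ∈ Ioo (s0 - δ₁) (s0 + δ₁), c s ∈ W := by
    have hn : c ⁻¹' W ∈ 𝓝 s0 := hc.continuous.continuousAt.preimage_mem_nhds
      (hW.mem_nhds (hKW rfl))
    obtain ⟨r, hr, hrW⟩ := Metric.mem_nhds_iff.1 hn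
    refine ⟨min r δ, lt_min hr hδ, min_le_right _ _, fun s hs => hrW ?_⟩
    rw [Real.ball_eq_Ioo]
    exact ⟨by linarith [hs.1, min_le_left r δ], by linarith [hs.2, min_le_left r δ]⟩
  set J := Ioo (s0 - δ₁) (s0 + δ₁) with hJ
  have hJo : IsOpen J := isOpen_Ioo
  have hJΩ : J ⊆ c ⁻¹' Ω := fun s hs => hWΩ (hδ₁W s hs)
  have hcΩ : ∀ {f : E4 → ℝ}, ContDiffOn ℝ ∞ f Ω → ContDiffOn ℝ ∞ (fun s => f (c s)) J :=
    fun hf => hf.comp hc.contDiffOn hJΩ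
  -- lifting test functions of the parameter
  set lift : (ℝ → ℝ) → E4 → ℝ := fun f y => χ y * f (τ y) with hlift
  have hliftT : ∀ f, IsTestFun J f → IsTestFun Ω (lift f) := fun f hf =>
    hχ.mul_right (hf.smooth.comp hτ)
  have hlift_c : ∀ f, IsTestFun J f → ∀ s ∈ A, lift f (c s) = f s := by
    intro f hf s hs
    simp only [hlift, hτc s (hA hs)]
    by_cases h : s ∈ J
    · rw [hW1 _ (hδ₁W s h), one_mul]
    · rw [hf.apply_eq_zero h, mul_zero]
  have hlift_pd : ∀ f, IsTestFun J f → ∀ s ∈ A, ∀ k,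
      pd k (lift f) (c s) = deriv f s * pd k τ (c s) := by
    intro f hf s hs k
    have e1 : pd k (lift f) (c s) = χ (c s) * pd k (fun y => f (τ y)) (c s)
        + pd k χ (c s) * f (τ (c s)) :=
      pd_mul (hχ.smooth.differentiable (by simp) _)
        ((hf.smooth.comp hτ).differentiable (by simp) _) k
    rw [e1, pd_comp (hf.smooth.differentiable (by simp) _) (hτ.differentiable (by simp) _),
      hτc s (hA hs)]
    by_cases h : s ∈ J
    · have hpχ : pd k χ (c s) = 0 := by
        have : χ =ᶠ[𝓝 (c s)] fun _ => 1 := by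
          filter_upwards [hW.mem_nhds (hδ₁W s h)] with y hy using hW1 y hy
        rw [pd, this.fderiv_eq]
        simp
      rw [hpχ, hW1 _ (hδ₁W s h)]
      ring
    · have hf' : deriv f s = 0 := (hf.fderiv_apply 1).apply_eq_zero h
      rw [hf', hf.apply_eq_zero h]
      ring
  have hcurve : ∀ {l : (E4 → ℝ) → ℝ}, IsCurveFunctional Ω (c '' A) l →
      IsCurveFunctional J A fun f => l (lift f) := by
    intro l hl
    refine ⟨fun f g hf hg => ?_, fun r f hf => ?_, fun f g hf hg h => ?_⟩
    · rw [← hl.add _ _ (hliftT f hf) (hliftT g hg)]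
      simp only [hlift, mul_add]
    · rw [← hl.smul _ _ (hliftT f hf)]
      simp only [hlift, mul_left_comm]
    · refine hl.ext _ _ (hliftT f hf) (hliftT g hg) ?_
      rintro _ ⟨s, hs, rfl⟩
      rw [hlift_c f hf s hs, hlift_c g hg s hs, h hs]
  have hM := hcurve hPf
  have hQ' := hcurve hQf
  have hderivT : ∀ f, IsTestFun J f → IsTestFun J (deriv f) := fun f hf => hf.fderiv_apply 1
  -- the charge is constant
  have hQder : ∀ f, IsTestFun J f → Q (lift (deriv f)) = 0 := by
    intro f hf
    rw [← hcharge _ (hliftT f hf)]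
    refine Finset.sum_congr rfl fun k _ => ?_
    refine (hN k).ext _ _ ((hliftT _ (hderivT f hf)).mul_right (hpτ k))
      ((hliftT f hf).pd k) ?_
    rintro _ ⟨s, hs, rfl⟩
    simp only [hlift_pd f hf s hs, hlift_c _ (hderivT f hf) s hs]
  have hJlt : s0 - δ₁ < s0 + δ₁ := by linarith
  obtain ⟨q, hq⟩ := exists_eq_const_mul_integral hJlt hQ' hQder
  -- the equation of motion in weak form
  set a : Fin 4 → ℝ → ℝ := fun i s => ∑ k, ∑ j, Γ i j k (c s) * (vel c k s * vel c j s) with ha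
  set b : Fin 4 → ℝ → ℝ := fun i s => ∑ k, F i k (c s) * vel c k s with hb
  have haJ : ∀ i, ContDiffOn ℝ ∞ (a i) J := fun i =>
    ContDiffOn.sum fun k _ => ContDiffOn.sum fun j _ =>
      (hcΩ (hΓ i j k)).mul ((hu k).mul (hu j)).contDiffOn
  have hbJ : ∀ i, ContDiffOn ℝ ∞ (b i) J := fun i =>
    ContDiffOn.sum fun k _ => (hcΩ (hF i k)).mul (hu k).contDiffOn
  have hau : ∀ i f, IsTestFun J f → IsTestFun J fun s => a i s * f s := fun i f hf =>
    hf.contDiffOn_mul hJo (haJ i)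
  have hbu : ∀ i f, IsTestFun J f → IsTestFun J fun s => b i s * f s := fun i f hf =>
    hf.contDiffOn_mul hJo (hbJ i)
  have hdu : ∀ i f, IsTestFun J f → IsTestFun J fun s => deriv f s * vel c i s := fun i f hf =>
    (hderivT f hf).mul_right (hu i)
  have hweak : ∀ i f, IsTestFun J f → P (lift fun s => deriv f s * vel c i s - a i s * f s)
      = -Q (lift fun s => b i s * f s) := by
    intro i f hf
    have h1 := hforce _ (hliftT f hf) i
    have e1 : ∑ j, L i j (pd j (lift f)) = P (lift fun s => deriv f s * vel c i s) := by
      have t1 : ∀ j, IsTestFun Ω fun y => pd j (lift f) y * (vel c i (τ y) * vel c j (τ y)) :=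
        fun j => ((hliftT f hf).pd j).mul_right ((huτ i).mul (huτ j))
      rw [Finset.sum_congr rfl fun j _ => hLP i j _ ((hliftT f hf).pd j),
        ← hPf.sum _ fun j _ => t1 j]
      refine hPf.ext _ _ (IsTestFun.sum _ fun j _ => t1 j) (hliftT _ (hdu i f hf)) ?_
      rintro _ ⟨s, hs, rfl⟩
      simp only [hlift_pd f hf s hs, hlift_c _ (hdu i f hf) s hs, hτc s (hA hs)]
      calc _ = deriv f s * vel c i s * ∑ j, pd j τ (c s) * vel c j s := by
            rw [Finset.mul_sum]
            exact Finset.sum_congr rfl fun j _ => by ring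
        _ = _ := by rw [sum_pd_mul_vel hc hτ hτc (hA hs), mul_one]
    have e2 : ∑ k, ∑ j, L k j (fun y => Γ i j k y * lift f y) = P (lift fun s => a i s * f s) := by
      have t0 : ∀ k j, IsTestFun Ω fun y => Γ i j k y * lift f y := fun k j =>
        (hliftT f hf).contDiffOn_mul hΩ (hΓ i j k)
      have t1 : ∀ k j, IsTestFun Ω fun y => Γ i j k y * lift f y
          * (vel c k (τ y) * vel c j (τ y)) :=
        fun k j => (t0 k j).mul_right ((huτ k).mul (huτ j))
      rw [Finset.sum_congr rfl fun k _ => (Finset.sum_congr rfl fun j _ =>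
        hLP k j _ (t0 k j)).trans (hPf.sum _ fun j _ => t1 k j).symm,
        ← hPf.sum _ fun k _ => IsTestFun.sum _ fun j _ => t1 k j]
      refine hPf.ext _ _ (IsTestFun.sum _ fun k _ => IsTestFun.sum _ fun j _ => t1 k j)
        (hliftT _ (hau i f hf)) ?_
      rintro _ ⟨s, hs, rfl⟩
      rw [hlift_c _ (hau i f hf) s hs]
      simp only [hlift_c f hf s hs, hτc s (hA hs), ha, Finset.sum_mul]
      exact Finset.sum_congr rfl fun k _ => Finset.sum_congr rfl fun j _ => by ring
    have e3 : ∑ k, N k (fun y => F i k y * lift f y) = Q (lift fun s => b i s * f s) := by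
      have t0 : ∀ k, IsTestFun Ω fun y => F i k y * lift f y := fun k =>
        (hliftT f hf).contDiffOn_mul hΩ (hF i k)
      have t1 : ∀ k, IsTestFun Ω fun y => F i k y * lift f y * vel c k (τ y) :=
        fun k => (t0 k).mul_right (huτ k)
      rw [Finset.sum_congr rfl fun k _ => hNQ k _ (t0 k), ← hQf.sum _ fun k _ => t1 k]
      refine hQf.ext _ _ (IsTestFun.sum _ fun k _ => t1 k) (hliftT _ (hbu i f hf)) ?_
      rintro _ ⟨s, hs, rfl⟩
      rw [hlift_c _ (hbu i f hf) s hs]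
      simp only [hlift_c f hf s hs, hτc s (hA hs), hb, Finset.sum_mul]
      exact Finset.sum_congr rfl fun k _ => by ring
    rw [e1, e2, e3] at h1
    rw [← h1]
    exact hM.sub (hdu i f hf) (hau i f hf)
  -- the mass is constant
  have hMder : ∀ f, IsTestFun J f → P (lift (deriv f)) = 0 := by
    intro f hf
    have hwf : ∀ i, IsTestFun J fun s => w i s * f s := fun i =>
      hf.contDiffOn_mul hJo ((hw i).mono hJΩ)
    have t1 : ∀ i, IsTestFun J fun s => deriv (fun s => w i s * f s) s * vel c i s
        - a i s * (w i s * f s) := fun i => (hdu i _ (hwf i)).sub (hau i _ (hwf i))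
    have h1 : ∑ i, P (lift fun s => deriv (fun s => w i s * f s) s * vel c i s
        - a i s * (w i s * f s)) = -∑ i, Q (lift fun s => b i s * (w i s * f s)) := by
      rw [← Finset.sum_neg_distrib]
      exact Finset.sum_congr rfl fun i _ => hweak i _ (hwf i)
    have h2 : ∑ i, Q (lift fun s => b i s * (w i s * f s)) = 0 := by
      refine (hQ'.sum Finset.univ fun i _ => hbu i _ (hwf i)).symm.trans ?_
      refine hQ'.eq_zero (IsTestFun.sum _ fun i _ => hbu i _ (hwf i)) fun s hs => ?_
      by_cases h : s ∈ J
      · have h3 := hwF s hs (hJΩ h)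
        calc _ = (∑ i, (∑ k, F i k (c s) * vel c k s) * w i s) * f s := by
              rw [Finset.sum_mul]
              exact Finset.sum_congr rfl fun i _ => by simp only [hb]; ring
          _ = 0 := by rw [h3, zero_mul]
      · exact Finset.sum_eq_zero fun i _ => (hbu i _ (hwf i)).apply_eq_zero h
    rw [h2, neg_zero] at h1
    rw [← h1]
    refine Eq.trans ?_ (hM.sum Finset.univ fun i _ => t1 i)
    refine hM.ext _ _ (hderivT f hf) (IsTestFun.sum _ fun i _ => t1 i) fun s hs => ?_
    by_cases h : s ∈ J
    · have hwd : ∀ i, DifferentiableAt ℝ (w i) s := fun i =>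
        (((hw i).mono hJΩ).contDiffAt (hJo.mem_nhds h)).differentiableAt (by simp)
      have hd : ∀ i, deriv (fun s => w i s * f s) s = deriv (w i) s * f s + w i s * deriv f s :=
        fun i => deriv_fun_mul (hwd i) (hf.smooth.differentiable (by simp) s)
      simp only [hd]
      have h3 := hwu s hs (hJΩ h)
      have h4 := hwΓ s hs (hJΩ h)
      calc deriv f s = deriv f s * (∑ i, w i s * vel c i s) + f s * (∑ i, deriv (w i) s * vel c i s
            - ∑ i, (∑ k, ∑ j, Γ i j k (c s) * (vel c k s * vel c j s)) * w i s) := by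
            rw [h3, h4]; ring
        _ = _ := by
            rw [mul_sub, Finset.mul_sum, Finset.mul_sum, Finset.mul_sum, ← Finset.sum_sub_distrib,
              ← Finset.sum_add_distrib]
            exact Finset.sum_congr rfl fun i _ => by simp only [ha]; ring
    · rw [(hderivT f hf).apply_eq_zero h]
      exact (Finset.sum_eq_zero fun i _ => (t1 i).apply_eq_zero h).symm
  obtain ⟨m, hm⟩ := exists_eq_const_mul_integral hJlt hM hMder
  have hint : ∀ {f : ℝ → ℝ}, IsTestFun J f → Integrable f := fun hf =>
    hf.smooth.continuous.integrable_of_hasCompactSupport hf.compact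
  -- the half-size interval, and evaluation on functions of the coordinates
  set δ₂ := δ₁ / 2 with hδ₂
  have hδ₂0 : 0 < δ₂ := by positivity
  have hδ₂₁ : δ₂ < δ₁ := by rw [hδ₂]; linarith
  obtain ⟨θ, hθ, -, -, W', hW', hKW', hW'1⟩ := exists_testFun_eq_one (E := ℝ)
    (K := Icc (s0 - δ₂) (s0 + δ₂)) (Ω := J) isCompact_Icc hJo
    (Icc_subset_Ioo (by linarith) (by linarith))
  set V := W ∩ τ ⁻¹' Ioo (s0 - δ₂) (s0 + δ₂) with hV
  have hVo : IsOpen V := hW.inter (isOpen_Ioo.preimage hτ.continuous)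
  have hVs : ∀ s ∈ Ioo (s0 - δ) (s0 + δ), c s ∈ V → s ∈ Ioo (s0 - δ₂) (s0 + δ₂) := by
    intro s hs h
    have := h.2
    rwa [mem_preimage, hτc s hs] at this
  have heval : ∀ {l : (E4 → ℝ) → ℝ} {r : ℝ}, IsCurveFunctional Ω (c '' A) l →
      (∀ f, IsTestFun J f → l (lift f) = r * ∫ s, f s) → ∀ φ, IsTestFun Ω φ → tsupport φ ⊆ V →
      l φ = r * ∫ s in Ioo (s0 - δ₂) (s0 + δ₂), φ (c s) := by
    intro l r hl hr φ hφ hφV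
    have hφV' : ∀ y, φ y ≠ 0 → y ∈ V := fun y hy => hφV (subset_tsupport _ hy)
    have hg : IsTestFun J fun s => θ s * φ (c s) := hθ.mul_right (hφ.smooth.comp hc)
    have h1 : l φ = l (lift fun s => θ s * φ (c s)) := by
      refine hl.ext _ _ hφ (hliftT _ hg) ?_
      rintro _ ⟨s, hs, rfl⟩
      rw [hlift_c _ hg s hs]
      by_cases h : φ (c s) = 0
      · rw [h, mul_zero]
      · rw [hW'1 s (hKW' (Ioo_subset_Icc_self (hVs s (hA hs) (hφV' _ h)))), one_mul]
    rw [h1, hr _ hg, ← setIntegral_eq_integral_of_forall_compl_eq_zero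
      (s := Ioo (s0 - δ₂) (s0 + δ₂))]
    · congr 1
      refine setIntegral_congr_fun measurableSet_Ioo fun s hs => ?_
      simp only [hW'1 s (hKW' (Ioo_subset_Icc_self hs)), one_mul]
    · intro s hs
      by_cases h : s ∈ J
      · by_contra hne
        refine hs (hVs s ⟨by linarith [h.1], by linarith [h.2]⟩ (hφV' _ fun h0 => hne ?_))
        rw [h0, mul_zero]
      · rw [hθ.apply_eq_zero h, zero_mul]
  have hτ2 : ∀ s ∈ Ioo (s0 - δ₂) (s0 + δ₂), τ (c s) = s := fun s hs =>
    hτc s ⟨by linarith [hs.1], by linarith [hs.2]⟩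
  refine ⟨δ₂, hδ₂0, V, hVo, ⟨hKW rfl, ?_⟩, m, q, fun φ hφ hφV => ⟨fun i j => ?_, fun i => ?_⟩,
    hδ₂₁.trans_le hδ₁δ, hVs, fun i => ?_, fun hside => ?_⟩
  · rw [mem_preimage, hτc s0 hs0]
    exact ⟨by linarith, by linarith⟩
  · rw [hLP i j φ hφ, heval hPf hm _ (hφ.mul_right ((huτ i).mul (huτ j)))
      ((tsupport_mul_subset_left (f := φ)).trans hφV)]
    congr 1
    refine setIntegral_congr_fun measurableSet_Ioo fun s hs => ?_
    simp only [hτ2 s hs]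
  · rw [hNQ i φ hφ, heval hQf hq _ (hφ.mul_right (huτ i))
      ((tsupport_mul_subset_left (f := φ)).trans hφV)]
    congr 1
    refine setIntegral_congr_fun measurableSet_Ioo fun s hs => ?_
    simp only [hτ2 s hs]
  · have hdu' : ∀ i, ContDiff ℝ ∞ (deriv (vel c i)) := fun i =>
      (contDiff_infty_iff_deriv.1 (hu i)).2
    have hcont : ContinuousOn (fun s => m * (deriv (vel c i) s + a i s) - q * b i s) J :=
      ((continuousOn_const.mul ((hdu' i).continuous.continuousOn.add (haJ i).continuousOn)).sub
        (continuousOn_const.mul (hbJ i).continuousOn))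
    have hzero : ∀ f, IsTestFun J f →
        ∫ s, f s * (m * (deriv (vel c i) s + a i s) - q * b i s) = 0 := by
      intro f hf
      have h1 := hweak i f hf
      rw [hm _ ((hdu i f hf).sub (hau i f hf)), hq _ (hbu i f hf),
        integral_sub (hint (hdu i f hf)) (hint (hau i f hf)),
        integral_mul_deriv_testFun hf (hu i)] at h1
      have i1 := hint (hf.mul_right (hdu' i))
      have i2 := hint (hau i f hf)
      have i3 := hint (hbu i f hf)
      have i12 : Integrable fun s => m * (f s * deriv (vel c i) s) + m * (a i s * f s) :=
        (i1.const_mul m).add (i2.const_mul m)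
      have h2 : ∫ s, f s * (m * (deriv (vel c i) s + a i s) - q * b i s)
          = m * (∫ s, f s * deriv (vel c i) s) + m * (∫ s, a i s * f s)
            - q * ∫ s, b i s * f s := by
        rw [← integral_const_mul, ← integral_const_mul, ← integral_const_mul,
          ← integral_add (i1.const_mul m) (i2.const_mul m),
          ← integral_sub i12 (i3.const_mul q)]
        refine integral_congr_ae (Eventually.of_forall fun s => ?_)
        ring
      rw [h2]
      linarith
    have h3 := eq_zero_of_integral_testFun_eq_zero hcont hzero
      (s := s0) ⟨by linarith, by linarith⟩
    simp only [ha, hb] at h3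
    linarith
  · obtain ⟨ρ, hρ, hρA, hρ1⟩ : ∃ ρ, IsTestFun J ρ ∧ (∀ s ∈ A, ρ s = 0) ∧ ∫ s, ρ s = 1 := by
      rcases hside with h | h
      · obtain ⟨ρ, hρ, -, -, h1⟩ := exists_testFun_integral_one (a := s0) (b := s0 + δ₁)
          (by linarith)
        exact ⟨ρ, hρ.mono (Ioo_subset_Ioo_left (by linarith)),
          fun s hs => hρ.apply_eq_zero fun h' => absurd h'.1 (not_lt.2 (h s hs)), h1⟩
      · obtain ⟨ρ, hρ, -, -, h1⟩ := exists_testFun_integral_one (a := s0 - δ₁) (b := s0)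
          (by linarith)
        exact ⟨ρ, hρ.mono (Ioo_subset_Ioo_right (by linarith)),
          fun s hs => hρ.apply_eq_zero fun h' => absurd h'.2 (not_lt.2 (h s hs)), h1⟩
    have h1 := hm ρ hρ
    have h2 := hq ρ hρ
    have h3 := hM.eq_zero hρ hρA
    have h4 := hQ'.eq_zero hρ hρA
    rw [hρ1, mul_one] at h1 h2
    exact ⟨h1.symm.trans h3, h2.symm.trans h4⟩

end CurveStructure

/-! ### The cone of tensors that satisfy the energy condition -/

section Cone

/-- The bilinear form `∑ A_{ij} α_i β_j` of a matrix. -/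
def bilin (A : Matrix (Fin 4) (Fin 4) ℝ) (α β : Fin 4 → ℝ) : ℝ :=
  ∑ i, ∑ j, A i j * (α i * β j)

variable {A G : Matrix (Fin 4) (Fin 4) ℝ} {κ : ℝ} {α β ℓ : Fin 4 → ℝ}

theorem bilin_add_left (α α' β : Fin 4 → ℝ) :
    bilin A (α + α') β = bilin A α β + bilin A α' β := by
  simp only [bilin, ← Finset.sum_add_distrib, Pi.add_apply]
  exact Finset.sum_congr rfl fun i _ => Finset.sum_congr rfl fun j _ => by ring

theorem bilin_add_right (α β β' : Fin 4 → ℝ) :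
    bilin A α (β + β') = bilin A α β + bilin A α β' := by
  simp only [bilin, ← Finset.sum_add_distrib, Pi.add_apply]
  exact Finset.sum_congr rfl fun i _ => Finset.sum_congr rfl fun j _ => by ring

theorem bilin_smul_left (r : ℝ) (α β : Fin 4 → ℝ) : bilin A (r • α) β = r * bilin A α β := by
  simp only [bilin, Finset.mul_sum, Pi.smul_apply, smul_eq_mul]
  exact Finset.sum_congr rfl fun i _ => Finset.sum_congr rfl fun j _ => by ring

theorem bilin_smul_right (r : ℝ) (α β : Fin 4 → ℝ) : bilin A α (r • β) = r * bilin A α β := by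
  simp only [bilin, Finset.mul_sum, Pi.smul_apply, smul_eq_mul]
  exact Finset.sum_congr rfl fun i _ => Finset.sum_congr rfl fun j _ => by ring

theorem bilin_single (i j : Fin 4) : bilin A (Pi.single i 1) (Pi.single j 1) = A i j := by
  simp [bilin, Pi.single_apply]

theorem continuous_bilin : Continuous fun A : Matrix (Fin 4) (Fin 4) ℝ => bilin A α β := by
  unfold bilin
  fun_prop

theorem abs_bilin_le {B : ℝ} (hB : ∀ i j, |A i j| ≤ B) (α β : Fin 4 → ℝ) :
    |bilin A α β| ≤ B * ∑ i, ∑ j, |α i * β j| := by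
  rw [bilin, Finset.mul_sum]
  refine (Finset.abs_sum_le_sum_abs _ _).trans (Finset.sum_le_sum fun i _ => ?_)
  rw [Finset.mul_sum]
  refine (Finset.abs_sum_le_sum_abs _ _).trans (Finset.sum_le_sum fun j _ => ?_)
  rw [abs_mul]
  exact mul_le_mul_of_nonneg_right (hB i j) (abs_nonneg _)

/-- The components `t^{ij}`, `j^i` of a tensor that satisfies the dominant energy condition and a
vector with the charge-to-mass bound `κ`, with respect to the metric with inverse matrix `G`. -/
structure EnergyMatrix (G : Matrix (Fin 4) (Fin 4) ℝ) (κ : ℝ) (t : Matrix (Fin 4) (Fin 4) ℝ)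
    (j : Fin 4 → ℝ) : Prop where
  symm : ∀ i j, t i j = t j i
  nonneg : ∀ ℓ α β, 0 < bilin G ℓ ℓ → 0 ≤ bilin G α α → 0 ≤ bilin G β β → 0 < bilin G ℓ α →
    0 < bilin G ℓ β → 0 ≤ bilin t α β
  bound : ∀ ξ, bilin G ξ ξ = 1 → |∑ i, ξ i * j i| ≤ κ * bilin t ξ ξ

variable {t : Matrix (Fin 4) (Fin 4) ℝ} {j : Fin 4 → ℝ}

theorem EnergyMatrix.bilin_self_nonneg (h : EnergyMatrix G κ t j) (hℓ : 0 < bilin G ℓ ℓ) :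
    0 ≤ bilin t ℓ ℓ := h.nonneg ℓ ℓ ℓ hℓ hℓ.le hℓ.le hℓ hℓ

/-- The charge-to-mass bound for timelike covectors that are not normalized. -/
theorem EnergyMatrix.sqrt_mul_abs_le (h : EnergyMatrix G κ t j) (hℓ : 0 < bilin G ℓ ℓ) :
    Real.sqrt (bilin G ℓ ℓ) * |∑ i, ℓ i * j i| ≤ κ * bilin t ℓ ℓ := by
  set r := Real.sqrt (bilin G ℓ ℓ) with hr
  have hr0 : 0 < r := Real.sqrt_pos.2 hℓ
  have hr2 : r * r = bilin G ℓ ℓ := Real.mul_self_sqrt hℓ.le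
  have h1 := h.bound (r⁻¹ • ℓ) (by
    rw [bilin_smul_left, bilin_smul_right, ← hr2]
    field_simp)
  have h2 : ∑ i, (r⁻¹ • ℓ) i * j i = r⁻¹ * ∑ i, ℓ i * j i := by
    rw [Finset.mul_sum]
    exact Finset.sum_congr rfl fun i _ => by simp only [Pi.smul_apply, smul_eq_mul]; ring
  rw [h2, bilin_smul_left, bilin_smul_right, abs_mul, abs_of_pos (inv_pos.2 hr0)] at h1
  have h3 := mul_le_mul_of_nonneg_left h1 (mul_pos hr0 hr0).le
  have e1 : r * r * (r⁻¹ * |∑ i, ℓ i * j i|) = r * |∑ i, ℓ i * j i| := by field_simp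
  have e2 : r * r * (κ * (r⁻¹ * (r⁻¹ * bilin t ℓ ℓ))) = κ * bilin t ℓ ℓ := by field_simp
  rwa [e1, e2] at h3

/-- The covectors near a timelike covector are timelike and co-oriented with it, uniformly for
nearby metrics. -/
theorem exists_timelike_shift {X : Type*} [TopologicalSpace X]
    {G : X → Matrix (Fin 4) (Fin 4) ℝ} {y : X} (hG : ContinuousAt G y)
    (hℓ : 0 < bilin (G y) ℓ ℓ) :
    ∃ ε > 0, ∃ η > 0, ∀ᶠ z in 𝓝 y, (∀ r ∈ ({1, -1} : Finset ℝ), ∀ i,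
      η < bilin (G z) ℓ (ℓ + (r * ε) • Pi.single i 1) ∧
      η < bilin (G z) (ℓ + (r * ε) • Pi.single i 1) (ℓ + (r * ε) • Pi.single i 1)) ∧
      η < bilin (G z) ℓ ℓ := by
  have hcG : ∀ α β, ContinuousAt (fun z => bilin (G z) α β) y := fun α β =>
    (continuous_bilin (α := α) (β := β)).continuousAt.comp hG
  have hcε : ∀ (r : ℝ) i, Tendsto (fun ε : ℝ => bilin (G y) ℓ (ℓ + (r * ε) • Pi.single i 1))
      (𝓝[>] 0) (𝓝 (bilin (G y) ℓ ℓ)) := by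
    intro r i
    have h : Continuous fun ε : ℝ => bilin (G y) ℓ (ℓ + (r * ε) • Pi.single i 1) := by
      simp only [bilin_add_right, bilin_smul_right]
      fun_prop
    have h2 := h.tendsto 0
    simp only [mul_zero, zero_smul, add_zero] at h2
    exact h2.mono_left nhdsWithin_le_nhds
  have hcε2 : ∀ (r : ℝ) i, Tendsto (fun ε : ℝ => bilin (G y) (ℓ + (r * ε) • Pi.single i 1)
      (ℓ + (r * ε) • Pi.single i 1)) (𝓝[>] 0) (𝓝 (bilin (G y) ℓ ℓ)) := by
    intro r i
    have h : Continuous fun ε : ℝ => bilin (G y) (ℓ + (r * ε) • Pi.single i 1)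
        (ℓ + (r * ε) • Pi.single i 1) := by
      simp only [bilin_add_right, bilin_add_left, bilin_smul_left, bilin_smul_right]
      fun_prop
    have h2 := h.tendsto 0
    simp only [mul_zero, zero_smul, add_zero] at h2
    exact h2.mono_left nhdsWithin_le_nhds
  obtain ⟨ε, hε, hε0⟩ : ∃ ε : ℝ, (∀ r ∈ ({1, -1} : Finset ℝ), ∀ i,
      bilin (G y) ℓ ℓ / 2 < bilin (G y) ℓ (ℓ + (r * ε) • Pi.single i 1) ∧
      bilin (G y) ℓ ℓ / 2 < bilin (G y) (ℓ + (r * ε) • Pi.single i 1)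
        (ℓ + (r * ε) • Pi.single i 1)) ∧ 0 < ε := by
    refine Eventually.exists (f := 𝓝[>] (0 : ℝ)) (Eventually.and ?_ self_mem_nhdsWithin)
    rw [Filter.eventually_all_finset]
    intro r _
    rw [Filter.eventually_all]
    intro i
    exact ((hcε r i).eventually_const_lt (by linarith)).and
      ((hcε2 r i).eventually_const_lt (by linarith))
  set η := bilin (G y) ℓ ℓ / 2 with hη
  have hη0 : 0 < η := by rw [hη]; linarith
  refine ⟨ε, hε0, η, hη0, ?_⟩
  refine Eventually.and ?_ ((hcG ℓ ℓ).tendsto.eventually_const_lt (by rw [hη]; linarith))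
  rw [Filter.eventually_all_finset]
  intro r hr
  rw [Filter.eventually_all]
  intro i
  exact ((hcG _ _).tendsto.eventually_const_lt (hε r hr i).1).and
    ((hcG _ _).tendsto.eventually_const_lt (hε r hr i).2)

/-- The shifts of a timelike covector `ℓ` by `±ε` along the axes control the components of `t`. -/
theorem EnergyMatrix.abs_apply_le (h : EnergyMatrix G κ t j) {ε : ℝ} (hε : 0 < ε)
    (hℓ : 0 < bilin G ℓ ℓ) (hs : ∀ r ∈ ({1, -1} : Finset ℝ), ∀ i,
      0 < bilin G ℓ (ℓ + (r * ε) • Pi.single i 1) ∧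
      0 < bilin G (ℓ + (r * ε) • Pi.single i 1) (ℓ + (r * ε) • Pi.single i 1)) (i k : Fin 4) :
    |t i k| ≤ 1 / ε ^ 2 * bilin t ℓ ℓ := by
  have h1 : ∀ r ∈ ({1, -1} : Finset ℝ), ∀ r' ∈ ({1, -1} : Finset ℝ),
      0 ≤ bilin t (ℓ + (r * ε) • Pi.single i 1) (ℓ + (r' * ε) • Pi.single k 1) :=
    fun r hr r' hr' => h.nonneg ℓ _ _ hℓ (hs r hr i).2.le (hs r' hr' k).2.le (hs r hr i).1
      (hs r' hr' k).1
  simp only [bilin_add_left, bilin_add_right, bilin_smul_left, bilin_smul_right,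
    bilin_single] at h1
  have a1 := h1 1 (by simp) 1 (by simp)
  have a2 := h1 1 (by simp) (-1) (by simp)
  have a3 := h1 (-1) (by simp) 1 (by simp)
  have a4 := h1 (-1) (by simp) (-1) (by simp)
  have hε2 : 0 < ε ^ 2 := by positivity
  rw [div_mul_eq_mul_div, one_mul, le_div_iff₀ hε2, ← abs_of_pos hε2, ← abs_mul, abs_le]
  constructor <;> nlinarith

/-- The sum of the absolute values of the products of the components of a covector. -/
def absSum (α : Fin 4 → ℝ) : ℝ := ∑ k, ∑ l, |α k * α l|

theorem absSum_nonneg (α : Fin 4 → ℝ) : 0 ≤ absSum α := by unfold absSum; positivity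

theorem EnergyMatrix.abs_pairing_le (h : EnergyMatrix G κ t j) (hκ : 0 ≤ κ) {η B : ℝ} (hη : 0 < η)
    (hB : ∀ i k, |t i k| ≤ B) (hα : η < bilin G α α) :
    |∑ i, α i * j i| ≤ κ * (B * absSum α) / Real.sqrt η := by
  rw [le_div_iff₀ (Real.sqrt_pos.2 hη), mul_comm]
  calc Real.sqrt η * |∑ i, α i * j i| ≤ Real.sqrt (bilin G α α) * |∑ i, α i * j i| := by
        gcongr
    _ ≤ κ * bilin t α α := h.sqrt_mul_abs_le (hη.trans hα)
    _ ≤ _ := mul_le_mul_of_nonneg_left ((le_abs_self _).trans (abs_bilin_le hB α α)) hκ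

theorem EnergyMatrix.abs_vec_le (h : EnergyMatrix G κ t j) (hκ : 0 ≤ κ) {ε η B : ℝ} (hε : 0 < ε)
    (hη : 0 < η) (hB : ∀ i k, |t i k| ≤ B) (hℓ : η < bilin G ℓ ℓ) {i : Fin 4}
    (hs : η < bilin G (ℓ + ε • Pi.single i 1) (ℓ + ε • Pi.single i 1)) :
    |j i| ≤ κ * (B * (absSum (ℓ + ε • Pi.single i 1) + absSum ℓ)) / Real.sqrt η / ε := by
  have e1 := h.abs_pairing_le hκ hη hB hs
  have e2 := h.abs_pairing_le hκ hη hB hℓ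
  have e3 : ∑ k, (ℓ + ε • Pi.single i 1 : Fin 4 → ℝ) k * j k
      = (∑ k, ℓ k * j k) + ε * j i := by
    simp only [Pi.add_apply, Pi.smul_apply, smul_eq_mul, add_mul, Finset.sum_add_distrib]
    simp [Pi.single_apply]
  rw [e3] at e1
  have e4 : ε * |j i| ≤ |(∑ k, ℓ k * j k) + ε * j i| + |∑ k, ℓ k * j k| := by
    calc ε * |j i| = |((∑ k, ℓ k * j k) + ε * j i) - ∑ k, ℓ k * j k| := by
          rw [add_sub_cancel_left, abs_mul, abs_of_pos hε]
      _ ≤ _ := abs_sub _ _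
  rw [le_div_iff₀ hε, mul_comm, mul_add, mul_add, add_div]
  exact e4.trans (add_le_add e1 e2)

/-- For a timelike covector `ℓ`, the value `t(ℓ,ℓ)` dominates all components of `t` and `j`, with
constants that are uniform for nearby metrics. -/
theorem exists_energyMatrix_bound {X : Type*} [TopologicalSpace X]
    {G : X → Matrix (Fin 4) (Fin 4) ℝ} {y : X} (hG : ContinuousAt G y) (hℓ : 0 < bilin (G y) ℓ ℓ)
    (hκ : 0 ≤ κ) :
    ∃ B : ℝ, 0 ≤ B ∧ ∀ᶠ z in 𝓝 y, ∀ t j, EnergyMatrix (G z) κ t j →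
      0 ≤ bilin t ℓ ℓ ∧ (∀ i k, |t i k| ≤ B * bilin t ℓ ℓ) ∧ ∀ i, |j i| ≤ B * bilin t ℓ ℓ := by
  obtain ⟨ε, hε0, η, hη0, hev⟩ := exists_timelike_shift hG hℓ
  set S : Fin 4 → ℝ := fun i => absSum (ℓ + (1 * ε) • Pi.single i 1) + absSum ℓ with hS
  have hS0 : ∀ i, 0 ≤ S i := fun i => add_nonneg (absSum_nonneg _) (absSum_nonneg _)
  set B' : Fin 4 → ℝ := fun i => κ * (1 / ε ^ 2 * S i) / Real.sqrt η / ε with hB'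
  have hB'0 : ∀ i, 0 ≤ B' i := fun i => by
    have := hS0 i
    simp only [hB']
    positivity
  have hB0 : 0 ≤ 1 / ε ^ 2 := by positivity
  refine ⟨1 / ε ^ 2 + ∑ i, B' i, add_nonneg hB0 (Finset.sum_nonneg fun i _ => hB'0 i), ?_⟩
  filter_upwards [hev] with z hz t j h
  have hℓz : 0 < bilin (G z) ℓ ℓ := hη0.trans hz.2
  have h0 : 0 ≤ bilin t ℓ ℓ := h.bilin_self_nonneg hℓz
  have h1 := h.abs_apply_le hε0 hℓz fun r hr i =>
    ⟨hη0.trans (hz.1 r hr i).1, hη0.trans (hz.1 r hr i).2⟩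
  refine ⟨h0, fun i k => (h1 i k).trans (mul_le_mul_of_nonneg_right
    (le_add_of_nonneg_right (Finset.sum_nonneg fun i _ => hB'0 i)) h0), fun i => ?_⟩
  have h2 := h.abs_vec_le hκ (by linarith : 0 < 1 * ε) hη0 h1 hz.2 (hz.1 1 (by simp) i).2
  have h3 : κ * (1 / ε ^ 2 * bilin t ℓ ℓ * S i) / Real.sqrt η / (1 * ε)
      = B' i * bilin t ℓ ℓ := by
    simp only [hB', one_mul]
    ring
  refine (h2.trans h3.le).trans (mul_le_mul_of_nonneg_right ?_ h0)
  exact (Finset.single_le_sum (fun i _ => hB'0 i) (Finset.mem_univ i)).trans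
    (le_add_of_nonneg_left hB0)

end Cone

section EnergyAt

variable {M : Type*} [TopologicalSpace M] [ChartedSpace E4 M] [IsManifold (𝓡 4) ∞ M]
  {e : OpenPartialHomeomorph M E4} (g : LorentzMetric M) {κ : ℝ}

/-- The tensor `T^{ab}` at `p` satisfies the dominant energy condition, and the vector `J^a` obeys
the charge-to-mass bound `κ`. -/
structure EnergyAt (κ : ℝ) (p : M)
    (T : (TangentSpace (𝓡 4) p →L[ℝ] ℝ) →L[ℝ] (TangentSpace (𝓡 4) p →L[ℝ] ℝ) →L[ℝ] ℝ)
    (J : TangentSpace (𝓡 4) p) : Prop where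
  dominant : DominantAt g p T
  bound : ∀ t, g.val p t t = 1 → |g.val p t J| ≤ κ * T (g.val p t) (g.val p t)

/-- The covector with constant components `α` in the chart `e`. -/
def chartCov (e : OpenPartialHomeomorph M E4) (p : M) (α : Fin 4 → ℝ) : E4 →L[ℝ] ℝ :=
  ∑ i, α i • dcoord e p i

/-- The vector obtained by raising the index of the covector with components `α`. -/
def raise (e : OpenPartialHomeomorph M E4) (p : M) (α : Fin 4 → ℝ) : E4 :=
  ∑ k, (∑ l, invMetric g e (e p) k l * α l) • chartDinv e p (stdVec k)

theorem chartCov_apply (p : M) (α : Fin 4 → ℝ) (v : E4) :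
    chartCov e p α v = ∑ i, α i * chartD e p v i := by
  simp [chartCov, dcoord_apply]

theorem chartD_raise (he : e ∈ atlas E4 M) {p : M} (hp : p ∈ e.source) (α : Fin 4 → ℝ)
    (k : Fin 4) : chartD e p (raise g e p α) k = ∑ l, invMetric g e (e p) k l * α l := by
  rw [← dcoord_apply, raise, map_sum]
  simp only [map_smul, dcoord_chartDinv he hp, smul_eq_mul]
  simp

theorem metric_raise (he : e ∈ atlas E4 M) {p : M} (hp : p ∈ e.source) (α : Fin 4 → ℝ) :
    (g.val p (raise g e p α) : E4 →L[ℝ] ℝ) = chartCov e p α := by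
  refine ContinuousLinearMap.ext fun v => ?_
  refine (metric_eq_sum g he hp _ v).trans (Eq.trans ?_ (chartCov_apply p α v).symm)
  rw [Finset.sum_comm]
  refine Finset.sum_congr rfl fun j _ => ?_
  have h : ∑ i, metricMatrix g e (e p) i j * chartD e p (raise g e p α) i = α j := by
    simp only [chartD_raise g he hp, Finset.mul_sum]
    rw [Finset.sum_comm]
    calc _ = ∑ l, (∑ i, metricMatrix g e (e p) j i * invMetric g e (e p) i l) * α l := by
          refine Finset.sum_congr rfl fun l _ => ?_
          rw [Finset.sum_mul]
          exact Finset.sum_congr rfl fun i _ => by rw [metricMatrix_symm g _ i j]; ring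
      _ = α j := by simp [sum_mul_invMetric g he (e.map_source hp)]
  rw [← h, Finset.sum_mul]
  exact Finset.sum_congr rfl fun i _ => by ring

theorem metric_raise_raise (he : e ∈ atlas E4 M) {p : M} (hp : p ∈ e.source) (α β : Fin 4 → ℝ) :
    g.val p (raise g e p α) (raise g e p β) = bilin (invMetric g e (e p)) α β := by
  refine (congrArg (fun L : E4 →L[ℝ] ℝ => L (raise g e p β)) (metric_raise g he hp α)).trans ?_
  simp only [chartCov_apply, chartD_raise g he hp, bilin, Finset.mul_sum]
  exact Finset.sum_congr rfl fun i _ => Finset.sum_congr rfl fun j _ => by ring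

theorem bilin_components (e : OpenPartialHomeomorph M E4) (p : M)
    (T : (E4 →L[ℝ] ℝ) →L[ℝ] (E4 →L[ℝ] ℝ) →L[ℝ] ℝ) (α β : Fin 4 → ℝ) :
    T (chartCov e p α) (chartCov e p β)
      = bilin (Matrix.of fun i j => T (dcoord e p i) (dcoord e p j)) α β := by
  simp only [chartCov, map_sum, map_smul, _root_.sum_apply, _root_.smul_apply, smul_eq_mul, bilin,
    Matrix.of_apply, Finset.mul_sum]
  rw [Finset.sum_comm]
  exact Finset.sum_congr rfl fun i _ => Finset.sum_congr rfl fun j _ => by ring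

theorem EnergyAt.energyMatrix (he : e ∈ atlas E4 M) {p : M} (hp : p ∈ e.source)
    {T : (TangentSpace (𝓡 4) p →L[ℝ] ℝ) →L[ℝ] (TangentSpace (𝓡 4) p →L[ℝ] ℝ) →L[ℝ] ℝ}
    {J : TangentSpace (𝓡 4) p} (h : EnergyAt g κ p T J) :
    EnergyMatrix (invMetric g e (e p)) κ (Matrix.of fun i j => T (dcoord e p i) (dcoord e p j))
      fun i => dcoord e p i J := by
  refine ⟨fun i j => h.dominant.1 _ _, fun ℓ α β hℓ hα hβ hℓα hℓβ => ?_, fun ξ hξ => ?_⟩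
  · rw [← metric_raise_raise g he hp] at hℓ hα hβ hℓα hℓβ
    have h1 := h.dominant.2 (raise g e p α) (raise g e p β) ⟨hα, hβ, raise g e p ℓ, hℓ, hℓα, hℓβ⟩
    refine le_of_le_of_eq ?_ (bilin_components e p T α β)
    have key : ∀ a b : E4 →L[ℝ] ℝ, (g.val p (raise g e p α) : E4 →L[ℝ] ℝ) = a →
        (g.val p (raise g e p β) : E4 →L[ℝ] ℝ) = b → 0 ≤ T a b := by
      rintro _ _ rfl rfl
      exact h1
    exact key _ _ (metric_raise g he hp α) (metric_raise g he hp β)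
  · rw [← metric_raise_raise g he hp] at hξ
    have h1 := h.bound (raise g e p ξ) hξ
    have key : ∀ a : E4 →L[ℝ] ℝ, (g.val p (raise g e p ξ) : E4 →L[ℝ] ℝ) = a →
        |a J| ≤ κ * T a a := by
      rintro _ rfl
      exact h1
    exact (congrArg abs (chartCov_apply p ξ J)).symm.le.trans
      ((key _ (metric_raise g he hp ξ)).trans (congrArg (κ * ·) (bilin_components e p T ξ ξ)).le)

/-- The components of a timelike vector, with lowered index, form a timelike covector. -/
theorem bilin_lower (he : e ∈ atlas E4 M) {p : M} (hp : p ∈ e.source) (v : E4) :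
    bilin (invMetric g e (e p)) (fun i => g.val p v (chartDinv e p (stdVec i)))
      (fun i => g.val p v (chartDinv e p (stdVec i))) = g.val p v v := by
  set α : Fin 4 → ℝ := fun i => g.val p v (chartDinv e p (stdVec i)) with hα
  have h1 : chartCov e p α = g.val p v := sum_covector_smul_dcoord he hp (g.val p v)
  have h2 : raise g e p α = v := by
    have h3 := (metric_raise g he hp α).trans h1
    have h4 : (raise g e p α - v : E4) = 0 := by
      refine g.nondegenerate p fun w => ?_
      have h5 : g.val p (raise g e p α) w = g.val p v w :=
        congrArg (fun L : E4 →L[ℝ] ℝ => L w) h3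
      have h6 : g.val p (raise g e p α - v : E4) w
          = g.val p (raise g e p α) w - g.val p v w := by
        have := map_sub (g.val p : E4 →L[ℝ] E4 →L[ℝ] ℝ) (raise g e p α) v
        exact (congrArg (fun L : E4 →L[ℝ] ℝ => L w) this)
      rw [h6, h5, sub_self]
    exact sub_eq_zero.1 h4
  rw [← metric_raise_raise g he hp, h2]

theorem exists_timelike_covector (he : e ∈ atlas E4 M) {p : M} (hp : p ∈ e.source) :
    ∃ ℓ : Fin 4 → ℝ, 0 < bilin (invMetric g e (e p)) ℓ ℓ := by
  obtain ⟨b, hb⟩ := g.signature p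
  refine ⟨fun i => g.val p (b 0) (chartDinv e p (stdVec i)), ?_⟩
  rw [bilin_lower g he hp (b 0), hb]
  norm_num

end EnergyAt

/-! ### Test fields that dominate, and the functionals of charged matter -/

section Domination

variable {M : Type*} [TopologicalSpace M] [ChartedSpace E4 M] [IsManifold (𝓡 4) ∞ M]
  [T2Space M] [SecondCountableTopology M] {e : OpenPartialHomeomorph M E4} (g : LorentzMetric M) {κ : ℝ}

/-- A contraction at a point, computed in a chart. -/
theorem contract_eq_sum_dcoord (he : e ∈ atlas E4 M) {p : M} (hp : p ∈ e.source)
    (T : (TangentSpace (𝓡 4) p →L[ℝ] ℝ) →L[ℝ] (TangentSpace (𝓡 4) p →L[ℝ] ℝ) →L[ℝ] ℝ)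
    (x : CovTensor M) :
    contract T (x p) = ∑ i, ∑ j, T (dcoord e p i) (dcoord e p j) * cov2Comp x e i j (e p) := by
  classical
  have h := contract_eq_sum he (Function.update (fun _ => 0) p T) x hp
  simp only [contra2Comp_chart _ _ _ hp] at h
  rw [Function.update_self] at h
  exact h

theorem pairing_eq_sum_dcoord (he : e ∈ atlas E4 M) {p : M} (hp : p ∈ e.source)
    (J : TangentSpace (𝓡 4) p) (w : CovField M) :
    w p J = ∑ i, covComp w e i (e p) * dcoord e p i J := by
  classical
  have h := pairing_eq_sum he w (Function.update (fun _ => 0) p J) hp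
  simp only [vecComp_chart _ _ hp] at h
  rw [Function.update_self] at h
  exact h

theorem cov2Comp_elemTensor (he : e ∈ atlas E4 M) {p : M} (hp : p ∈ e.source) (i j k l : Fin 4)
    (φ : E4 → ℝ) : cov2Comp (elemTensor e i j φ) e k l (e p)
      = φ (e p) * ((if i = k then 1 else 0) * (if j = l then 1 else 0)) := by
  rw [cov2Comp_chart _ _ _ hp]
  refine (elemTensor_apply i j p _ _).trans ?_
  rw [chartExt_of_mem hp, chartD_chartDinv he hp, chartD_chartDinv he hp, stdVec_apply,
    stdVec_apply]

theorem contract_elemTensor_of_mem (he : e ∈ atlas E4 M) {p : M} (hp : p ∈ e.source)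
    (T : (TangentSpace (𝓡 4) p →L[ℝ] ℝ) →L[ℝ] (TangentSpace (𝓡 4) p →L[ℝ] ℝ) →L[ℝ] ℝ)
    (i j : Fin 4) (φ : E4 → ℝ) :
    contract T (elemTensor e i j φ p) = φ (e p) * T (dcoord e p i) (dcoord e p j) := by
  rw [contract_eq_sum_dcoord he hp]
  simp only [cov2Comp_elemTensor he hp]
  simp [mul_comm]

theorem elemTensor_of_notMem {p : M} (hp : p ∉ e.source) (i j : Fin 4) (φ : E4 → ℝ) :
    elemTensor e i j φ p = 0 := by
  refine ContinuousLinearMap.ext fun v => ContinuousLinearMap.ext fun w => ?_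
  refine (elemTensor_apply i j p v w).trans ?_
  rw [chartExt_of_notMem hp, zero_mul]
  rfl

theorem elemCov_of_notMem {p : M} (hp : p ∉ e.source) (i : Fin 4) (φ : E4 → ℝ) :
    elemCov e i φ p = 0 := by
  refine ContinuousLinearMap.ext fun v => ?_
  refine (elemCov_apply i p v).trans ?_
  rw [chartExt_of_notMem hp, zero_mul]
  rfl

/-- The field `ψ α_i α_j dy^i dy^j`, for a covector with constant components `α` in the chart. -/
def covSq (e : OpenPartialHomeomorph M E4) (α : Fin 4 → ℝ) (ψ : E4 → ℝ) : CovTensor M :=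
  ∑ i, ∑ j, (α i * α j) • elemTensor e i j ψ

theorem covSq_apply (α : Fin 4 → ℝ) (ψ : E4 → ℝ) (p : M) (v w : E4) :
    covSq e α ψ p v w = chartExt e ψ p * (chartCov e p α v * chartCov e p α w) := by
  have h : covSq e α ψ p v w = ∑ i, ∑ j, (α i * α j) * elemTensor e i j ψ p v w := by
    simp only [covSq, Finset.sum_apply, Pi.smul_apply]
    have : ∀ (f : Fin 4 → Fin 4 → E4 →L[ℝ] E4 →L[ℝ] ℝ), (∑ i, ∑ j, (α i * α j) • f i j) v w
        = ∑ i, ∑ j, (α i * α j) * f i j v w := by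
      intro f
      simp only [_root_.sum_apply, _root_.smul_apply, smul_eq_mul]
    exact this _
  rw [h, chartCov_apply, chartCov_apply, Finset.sum_mul_sum, Finset.mul_sum]
  refine Finset.sum_congr rfl fun i _ => ?_
  rw [Finset.mul_sum]
  refine Finset.sum_congr rfl fun j _ => ?_
  rw [elemTensor_apply]
  ring

theorem isTestCov2_covSq (he : e ∈ atlas E4 M) (α : Fin 4 → ℝ) {ψ : E4 → ℝ}
    (hψ : IsTestFun e.target ψ) : IsTestCov2 (covSq e α ψ) :=
  IsTestCov2.sum _ fun i _ => IsTestCov2.sum _ fun j _ =>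
    (isTestCov2_elemTensor he i j hψ).const_smul _

theorem covSq_of_chartExt_eq_zero {p : M} (α : Fin 4 → ℝ) {ψ : E4 → ℝ} (h : chartExt e ψ p = 0) :
    covSq e α ψ p = 0 := by
  refine ContinuousLinearMap.ext fun v => ContinuousLinearMap.ext fun w => ?_
  refine (covSq_apply α ψ p v w).trans ?_
  rw [h, zero_mul]
  rfl

theorem contract_covSq (he : e ∈ atlas E4 M) {p : M} (hp : p ∈ e.source)
    (T : (TangentSpace (𝓡 4) p →L[ℝ] ℝ) →L[ℝ] (TangentSpace (𝓡 4) p →L[ℝ] ℝ) →L[ℝ] ℝ)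
    (α : Fin 4 → ℝ) (ψ : E4 → ℝ) :
    contract T (covSq e α ψ p)
      = ψ (e p) * bilin (Matrix.of fun i j => T (dcoord e p i) (dcoord e p j)) α α := by
  rw [contract_eq_sum_dcoord he hp]
  have h1 : ∀ i j, cov2Comp (covSq e α ψ) e i j (e p) = ψ (e p) * (α i * α j) := by
    intro i j
    rw [cov2Comp_chart _ _ _ hp]
    refine (covSq_apply α ψ p _ _).trans ?_
    rw [chartExt_of_mem hp, chartCov_apply, chartCov_apply, chartD_chartDinv he hp,
      chartD_chartDinv he hp]
    simp [stdVec_apply]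
  simp only [h1, bilin, Finset.mul_sum]
  exact Finset.sum_congr rfl fun i _ => Finset.sum_congr rfl fun j _ => mul_left_comm _ _ _

/-- The field `Ψ` is nonnegative on all matter. -/
def NonnegField (κ : ℝ) (Ψ : CovTensor M) : Prop :=
  ∀ q T J, EnergyAt g κ q T J → 0 ≤ contract T (Ψ q)

/-- Near `p`, the contraction with the field `Ψ` controls all components of matter. -/
def Dominates (κ : ℝ) (Ψ : CovTensor M) (p : M) : Prop :=
  (∀ x, SmoothCov2 x → ∃ C, 0 ≤ C ∧ ∀ᶠ q in 𝓝 p, ∀ T J, EnergyAt g κ q T J →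
    |contract T (x q)| ≤ C * contract T (Ψ q)) ∧
  ∀ w, SmoothCov w → ∃ C, 0 ≤ C ∧ ∀ᶠ q in 𝓝 p, ∀ T J, EnergyAt g κ q T J →
    |w q J| ≤ C * contract T (Ψ q)

variable {g}

theorem NonnegField.add {Ψ Ψ' : CovTensor M} (h : NonnegField g κ Ψ) (h' : NonnegField g κ Ψ') :
    NonnegField g κ (Ψ + Ψ') := fun q T J hq => by
  rw [Pi.add_apply, contract_add_right]
  exact add_nonneg (h q T J hq) (h' q T J hq)

theorem Dominates.mono {Ψ Ψ' : CovTensor M} {p : M} (h : Dominates g κ Ψ p)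
    (hle : ∀ q T J, EnergyAt g κ q T J → contract T (Ψ q) ≤ contract T (Ψ' q)) :
    Dominates g κ Ψ' p := by
  refine ⟨fun x hx => ?_, fun w hw => ?_⟩
  · obtain ⟨C, hC, h1⟩ := h.1 x hx
    refine ⟨C, hC, ?_⟩
    filter_upwards [h1] with q hq T J hTJ
    exact (hq T J hTJ).trans (mul_le_mul_of_nonneg_left (hle q T J hTJ) hC)
  · obtain ⟨C, hC, h1⟩ := h.2 w hw
    refine ⟨C, hC, ?_⟩
    filter_upwards [h1] with q hq T J hTJ
    exact (hq T J hTJ).trans (mul_le_mul_of_nonneg_left (hle q T J hTJ) hC)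

theorem continuousAt_comp_chart {f : E4 → ℝ} (hf : ContDiffOn ℝ ∞ f e.target) {p : M}
    (hp : p ∈ e.source) : ContinuousAt (fun q => f (e q)) p :=
  (hf.continuousOn.continuousAt (e.open_target.mem_nhds (e.map_source hp))).comp
    (f := e) (e.continuousAt hp)

theorem continuousAt_invMetric (he : e ∈ atlas E4 M) {p : M} (hp : p ∈ e.source) :
    ContinuousAt (fun q => invMetric g e (e q)) p := by
  exact continuousAt_pi.2 fun i => continuousAt_pi.2 fun j =>
    continuousAt_comp_chart (contDiffOn_invMetric g he i j) hp

theorem dominates_covSq (he : e ∈ atlas E4 M) {p : M} (hp : p ∈ e.source) {ℓ : Fin 4 → ℝ}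
    (hκ : 0 ≤ κ) (hℓ : 0 < bilin (invMetric g e (e p)) ℓ ℓ) {ψ : E4 → ℝ}
    (hψ : ContinuousAt ψ (e p)) (hψ0 : 0 < ψ (e p)) : Dominates g κ (covSq e ℓ ψ) p := by
  obtain ⟨B, hB0, hB⟩ := exists_energyMatrix_bound (continuousAt_invMetric (g := g) he hp) hℓ hκ
  set m := ψ (e p) / 2 with hm
  have hm0 : 0 < m := by rw [hm]; linarith
  have hψ' : ∀ᶠ q in 𝓝 p, m < ψ (e q) := by
    have h : ContinuousAt (fun q => ψ (e q)) p := hψ.comp (f := e) (e.continuousAt hp)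
    exact h.tendsto.eventually_const_lt (by rw [hm]; linarith)
  have hs := e.open_source.mem_nhds hp
  have hfin : ∀ {b ψq X : ℝ}, 0 ≤ b → m < ψq → 0 ≤ X → X * (B * b) ≤ X * B / m * (ψq * b) := by
    intro b ψq X hb hq hX
    have h1 : m * b ≤ ψq * b := mul_le_mul_of_nonneg_right hq.le hb
    calc X * (B * b) = X * B / m * (m * b) := by field_simp
      _ ≤ _ := mul_le_mul_of_nonneg_left h1 (by positivity)
  refine ⟨fun x hx => ?_, fun w hw => ?_⟩
  · set X := ∑ i, ∑ j, (|cov2Comp x e i j (e p)| + 1) with hX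
    have hX0 : 0 ≤ X := by positivity
    have hx' : ∀ᶠ q in 𝓝 p, ∀ i j, |cov2Comp x e i j (e q)| ≤ |cov2Comp x e i j (e p)| + 1 := by
      rw [Filter.eventually_all]; intro i
      rw [Filter.eventually_all]; intro j
      have h := (continuousAt_comp_chart (hx e he i j) hp).abs
      filter_upwards [h.tendsto.eventually_lt_const (lt_add_one _)] with q hq using hq.le
    refine ⟨X * B / m, by positivity, ?_⟩
    filter_upwards [hB, hψ', hs, hx'] with q h1 h2 h3 h4 T J hTJ
    obtain ⟨b0, b1, -⟩ := h1 _ _ (hTJ.energyMatrix g he h3)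
    rw [contract_covSq he h3, contract_eq_sum_dcoord he h3]
    refine le_trans ?_ (hfin b0 h2 hX0)
    rw [hX, Finset.sum_mul]
    refine (Finset.abs_sum_le_sum_abs _ _).trans (Finset.sum_le_sum fun i _ => ?_)
    rw [Finset.sum_mul]
    refine (Finset.abs_sum_le_sum_abs _ _).trans (Finset.sum_le_sum fun j _ => ?_)
    rw [abs_mul, mul_comm]
    exact mul_le_mul (h4 i j) (b1 i j) (abs_nonneg _) (by positivity)
  · set X := ∑ i, (|covComp w e i (e p)| + 1) with hX
    have hX0 : 0 ≤ X := by positivity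
    have hx' : ∀ᶠ q in 𝓝 p, ∀ i, |covComp w e i (e q)| ≤ |covComp w e i (e p)| + 1 := by
      rw [Filter.eventually_all]; intro i
      have h := (continuousAt_comp_chart (hw e he i) hp).abs
      filter_upwards [h.tendsto.eventually_lt_const (lt_add_one _)] with q hq using hq.le
    refine ⟨X * B / m, by positivity, ?_⟩
    filter_upwards [hB, hψ', hs, hx'] with q h1 h2 h3 h4 T J hTJ
    obtain ⟨b0, -, b2⟩ := h1 _ _ (hTJ.energyMatrix g he h3)
    rw [contract_covSq he h3, pairing_eq_sum_dcoord he h3]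
    refine le_trans ?_ (hfin b0 h2 hX0)
    rw [hX, Finset.sum_mul]
    refine (Finset.abs_sum_le_sum_abs _ _).trans (Finset.sum_le_sum fun i _ => ?_)
    rw [abs_mul]
    exact mul_le_mul (h4 i) (b2 i) (abs_nonneg _) (by positivity)

/-- A field that dominates at all points of a compact set does so with uniform constants. -/
theorem exists_uniform_domination {K : Set M} (hK : IsCompact K) {Ψ : CovTensor M}
    (hnn : NonnegField g κ Ψ) (hΨ : ∀ p ∈ K, Dominates g κ Ψ p) {x : CovTensor M}
    (hx : SmoothCov2 x) (hx0 : ∀ p, p ∉ K → x p = 0) {w : CovField M} (hw : SmoothCov w)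
    (hw0 : ∀ p, p ∉ K → w p = 0) :
    ∃ C, 0 ≤ C ∧ ∀ q T J, EnergyAt g κ q T J →
      |contract T (x q)| ≤ C * contract T (Ψ q) ∧ |w q J| ≤ C * contract T (Ψ q) := by
  have key : ∃ C, 0 ≤ C ∧ ∀ q ∈ K, ∀ T J, EnergyAt g κ q T J →
      |contract T (x q)| ≤ C * contract T (Ψ q) ∧ |w q J| ≤ C * contract T (Ψ q) := by
    refine hK.induction_on (p := fun s => ∃ C, 0 ≤ C ∧ ∀ q ∈ s, ∀ T J, EnergyAt g κ q T J →
      |contract T (x q)| ≤ C * contract T (Ψ q) ∧ |w q J| ≤ C * contract T (Ψ q)) ?_ ?_ ?_ ?_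
    · exact ⟨0, le_rfl, fun q hq => hq.elim⟩
    · rintro s t hst ⟨C, hC, h⟩
      exact ⟨C, hC, fun q hq => h q (hst hq)⟩
    · rintro s t ⟨C, hC, h⟩ ⟨C', hC', h'⟩
      have hmax : ∀ {q T J}, EnergyAt g κ q T J →
          C * contract T (Ψ q) ≤ max C C' * contract T (Ψ q) ∧
          C' * contract T (Ψ q) ≤ max C C' * contract T (Ψ q) := fun hTJ =>
        ⟨mul_le_mul_of_nonneg_right (le_max_left _ _) (hnn _ _ _ hTJ),
          mul_le_mul_of_nonneg_right (le_max_right _ _) (hnn _ _ _ hTJ)⟩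
      refine ⟨max C C', le_max_of_le_left hC, ?_⟩
      rintro q (hq | hq) T J hTJ
      · exact ⟨(h q hq T J hTJ).1.trans (hmax hTJ).1, (h q hq T J hTJ).2.trans (hmax hTJ).1⟩
      · exact ⟨(h' q hq T J hTJ).1.trans (hmax hTJ).2, (h' q hq T J hTJ).2.trans (hmax hTJ).2⟩
    · intro p hp
      obtain ⟨C, hC, h⟩ := (hΨ p hp).1 x hx
      obtain ⟨C', hC', h'⟩ := (hΨ p hp).2 w hw
      refine ⟨_, mem_nhdsWithin_of_mem_nhds (h.and h'), max C C', le_max_of_le_left hC,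
        fun q hq T J hTJ => ⟨(hq.1 T J hTJ).trans ?_, (hq.2 T J hTJ).trans ?_⟩⟩
      · exact mul_le_mul_of_nonneg_right (le_max_left _ _) (hnn _ _ _ hTJ)
      · exact mul_le_mul_of_nonneg_right (le_max_right _ _) (hnn _ _ _ hTJ)
  obtain ⟨C, hC, h⟩ := key
  refine ⟨C, hC, fun q T J hTJ => ?_⟩
  by_cases hq : q ∈ K
  · exact h q hq T J hTJ
  · have h1 : contract T (x q) = 0 := by rw [hx0 q hq]; exact contract_zero_right T
    have h2 : w q J = 0 := by rw [hw0 q hq]; rfl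
    rw [h1, h2, abs_zero]
    exact ⟨mul_nonneg hC (hnn q T J hTJ), mul_nonneg hC (hnn q T J hTJ)⟩

theorem isOpen_timelike (he : e ∈ atlas E4 M) (ℓ : Fin 4 → ℝ) :
    IsOpen {y | y ∈ e.target ∧ 0 < bilin (invMetric g e y) ℓ ℓ} := by
  have h : ContinuousOn (fun y => bilin (invMetric g e y) ℓ ℓ) e.target := by
    unfold bilin
    refine continuousOn_finsetSum _ fun i _ => continuousOn_finsetSum _ fun j _ => ?_
    exact (contDiffOn_invMetric g he i j).continuousOn.mul continuousOn_const
  exact h.isOpen_inter_preimage e.open_target isOpen_Ioi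

/-- A nonnegative multiple of the square of a timelike covector is nonnegative on all matter. -/
theorem nonnegField_covSq (he : e ∈ atlas E4 M) {ℓ : Fin 4 → ℝ} {ψ : E4 → ℝ}
    (hψ0 : ∀ y, 0 ≤ ψ y) (hψ : ∀ y ∈ e.target, ψ y ≠ 0 → 0 < bilin (invMetric g e y) ℓ ℓ) :
    NonnegField g κ (covSq e ℓ ψ) := by
  intro q T J hTJ
  by_cases hq : q ∈ e.source
  · rw [contract_covSq he hq]
    by_cases h0 : ψ (e q) = 0
    · rw [h0, zero_mul]
    · exact mul_nonneg (hψ0 _) ((hTJ.energyMatrix g he hq).bilin_self_nonneg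
        (hψ _ (e.map_source hq) h0))
  · rw [covSq_of_chartExt_eq_zero ℓ (chartExt_of_notMem hq), contract_zero_right]

/-- Near each point there is a test field of the form `ψ ℓ ⊗ ℓ`, with `ℓ` timelike. -/
theorem exists_timelike_bump (he : e ∈ atlas E4 M) {p : M} (hp : p ∈ e.source)
    {O : Set M} (hO : IsOpen O) (hpO : p ∈ O) {ℓ : Fin 4 → ℝ}
    (hℓ : 0 < bilin (invMetric g e (e p)) ℓ ℓ) :
    ∃ ψ : E4 → ℝ, IsTestFun e.target ψ ∧ (∀ y, 0 ≤ ψ y) ∧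
      (∀ y ∈ e.target, ψ y ≠ 0 → 0 < bilin (invMetric g e y) ℓ ℓ) ∧ ψ (e p) = 1 ∧
      e.symm '' tsupport ψ ⊆ O := by
  have hopen : IsOpen ({y | y ∈ e.target ∧ 0 < bilin (invMetric g e y) ℓ ℓ} ∩
      (e.target ∩ e.symm ⁻¹' O)) :=
    (isOpen_timelike he ℓ).inter (e.isOpen_inter_preimage_symm hO)
  obtain ⟨ψ, hψ, h0, -, W, -, hKW, hW1⟩ := exists_testFun_eq_one
    (K := {e p}) isCompact_singleton hopen (by
      rw [singleton_subset_iff]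
      refine ⟨⟨e.map_source hp, hℓ⟩, e.map_source hp, ?_⟩
      rwa [mem_preimage, e.left_inv hp])
  refine ⟨ψ, hψ.mono fun y hy => hy.2.1, h0, fun y _ hy => ?_, hW1 _ (hKW rfl), ?_⟩
  · exact (hψ.subset (subset_tsupport _ hy)).1.2
  · rintro _ ⟨y, hy, rfl⟩
    exact (hψ.subset hy).2.2

/-- A compact set has, within every open neighborhood, a nonnegative test field that dominates at
all its points. -/
theorem exists_dominating {K O : Set M} (hK : IsCompact K) (hO : IsOpen O)
    (hKO : K ⊆ O) (hκ : 0 ≤ κ) :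
    ∃ Ψ : CovTensor M, IsTestCov2 Ψ ∧ NonnegField g κ Ψ ∧ (∀ p ∈ K, Dominates g κ Ψ p) ∧
      ∃ K', IsCompact K' ∧ K' ⊆ O ∧ ∀ p, p ∉ K' → Ψ p = 0 := by
  refine hK.induction_on (p := fun s => ∃ Ψ : CovTensor M, IsTestCov2 Ψ ∧ NonnegField g κ Ψ ∧
    (∀ p ∈ s, Dominates g κ Ψ p) ∧ ∃ K', IsCompact K' ∧ K' ⊆ O ∧ ∀ p, p ∉ K' → Ψ p = 0)
    ?_ ?_ ?_ ?_
  · refine ⟨0, IsTestCov2.zero, fun q T J _ => ?_, fun p hp => hp.elim, ∅, isCompact_empty,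
      empty_subset _, fun _ _ => rfl⟩
    exact (contract_zero_right T).ge
  · rintro s t hst ⟨Ψ, h1, h2, h3, h4⟩
    exact ⟨Ψ, h1, h2, fun p hp => h3 p (hst hp), h4⟩
  · rintro s t ⟨Ψ, h1, h2, h3, K', hK', hKO', h4⟩ ⟨Φ, h1', h2', h3', L', hL', hLO', h4'⟩
    refine ⟨Ψ + Φ, h1.add h1', h2.add h2', ?_, K' ∪ L', hK'.union hL', union_subset hKO' hLO',
      fun p hp => ?_⟩
    · rintro p (hp | hp)
      · refine (h3 p hp).mono fun q T J hTJ => ?_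
        rw [Pi.add_apply, contract_add_right]
        linarith [h2' q T J hTJ]
      · refine (h3' p hp).mono fun q T J hTJ => ?_
        rw [Pi.add_apply, contract_add_right]
        linarith [h2 q T J hTJ]
    · rw [mem_union, not_or] at hp
      rw [Pi.add_apply, h4 p hp.1, h4' p hp.2]
      exact add_zero (0 : TangentSpace (𝓡 4) p →L[ℝ] TangentSpace (𝓡 4) p →L[ℝ] ℝ)
  · intro p hp
    have he := chart_mem_atlas E4 p
    have hps := mem_chart_source E4 p
    obtain ⟨ℓ, hℓ⟩ := exists_timelike_covector g he hps
    obtain ⟨ψ, hψ, h0, h1, h2, h3⟩ := exists_timelike_bump he hps hO (hKO hp) hℓ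
    -- near `p`, the covector stays timelike and the bump function positive
    have hW : ∀ᶠ q in 𝓝 p, q ∈ (chartAt E4 p).source ∧ 0 < ψ (chartAt E4 p q) := by
      refine ((chartAt E4 p).open_source.eventually_mem hps).and ?_
      have h : ContinuousAt (fun q => ψ (chartAt E4 p q)) p :=
        hψ.smooth.continuous.continuousAt.comp (f := chartAt E4 p)
          ((chartAt E4 p).continuousAt hps)
      exact h.tendsto.eventually_const_lt (by rw [h2]; exact one_pos)
    refine ⟨_, mem_nhdsWithin_of_mem_nhds hW, covSq (chartAt E4 p) ℓ ψ,
      isTestCov2_covSq he ℓ hψ, nonnegField_covSq he h0 h1, fun q hq => ?_,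
      (chartAt E4 p).symm '' tsupport ψ, isCompact_symm_image_tsupport hψ, h3, fun q hq =>
        covSq_of_chartExt_eq_zero ℓ (chartExt_eq_zero hq)⟩
    exact dominates_covSq he hq.1 hκ (h1 _ ((chartAt E4 p).map_source hq.1) hq.2.ne')
      hψ.smooth.continuous.continuousAt hq.2

end Domination

section ElementarySums

variable {M : Type*} [TopologicalSpace M] [ChartedSpace E4 M] [IsManifold (𝓡 4) ∞ M]
  [T2Space M] [SecondCountableTopology M] {e : OpenPartialHomeomorph M E4}

/-- The tensor field with components `c i j` in a chart, extended by zero. -/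
def elemSum (e : OpenPartialHomeomorph M E4) (c : Fin 4 → Fin 4 → E4 → ℝ) : CovTensor M :=
  ∑ i, ∑ j, elemTensor e i j (c i j)

/-- The covector field with components `c i` in a chart, extended by zero. -/
def elemCovSum (e : OpenPartialHomeomorph M E4) (c : Fin 4 → E4 → ℝ) : CovField M :=
  ∑ i, elemCov e i (c i)

theorem elemTensor_add (i j : Fin 4) (φ ψ : E4 → ℝ) :
    (elemTensor e i j fun y => φ y + ψ y) = elemTensor e i j φ + elemTensor e i j ψ := by
  funext p
  refine ContinuousLinearMap.ext fun v => ContinuousLinearMap.ext fun w => ?_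
  refine (elemTensor_apply i j p v w).trans ?_
  rw [chartExt_add]
  exact add_mul _ _ _

theorem elemTensor_const_mul (i j : Fin 4) (r : ℝ) (φ : E4 → ℝ) :
    (elemTensor e i j fun y => r * φ y) = r • elemTensor e i j φ := by
  funext p
  refine ContinuousLinearMap.ext fun v => ContinuousLinearMap.ext fun w => ?_
  refine (elemTensor_apply i j p v w).trans ?_
  rw [chartExt_const_mul]
  exact mul_assoc _ _ _

theorem elemCov_add (i : Fin 4) (φ ψ : E4 → ℝ) :
    (elemCov e i fun y => φ y + ψ y) = elemCov e i φ + elemCov e i ψ := by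
  funext p
  refine ContinuousLinearMap.ext fun v => ?_
  refine (elemCov_apply i p v).trans ?_
  rw [chartExt_add]
  exact add_mul _ _ _

theorem elemCov_const_mul (i : Fin 4) (r : ℝ) (φ : E4 → ℝ) :
    (elemCov e i fun y => r * φ y) = r • elemCov e i φ := by
  funext p
  refine ContinuousLinearMap.ext fun v => ?_
  refine (elemCov_apply i p v).trans ?_
  rw [chartExt_const_mul]
  exact mul_assoc _ _ _

theorem isTestCov2_elemSum (he : e ∈ atlas E4 M) {c : Fin 4 → Fin 4 → E4 → ℝ}
    (hc : ∀ i j, IsTestFun e.target (c i j)) : IsTestCov2 (elemSum e c) :=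
  IsTestCov2.sum _ fun i _ => IsTestCov2.sum _ fun j _ => isTestCov2_elemTensor he i j (hc i j)

theorem isTestCov_elemCovSum (he : e ∈ atlas E4 M) {c : Fin 4 → E4 → ℝ}
    (hc : ∀ i, IsTestFun e.target (c i)) : IsTestCov (elemCovSum e c) :=
  IsTestCov.sum _ fun i _ => isTestCov_elemCov he i (hc i)

theorem contract_sum_right {p : M} (T : (TangentSpace (𝓡 4) p →L[ℝ] ℝ) →L[ℝ]
    (TangentSpace (𝓡 4) p →L[ℝ] ℝ) →L[ℝ] ℝ) {ι : Type*} (s : Finset ι) (x : ι → CovTensor M) :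
    contract T ((∑ i ∈ s, x i) p) = ∑ i ∈ s, contract T (x i p) := by
  classical
  induction s using Finset.induction_on with
  | empty => exact contract_zero_right T
  | insert a s ha ih =>
    rw [Finset.sum_insert ha, Finset.sum_insert ha, Pi.add_apply, contract_add_right, ih]

theorem contract_elemSum (he : e ∈ atlas E4 M) {p : M} (hp : p ∈ e.source)
    (T : (TangentSpace (𝓡 4) p →L[ℝ] ℝ) →L[ℝ] (TangentSpace (𝓡 4) p →L[ℝ] ℝ) →L[ℝ] ℝ)
    (c : Fin 4 → Fin 4 → E4 → ℝ) :
    contract T (elemSum e c p) = ∑ i, ∑ j, c i j (e p) * T (dcoord e p i) (dcoord e p j) := by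
  rw [elemSum, contract_sum_right]
  refine Finset.sum_congr rfl fun i _ => ?_
  rw [contract_sum_right]
  exact Finset.sum_congr rfl fun j _ => contract_elemTensor_of_mem he hp T i j _

theorem elemSum_of_notMem {p : M} (hp : p ∉ e.source) (c : Fin 4 → Fin 4 → E4 → ℝ) :
    elemSum e c p = 0 := by
  simp only [elemSum, Finset.sum_apply]
  exact Finset.sum_eq_zero fun i _ => Finset.sum_eq_zero fun j _ => elemTensor_of_notMem hp i j _

theorem elemCovSum_of_notMem {p : M} (hp : p ∉ e.source) (c : Fin 4 → E4 → ℝ) :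
    elemCovSum e c p = 0 := by
  simp only [elemCovSum, Finset.sum_apply]
  exact Finset.sum_eq_zero fun i _ => elemCov_of_notMem hp i _

theorem elemCovSum_apply_of_mem {p : M} (hp : p ∈ e.source) (c : Fin 4 → E4 → ℝ)
    (J : TangentSpace (𝓡 4) p) :
    elemCovSum e c p J = ∑ i, c i (e p) * dcoord e p i J := by
  have h : elemCovSum e c p J = ∑ i, elemCov e i (c i) p J := by
    simp only [elemCovSum, Finset.sum_apply]
    have : ∀ f : Fin 4 → E4 →L[ℝ] ℝ, (∑ i, f i) J = ∑ i, f i J := by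
      intro f
      exact _root_.sum_apply _ _ _
    exact this _
  rw [h]
  refine Finset.sum_congr rfl fun i _ => (elemCov_apply i p J).trans ?_
  rw [chartExt_of_mem hp]
  rfl

theorem covSq_eq_elemSum (α : Fin 4 → ℝ) (ψ : E4 → ℝ) :
    covSq e α ψ = elemSum e fun i j y => (α i * α j) * ψ y := by
  simp only [covSq, elemSum, elemTensor_const_mul]

end ElementarySums

/-! ### The functionals of charged matter -/

section Matter

variable {M : Type*} [TopologicalSpace M] [ChartedSpace E4 M] [IsManifold (𝓡 4) ∞ M]
  [T2Space M] [SecondCountableTopology M] {e : OpenPartialHomeomorph M E4} (g : LorentzMetric M)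
  (F : CovTensor M) (κ : ℝ)

/-- A pair of distributions with the properties of charged matter: `L` is the energy-momentum
tensor, `N` the current.  The field `le` combines the dominant energy condition and the bound of
the charge-to-mass ratio; `force` and `charge` are the force law and the conservation of charge in
weak form. -/
structure IsMatter (L : CovTensor M → ℝ) (N : CovField M → ℝ) : Prop where
  add : ∀ x y, IsTestCov2 x → IsTestCov2 y → L (x + y) = L x + L y
  smul : ∀ (r : ℝ) x, IsTestCov2 x → L (r • x) = r * L x
  vec_add : ∀ x y, IsTestCov x → IsTestCov y → N (x + y) = N x + N y
  vec_smul : ∀ (r : ℝ) x, IsTestCov x → N (r • x) = r * N x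
  le : ∀ x w, IsTestCov2 x → IsTestCov w →
    (∀ p T J, EnergyAt g κ p T J → |w p J| ≤ contract T (x p)) → |N w| ≤ L x
  force : ∀ e ∈ atlas E4 M, ∀ φ, IsTestFun e.target φ → ∀ i,
    ∑ j, L (elemTensor e i j (pd j φ))
      - ∑ k, ∑ j, L (elemTensor e k j fun y => christoffel g e i j k y * φ y)
      = -∑ k, N (elemCov e k fun y => mixedComp g F e i k y * φ y)
  charge : ∀ e ∈ atlas E4 M, ∀ φ, IsTestFun e.target φ → ∑ i, N (elemCov e i (pd i φ)) = 0

variable {g F κ} {L : CovTensor M → ℝ} {N : CovField M → ℝ}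

namespace IsMatter

/-- Smooth charged matter. -/
theorem of_smooth [MeasurableSpace M] [BorelSpace M] [Nonempty M] (hF : SmoothCov2 F)
    {T : ContraTensor M} {J : VecField M} (hT : SmoothContra2 T) (hJ : SmoothVec J)
    (henergy : ∀ p, EnergyAt g κ p (T p) (J p)) (hdiv : IsDivFree g J)
    (hforce : SatisfiesForceLaw g F T J) :
    IsMatter g F κ (tensorAction g T) (vecAction g J) where
  add _ _ hx hy := tensorAction_add g hT hx hy
  smul r x _ := tensorAction_const_smul g T r x
  vec_add _ _ hx hy := vecAction_add g hJ hx hy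
  vec_smul r x _ := vecAction_const_smul g J r x
  le x w hx hw h := by
    refine (abs_integral_le_integral_abs).trans ?_
    exact integral_mono (integrable_pairing g hJ hw).abs (integrable_contract g hT hx)
      fun p => h p _ _ (henergy p)
  force _ he _ hφ i := sum_tensorAction_pd g hF hT hJ hforce he hφ i
  charge _ he _ hφ := sum_vecAction_pd g hJ hdiv he hφ

theorem const_mul (h : IsMatter g F κ L N) {c : ℝ} (hc : 0 ≤ c) :
    IsMatter g F κ (fun x => c * L x) fun w => c * N w where
  add x y hx hy := by rw [h.add x y hx hy]; ring
  smul r x hx := by rw [h.smul r x hx]; ring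
  vec_add x y hx hy := by rw [h.vec_add x y hx hy]; ring
  vec_smul r x hx := by rw [h.vec_smul r x hx]; ring
  le x w hx hw hle := by
    rw [abs_mul, abs_of_nonneg hc]
    exact mul_le_mul_of_nonneg_left (h.le x w hx hw hle) hc
  force e he φ hφ i := by
    simp only [← Finset.mul_sum]
    rw [← mul_sub, h.force e he φ hφ i]
    ring
  charge e he φ hφ := by rw [← Finset.mul_sum, h.charge e he φ hφ, mul_zero]

theorem vec_zero (h : IsMatter g F κ L N) : N 0 = 0 := by
  have := h.vec_smul 0 0 IsTestCov.zero
  rwa [zero_smul, zero_mul] at this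

theorem zero (h : IsMatter g F κ L N) : L 0 = 0 := by
  have := h.smul 0 0 IsTestCov2.zero
  rwa [zero_smul, zero_mul] at this

theorem nonneg (h : IsMatter g F κ L N) {x : CovTensor M} (hx : IsTestCov2 x)
    (hx0 : NonnegField g κ x) : 0 ≤ L x := by
  have h1 := h.le x 0 hx IsTestCov.zero fun p T J hTJ => by
    refine le_of_eq_of_le ?_ (hx0 p T J hTJ)
    exact abs_zero
  rwa [h.vec_zero, abs_zero] at h1

theorem sub (h : IsMatter g F κ L N) {x y : CovTensor M} (hx : IsTestCov2 x) (hy : IsTestCov2 y) :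
    L (x + (-1 : ℝ) • y) = L x - L y := by
  rw [h.add _ _ hx (hy.const_smul _), h.smul _ _ hy]
  ring

theorem mono (h : IsMatter g F κ L N) {x y : CovTensor M} (hx : IsTestCov2 x) (hy : IsTestCov2 y)
    (hxy : ∀ p T J, EnergyAt g κ p T J → contract T (x p) ≤ contract T (y p)) : L x ≤ L y := by
  have h1 := h.nonneg (hy.add (hx.const_smul (-1))) fun p T J hTJ => by
    rw [Pi.add_apply, Pi.smul_apply, contract_add_right, contract_smul_right]
    linarith [hxy p T J hTJ]
  rw [h.sub hy hx] at h1
  linarith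

theorem abs_le (h : IsMatter g F κ L N) {x y : CovTensor M} (hx : IsTestCov2 x) (hy : IsTestCov2 y)
    (hxy : ∀ p T J, EnergyAt g κ p T J → |contract T (x p)| ≤ contract T (y p)) : |L x| ≤ L y := by
  rw [_root_.abs_le]
  constructor
  · have h1 := h.mono (hy.const_smul (-1)) hx fun p T J hTJ => by
      rw [Pi.smul_apply, contract_smul_right]
      linarith [(_root_.abs_le.1 (hxy p T J hTJ)).1]
    rw [h.smul _ _ hy] at h1
    linarith
  · exact h.mono hx hy fun p T J hTJ => (_root_.abs_le.1 (hxy p T J hTJ)).2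

theorem sum (h : IsMatter g F κ L N) {ι : Type*} (s : Finset ι) {x : ι → CovTensor M}
    (hx : ∀ i ∈ s, IsTestCov2 (x i)) : L (∑ i ∈ s, x i) = ∑ i ∈ s, L (x i) := by
  classical
  induction s using Finset.induction_on with
  | empty => exact h.zero
  | insert a s ha ih =>
    have hs : ∀ i ∈ s, IsTestCov2 (x i) := fun i hi => hx i (Finset.mem_insert_of_mem hi)
    rw [Finset.sum_insert ha, Finset.sum_insert ha,
      h.add _ _ (hx a (Finset.mem_insert_self a s)) (IsTestCov2.sum s hs), ih hs]

theorem vec_sum (h : IsMatter g F κ L N) {ι : Type*} (s : Finset ι) {x : ι → CovField M}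
    (hx : ∀ i ∈ s, IsTestCov (x i)) : N (∑ i ∈ s, x i) = ∑ i ∈ s, N (x i) := by
  classical
  induction s using Finset.induction_on with
  | empty => exact h.vec_zero
  | insert a s ha ih =>
    have hs : ∀ i ∈ s, IsTestCov (x i) := fun i hi => hx i (Finset.mem_insert_of_mem hi)
    rw [Finset.sum_insert ha, Finset.sum_insert ha,
      h.vec_add _ _ (hx a (Finset.mem_insert_self a s)) (IsTestCov.sum s hs), ih hs]

theorem elemTensor_symm (h : IsMatter g F κ L N) (he : e ∈ atlas E4 M) (i j : Fin 4) {φ : E4 → ℝ}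
    (hφ : IsTestFun e.target φ) : L (elemTensor e i j φ) = L (elemTensor e j i φ) := by
  have hi := isTestCov2_elemTensor he i j hφ
  have hj := isTestCov2_elemTensor he j i hφ
  have key : ∀ p T J, EnergyAt g κ p T J →
      contract T (elemTensor e i j φ p) = contract T (elemTensor e j i φ p) := by
    intro p T J hTJ
    by_cases hp : p ∈ e.source
    · rw [contract_elemTensor_of_mem he hp, contract_elemTensor_of_mem he hp]
      exact congrArg (φ (e p) * ·) (hTJ.dominant.1 (dcoord e p i) (dcoord e p j))
    · rw [elemTensor_of_notMem hp, elemTensor_of_notMem hp]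
  exact le_antisymm (h.mono hi hj fun p T J hTJ => (key p T J hTJ).le)
    (h.mono hj hi fun p T J hTJ => (key p T J hTJ).ge)

theorem elem_add (h : IsMatter g F κ L N) (he : e ∈ atlas E4 M) (i j : Fin 4) {φ ψ : E4 → ℝ}
    (hφ : IsTestFun e.target φ) (hψ : IsTestFun e.target ψ) :
    L (elemTensor e i j fun y => φ y + ψ y) = L (elemTensor e i j φ) + L (elemTensor e i j ψ) := by
  rw [elemTensor_add, h.add _ _ (isTestCov2_elemTensor he i j hφ) (isTestCov2_elemTensor he i j hψ)]

theorem elem_const_mul (h : IsMatter g F κ L N) (he : e ∈ atlas E4 M) (i j : Fin 4) (r : ℝ)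
    {φ : E4 → ℝ} (hφ : IsTestFun e.target φ) :
    L (elemTensor e i j fun y => r * φ y) = r * L (elemTensor e i j φ) := by
  rw [elemTensor_const_mul, h.smul _ _ (isTestCov2_elemTensor he i j hφ)]

theorem vec_elem_add (h : IsMatter g F κ L N) (he : e ∈ atlas E4 M) (i : Fin 4) {φ ψ : E4 → ℝ}
    (hφ : IsTestFun e.target φ) (hψ : IsTestFun e.target ψ) :
    N (elemCov e i fun y => φ y + ψ y) = N (elemCov e i φ) + N (elemCov e i ψ) := by
  rw [elemCov_add, h.vec_add _ _ (isTestCov_elemCov he i hφ) (isTestCov_elemCov he i hψ)]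

theorem vec_elem_const_mul (h : IsMatter g F κ L N) (he : e ∈ atlas E4 M) (i : Fin 4) (r : ℝ)
    {φ : E4 → ℝ} (hφ : IsTestFun e.target φ) :
    N (elemCov e i fun y => r * φ y) = r * N (elemCov e i φ) := by
  rw [elemCov_const_mul, h.vec_smul _ _ (isTestCov_elemCov he i hφ)]

theorem elem_sum (h : IsMatter g F κ L N) (he : e ∈ atlas E4 M) (i j : Fin 4) {ι : Type*}
    (s : Finset ι) (r : ι → ℝ) {φ : ι → E4 → ℝ} (hφ : ∀ a, IsTestFun e.target (φ a)) :
    L (elemTensor e i j fun y => ∑ a ∈ s, r a * φ a y)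
      = ∑ a ∈ s, r a * L (elemTensor e i j (φ a)) := by
  classical
  induction s using Finset.induction_on with
  | empty =>
    have h1 := h.elem_const_mul he i j 0 (IsTestFun.zero (Ω := e.target))
    simpa using h1
  | insert a s ha ih =>
    simp only [Finset.sum_insert ha]
    rw [h.elem_add he i j ((hφ a).const_mul _) (IsTestFun.sum s fun b _ => (hφ b).const_mul _),
      ih, h.elem_const_mul he i j _ (hφ a)]

theorem vec_elem_sum (h : IsMatter g F κ L N) (he : e ∈ atlas E4 M) (i : Fin 4) {ι : Type*}
    (s : Finset ι) (r : ι → ℝ) {φ : ι → E4 → ℝ} (hφ : ∀ a, IsTestFun e.target (φ a)) :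
    N (elemCov e i fun y => ∑ a ∈ s, r a * φ a y) = ∑ a ∈ s, r a * N (elemCov e i (φ a)) := by
  classical
  induction s using Finset.induction_on with
  | empty =>
    have h1 := h.vec_elem_const_mul he i 0 (IsTestFun.zero (Ω := e.target))
    simpa using h1
  | insert a s ha ih =>
    simp only [Finset.sum_insert ha]
    rw [h.vec_elem_add he i ((hφ a).const_mul _) (IsTestFun.sum s fun b _ => (hφ b).const_mul _),
      ih, h.vec_elem_const_mul he i _ (hφ a)]

theorem elemSum (h : IsMatter g F κ L N) (he : e ∈ atlas E4 M) {c : Fin 4 → Fin 4 → E4 → ℝ}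
    (hc : ∀ i j, IsTestFun e.target (c i j)) :
    L (elemSum e c) = ∑ i, ∑ j, L (elemTensor e i j (c i j)) := by
  rw [Spacetime.elemSum, h.sum _ fun i _ => IsTestCov2.sum _ fun j _ =>
    isTestCov2_elemTensor he i j (hc i j)]
  exact Finset.sum_congr rfl fun i _ => h.sum _ fun j _ => isTestCov2_elemTensor he i j (hc i j)

theorem elemCovSum (h : IsMatter g F κ L N) (he : e ∈ atlas E4 M) {c : Fin 4 → E4 → ℝ}
    (hc : ∀ i, IsTestFun e.target (c i)) :
    N (elemCovSum e c) = ∑ i, N (elemCov e i (c i)) :=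
  h.vec_sum _ fun i _ => isTestCov_elemCov he i (hc i)

theorem elemSum_add (h : IsMatter g F κ L N) (he : e ∈ atlas E4 M)
    {c d : Fin 4 → Fin 4 → E4 → ℝ} (hc : ∀ i j, IsTestFun e.target (c i j))
    (hd : ∀ i j, IsTestFun e.target (d i j)) :
    L (Spacetime.elemSum e fun i j y => c i j y + d i j y)
      = L (Spacetime.elemSum e c) + L (Spacetime.elemSum e d) := by
  rw [h.elemSum he hc, h.elemSum he hd, h.elemSum he fun i j => (hc i j).add (hd i j)]
  simp only [← Finset.sum_add_distrib]
  exact Finset.sum_congr rfl fun i _ => Finset.sum_congr rfl fun j _ =>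
    h.elem_add he i j (hc i j) (hd i j)

theorem elemSum_sub (h : IsMatter g F κ L N) (he : e ∈ atlas E4 M)
    {c d : Fin 4 → Fin 4 → E4 → ℝ} (hc : ∀ i j, IsTestFun e.target (c i j))
    (hd : ∀ i j, IsTestFun e.target (d i j)) :
    L (Spacetime.elemSum e fun i j y => c i j y - d i j y)
      = L (Spacetime.elemSum e c) - L (Spacetime.elemSum e d) := by
  have h1 := h.elemSum_add he (fun i j => (hc i j).sub (hd i j)) hd
  simp only [sub_add_cancel] at h1
  rw [eq_sub_iff_add_eq]
  exact h1.symm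

/-- The force law, tested against the covector field `φ ℓ`, with `ℓ` constant in the chart. -/
theorem force_covector (h : IsMatter g F κ L N) (hF : SmoothCov2 F) (he : e ∈ atlas E4 M)
    (ℓ : Fin 4 → ℝ) {φ : E4 → ℝ} (hφ : IsTestFun e.target φ) :
    L (Spacetime.elemSum e fun i j y => ℓ i * pd j φ y)
      - L (Spacetime.elemSum e fun k j y => ∑ i, ℓ i * (christoffel g e i j k y * φ y))
      = -N (Spacetime.elemCovSum e fun k y => ∑ i, ℓ i * (mixedComp g F e i k y * φ y)) := by
  have hΓφ := fun i k j => hφ.contDiffOn_mul e.open_target (contDiffOn_christoffel g he i j k)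
  have hFφ := fun i k => hφ.contDiffOn_mul e.open_target (contDiffOn_mixedComp g hF he i k)
  rw [h.elemSum he fun i j => (hφ.pd j).const_mul _,
    h.elemSum he fun k j => IsTestFun.sum _ fun i _ => (hΓφ i k j).const_mul _,
    h.elemCovSum he fun k => IsTestFun.sum _ fun i _ => (hFφ i k).const_mul _]
  have e1 : ∀ i, ∑ j, L (elemTensor e i j fun y => ℓ i * pd j φ y)
      = ℓ i * ∑ j, L (elemTensor e i j (pd j φ)) := fun i => by
    rw [Finset.mul_sum]
    exact Finset.sum_congr rfl fun j _ => h.elem_const_mul he i j _ (hφ.pd j)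
  have e2 : ∑ k, ∑ j, L (elemTensor e k j fun y => ∑ i, ℓ i * (christoffel g e i j k y * φ y))
      = ∑ i, ℓ i * ∑ k, ∑ j, L (elemTensor e k j fun y => christoffel g e i j k y * φ y) := by
    calc _ = ∑ k, ∑ j, ∑ i, ℓ i * L (elemTensor e k j fun y => christoffel g e i j k y * φ y) :=
          Finset.sum_congr rfl fun k _ => Finset.sum_congr rfl fun j _ =>
            h.elem_sum he k j _ ℓ fun i => hΓφ i k j
      _ = ∑ k, ∑ i, ∑ j, ℓ i * L (elemTensor e k j fun y => christoffel g e i j k y * φ y) :=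
          Finset.sum_congr rfl fun k _ => Finset.sum_comm
      _ = ∑ i, ∑ k, ∑ j, ℓ i * L (elemTensor e k j fun y => christoffel g e i j k y * φ y) :=
          Finset.sum_comm
      _ = _ := by simp only [Finset.mul_sum]
  have e3 : ∑ k, N (elemCov e k fun y => ∑ i, ℓ i * (mixedComp g F e i k y * φ y))
      = ∑ i, ℓ i * ∑ k, N (elemCov e k fun y => mixedComp g F e i k y * φ y) := by
    calc _ = ∑ k, ∑ i, ℓ i * N (elemCov e k fun y => mixedComp g F e i k y * φ y) :=
          Finset.sum_congr rfl fun k _ => h.vec_elem_sum he k _ ℓ fun i => hFφ i k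
      _ = ∑ i, ∑ k, ℓ i * N (elemCov e k fun y => mixedComp g F e i k y * φ y) :=
          Finset.sum_comm
      _ = _ := by simp only [Finset.mul_sum]
  rw [e2, e3, Finset.sum_congr rfl fun i _ => e1 i, ← Finset.sum_sub_distrib,
    ← Finset.sum_neg_distrib]
  refine Finset.sum_congr rfl fun i _ => ?_
  rw [← mul_sub, h.force e he φ hφ i]
  ring

/-- A limit of charged matter is charged matter. -/
theorem of_tendsto {ι : Type*} {U : Filter ι} [U.NeBot] {Ln : ι → CovTensor M → ℝ}
    {Nn : ι → CovField M → ℝ} (h : ∀ n, IsMatter g F κ (Ln n) (Nn n)) (hF : SmoothCov2 F)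
    (hL : ∀ x, IsTestCov2 x → Tendsto (fun n => Ln n x) U (𝓝 (L x)))
    (hN : ∀ w, IsTestCov w → Tendsto (fun n => Nn n w) U (𝓝 (N w))) : IsMatter g F κ L N where
  add x y hx hy := tendsto_nhds_unique (hL _ (hx.add hy)) <| by
    simp only [fun n => (h n).add x y hx hy]
    exact (hL x hx).add (hL y hy)
  smul r x hx := tendsto_nhds_unique (hL _ (hx.const_smul r)) <| by
    simp only [fun n => (h n).smul r x hx]
    exact (hL x hx).const_mul r
  vec_add x y hx hy := tendsto_nhds_unique (hN _ (hx.add hy)) <| by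
    simp only [fun n => (h n).vec_add x y hx hy]
    exact (hN x hx).add (hN y hy)
  vec_smul r x hx := tendsto_nhds_unique (hN _ (hx.const_smul r)) <| by
    simp only [fun n => (h n).vec_smul r x hx]
    exact (hN x hx).const_mul r
  le x w hx hw hle := le_of_tendsto_of_tendsto' (hN w hw).abs (hL x hx) fun n =>
    (h n).le x w hx hw hle
  force e he φ hφ i := by
    have hΓφ := fun k j => hφ.contDiffOn_mul e.open_target (contDiffOn_christoffel g he i j k)
    have hFφ := fun k => hφ.contDiffOn_mul e.open_target (contDiffOn_mixedComp g hF he i k)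
    refine tendsto_nhds_unique (f := fun n => ∑ j, Ln n (elemTensor e i j (pd j φ))
      - ∑ k, ∑ j, Ln n (elemTensor e k j fun y => christoffel g e i j k y * φ y)) (l := U)
      ((tendsto_finsetSum _ fun j _ => hL _ (isTestCov2_elemTensor he i j (hφ.pd j))).sub
        (tendsto_finsetSum _ fun k _ => tendsto_finsetSum _ fun j _ =>
          hL _ (isTestCov2_elemTensor he k j (hΓφ k j)))) ?_
    simp only [fun n => (h n).force e he φ hφ i]
    exact (tendsto_finsetSum _ fun k _ => hN _ (isTestCov_elemCov he k (hFφ k))).neg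
  charge e he φ hφ := by
    refine tendsto_nhds_unique (f := fun n => ∑ i, Nn n (elemCov e i (pd i φ))) (l := U)
      (tendsto_finsetSum _ fun i _ => hN _ (isTestCov_elemCov he i (hφ.pd i))) ?_
    simp only [fun n => (h n).charge e he φ hφ]
    exact tendsto_const_nhds

/-- A nonnegative test field controls all matter on the compact sets on which it dominates. -/
theorem exists_le_of_dominates {K : Set M} (hK : IsCompact K) {Ψ : CovTensor M}
    (hΨ : IsTestCov2 Ψ) (hnn : NonnegField g κ Ψ) (hdom : ∀ p ∈ K, Dominates g κ Ψ p)
    {x : CovTensor M} (hx : SmoothCov2 x) (hx0 : ∀ p, p ∉ K → x p = 0) {w : CovField M}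
    (hw : SmoothCov w) (hw0 : ∀ p, p ∉ K → w p = 0) :
    ∃ C, 0 ≤ C ∧ ∀ L N, IsMatter g F κ L N → |L x| ≤ C * L Ψ ∧ |N w| ≤ C * L Ψ := by
  obtain ⟨C, hC, h⟩ := exists_uniform_domination hK hnn hdom hx hx0 hw hw0
  refine ⟨C, hC, fun L N hL => ?_⟩
  rw [← hL.smul C Ψ hΨ]
  refine ⟨hL.abs_le ⟨hx, K, hK, hx0⟩ (hΨ.const_smul C) fun p T J hTJ => ?_,
    hL.le _ _ (hΨ.const_smul C) ⟨hw, K, hK, hw0⟩ fun p T J hTJ => ?_⟩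
  · rw [Pi.smul_apply, contract_smul_right]
    exact (h p T J hTJ).1
  · rw [Pi.smul_apply, contract_smul_right]
    exact (h p T J hTJ).2

/-- Matter is of order zero: it is bounded by the supremum norm of the components. -/
theorem exists_bound (h : IsMatter g F κ L N) (hκ : 0 ≤ κ) (he : e ∈ atlas E4 M) {K : Set E4}
    (hK : IsCompact K) (hKe : K ⊆ e.target) (i j : Fin 4) :
    ∃ B, ∀ φ, IsTestFun e.target φ → tsupport φ ⊆ K → ∀ ε, (∀ y, |φ y| ≤ ε) →
      |L (elemTensor e i j φ)| ≤ B * ε ∧ |N (elemCov e i φ)| ≤ B * ε := by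
  obtain ⟨χ, hχ, -, -, W, -, hKW, hW1⟩ := exists_testFun_eq_one hK e.open_target hKe
  obtain ⟨Ψ, hΨ, hnn, hdom, -⟩ := exists_dominating (g := g) (κ := κ)
    (isCompact_symm_image_tsupport hχ) isOpen_univ (subset_univ _) hκ
  have hx0 : ∀ p, p ∉ e.symm '' tsupport χ → elemTensor e i j χ p = 0 := fun p hp =>
    ContinuousLinearMap.ext fun v => ContinuousLinearMap.ext fun w => by
      refine (elemTensor_apply i j p v w).trans ?_
      rw [chartExt_eq_zero hp, zero_mul]
      rfl
  have hw0 : ∀ p, p ∉ e.symm '' tsupport χ → elemCov e i χ p = 0 := fun p hp =>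
    ContinuousLinearMap.ext fun v => by
      refine (elemCov_apply i p v).trans ?_
      rw [chartExt_eq_zero hp, zero_mul]
      rfl
  obtain ⟨C, hC, hb⟩ := exists_uniform_domination (isCompact_symm_image_tsupport hχ) hnn hdom
    (isTestCov2_elemTensor he i j hχ).1 hx0 (isTestCov_elemCov he i hχ).1 hw0
  refine ⟨C * L Ψ, fun φ hφ hφK ε hε => ?_⟩
  have hε0 : 0 ≤ ε := (abs_nonneg _).trans (hε 0)
  have key : ∀ p T J, EnergyAt g κ p T J →
      |contract T (elemTensor e i j φ p)| ≤ ε * C * contract T (Ψ p) ∧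
      |elemCov e i φ p J| ≤ ε * C * contract T (Ψ p) := by
    intro p T J hTJ
    have h0 : 0 ≤ C * contract T (Ψ p) := mul_nonneg hC (hnn p T J hTJ)
    by_cases hp : p ∈ e.source
    · by_cases hpK : e p ∈ K
      · obtain ⟨h1, h2⟩ := hb p T J hTJ
        have e2 : ∀ φ : E4 → ℝ, elemCov e i φ p J = φ (e p) * dcoord e p i J := by
          intro φ
          refine (elemCov_apply i p J).trans ?_
          rw [chartExt_of_mem hp]
          rfl
        rw [contract_elemTensor_of_mem he hp, hW1 _ (hKW hpK), one_mul] at h1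
        rw [e2, hW1 _ (hKW hpK), one_mul] at h2
        rw [contract_elemTensor_of_mem he hp, e2, abs_mul, abs_mul, mul_assoc]
        exact ⟨mul_le_mul (hε _) h1 (abs_nonneg _) hε0, mul_le_mul (hε _) h2 (abs_nonneg _) hε0⟩
      · have hφ0 : φ (e p) = 0 := image_eq_zero_of_notMem_tsupport fun hn => hpK (hφK hn)
        have h2 : elemCov e i φ p J = 0 := by
          refine (elemCov_apply i p J).trans ?_
          rw [chartExt_of_mem hp, hφ0, zero_mul]
        rw [contract_elemTensor_of_mem he hp, hφ0, zero_mul, h2, abs_zero, mul_assoc]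
        exact ⟨mul_nonneg hε0 h0, mul_nonneg hε0 h0⟩
    · have h1 : contract T (elemTensor e i j φ p) = 0 := by
        rw [elemTensor_of_notMem hp]; exact contract_zero_right T
      have h2 : elemCov e i φ p J = 0 := by rw [elemCov_of_notMem hp]; rfl
      rw [h1, h2, abs_zero, mul_assoc]
      exact ⟨mul_nonneg hε0 h0, mul_nonneg hε0 h0⟩
  have hle : ε * C * L Ψ = L ((ε * C) • Ψ) := (h.smul _ Ψ hΨ).symm
  rw [mul_comm, ← mul_assoc, hle]
  refine ⟨h.abs_le (isTestCov2_elemTensor he i j hφ) (hΨ.const_smul _) fun p T J hTJ => ?_,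
    h.le _ _ (hΨ.const_smul _) (isTestCov_elemCov he i hφ) fun p T J hTJ => ?_⟩
  · rw [Pi.smul_apply, contract_smul_right]
    exact (key p T J hTJ).1
  · rw [Pi.smul_apply, contract_smul_right]
    exact (key p T J hTJ).2

end IsMatter

end Matter

/-! ### Transport of bounds along a timelike direction -/

section Transport

/-- A function that grows at least exponentially except near `t1`, and that has compact support
around `0` and `t1`. -/
theorem exists_transport_of_pos {C t1 δ : ℝ} (hδ : 0 < δ)
    (hδ1 : δ ≤ t1 / 2) :
    ∃ f a b : ℝ → ℝ, ContDiff ℝ ∞ f ∧ ContDiff ℝ ∞ a ∧ ContDiff ℝ ∞ b ∧ (∀ t, 0 ≤ b t) ∧ 0 < b 0 ∧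
      (∀ t, C * |f t| + b t ≤ deriv f t + a t) ∧ (∀ t, t1 + δ ≤ |t| → f t = 0) ∧
      ∀ t, δ ≤ |t - t1| → a t = 0 := by
  obtain ⟨β, hβ, hβ0, hβpos, hβ1⟩ := exists_testFun_integral_one (a := -δ) (b := δ) (by linarith)
  rw [neg_add_cancel, zero_div] at hβpos
  have hβs : ∀ t, δ ≤ |t| → β t = 0 := fun t h => hβ.apply_eq_zero fun h' =>
    absurd (abs_lt.2 h') (not_lt.2 h)
  -- the bump function, moved to `t1`
  have hβ' : IsTestFun (Ioo (-δ) (t1 + δ)) fun t => β (t - t1) := by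
    have hsub : tsupport (fun t => β (t - t1)) ⊆ Icc (t1 - δ) (t1 + δ) := by
      refine closure_minimal (fun t h => ?_) isClosed_Icc
      by_contra hn
      refine h (hβs _ (le_of_not_gt fun h' => hn ?_))
      rw [abs_lt] at h'
      exact ⟨by linarith, by linarith⟩
    have hlt : tsupport (fun t => β (t - t1)) ⊆ Ioo (-δ) (t1 + δ) := by
      have h1 : tsupport (fun t => β (t - t1)) ⊆ (fun t => t - t1) ⁻¹' tsupport β :=
        closure_minimal (fun t h => subset_tsupport _ h)
          ((isClosed_tsupport _).preimage (by fun_prop))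
      intro t h
      have h2 := hβ.subset (h1 h)
      exact ⟨by linarith [h2.1], by linarith [h2.2]⟩
    exact ⟨hβ.smooth.comp (by fun_prop),
      isCompact_Icc.of_isClosed_subset (isClosed_tsupport _) hsub, hlt⟩
  have hh : IsTestFun (Ioo (-δ) (t1 + δ)) fun t => β t - β (t - t1) :=
    (hβ.mono (Ioo_subset_Ioo_right (by linarith))).sub hβ'
  have hi : Integrable β := hβ.smooth.continuous.integrable_of_hasCompactSupport hβ.compact
  have hint : ∫ t, β t - β (t - t1) = 0 := by
    rw [integral_sub hi (hi.comp_sub_right t1), integral_sub_right_eq_self β t1, sub_self]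
  obtain ⟨H, hH, hHd⟩ := exists_primitive_testFun hh hint
  have hHdiff : Differentiable ℝ H := hH.smooth.differentiable (by simp)
  have hH0 : ∀ t, 0 ≤ H t := by
    intro t
    rcases le_total t (t1 / 2) with h | h
    · have hmono : MonotoneOn H (Iic (t1 / 2)) := by
        refine monotoneOn_of_deriv_nonneg (convex_Iic _) hH.smooth.continuous.continuousOn
          hHdiff.differentiableOn fun s hs => ?_
        rw [interior_Iic] at hs
        have : β (s - t1) = 0 := hβs _ (by
          rw [abs_of_nonpos (by linarith [hs.out])]; linarith [hs.out])
        simp only [hHd, this, sub_zero]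
        exact hβ0 s
      have h0 : H (min t (-δ)) = 0 := hH.apply_eq_zero fun h' =>
        absurd h'.1 (not_lt.2 (min_le_right _ _))
      rw [← h0]
      exact hmono ((min_le_left _ _).trans h) h (min_le_left _ _)
    · have hanti : AntitoneOn H (Ici (t1 / 2)) := by
        refine antitoneOn_of_deriv_nonpos (convex_Ici _) hH.smooth.continuous.continuousOn
          hHdiff.differentiableOn fun s hs => ?_
        rw [interior_Ici] at hs
        have : β s = 0 := hβs _ (by
          rw [abs_of_nonneg (by linarith [hs.out])]; linarith [hs.out])
        simp only [hHd, this, zero_sub]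
        linarith [hβ0 (s - t1)]
      have h0 : H (max t (t1 + δ)) = 0 := hH.apply_eq_zero fun h' =>
        absurd h'.2 (not_lt.2 (le_max_right _ _))
      rw [← h0]
      exact hanti h (h.trans (le_max_left _ _)) (le_max_left _ _)
  have hexp : ContDiff ℝ ∞ fun t => Real.exp (C * t) := by fun_prop
  refine ⟨fun t => H t * Real.exp (C * t), fun t => β (t - t1) * Real.exp (C * t),
    fun t => β t * Real.exp (C * t), hH.smooth.mul hexp, hβ'.smooth.mul hexp, hβ.smooth.mul hexp,
    fun t => mul_nonneg (hβ0 t) (Real.exp_pos _).le, by simpa using hβpos, fun t => ?_, fun t h => ?_,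
    fun t h => by simp only [hβs _ h, zero_mul]⟩
  · have hd : HasDerivAt (fun t => H t * Real.exp (C * t))
        (deriv H t * Real.exp (C * t) + H t * (Real.exp (C * t) * (C * 1))) t :=
      (hHdiff t).hasDerivAt.mul ((hasDerivAt_id t).const_mul C).exp
    rw [hd.deriv, hHd, abs_of_nonneg (mul_nonneg (hH0 t) (Real.exp_pos _).le)]
    exact le_of_eq (by ring)
  · have : H t = 0 := hH.apply_eq_zero fun h' => absurd h (not_le.2 (abs_lt.2
      ⟨by linarith [h'.1], h'.2⟩))
    simp only [this, zero_mul]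

theorem exists_transport (C : ℝ) {t1 δ : ℝ} (ht : t1 ≠ 0) (hδ : 0 < δ) (hδ1 : δ ≤ |t1| / 2) :
    ∃ f a b : ℝ → ℝ, ContDiff ℝ ∞ f ∧ ContDiff ℝ ∞ a ∧ ContDiff ℝ ∞ b ∧ (∀ t, 0 ≤ b t) ∧ 0 < b 0 ∧
      (∀ t, C * |f t| + b t ≤ deriv f t + a t) ∧ (∀ t, |t1| + δ ≤ |t| → f t = 0) ∧
      ∀ t, δ ≤ |t - t1| → a t = 0 := by
  rcases lt_or_gt_of_ne ht with h | h
  · rw [abs_of_neg h] at hδ1 ⊢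
    obtain ⟨f, a, b, hf, ha, hb, hb0, hb1, hle, hfs, has⟩ :=
      exists_transport_of_pos (C := C) hδ hδ1
    refine ⟨fun t => -f (-t), fun t => a (-t), fun t => b (-t), (hf.comp contDiff_neg).neg,
      ha.comp contDiff_neg, hb.comp contDiff_neg, fun t => hb0 _, by simpa using hb1, fun t => ?_,
      fun t ht => neg_eq_zero.2 (hfs _ (by rwa [abs_neg])), fun t ht => has _ ?_⟩
    · have hd : HasDerivAt (fun t => -f (-t)) (deriv f (-t)) t := by
        have h1 := ((hf.differentiable (by simp) (-t)).hasDerivAt.comp t (hasDerivAt_neg t)).neg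
        rw [mul_neg_one, neg_neg] at h1
        exact h1
      rw [hd.deriv, abs_neg]
      exact hle (-t)
    · rwa [show -t - -t1 = -(t - t1) by ring, abs_neg]
  · rw [abs_of_pos h] at hδ1 ⊢
    exact exists_transport_of_pos hδ hδ1

variable {M : Type*} [TopologicalSpace M] [ChartedSpace E4 M] [IsManifold (𝓡 4) ∞ M]
  [T2Space M] [SecondCountableTopology M] {e : OpenPartialHomeomorph M E4} {g : LorentzMetric M}
  {F : CovTensor M} {κ : ℝ}

/-- The affine function with constant differential `ℓ` that vanishes at `y0`. -/
def affine (ℓ : Fin 4 → ℝ) (y0 y : E4) : ℝ := ∑ i, ℓ i * (y i - y0 i)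

theorem contDiff_affine (ℓ : Fin 4 → ℝ) (y0 : E4) : ContDiff ℝ ∞ (affine ℓ y0) := by
  unfold affine
  refine ContDiff.sum fun i _ => contDiff_const.mul (ContDiff.sub ?_ contDiff_const)
  exact (EuclideanSpace.proj (𝕜 := ℝ) i : E4 →L[ℝ] ℝ).contDiff

theorem pd_affine (ℓ : Fin 4 → ℝ) (y0 y : E4) (j : Fin 4) : pd j (affine ℓ y0) y = ℓ j := by
  have h : HasFDerivAt (affine ℓ y0) (∑ i, ℓ i • (EuclideanSpace.proj (𝕜 := ℝ) i : E4 →L[ℝ] ℝ)) y := by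
    unfold affine
    exact HasFDerivAt.fun_sum fun i _ =>
      (((EuclideanSpace.proj (𝕜 := ℝ) i : E4 →L[ℝ] ℝ).hasFDerivAt).sub_const _).const_mul (ℓ i)
  rw [pd, h.fderiv]
  simp [stdVec]

/-- The constants of `exists_energyMatrix_bound` are uniform on compact sets. -/
theorem exists_uniform_energyMatrix_bound (he : e ∈ atlas E4 M) (hκ : 0 ≤ κ) {ℓ : Fin 4 → ℝ}
    {K : Set E4} (hK : IsCompact K) (hKe : K ⊆ e.target)
    (hℓ : ∀ y ∈ K, 0 < bilin (invMetric g e y) ℓ ℓ) :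
    ∃ B : ℝ, 0 ≤ B ∧ ∀ y ∈ K, ∀ t j, EnergyMatrix (invMetric g e y) κ t j →
      0 ≤ bilin t ℓ ℓ ∧ (∀ i k, |t i k| ≤ B * bilin t ℓ ℓ) ∧ ∀ i, |j i| ≤ B * bilin t ℓ ℓ := by
  have h := hK.induction_on (p := fun s => ∃ B : ℝ, 0 ≤ B ∧ ∀ y ∈ s, y ∈ K → ∀ t j,
      EnergyMatrix (invMetric g e y) κ t j →
      (∀ i k, |t i k| ≤ B * bilin t ℓ ℓ) ∧ ∀ i, |j i| ≤ B * bilin t ℓ ℓ) ?_ ?_ ?_ ?_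
  · obtain ⟨B, hB, h⟩ := h
    exact ⟨B, hB, fun y hy t j htj => ⟨htj.bilin_self_nonneg (hℓ y hy), h y hy hy t j htj⟩⟩
  · exact ⟨0, le_rfl, fun y hy => hy.elim⟩
  · rintro s t hst ⟨B, hB, h⟩
    exact ⟨B, hB, fun y hy => h y (hst hy)⟩
  · rintro s s' ⟨B, hB, h⟩ ⟨B', hB', h'⟩
    refine ⟨B + B', add_nonneg hB hB', fun y hy hyK t j htj => ?_⟩
    have h0 := htj.bilin_self_nonneg (hℓ y hyK)
    have m1 : B * bilin t ℓ ℓ ≤ (B + B') * bilin t ℓ ℓ :=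
      mul_le_mul_of_nonneg_right (by linarith) h0
    have m2 : B' * bilin t ℓ ℓ ≤ (B + B') * bilin t ℓ ℓ :=
      mul_le_mul_of_nonneg_right (by linarith) h0
    rcases hy with hy | hy
    · obtain ⟨a1, a2⟩ := h y hy hyK t j htj
      exact ⟨fun i k => (a1 i k).trans m1, fun i => (a2 i).trans m1⟩
    · obtain ⟨a1, a2⟩ := h' y hy hyK t j htj
      exact ⟨fun i k => (a1 i k).trans m2, fun i => (a2 i).trans m2⟩
  · intro y hy
    have hc : ContinuousAt (fun y => invMetric g e y) y :=
      continuousAt_pi.2 fun i => continuousAt_pi.2 fun j =>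
        (contDiffOn_invMetric g he i j).continuousOn.continuousAt (e.open_target.mem_nhds (hKe hy))
    obtain ⟨B, hB, h⟩ := exists_energyMatrix_bound hc (hℓ y hy) hκ
    exact ⟨_, mem_nhdsWithin_of_mem_nhds h, B, hB, fun z hz _ t j htj => (hz t j htj).2⟩

/-- An energy estimate.  Testing the force law against `f(τ) χ dτ`, with `τ` an affine function
of the coordinates whose differential is timelike, gives `∫ f' T(dτ,dτ)`; the other terms are
controlled by `∫ C |f| T(dτ,dτ)`, up to a term with the derivatives of `χ`. -/
theorem exists_energy_estimate (hF : SmoothCov2 F) (hκ : 0 ≤ κ) (he : e ∈ atlas E4 M)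
    {ℓ : Fin 4 → ℝ} (y0 : E4) {χ : E4 → ℝ} (hχ : IsTestFun e.target χ) (hχ0 : ∀ y, 0 ≤ χ y)
    (hℓ : ∀ y ∈ tsupport χ, 0 < bilin (invMetric g e y) ℓ ℓ) :
    ∃ C : ℝ, ∀ f a b : ℝ → ℝ, ContDiff ℝ ∞ f → ContDiff ℝ ∞ a → ContDiff ℝ ∞ b →
      (∀ t, C * |f t| + b t ≤ deriv f t + a t) → ∀ L N, IsMatter g F κ L N →
      L (covSq e ℓ fun y => b (affine ℓ y0 y) * χ y)
        ≤ L (covSq e ℓ fun y => a (affine ℓ y0 y) * χ y)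
          + |L (elemSum e fun i j y => ℓ i * (f (affine ℓ y0 y) * pd j χ y))| := by
  set τ := affine ℓ y0 with hτdef
  have hτ : ContDiff ℝ ∞ τ := contDiff_affine ℓ y0
  obtain ⟨B, hB, hbd⟩ := exists_uniform_energyMatrix_bound he hκ hχ.compact hχ.subset hℓ
  set A : Fin 4 → Fin 4 → E4 → ℝ := fun k j y => ∑ i, ℓ i * christoffel g e i j k y with hA
  set D : Fin 4 → E4 → ℝ := fun k y => ∑ i, ℓ i * mixedComp g F e i k y with hD
  have hAs : ∀ k j, ContDiffOn ℝ ∞ (A k j) e.target := fun k j => ContDiffOn.sum fun i _ =>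
    contDiffOn_const.mul (contDiffOn_christoffel g he i j k)
  have hDs : ∀ k, ContDiffOn ℝ ∞ (D k) e.target := fun k => ContDiffOn.sum fun i _ =>
    contDiffOn_const.mul (contDiffOn_mixedComp g hF he i k)
  obtain ⟨G0, hG0⟩ := hχ.compact.isCompact.exists_bound_of_continuousOn
    (f := fun y => (∑ k, ∑ j, |A k j y|) + ∑ k, |D k y|) (by
      refine ContinuousOn.mono (ContinuousOn.add ?_ ?_) hχ.subset
      · exact continuousOn_finsetSum _ fun k _ => continuousOn_finsetSum _ fun j _ =>
          (hAs k j).continuousOn.abs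
      · exact continuousOn_finsetSum _ fun k _ => (hDs k).continuousOn.abs)
  refine ⟨G0 * B, fun f a b hf ha hb hle L N h => ?_⟩
  -- the test functions
  have hT : ∀ {f : ℝ → ℝ}, ContDiff ℝ ∞ f → IsTestFun e.target fun y => f (τ y) * χ y :=
    fun hf => hχ.mul_left (hf.comp hτ)
  have hf' : ContDiff ℝ ∞ (deriv f) := (contDiff_infty_iff_deriv.1 hf).2
  have hψ := hT hf
  have hsq : ∀ {φ : E4 → ℝ}, IsTestFun e.target φ → ∀ i j,
      IsTestFun e.target fun y => (ℓ i * ℓ j) * φ y := fun hφ i j => hφ.const_mul _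
  have hAψ : ∀ k j, IsTestFun e.target fun y => A k j y * (f (τ y) * χ y) := fun k j =>
    hψ.contDiffOn_mul e.open_target (hAs k j)
  have hDψ : ∀ k, IsTestFun e.target fun y => D k y * (f (τ y) * χ y) := fun k =>
    hψ.contDiffOn_mul e.open_target (hDs k)
  have hz : ∀ i j, IsTestFun e.target fun y => ℓ i * (f (τ y) * pd j χ y) := fun i j =>
    ((hχ.pd j).mul_left (hf.comp hτ)).const_mul _
  -- the force law
  have hpd : ∀ j y, pd j (fun y => f (τ y) * χ y) y
      = ℓ j * (deriv f (τ y) * χ y) + f (τ y) * pd j χ y := by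
    intro j y
    rw [pd_mul (f := fun y => f (τ y)) ((hf.comp hτ).differentiable (by simp) y)
      (hχ.smooth.differentiable (by simp) y),
      pd_comp (hf.differentiable (by simp) _) (hτ.differentiable (by simp) y), hτdef, pd_affine]
    ring
  have hforce := h.force_covector hF he ℓ hψ
  have e1 : L (elemSum e fun i j y => ℓ i * pd j (fun y => f (τ y) * χ y) y)
      = L (covSq e ℓ fun y => deriv f (τ y) * χ y)
        + L (elemSum e fun i j y => ℓ i * (f (τ y) * pd j χ y)) := by
    rw [covSq_eq_elemSum, ← h.elemSum_add he (hsq (hT hf')) hz]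
    congr 2
    funext i j y
    rw [hpd]
    ring
  have e2 : (fun k j y => ∑ i, ℓ i * (christoffel g e i j k y * (f (τ y) * χ y)))
      = fun k j y => A k j y * (f (τ y) * χ y) := by
    funext k j y
    simp only [hA, Finset.sum_mul, mul_assoc]
  have e3 : (fun k y => ∑ i, ℓ i * (mixedComp g F e i k y * (f (τ y) * χ y)))
      = fun k y => D k y * (f (τ y) * χ y) := by
    funext k y
    simp only [hD, Finset.sum_mul, mul_assoc]
  rw [e1, e2, e3] at hforce
  -- the pointwise estimate
  have hx1 := fun i j => (hsq (hT hf') i j).add (hsq (hT ha) i j)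
  have hx2 := fun i j => (hx1 i j).sub (hsq (hT hb) i j)
  have hx3 := fun i j => (hx2 i j).sub (hAψ i j)
  have hmain := h.le _ _ (isTestCov2_elemSum he hx3) (isTestCov_elemCovSum he hDψ) ?_
  · rw [h.elemSum_sub he hx2 hAψ, h.elemSum_sub he hx1 (hsq (hT hb)),
      h.elemSum_add he (hsq (hT hf')) (hsq (hT ha)), ← covSq_eq_elemSum, ← covSq_eq_elemSum,
      ← covSq_eq_elemSum] at hmain
    have h1 := neg_abs_le (N (elemCovSum e fun k y => D k y * (f (τ y) * χ y)))
    have h2 := neg_abs_le (L (elemSum e fun i j y => ℓ i * (f (τ y) * pd j χ y)))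
    linarith
  · intro p T J hTJ
    by_cases hp : p ∈ e.source
    · rw [contract_elemSum he hp, elemCovSum_apply_of_mem hp]
      set t : Matrix (Fin 4) (Fin 4) ℝ := Matrix.of fun i j => T (dcoord e p i) (dcoord e p j)
        with ht
      set v : Fin 4 → ℝ := fun i => dcoord e p i J with hv
      have hE : EnergyMatrix (invMetric g e (e p)) κ t v := hTJ.energyMatrix g he hp
      by_cases hy : χ (e p) = 0
      · have z1 : ∑ i, D i (e p) * (f (τ (e p)) * χ (e p)) * v i = 0 :=
          Finset.sum_eq_zero fun i _ => by rw [hy]; ring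
        have z2 : ∑ i, ∑ j, (ℓ i * ℓ j * (deriv f (τ (e p)) * χ (e p))
            + ℓ i * ℓ j * (a (τ (e p)) * χ (e p)) - ℓ i * ℓ j * (b (τ (e p)) * χ (e p))
            - A i j (e p) * (f (τ (e p)) * χ (e p))) * t i j = 0 :=
          Finset.sum_eq_zero fun i _ => Finset.sum_eq_zero fun j _ => by rw [hy]; ring
        refine (congrArg abs z1).le.trans (le_of_eq_of_le abs_zero z2.ge)
      · obtain ⟨b0, b1, b2⟩ := hbd (e p) (subset_tsupport _ hy) t v hE
        have hG := hG0 (e p) (subset_tsupport _ hy)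
        rw [Real.norm_of_nonneg (by positivity)] at hG
        set β := bilin t ℓ ℓ with hβ
        set fy := f (τ (e p)) with hfy
        set SA := ∑ k, ∑ j, A k j (e p) * t k j with hSA
        set SD := ∑ k, D k (e p) * v k with hSD
        have z1 : ∑ i, D i (e p) * (fy * χ (e p)) * v i = fy * χ (e p) * SD := by
          rw [hSD, Finset.mul_sum]
          exact Finset.sum_congr rfl fun i _ => by ring
        have z2 : ∑ i, ∑ j, (ℓ i * ℓ j * (deriv f (τ (e p)) * χ (e p))
            + ℓ i * ℓ j * (a (τ (e p)) * χ (e p)) - ℓ i * ℓ j * (b (τ (e p)) * χ (e p))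
            - A i j (e p) * (fy * χ (e p))) * t i j
            = (deriv f (τ (e p)) + a (τ (e p)) - b (τ (e p))) * χ (e p) * β
              - fy * χ (e p) * SA := by
          rw [hβ, hSA, bilin, Finset.mul_sum, Finset.mul_sum, ← Finset.sum_sub_distrib]
          refine Finset.sum_congr rfl fun i _ => ?_
          rw [Finset.mul_sum, Finset.mul_sum, ← Finset.sum_sub_distrib]
          exact Finset.sum_congr rfl fun j _ => by ring
        have hS : |SA| + |SD| ≤ G0 * B * β := by
          have s1 : |SA| ≤ (∑ k, ∑ j, |A k j (e p)|) * (B * β) := by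
            rw [Finset.sum_mul]
            refine (Finset.abs_sum_le_sum_abs _ _).trans (Finset.sum_le_sum fun k _ => ?_)
            rw [Finset.sum_mul]
            refine (Finset.abs_sum_le_sum_abs _ _).trans (Finset.sum_le_sum fun j _ => ?_)
            rw [abs_mul]
            exact mul_le_mul_of_nonneg_left (b1 k j) (abs_nonneg _)
          have s2 : |SD| ≤ (∑ k, |D k (e p)|) * (B * β) := by
            rw [Finset.sum_mul]
            refine (Finset.abs_sum_le_sum_abs _ _).trans (Finset.sum_le_sum fun k _ => ?_)
            rw [abs_mul]
            exact mul_le_mul_of_nonneg_left (b2 k) (abs_nonneg _)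
          have s3 := mul_le_mul_of_nonneg_right hG (mul_nonneg hB b0)
          linarith
        have hχp : 0 ≤ χ (e p) := hχ0 _
        refine le_trans (congrArg abs z1).le (le_of_le_of_eq ?_ z2.symm)
        have h5 : |fy * χ (e p) * SD| + fy * χ (e p) * SA ≤ χ (e p) * (|fy| * (|SA| + |SD|)) := by
          have q1 : |fy * χ (e p) * SD| = χ (e p) * (|fy| * |SD|) := by
            rw [abs_mul, abs_mul, abs_of_nonneg hχp]; ring
          have q2 : fy * χ (e p) * SA ≤ χ (e p) * (|fy| * |SA|) := by
            rw [show fy * χ (e p) * SA = χ (e p) * (fy * SA) by ring, ← abs_mul]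
            exact mul_le_mul_of_nonneg_left (le_abs_self _) hχp
          rw [q1]
          linarith
        have h6 : |fy| * (|SA| + |SD|) ≤ |fy| * (G0 * B * β) :=
          mul_le_mul_of_nonneg_left hS (abs_nonneg _)
        have h7 : (G0 * B * |fy|) * β ≤ (deriv f (τ (e p)) + a (τ (e p)) - b (τ (e p))) * β :=
          mul_le_mul_of_nonneg_right (by linarith [hle (τ (e p))]) b0
        have h8 := mul_le_mul_of_nonneg_left (h6.trans (by linarith : |fy| * (G0 * B * β) ≤
          (deriv f (τ (e p)) + a (τ (e p)) - b (τ (e p))) * β)) hχp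
        linarith
    · rw [elemSum_of_notMem hp, elemCovSum_of_notMem hp, contract_zero_right]
      exact abs_zero.le

end Transport

/-! ### Reparametrization of closed curves -/

section Curves

variable {M : Type*} [TopologicalSpace M] [ChartedSpace E4 M] [IsManifold (𝓡 4) ∞ M]
  [T2Space M] [SecondCountableTopology M] {e : OpenPartialHomeomorph M E4} {g : LorentzMetric M}
  {γ : ℝ → M} {I : Set ℝ}

/-- Functions of the velocity of a periodic curve are periodic. -/
theorem periodic_velocity {T : ℝ} (hγ : Function.Periodic γ T)
    (hd : ∀ s, MDifferentiableAt 𝓘(ℝ, ℝ) (𝓡 4) γ s) {β : Type*}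
    (Φ : ∀ p : M, TangentSpace (𝓡 4) p → β) :
    Function.Periodic (fun s => Φ (γ s) (velocity γ s)) T := by
  intro s
  have h1 : γ ∘ (fun s => s + T) = γ := funext hγ
  have h2 : HasMFDerivAt 𝓘(ℝ, ℝ) 𝓘(ℝ, ℝ) (fun s : ℝ => s + T) s (ContinuousLinearMap.id ℝ ℝ) :=
    ((hasFDerivAt_id s).add_const T).hasMFDerivAt
  have h3 := (hd (s + T)).hasMFDerivAt.comp s h2
  have h4 : velocity (γ ∘ fun s => s + T) s = velocity γ (s + T) := by
    have := congrArg (fun L : ℝ →L[ℝ] E4 => L 1) h3.mfderiv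
    exact this
  have h5 : ∀ γ' : ℝ → M, γ' = γ → Φ (γ' s) (velocity γ' s) = Φ (γ s) (velocity γ s) := by
    rintro _ rfl
    rfl
  refine Eq.trans ?_ (h5 _ h1)
  exact congrArg (Φ (γ (s + T))) h4.symm

theorem injOn_Ico_of_periodic {T a : ℝ} (hT : 0 < T) (hγ : Function.Periodic γ T)
    (hinj : InjOn γ (Ico a (a + T))) (c : ℝ) : InjOn γ (Ico c (c + T)) := by
  intro s hs t ht hst
  have h1 : toIcoMod hT a s = toIcoMod hT a t := by
    refine hinj (toIcoMod_mem_Ico hT a s) (toIcoMod_mem_Ico hT a t) ?_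
    rw [toIcoMod, toIcoMod, hγ.sub_zsmul_eq, hγ.sub_zsmul_eq, hst]
  obtain ⟨n, hn⟩ := (toIcoMod_eq_toIcoMod hT).1 h1
  rw [zsmul_eq_mul] at hn
  have h2 : |(n : ℝ)| < 1 := by
    have h3 : |(n : ℝ)| * T < 1 * T := by
      rw [← abs_of_pos hT, ← abs_mul, ← hn, abs_of_pos hT, one_mul, abs_lt]
      exact ⟨by linarith [hs.2, ht.1], by linarith [hs.1, ht.2]⟩
    exact lt_of_mul_lt_mul_right h3 hT.le
  have h4 : n = 0 := by
    have : |n| < 1 := by exact_mod_cast h2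
    exact Int.abs_lt_one_iff.1 this
  rw [h4, Int.cast_zero, zero_mul] at hn
  linarith

/-- The parameter interval of a closed curve may be moved so that a given point is not an end
point.  Thus each point of the curve is, for a suitable interval `I'`, passed only once. -/
theorem IsTimelikeCurve.exists_shift (hγ : IsTimelikeCurve g γ I) {s0 : ℝ} (hs0 : s0 ∈ I) :
    ∃ I', IsTimelikeCurve g γ I' ∧ s0 ∈ I' ∧ γ '' I' = γ '' I ∧ (∀ s ∈ I', γ s = γ s0 → s = s0) ∧
      (∀ x, tensorDelta γ I x = tensorDelta γ I' x) ∧ ∀ w, vecDelta γ I w = vecDelta γ I' w := by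
  rcases hγ.simple with hinj | ⟨a, b, hab, hI, hper, hinj⟩
  · exact ⟨I, hγ, hs0, rfl, fun s hs h => hinj hs hs0 h, fun _ => rfl,
      fun _ => rfl⟩
  set T := b - a with hT
  have hT0 : 0 < T := by rw [hT]; linarith
  obtain ⟨U, hU, hIU, hsm⟩ := hγ.smooth
  have hsmooth : ∀ s, ContMDiffAt 𝓘(ℝ, ℝ) (𝓡 4) ∞ γ s := by
    intro s
    obtain ⟨n, hn⟩ : ∃ n : ℤ, s + n • T ∈ Ico a (a + T) :=
      ⟨-toIcoDiv hT0 a s, by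
        rw [neg_smul, ← sub_eq_add_neg]; exact toIcoMod_mem_Ico hT0 a s⟩
    have hn' : s + n • T ∈ U := hIU (by
      rw [hI]; exact ⟨hn.1, by linarith [hn.2]⟩)
    have h1 : ContMDiffAt 𝓘(ℝ, ℝ) (𝓡 4) ∞ γ (s + n • T) := hsm.contMDiffAt (hU.mem_nhds hn')
    have h2 : ContMDiffAt 𝓘(ℝ, ℝ) 𝓘(ℝ, ℝ) ∞ (fun s : ℝ => s + n • T) s :=
      (contDiff_id.add contDiff_const).contDiffAt.contMDiffAt
    have h3 := ContMDiffAt.comp s (g := γ) h1 h2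
    have h4 : γ ∘ (fun s => s + n • T) = γ := funext fun s => hper.zsmul n s
    rwa [h4] at h3
  have hcont : Continuous γ := continuous_iff_continuousAt.2 fun s => (hsmooth s).continuousAt
  have hd : ∀ s, MDifferentiableAt 𝓘(ℝ, ℝ) (𝓡 4) γ s := fun s =>
    (hsmooth s).mdifferentiableAt (by simp)
  have hinj' : ∀ c, InjOn γ (Ico c (c + T)) := by
    refine injOn_Ico_of_periodic hT0 hper (a := a) ?_
    rwa [hT, add_sub_cancel]
  set c := s0 - T / 2 with hc
  have hcI : Icc c (c + T) = Icc (s0 - T / 2) (s0 + T / 2) := by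
    rw [hc]; congr 1; ring
  have hs0c : s0 ∈ Icc c (c + T) := by rw [hcI]; exact ⟨by linarith, by linarith⟩
  have hIcc : ∀ c, γ '' Icc c (c + T) = range γ := by
    intro c
    refine Subset.antisymm (image_subset_range _ _) ?_
    rintro _ ⟨s, rfl⟩
    obtain ⟨t, ht, hst⟩ := hper.exists_mem_Ico hT0 s c
    exact ⟨t, Ico_subset_Icc_self ht, hst.symm⟩
  have hI2 : I = Icc a (a + T) := by rw [hI, hT, add_sub_cancel]
  have hint : ∀ Φ : ∀ p : M, TangentSpace (𝓡 4) p → ℝ,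
      ∫ s in I, Φ (γ s) (velocity γ s) = ∫ s in Icc c (c + T), Φ (γ s) (velocity γ s) := by
    intro Φ
    rw [hI2, integral_Icc_eq_integral_Ioc, integral_Icc_eq_integral_Ioc,
      ← intervalIntegral.integral_of_le (by linarith),
      ← intervalIntegral.integral_of_le (by linarith)]
    exact (periodic_velocity hper hd Φ).intervalIntegral_add_eq a c
  refine ⟨Icc c (c + T), ⟨ordConnected_Icc, ⟨c, ⟨le_rfl, by linarith⟩, s0, hs0c, by
    rw [hc]; linarith⟩, ⟨univ, isOpen_univ, subset_univ _, fun s _ => (hsmooth s).contMDiffWithinAt⟩,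
    fun s _ => ?_, Or.inr ⟨c, c + T, by linarith, rfl, by rwa [add_sub_cancel_left], hinj' c⟩,
    fun K hK => isCompact_Icc.inter_right (hK.isClosed.preimage hcont)⟩, hs0c, ?_, ?_,
    ?_, ?_⟩
  · obtain ⟨t, ht, hst⟩ := (periodic_velocity hper hd fun p v => g.val p v v).exists_mem_Ico hT0 s a
    refine hst.trans (hγ.unit_speed t ?_)
    rw [hI2]
    exact Ico_subset_Icc_self ht
  · rw [hIcc, hI2, hIcc]
  · intro s hs h
    rw [hcI] at hs
    have hmem : s0 ∈ Ico c (c + T) := by rw [hc]; exact ⟨by linarith, by linarith⟩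
    rcases hs.2.lt_or_eq with h1 | h1
    · exact hinj' c (by rw [hc]; exact ⟨by linarith [hs.1], by linarith⟩) hmem h
    · have h2 : γ c = γ s0 := by
        rw [← h, ← hper c, h1, hc]
        congr 1
        ring
      have h3 := hinj' c (left_mem_Ico.2 (by linarith)) hmem h2
      rw [hc] at h3
      linarith
  · exact fun x => hint fun p v => x p v v
  · exact fun w => hint fun p v => w p v

theorem IsTimelikeCurve.continuousOn (hγ : IsTimelikeCurve g γ I) : ContinuousOn γ I := by
  obtain ⟨U, -, hIU, h⟩ := hγ.smooth
  exact h.continuousOn.mono hIU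

/-- The trace of the curve over a closed set of parameters is closed. -/
theorem IsTimelikeCurve.isClosed_image (hγ : IsTimelikeCurve g γ I) {Z : Set ℝ} (hZ : IsClosed Z) :
    IsClosed (γ '' (I ∩ Z)) := by
  have : LocallyCompactSpace M := Manifold.locallyCompact_of_finiteDimensional (𝓡 4)
  rw [← isOpen_compl_iff, isOpen_iff_mem_nhds]
  intro p hp
  obtain ⟨K, hK, hpK⟩ := exists_compact_mem_nhds p
  have h1 : IsCompact (γ '' (I ∩ γ ⁻¹' K ∩ Z)) :=
    ((hγ.proper K hK).inter_right hZ).image_of_continuousOn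
      (hγ.continuousOn.mono fun s hs => hs.1.1)
  have h2 : p ∉ γ '' (I ∩ γ ⁻¹' K ∩ Z) := fun ⟨s, hs, h⟩ => hp ⟨s, ⟨hs.1.1, hs.2⟩, h⟩
  filter_upwards [hpK, h1.isClosed.isOpen_compl.mem_nhds h2] with q hq hq2
  rintro ⟨s, hs, rfl⟩
  exact hq2 ⟨s, ⟨⟨hs.1, hq⟩, hs.2⟩, rfl⟩

end Curves

/-! ### Charts adapted to a point of the curve -/

theorem IsTestFun.contDiff_smul {E G : Type*} [NormedAddCommGroup E] [NormedSpace ℝ E]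
    [NormedAddCommGroup G] [NormedSpace ℝ G] {Ω : Set E} {θ : E → ℝ} {f : E → G}
    (hθ : IsTestFun Ω θ) (hΩ : IsOpen Ω) (hf : ContDiffOn ℝ ∞ f Ω) :
    ContDiff ℝ ∞ fun y => θ y • f y := by
  rw [contDiff_iff_contDiffAt]
  intro y
  by_cases hy : y ∈ Ω
  · exact hθ.smooth.contDiffAt.smul (hf.contDiffAt (hΩ.mem_nhds hy))
  · have h1 : (tsupport θ)ᶜ ∈ 𝓝 y :=
      (isClosed_tsupport θ).isOpen_compl.mem_nhds fun h => hy (hθ.subset h)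
    refine (contDiffAt_const (c := (0 : G))).congr_of_eventuallyEq ?_
    filter_upwards [h1] with z hz
    rw [image_eq_zero_of_notMem_tsupport hz, zero_smul]

/-- A smooth function with nonzero derivative at a point has, near this point, a left inverse that
is smooth on the whole line. -/
theorem exists_smooth_leftInverse {h : ℝ → ℝ} (hh : ContDiff ℝ ∞ h) {s0 : ℝ}
    (h0 : deriv h s0 ≠ 0) :
    ∃ S : ℝ → ℝ, ContDiff ℝ ∞ S ∧ ∃ δ > 0, ∀ s ∈ Ioo (s0 - δ) (s0 + δ), S (h s) = s := by
  have hder : HasFDerivAt h (ContinuousLinearEquiv.unitsEquivAut ℝ (Units.mk0 _ h0) : ℝ →L[ℝ] ℝ)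
      s0 :=
    (hh.differentiable (by simp) s0).hasDerivAt.hasFDerivAt.congr_fderiv (by ext; simp)
  have hn : (∞ : WithTop ℕ∞) ≠ 0 := by simp
  set P := hh.contDiffAt.toOpenPartialHomeomorph h hder hn with hP
  have hPs : s0 ∈ P.source := hh.contDiffAt.mem_toOpenPartialHomeomorph_source hder hn
  have hPh : ∀ s, P s = h s := fun s => rfl
  have hd' : Continuous (deriv h) := (contDiff_infty_iff_deriv.1 hh).2.continuous
  have hW : IsOpen {s | deriv h s ≠ 0} := isOpen_ne_fun hd' continuous_const
  set D := P.target ∩ P.symm ⁻¹' {s | deriv h s ≠ 0} with hD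
  have hDo : IsOpen D := P.isOpen_inter_preimage_symm hW
  have hD0 : h s0 ∈ D := by
    refine ⟨P.map_source hPs, ?_⟩
    rw [mem_preimage, ← hPh, P.left_inv hPs]
    exact h0
  have hsymm : ContDiffOn ℝ ∞ P.symm D := fun t ht =>
    (P.contDiffAt_symm_deriv ht.2 ht.1 (hh.differentiable (by simp) _).hasDerivAt
      hh.contDiffAt).contDiffWithinAt
  obtain ⟨β, hβ, -, -, W, hWo, hKW, hW1⟩ := exists_testFun_eq_one (K := {h s0})
    isCompact_singleton hDo (by simpa using hD0)
  have hnhds : P.source ∩ h ⁻¹' W ∈ 𝓝 s0 := inter_mem (P.open_source.mem_nhds hPs)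
    (hh.continuous.continuousAt.preimage_mem_nhds (hWo.mem_nhds (hKW rfl)))
  obtain ⟨δ, hδ, hδs⟩ := Metric.mem_nhds_iff.1 hnhds
  refine ⟨fun t => β t • P.symm t, hβ.contDiff_smul hDo hsymm, δ, hδ, fun s hs => ?_⟩
  rw [← Real.ball_eq_Ioo] at hs
  simp only [hW1 _ (hδs hs).2, one_smul]
  exact P.left_inv (hδs hs).1

section CurveChart

variable {M : Type*} [TopologicalSpace M] [ChartedSpace E4 M] [IsManifold (𝓡 4) ∞ M]
  [T2Space M] [SecondCountableTopology M] {e : OpenPartialHomeomorph M E4} {g : LorentzMetric M}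
  {γ : ℝ → M} {I : Set ℝ}

theorem hasDerivAt_chart_curve (he : e ∈ atlas E4 M) {s : ℝ}
    (hd : MDifferentiableAt 𝓘(ℝ, ℝ) (𝓡 4) γ s) (hs : γ s ∈ e.source) :
    HasDerivAt (fun t => e (γ t)) (chartD e (γ s) (velocity γ s)) s := by
  have h1 : MDifferentiableAt (𝓡 4) (𝓡 4) e (γ s) :=
    (mdifferentiable_chart he).mdifferentiableAt hs
  have h2 : HasFDerivAt (fun t => e (γ t))
      ((chartD e (γ s)).comp (mfderiv 𝓘(ℝ, ℝ) (𝓡 4) γ s : ℝ →L[ℝ] E4)) s :=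
    (h1.hasMFDerivAt.comp s hd.hasMFDerivAt).hasFDerivAt
  exact h2.hasDerivAt

theorem sum_apply_chartDinv_mul (he : e ∈ atlas E4 M) {p : M} (hp : p ∈ e.source)
    (α : E4 →L[ℝ] ℝ) (v : E4) :
    ∑ i, α (chartDinv e p (stdVec i)) * chartD e p v i = α v := by
  conv_rhs => rw [← sum_dcoord_smul he hp v, map_sum]
  simp [dcoord_apply, mul_comm]

/-- The data of a chart `e` around the point `γ s0` of a curve: a parameter interval `I'` in which
`γ s0` is passed only once; a neighborhood `O` of `γ s0` that the curve meets only for parameters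
that are `δ`-close to `s0`; a curve `c` in the model space, defined for all times, that agrees with
the coordinates of `γ` near `s0`; and an affine function of the coordinates, with timelike
differential `ℓ`, from which the parameter of the curve can be recovered by means of `S`. -/
structure CurveChart (g : LorentzMetric M) (γ : ℝ → M) (I : Set ℝ) (e : OpenPartialHomeomorph M E4)
    (s0 δ : ℝ) (I' : Set ℝ) (O : Set M) (c : ℝ → E4) (ℓ : Fin 4 → ℝ) (S : ℝ → ℝ) : Prop where
  pos : 0 < δ
  curve : IsTimelikeCurve g γ I'
  mem : s0 ∈ I'
  image_eq : γ '' I' = γ '' I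
  tensorDelta_eq : ∀ x, tensorDelta γ I x = tensorDelta γ I' x
  vecDelta_eq : ∀ w, vecDelta γ I w = vecDelta γ I' w
  isOpen : IsOpen O
  mem_nhd : γ s0 ∈ O
  nhd_sub : O ⊆ e.source
  mem_Ioo : ∀ s ∈ I', γ s ∈ O → s ∈ Ioo (s0 - δ) (s0 + δ)
  smooth : ContDiff ℝ ∞ c
  source : ∀ s ∈ Ioo (s0 - δ) (s0 + δ), γ s ∈ e.source
  coord : ∀ s ∈ Ioo (s0 - δ) (s0 + δ), e (γ s) = c s
  mdiff : ∀ s ∈ Ioo (s0 - δ) (s0 + δ), MDifferentiableAt 𝓘(ℝ, ℝ) (𝓡 4) γ s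
  smooth_param : ContDiff ℝ ∞ S
  param : ∀ s ∈ Ioo (s0 - δ) (s0 + δ), S (affine ℓ (c s0) (c s)) = s
  timelike : 0 < bilin (invMetric g e (c s0)) ℓ ℓ

theorem exists_curveChart (hγ : IsTimelikeCurve g γ I) {s0 : ℝ} (hs0 : s0 ∈ I)
    (he : e ∈ atlas E4 M) (hse : γ s0 ∈ e.source) :
    ∃ δ I' O c ℓ S, CurveChart g γ I e s0 δ I' O c ℓ S := by
  obtain ⟨I', hγ', hs0', himg, huniq, ht, hv⟩ := hγ.exists_shift hs0
  obtain ⟨U, hU, hIU, hsm⟩ := hγ'.smooth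
  -- the coordinates of the curve near `s0`
  have hVo : IsOpen (U ∩ γ ⁻¹' e.source) := hsm.continuousOn.isOpen_inter_preimage hU e.open_source
  have hcs : ContDiffOn ℝ ∞ (fun s => e (γ s)) (U ∩ γ ⁻¹' e.source) := by
    have h1 := contMDiffOn_of_mem_maximalAtlas (I := 𝓡 4) (n := ∞)
      (IsManifold.subset_maximalAtlas he)
    exact (h1.comp (hsm.mono inter_subset_left) fun s hs => hs.2).contDiffOn
  have hmd : ∀ s ∈ U, MDifferentiableAt 𝓘(ℝ, ℝ) (𝓡 4) γ s := fun s hs =>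
    (hsm.contMDiffAt (hU.mem_nhds hs)).mdifferentiableAt (by simp)
  obtain ⟨δ₁, hδ₁, hδ₁V⟩ := Metric.isOpen_iff.1 hVo s0 ⟨hIU hs0', hse⟩
  rw [Real.ball_eq_Ioo] at hδ₁V
  obtain ⟨θ, hθ, -, -, W, hW, hKW, hW1⟩ := exists_testFun_eq_one (E := ℝ) (K := {s0})
    (Ω := Ioo (s0 - δ₁) (s0 + δ₁)) isCompact_singleton isOpen_Ioo
    (by rw [singleton_subset_iff]; exact ⟨by linarith, by linarith⟩)
  set c : ℝ → E4 := fun s => θ s • e (γ s) with hc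
  have hcsm : ContDiff ℝ ∞ c := hθ.contDiff_smul isOpen_Ioo (hcs.mono hδ₁V)
  obtain ⟨δ₂, hδ₂, hδ₂W⟩ := Metric.isOpen_iff.1 hW s0 (hKW rfl)
  rw [Real.ball_eq_Ioo] at hδ₂W
  have hcW : ∀ s ∈ W, e (γ s) = c s := fun s hs => by simp only [hc, hW1 s hs, one_smul]
  have hc0 : e (γ s0) = c s0 := hcW s0 (hKW rfl)
  -- a timelike covector
  set u : E4 := velocity γ s0 with hu
  set ℓ : Fin 4 → ℝ := fun i => g.val (γ s0) u (chartDinv e (γ s0) (stdVec i)) with hℓ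
  have hℓt : bilin (invMetric g e (c s0)) ℓ ℓ = 1 := by
    rw [← hc0]
    exact (bilin_lower g he hse u).trans (hγ'.unit_speed s0 hs0')
  have hdc : HasDerivAt c (chartD e (γ s0) u) s0 := by
    refine (hasDerivAt_chart_curve he (hmd s0 (hIU hs0')) hse).congr_of_eventuallyEq ?_
    filter_upwards [hW.mem_nhds (hKW rfl)] with s hs
    exact (hcW s hs).symm
  have hℓu : ∑ i, ℓ i * chartD e (γ s0) u i = 1 := by
    exact (sum_apply_chartDinv_mul he hse (g.val (γ s0) u) u).trans (hγ'.unit_speed s0 hs0')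
  -- the parameter as a function of the coordinates
  have hh : ContDiff ℝ ∞ fun s => affine ℓ (c s0) (c s) := (contDiff_affine ℓ (c s0)).comp hcsm
  have hhd : deriv (fun s => affine ℓ (c s0) (c s)) s0 = 1 := by
    have h1 := hasDerivAt_comp_curve ((contDiff_affine ℓ (c s0)).differentiable (by simp) (c s0))
      hdc.differentiableAt
    rw [h1.deriv, ← hℓu]
    refine Finset.sum_congr rfl fun i _ => ?_
    rw [pd_affine]
    congr 1
    exact ((EuclideanSpace.proj (𝕜 := ℝ) i : E4 →L[ℝ] ℝ).hasFDerivAt.comp_hasDerivAt s0 hdc).deriv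
  obtain ⟨S, hS, δ₃, hδ₃, hSh⟩ := exists_smooth_leftInverse hh (by rw [hhd]; exact one_ne_zero)
  set δ := min (min δ₁ δ₂) δ₃ with hδ
  have hδ0 : 0 < δ := lt_min (lt_min hδ₁ hδ₂) hδ₃
  have hsub : ∀ δ', δ ≤ δ' → Ioo (s0 - δ) (s0 + δ) ⊆ Ioo (s0 - δ') (s0 + δ') := fun δ' h =>
    Ioo_subset_Ioo (by linarith) (by linarith)
  have hs1 := hsub δ₁ ((min_le_left _ _).trans (min_le_left _ _))
  have hs2 := hsub δ₂ ((min_le_left _ _).trans (min_le_right _ _))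
  have hs3 := hsub δ₃ (min_le_right _ _)
  refine ⟨δ, I', e.source ∩ (γ '' (I' ∩ (Ioo (s0 - δ) (s0 + δ))ᶜ))ᶜ, c, ℓ, S, hδ0, hγ', hs0', himg,
    ht, hv, e.open_source.inter
      (hγ'.isClosed_image isOpen_Ioo.isClosed_compl).isOpen_compl, ⟨hse, ?_⟩, inter_subset_left,
    fun s hs hO => ?_, hcsm, fun s hs => (hδ₁V (hs1 hs)).2, fun s hs => hcW s (hδ₂W (hs2 hs)),
    fun s hs => hmd s (hδ₁V (hs1 hs)).1, hS, fun s hs => hSh s (hs3 hs), by rw [hℓt]; exact one_pos⟩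
  · rintro ⟨s, hs, h⟩
    refine hs.2 ?_
    rw [huniq s hs.1 h]
    exact ⟨by linarith, by linarith⟩
  · by_contra hn
    exact hO.2 ⟨s, ⟨hs, hn⟩, rfl⟩

end CurveChart

/-! ### Boundedness of normalized matter -/

section Bounded

variable {M : Type*} [TopologicalSpace M] [ChartedSpace E4 M] [IsManifold (𝓡 4) ∞ M]
  [T2Space M] [SecondCountableTopology M] {e : OpenPartialHomeomorph M E4} {g : LorentzMetric M}
  {γ : ℝ → M} {I : Set ℝ} {F : CovTensor M} {κ : ℝ} {Ln : ℕ → CovTensor M → ℝ}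
  {Nn : ℕ → CovField M → ℝ}

/-- Near `p`, the sequence `Ln` is bounded: it is bounded on a nonnegative test field that dominates
near `p`. -/
def BoundedNear (g : LorentzMetric M) (κ : ℝ) (Ln : ℕ → CovTensor M → ℝ) (p : M) : Prop :=
  ∃ Ψ, IsTestCov2 Ψ ∧ NonnegField g κ Ψ ∧ (∃ B, ∀ n, Ln n Ψ ≤ B) ∧ ∀ᶠ q in 𝓝 p, Dominates g κ Ψ q

theorem isOpen_boundedNear : IsOpen {p | BoundedNear g κ Ln p} := by
  rw [isOpen_iff_mem_nhds]
  rintro p ⟨Ψ, h1, h2, h3, h4⟩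
  filter_upwards [eventually_eventually_nhds.2 h4] with q hq
  exact ⟨Ψ, h1, h2, h3, hq⟩

theorem exists_bounded_dominating (hm : ∀ n, IsMatter g F κ (Ln n) (Nn n)) {K : Set M}
    (hK : IsCompact K) (hb : ∀ p ∈ K, BoundedNear g κ Ln p) :
    ∃ Ψ, IsTestCov2 Ψ ∧ NonnegField g κ Ψ ∧ (∃ B, ∀ n, Ln n Ψ ≤ B) ∧
      ∀ p ∈ K, Dominates g κ Ψ p := by
  refine hK.induction_on (p := fun s => ∃ Ψ, IsTestCov2 Ψ ∧ NonnegField g κ Ψ ∧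
    (∃ B, ∀ n, Ln n Ψ ≤ B) ∧ ∀ p ∈ s, Dominates g κ Ψ p) ?_ ?_ ?_ ?_
  · exact ⟨0, IsTestCov2.zero, fun q T J _ => (contract_zero_right T).ge,
      ⟨0, fun n => (hm n).zero.le⟩, fun p hp => hp.elim⟩
  · rintro s t hst ⟨Ψ, h1, h2, h3, h4⟩
    exact ⟨Ψ, h1, h2, h3, fun p hp => h4 p (hst hp)⟩
  · rintro s t ⟨Ψ, h1, h2, ⟨B, h3⟩, h4⟩ ⟨Φ, h1', h2', ⟨B', h3'⟩, h4'⟩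
    refine ⟨Ψ + Φ, h1.add h1', h2.add h2', ⟨B + B', fun n => ?_⟩, ?_⟩
    · rw [(hm n).add _ _ h1 h1']
      exact add_le_add (h3 n) (h3' n)
    · rintro p (hp | hp)
      · refine (h4 p hp).mono fun q T J hTJ => ?_
        rw [Pi.add_apply, contract_add_right]
        linarith [h2' q T J hTJ]
      · refine (h4' p hp).mono fun q T J hTJ => ?_
        rw [Pi.add_apply, contract_add_right]
        linarith [h2 q T J hTJ]
  · intro p hp
    obtain ⟨Ψ, h1, h2, h3, h4⟩ := hb p hp
    exact ⟨_, mem_nhdsWithin_of_mem_nhds h4, Ψ, h1, h2, h3, fun q hq => hq⟩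

theorem exists_bound_of_boundedNear (hm : ∀ n, IsMatter g F κ (Ln n) (Nn n)) {K : Set M}
    (hK : IsCompact K) (hb : ∀ p ∈ K, BoundedNear g κ Ln p) {x : CovTensor M} (hx : SmoothCov2 x)
    (hx0 : ∀ p, p ∉ K → x p = 0) {w : CovField M} (hw : SmoothCov w)
    (hw0 : ∀ p, p ∉ K → w p = 0) : ∃ B, ∀ n, |Ln n x| ≤ B ∧ |Nn n w| ≤ B := by
  obtain ⟨Ψ, h1, h2, ⟨B, hB⟩, h4⟩ := exists_bounded_dominating hm hK hb
  obtain ⟨C, hC, h⟩ := IsMatter.exists_le_of_dominates (F := F) hK h1 h2 h4 hx hx0 hw hw0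
  refine ⟨C * B, fun n => ?_⟩
  have := mul_le_mul_of_nonneg_left (hB n) hC
  exact ⟨((h _ _ (hm n)).1).trans this, ((h _ _ (hm n)).2).trans this⟩

theorem exists_tensor_bound (hm : ∀ n, IsMatter g F κ (Ln n) (Nn n)) {K : Set M}
    (hK : IsCompact K) (hb : ∀ p ∈ K, BoundedNear g κ Ln p) {x : CovTensor M} (hx : SmoothCov2 x)
    (hx0 : ∀ p, p ∉ K → x p = 0) : ∃ B, ∀ n, |Ln n x| ≤ B := by
  obtain ⟨B, h⟩ := exists_bound_of_boundedNear hm hK hb hx hx0 IsTestCov.zero.1 fun _ _ => rfl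
  exact ⟨B, fun n => (h n).1⟩

theorem boundedNear_of_covSq (he : e ∈ atlas E4 M) (hκ : 0 ≤ κ) {p : M} (hp : p ∈ e.source)
    {ℓ : Fin 4 → ℝ} {ψ : E4 → ℝ} (hψ : IsTestFun e.target ψ) (h0 : ∀ y, 0 ≤ ψ y)
    (hℓ : ∀ y ∈ e.target, ψ y ≠ 0 → 0 < bilin (invMetric g e y) ℓ ℓ) (hψp : 0 < ψ (e p)) {B : ℝ}
    (hB : ∀ n, Ln n (covSq e ℓ ψ) ≤ B) : BoundedNear g κ Ln p := by
  refine ⟨covSq e ℓ ψ, isTestCov2_covSq he ℓ hψ, nonnegField_covSq he h0 hℓ, ⟨B, hB⟩, ?_⟩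
  have h1 : ContinuousAt (fun q => ψ (e q)) p :=
    hψ.smooth.continuous.continuousAt.comp (f := e) (e.continuousAt hp)
  filter_upwards [e.open_source.mem_nhds hp, h1.tendsto.eventually_const_lt hψp] with q hq hq0
  exact dominates_covSq he hq hκ (hℓ _ (e.map_source hq) hq0.ne') hψ.smooth.continuous.continuousAt
    hq0

/-- Points of the curve inside the neighborhood of a curve chart, in coordinates. -/
theorem CurveChart.exists_param {s0 δ : ℝ} {I' : Set ℝ} {O : Set M} {c : ℝ → E4} {ℓ : Fin 4 → ℝ}
    {S : ℝ → ℝ} (h : CurveChart g γ I e s0 δ I' O c ℓ S) {y : E4} (hy : y ∈ e.target)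
    (hyO : e.symm y ∈ O) (hyγ : e.symm y ∈ γ '' I) :
    ∃ s ∈ I', s ∈ Ioo (s0 - δ) (s0 + δ) ∧ γ s = e.symm y ∧ c s = y := by
  rw [← h.image_eq] at hyγ
  obtain ⟨s, hs, hsy⟩ := hyγ
  have hsδ : s ∈ Ioo (s0 - δ) (s0 + δ) := h.mem_Ioo s hs (by rwa [hsy])
  exact ⟨s, hs, hsδ, hsy, by rw [← h.coord s hsδ, hsy, e.right_inv hy]⟩

/-- Bounds propagate along the curve, by the energy estimate. -/
theorem CurveChart.exists_propagation {s0 δ : ℝ} {I' : Set ℝ} {O : Set M} {c : ℝ → E4}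
    {ℓ : Fin 4 → ℝ} {S : ℝ → ℝ} (h : CurveChart g γ I e s0 δ I' O c ℓ S) (he : e ∈ atlas E4 M)
    (hF : SmoothCov2 F) (hκ : 0 ≤ κ) (hm : ∀ n, IsMatter g F κ (Ln n) (Nn n))
    (hoff : ∀ p, p ∉ γ '' I → BoundedNear g κ Ln p) :
    ∃ ε > 0, ∀ s ∈ Ioo (s0 - ε) (s0 + ε), BoundedNear g κ Ln (γ s) →
      BoundedNear g κ Ln (γ s0) := by
  have hs0 : s0 ∈ Ioo (s0 - δ) (s0 + δ) := ⟨by linarith [h.pos], by linarith [h.pos]⟩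
  have hse := h.source s0 hs0
  set y0 := c s0 with hy0
  have hy0e : e (γ s0) = y0 := h.coord s0 hs0
  have hτ : ContDiff ℝ ∞ (affine ℓ y0) := contDiff_affine ℓ y0
  have hτ0 : affine ℓ y0 y0 = 0 := by simp [affine]
  have hS0 : S 0 = s0 := by
    have := h.param s0 hs0
    rwa [← hy0, hτ0] at this
  -- a cut-off function
  have hΩo : IsOpen ({y | y ∈ e.target ∧ 0 < bilin (invMetric g e y) ℓ ℓ} ∩
      (e.target ∩ e.symm ⁻¹' O)) :=
    (isOpen_timelike he ℓ).inter (e.isOpen_inter_preimage_symm h.isOpen)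
  have hy0t : y0 ∈ e.target := by rw [← hy0e]; exact e.map_source hse
  have hy0O : e.symm y0 ∈ O := by rw [← hy0e, e.left_inv hse]; exact h.mem_nhd
  obtain ⟨χ, hχ, hχ0, -, W, hW, hKW, hW1⟩ := exists_testFun_eq_one (K := {y0})
    isCompact_singleton hΩo (by
      rw [singleton_subset_iff]; exact ⟨⟨hy0t, h.timelike⟩, hy0t, hy0O⟩)
  have hχt : IsTestFun e.target χ := hχ.mono fun y hy => hy.2.1
  have hχℓ : ∀ y ∈ tsupport χ, 0 < bilin (invMetric g e y) ℓ ℓ := fun y hy => (hχ.subset hy).1.2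
  obtain ⟨C, hC⟩ := exists_energy_estimate (g := g) (F := F) hF hκ he y0 hχt hχ0 hχℓ
  -- times at which the cut-off function is constant along the curve
  obtain ⟨r, hr, hrW⟩ : ∃ r > 0, ∀ s ∈ Ioo (s0 - δ) (s0 + δ), |affine ℓ y0 (c s)| < r → c s ∈ W := by
    have h1 : Continuous fun t => c (S t) := h.smooth.continuous.comp h.smooth_param.continuous
    have h2 : (fun t => c (S t)) ⁻¹' W ∈ 𝓝 (0 : ℝ) := h1.continuousAt.preimage_mem_nhds (by
      rw [hS0]; exact hW.mem_nhds (hKW rfl))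
    obtain ⟨r, hr, hrs⟩ := Metric.mem_nhds_iff.1 h2
    refine ⟨r, hr, fun s hs hlt => ?_⟩
    have h3 : affine ℓ y0 (c s) ∈ (fun t => c (S t)) ⁻¹' W :=
      hrs (by rwa [mem_ball_zero_iff, Real.norm_eq_abs])
    rwa [mem_preimage, h.param s hs] at h3
  obtain ⟨ε, hε, hεr⟩ : ∃ ε > 0, ∀ s ∈ Ioo (s0 - ε) (s0 + ε),
      s ∈ Ioo (s0 - δ) (s0 + δ) ∧ |affine ℓ y0 (c s)| < r / 2 := by
    have h1 : Continuous fun s => |affine ℓ y0 (c s)| :=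
      (hτ.continuous.comp h.smooth.continuous).abs
    have h2 : ∀ᶠ s in 𝓝 s0, |affine ℓ y0 (c s)| < r / 2 := by
      refine h1.continuousAt.eventually_lt_const ?_
      change |affine ℓ y0 (c s0)| < r / 2
      rw [← hy0, hτ0, abs_zero]
      linarith
    obtain ⟨ε, hε, hs⟩ := Metric.mem_nhds_iff.1 (h2.and (isOpen_Ioo.mem_nhds hs0))
    refine ⟨ε, hε, fun s hs' => ?_⟩
    rw [← Real.ball_eq_Ioo] at hs'
    exact ⟨(hs hs').2, (hs hs').1⟩
  refine ⟨ε, hε, fun s1 hs1 hb1 => ?_⟩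
  by_cases hne : s1 = s0
  · rwa [hne] at hb1
  obtain ⟨hs1δ, hs1r⟩ := hεr s1 hs1
  set t1 := affine ℓ y0 (c s1) with ht1
  have ht1S : S t1 = s1 := h.param s1 hs1δ
  have ht10 : t1 ≠ 0 := fun h0 => hne (by rw [← ht1S, h0, hS0])
  -- points of the support at time `t1` are good, hence so are those at nearby times
  have hgood : IsOpen (e.target ∩ e.symm ⁻¹' {p | BoundedNear g κ Ln p}) :=
    e.isOpen_inter_preimage_symm isOpen_boundedNear
  obtain ⟨δ', hδ', hδ't, hδ'b⟩ : ∃ δ' > 0, δ' ≤ |t1| / 2 ∧ ∀ y ∈ tsupport χ,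
      |affine ℓ y0 y - t1| ≤ δ' → BoundedNear g κ Ln (e.symm y) := by
    have hZ : IsCompact (tsupport χ ∩ (e.target ∩ e.symm ⁻¹' {p | BoundedNear g κ Ln p})ᶜ) :=
      hχ.compact.isCompact.inter_right hgood.isClosed_compl
    have hpos : ∀ y ∈ tsupport χ ∩ (e.target ∩ e.symm ⁻¹' {p | BoundedNear g κ Ln p})ᶜ,
        0 < |affine ℓ y0 y - t1| := by
      intro y hy
      rw [abs_pos, sub_ne_zero]
      intro hyt
      refine hy.2 ⟨hχt.subset hy.1, ?_⟩
      by_cases hyγ : e.symm y ∈ γ '' I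
      · obtain ⟨s, -, hs, hsy, hcs⟩ := h.exists_param (hχt.subset hy.1) (hχ.subset hy.1).2.2 hyγ
        have h1 := h.param s hs
        rw [hcs, hyt, ht1S] at h1
        rw [mem_preimage, ← hsy, ← h1]
        exact hb1
      · exact hoff _ hyγ
    obtain ⟨m, hm0, hmle⟩ := hZ.exists_forall_le' (a := 0)
      ((hτ.continuous.sub continuous_const).abs.continuousOn) hpos
    refine ⟨min (|t1| / 2) (m / 2), lt_min (by positivity) (by linarith), min_le_left _ _,
      fun y hy hle => ?_⟩
    by_contra hn
    have h1 : m ≤ |affine ℓ y0 y - t1| := hmle y ⟨hy, fun hh => hn hh.2⟩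
    have h2 := hle.trans (min_le_right _ _)
    linarith
  obtain ⟨f, a, b, hf, ha, hb, hb0, hbpos, hle, hfs, has⟩ := exists_transport C ht10 hδ' hδ't
  have hT : ∀ {f : ℝ → ℝ}, ContDiff ℝ ∞ f → IsTestFun e.target fun y => f (affine ℓ y0 y) * χ y :=
    fun hf => hχt.mul_left (hf.comp hτ)
  have hest := fun n => hC f a b hf ha hb hle (Ln n) (Nn n) (hm n)
  have himage : ∀ {Z : Set E4}, IsClosed Z → IsCompact (e.symm '' (tsupport χ ∩ Z)) := fun hZ =>
    (hχ.compact.isCompact.inter_right hZ).image_of_continuousOn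
      (e.continuousOn_symm.mono fun y hy => hχt.subset hy.1)
  -- the term with `a` lives near the good point
  obtain ⟨B₁, hB₁⟩ := exists_tensor_bound hm
    (K := e.symm '' (tsupport χ ∩ {y | |affine ℓ y0 y - t1| ≤ δ'}))
    (himage (isClosed_le ((hτ.continuous.sub continuous_const).abs) continuous_const))
    (by rintro _ ⟨y, hy, rfl⟩; exact hδ'b y hy.1 hy.2)
    (isTestCov2_covSq he ℓ (hT ha)).1 (by
      intro p hp
      refine covSq_of_chartExt_eq_zero ℓ ?_
      by_cases hpe : p ∈ e.source
      · rw [chartExt_of_mem hpe]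
        by_contra hn
        refine hp ⟨e p, ⟨subset_tsupport _ (right_ne_zero_of_mul hn), ?_⟩, e.left_inv hpe⟩
        exact le_of_not_ge fun hge => left_ne_zero_of_mul hn (has _ hge)
      · exact chartExt_of_notMem hpe)
  -- the term with the derivatives of the cut-off function lives off the curve
  obtain ⟨B₂, hB₂⟩ := exists_tensor_bound hm
    (x := elemSum e fun i j y => ℓ i * (f (affine ℓ y0 y) * pd j χ y))
    (K := e.symm '' (tsupport χ ∩ ({y | |affine ℓ y0 y| ≤ |t1| + δ'} ∩ Wᶜ)))
    (himage ((isClosed_le hτ.continuous.abs continuous_const).inter hW.isClosed_compl))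
    (by
      rintro _ ⟨y, ⟨hy, hyt, hyW⟩, rfl⟩
      refine hoff _ fun hyγ => hyW ?_
      obtain ⟨s, -, hs, -, hcs⟩ := h.exists_param (hχt.subset hy) (hχ.subset hy).2.2 hyγ
      rw [← hcs]
      refine hrW s hs ?_
      rw [hcs]
      have : |affine ℓ y0 y| ≤ |t1| + δ' := hyt
      linarith)
    (isTestCov2_elemSum he fun i j => ((hχt.pd j).mul_left (hf.comp hτ)).const_mul _).1 (by
      intro p hp
      by_cases hpe : p ∈ e.source
      · have hzero : ∀ j, f (affine ℓ y0 (e p)) * pd j χ (e p) = 0 := by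
          intro j
          by_contra hn
          have h1 : pd j χ (e p) ≠ 0 := right_ne_zero_of_mul hn
          refine hp ⟨e p, ⟨?_, ?_, fun hpW => h1 ?_⟩, e.left_inv hpe⟩
          · exact by_contra fun hn' => h1 (by
              have : χ =ᶠ[𝓝 (e p)] 0 := notMem_tsupport_iff_eventuallyEq.1 hn'
              rw [pd, this.fderiv_eq]
              simp)
          · exact le_of_not_ge fun hge => left_ne_zero_of_mul hn (hfs _ hge)
          · have : χ =ᶠ[𝓝 (e p)] fun _ => 1 := by
              filter_upwards [hW.mem_nhds hpW] with y hy using hW1 y hy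
            rw [pd, this.fderiv_eq]
            simp
        refine ContinuousLinearMap.ext fun v => ContinuousLinearMap.ext fun w => ?_
        have h2 : elemSum e (fun i j y => ℓ i * (f (affine ℓ y0 y) * pd j χ y)) p = 0 := by
          simp only [elemSum, Finset.sum_apply]
          refine Finset.sum_eq_zero fun i _ => Finset.sum_eq_zero fun j _ => ?_
          refine ContinuousLinearMap.ext fun v => ContinuousLinearMap.ext fun w => ?_
          refine (elemTensor_apply i j p v w).trans ?_
          rw [chartExt_of_mem hpe, hzero, mul_zero, zero_mul]
          rfl
        rw [h2]
      · exact elemSum_of_notMem hpe _)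
  refine boundedNear_of_covSq he hκ hse (hT hb) (fun y => mul_nonneg (hb0 _) (hχ0 y))
    (fun y _ hy => hχℓ y (subset_tsupport _ (right_ne_zero_of_mul hy))) ?_ (B := B₁ + B₂) fun n => ?_
  · rw [hy0e, hτ0, hW1 _ (hKW rfl), mul_one]
    exact hbpos
  · refine (hest n).trans (add_le_add ((le_abs_self _).trans (hB₁ n)) (hB₂ n))

/-- If matter is bounded off the curve and near one of its points, it is bounded everywhere. -/
theorem IsTimelikeCurve.boundedNear_everywhere (hγ : IsTimelikeCurve g γ I) (hF : SmoothCov2 F)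
    (hκ : 0 ≤ κ) (hm : ∀ n, IsMatter g F κ (Ln n) (Nn n))
    (hoff : ∀ p, p ∉ γ '' I → BoundedNear g κ Ln p) {s0 : ℝ} (hs0 : s0 ∈ I)
    (hb : BoundedNear g κ Ln (γ s0)) (p : M) : BoundedNear g κ Ln p := by
  by_cases hp : p ∈ γ '' I
  swap
  · exact hoff p hp
  obtain ⟨s, hs, rfl⟩ := hp
  obtain ⟨U, hU, hIU, hsm⟩ := hγ.smooth
  have hopen : IsOpen (U ∩ γ ⁻¹' {p | BoundedNear g κ Ln p}) :=
    hsm.continuousOn.isOpen_inter_preimage hU isOpen_boundedNear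
  have hsub := hγ.interval.isPreconnected.subset_of_closure_inter_subset hopen
    ⟨s0, hs0, hIU hs0, hb⟩ ?_
  · exact (hsub hs).2
  · rintro t ⟨htc, htI⟩
    refine ⟨hIU htI, ?_⟩
    have he := chart_mem_atlas E4 (γ t)
    obtain ⟨δ, I', O, c, ℓ, S, h⟩ := exists_curveChart hγ htI he (mem_chart_source E4 (γ t))
    obtain ⟨ε, hε, hprop⟩ := h.exists_propagation he hF hκ hm hoff
    obtain ⟨t', ht', ht'b⟩ := mem_closure_iff_nhds.1 htc (Ioo (t - ε) (t + ε))
      (isOpen_Ioo.mem_nhds ⟨by linarith, by linarith⟩)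
    exact hprop t' ht' ht'b.2

end Bounded

/-! ### Matter that concentrates on the curve -/

section Concentration

variable {M : Type*} [TopologicalSpace M] [ChartedSpace E4 M] [IsManifold (𝓡 4) ∞ M]
  [T2Space M] [SecondCountableTopology M] {e : OpenPartialHomeomorph M E4} {g : LorentzMetric M}
  {γ : ℝ → M} {I : Set ℝ} {F : CovTensor M} {κ : ℝ}

theorem dualEnergyAt_covSq (he : e ∈ atlas E4 M) {ℓ : Fin 4 → ℝ} {ψ : E4 → ℝ}
    (h0 : ∀ y, 0 ≤ ψ y) (hℓ : ∀ y ∈ e.target, ψ y ≠ 0 → 0 < bilin (invMetric g e y) ℓ ℓ) (p : M) :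
    DualEnergyAt g p (covSq e ℓ ψ p) := by
  by_cases hp : chartExt e ψ p = 0
  · refine ⟨0, Fin.elim0, Fin.elim0, fun i => i.elim0, fun a b => ?_⟩
    rw [covSq_of_chartExt_eq_zero ℓ hp]
    simp
  have hps : p ∈ e.source := by_contra fun hn => hp (chartExt_of_notMem hn)
  rw [chartExt_of_mem hps] at hp
  have hpos := lt_of_le_of_ne (h0 (e p)) (Ne.symm hp)
  have ht := hℓ _ (e.map_source hps) hp
  rw [← metric_raise_raise g he hps] at ht
  refine ⟨1, fun _ => ψ (e p) • raise g e p ℓ, fun _ => raise g e p ℓ, fun _ => ⟨?_, ht.le,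
    raise g e p ℓ, ht, ?_, ht⟩, fun a b => ?_⟩
  · have h1 : g.val p (ψ (e p) • raise g e p ℓ) (ψ (e p) • raise g e p ℓ)
        = ψ (e p) * (ψ (e p) * g.val p (raise g e p ℓ) (raise g e p ℓ)) := by
      have key : ∀ (B : E4 →L[ℝ] E4 →L[ℝ] ℝ) (r : ℝ) (v : E4), B (r • v) (r • v) = r * (r * B v v) :=
        fun B r v => by simp only [map_smul, _root_.smul_apply, smul_eq_mul]
      exact key (g.val p) _ _
    exact (mul_nonneg hpos.le (mul_nonneg hpos.le ht.le)).trans_eq h1.symm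
  · have h1 : g.val p (raise g e p ℓ) (ψ (e p) • raise g e p ℓ)
        = ψ (e p) * g.val p (raise g e p ℓ) (raise g e p ℓ) :=
      (g.val p (raise g e p ℓ)).map_smul _ _
    exact (mul_pos hpos ht).trans_eq h1.symm
  · refine (covSq_apply ℓ ψ p a b).trans ?_
    rw [chartExt_of_mem hps]
    have key : ∀ (B : E4 →L[ℝ] E4 →L[ℝ] ℝ) (α : E4 →L[ℝ] ℝ) (r : ℝ) (v a b : E4), B v = α →
        r * (α a * α b) = ∑ _i : Fin 1, (B (r • v) a * B v b + B v a * B (r • v) b) / 2 := by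
      rintro B α r v a b rfl
      simp only [map_smul, _root_.smul_apply, smul_eq_mul, Finset.univ_unique, Finset.sum_const,
        Finset.card_singleton, one_smul]
      ring
    exact key (g.val p) _ _ _ a b (metric_raise g he hps ℓ)

theorem genericAt_covSq (he : e ∈ atlas E4 M) {p : M} (hp : p ∈ e.source) {ℓ : Fin 4 → ℝ}
    {ψ : E4 → ℝ} (hψ : 0 < ψ (e p)) (hℓ : 0 < bilin (invMetric g e (e p)) ℓ ℓ) :
    GenericAt g p (covSq e ℓ ψ p) := by
  intro T hT hT0
  rw [contract_covSq he hp]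
  refine mul_pos hψ ?_
  have hE : EnergyAt g 0 p T 0 := by
    refine ⟨hT, fun t _ => ?_⟩
    rw [zero_mul]
    refine le_of_eq ?_
    rw [abs_eq_zero]
    exact (g.val p t).map_zero
  obtain ⟨B, -, hB⟩ := exists_energyMatrix_bound (continuousAt_invMetric (g := g) he hp) hℓ le_rfl
  obtain ⟨h1, h2, -⟩ := hB.self_of_nhds _ _ (hE.energyMatrix g he hp)
  refine lt_of_le_of_ne h1 fun h3 => hT0 ?_
  rw [← h3, mul_zero] at h2
  have key : ∀ T : (E4 →L[ℝ] ℝ) →L[ℝ] (E4 →L[ℝ] ℝ) →L[ℝ] ℝ,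
      (∀ i k, |T (dcoord e p i) (dcoord e p k)| ≤ 0) → T = 0 := by
    intro T h
    refine ContinuousLinearMap.ext fun ξ => ContinuousLinearMap.ext fun η => ?_
    rw [← sum_covector_smul_dcoord he hp ξ, ← sum_covector_smul_dcoord he hp η]
    have h' : ∀ i k, T (dcoord e p i) (dcoord e p k) = 0 := fun i k => abs_nonpos_iff.1 (h i k)
    simp [h']
  exact key T h2

/-- An open set has a countable family of nonnegative test fields supported in it that dominates on
all its compact subsets. -/
theorem exists_dominating_sequence {O : Set M} (hO : IsOpen O) (hκ : 0 ≤ κ) :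
    ∃ Ψ : ℕ → CovTensor M, (∀ n, IsTestCov2 (Ψ n)) ∧ (∀ n, NonnegField g κ (Ψ n)) ∧
      (∀ n, ∃ K, IsCompact K ∧ K ⊆ O ∧ ∀ p, p ∉ K → Ψ n p = 0) ∧
      ∀ K, IsCompact K → K ⊆ O → ∃ n, ∀ p ∈ K, Dominates g κ (Ψ n) p := by
  have : LocallyCompactSpace M := Manifold.locallyCompact_of_finiteDimensional (𝓡 4)
  have : LocallyCompactSpace O := hO.locallyCompactSpace
  let E := CompactExhaustion.choice O
  have hE : ∀ n, IsCompact (Subtype.val '' E n) := fun n =>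
    (E.isCompact n).image continuous_subtype_val
  have hEO : ∀ n, Subtype.val '' E n ⊆ O := fun n => Subtype.coe_image_subset O (E n)
  choose Ψ h1 h2 h3 h4 using fun n => exists_dominating (g := g) (hE n) hO (hEO n) hκ
  refine ⟨Ψ, h1, h2, h4, fun K hK hKO => ?_⟩
  have hK' : IsCompact (Subtype.val ⁻¹' K : Set O) :=
    Topology.IsInducing.subtypeVal.isCompact_preimage' hK (by simpa using hKO)
  obtain ⟨n, hn⟩ := E.exists_superset_of_isCompact hK'
  exact ⟨n, fun p hp => h3 n p ⟨⟨p, hKO hp⟩, hn hp, rfl⟩⟩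

variable [MeasurableSpace M] [BorelSpace M] [Nonempty M] {C : Set (ContraTensor M × VecField M)}

/-- Some sequence of normalized members of the collection concentrates on the curve: tracking is
applied to the test fields `covSq e ℓ ψ - n • (Ψ 0 + ⋯ + Ψ n)`, where the fields `Ψ` exhaust the
complement of the curve. -/
theorem exists_concentrating_sequence (hγ : IsTimelikeCurve g γ I) (hF : SmoothCov2 F) (hκ : 0 ≤ κ)
    (hsmooth : ∀ P ∈ C, SmoothContra2 P.1 ∧ SmoothVec P.2)
    (hdec : ∀ P ∈ C, ∀ p, DominantAt g p (P.1 p)) (hdiv : ∀ P ∈ C, IsDivFree g P.2)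
    (hforce : ∀ P ∈ C, SatisfiesForceLaw g F P.1 P.2) (hbound : BoundsChargeToMass g κ C)
    (htrack : Tracks g (Prod.fst '' C) γ I) :
    ∃ Q : ℕ → ContraTensor M × VecField M, (∀ n, ∃ c : ℝ, 0 < c ∧ ∃ P ∈ C, Q n = c • P) ∧
      (∀ n, IsMatter g F κ (tensorAction g (Q n).1) (vecAction g (Q n).2)) ∧
      (∀ K, IsCompact K → K ⊆ (γ '' I)ᶜ → ∀ x w, SmoothCov2 x → SmoothCov w →
        (∀ p, p ∉ K → x p = 0) → (∀ p, p ∉ K → w p = 0) →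
        Tendsto (fun n => tensorAction g (Q n).1 x) atTop (𝓝 0) ∧
        Tendsto (fun n => vecAction g (Q n).2 w) atTop (𝓝 0)) ∧
      ∃ s0 ∈ I, ∃ Φ, IsTestCov2 Φ ∧ (∀ n, tensorAction g (Q n).1 Φ = 1) ∧
        BoundedNear g κ (fun n => tensorAction g (Q n).1) (γ s0) := by
  obtain ⟨s0, hs0⟩ := hγ.nontrivial.nonempty
  have he := chart_mem_atlas E4 (γ s0)
  have hs := mem_chart_source E4 (γ s0)
  set e := chartAt E4 (γ s0)
  obtain ⟨ℓ, hℓ⟩ := exists_timelike_covector g he hs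
  obtain ⟨ψ, hψ, hψ0, hψℓ, hψ1, -⟩ := exists_timelike_bump he hs isOpen_univ (mem_univ _) hℓ
  set Φ := covSq e ℓ ψ with hΦ
  have hΦt : IsTestCov2 Φ := isTestCov2_covSq he ℓ hψ
  have hO : IsOpen (γ '' I)ᶜ := by
    have := hγ.isClosed_image isClosed_univ
    rw [inter_univ] at this
    exact this.isOpen_compl
  obtain ⟨Ψ, hΨt, hΨ0, hΨK, hΨ⟩ := exists_dominating_sequence (g := g) hO hκ
  have hmat : ∀ P ∈ C, IsMatter g F κ (tensorAction g P.1) (vecAction g P.2) := fun P hP =>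
    IsMatter.of_smooth hF (hsmooth P hP).1 (hsmooth P hP).2
      (fun p => ⟨hdec P hP p, hbound P hP p⟩) (hdiv P hP) (hforce P hP)
  have hsumt : ∀ n, IsTestCov2 (∑ j ∈ Finset.range (n + 1), Ψ j) := fun n =>
    IsTestCov2.sum _ fun j _ => hΨt j
  -- tracking
  have hP : ∀ n : ℕ, ∃ P ∈ C,
      (n : ℝ) * ∑ j ∈ Finset.range (n + 1), tensorAction g P.1 (Ψ j) < tensorAction g P.1 Φ := by
    intro n
    choose K hK hKO hK0 using hΨK
    have hU : IsCompact (⋃ j ∈ Finset.range (n + 1), K j) :=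
      (Finset.range (n + 1)).isCompact_biUnion fun j _ => hK j
    have hzero : ∀ p, p ∉ (⋃ j ∈ Finset.range (n + 1), K j) →
        (Φ + (-(n : ℝ)) • ∑ j ∈ Finset.range (n + 1), Ψ j) p = Φ p := by
      intro p hp
      have h1 : (∑ j ∈ Finset.range (n + 1), Ψ j) p = 0 := by
        rw [Finset.sum_apply]
        exact Finset.sum_eq_zero fun j hj => hK0 j p fun h => hp (mem_biUnion hj h)
      rw [Pi.add_apply, Pi.smul_apply, h1]
      exact ContinuousLinearMap.ext fun v => ContinuousLinearMap.ext fun w => by simp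
    have hUγ : γ '' I ⊆ (⋃ j ∈ Finset.range (n + 1), K j)ᶜ := by
      intro p hp hp'
      obtain ⟨j, -, hj⟩ := mem_iUnion₂.1 hp'
      exact hKO j hj hp
    obtain ⟨_, ⟨P, hPC, rfl⟩, hpos⟩ := htrack (Φ + (-(n : ℝ)) • ∑ j ∈ Finset.range (n + 1), Ψ j)
      (hΦt.add ((hsumt n).const_smul _)) ⟨_, hU.isClosed.isOpen_compl, hUγ, fun p hp => by
        rw [hzero p hp]
        exact dualEnergyAt_covSq he hψ0 hψℓ p⟩ ⟨s0, hs0, by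
        rw [hzero _ (hUγ ⟨s0, hs0, rfl⟩)]
        exact genericAt_covSq he hs (by rw [hψ1]; exact one_pos) hℓ⟩
    refine ⟨P, hPC, ?_⟩
    have hm := hmat P hPC
    rw [hm.add _ _ hΦt ((hsumt n).const_smul _), hm.smul _ _ (hsumt n),
      hm.sum _ fun j _ => hΨt j] at hpos
    linarith
  choose P hPC hPlt using hP
  have hΨnn : ∀ n j, 0 ≤ tensorAction g (P n).1 (Ψ j) := fun n j =>
    (hmat _ (hPC n)).nonneg (hΨt j) (hΨ0 j)
  have hΦpos : ∀ n, 0 < tensorAction g (P n).1 Φ := fun n => by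
    refine lt_of_le_of_lt ?_ (hPlt n)
    exact mul_nonneg n.cast_nonneg (Finset.sum_nonneg fun j _ => hΨnn n j)
  set r : ℕ → ℝ := fun n => (tensorAction g (P n).1 Φ)⁻¹ with hr
  have hr0 : ∀ n, 0 < r n := fun n => inv_pos.2 (hΦpos n)
  have hT : ∀ n x, tensorAction g (r n • P n).1 x = r n * tensorAction g (P n).1 x := fun n x =>
    tensorAction_smul_left g _ _ x
  have hV : ∀ n x, vecAction g (r n • P n).2 x = r n * vecAction g (P n).2 x := fun n x =>
    vecAction_smul_left g _ _ x
  have hm : ∀ n, IsMatter g F κ (tensorAction g (r n • P n).1) (vecAction g (r n • P n).2) := by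
    intro n
    rw [show tensorAction g (r n • P n).1 = fun x => r n * tensorAction g (P n).1 x from
      funext (hT n), show vecAction g (r n • P n).2 = fun x => r n * vecAction g (P n).2 x from
      funext (hV n)]
    exact (hmat _ (hPC n)).const_mul (hr0 n).le
  have hone : ∀ n, tensorAction g (r n • P n).1 Φ = 1 := fun n => by
    rw [hT, hr]
    exact inv_mul_cancel₀ (hΦpos n).ne'
  -- the exhausting fields tend to zero
  have hΨlim : ∀ j, Tendsto (fun n => tensorAction g (r n • P n).1 (Ψ j)) atTop (𝓝 0) := by
    intro j
    refine squeeze_zero' (Eventually.of_forall fun n => (hm n).nonneg (hΨt j) (hΨ0 j)) ?_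
      tendsto_inv_atTop_nhds_zero_nat
    filter_upwards [eventually_gt_atTop 0, eventually_ge_atTop j] with n hn hnj
    have hn' : (0 : ℝ) < n := by exact_mod_cast hn
    have h1 : (n : ℝ) * tensorAction g (P n).1 (Ψ j) ≤ tensorAction g (P n).1 Φ := by
      refine le_trans (mul_le_mul_of_nonneg_left ?_ hn'.le) (hPlt n).le
      exact Finset.single_le_sum (f := fun j => tensorAction g (P n).1 (Ψ j))
        (fun j _ => hΨnn n j) (Finset.mem_range.2 (by omega))
    rw [hT, ← one_div, le_div_iff₀ hn', ← hone n, hT, mul_assoc, mul_comm _ (n : ℝ)]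
    exact mul_le_mul_of_nonneg_left h1 (hr0 n).le
  refine ⟨fun n => r n • P n, fun n => ⟨r n, hr0 n, P n, hPC n, rfl⟩, hm, ?_, s0, hs0, Φ, hΦt, hone,
    ?_⟩
  · intro K hK hKO x w hx hw hx0 hw0
    obtain ⟨j, hj⟩ := hΨ K hK hKO
    obtain ⟨B, -, hB⟩ := IsMatter.exists_le_of_dominates (F := F) hK (hΨt j) (hΨ0 j) hj hx hx0 hw hw0
    have h0 := (hΨlim j).const_mul B
    rw [mul_zero] at h0
    exact ⟨squeeze_zero_norm (fun n => (hB _ _ (hm n)).1) h0,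
      squeeze_zero_norm (fun n => (hB _ _ (hm n)).2) h0⟩
  · exact boundedNear_of_covSq he hκ hs hψ hψ0 hψℓ (by rw [hψ1]; exact one_pos)
      fun n => (hone n).le

/-- Matter that concentrates on the curve is bounded off the curve. -/
theorem boundedNear_of_tendsto {Ln : ℕ → CovTensor M → ℝ} (hκ : 0 ≤ κ) {O : Set M} (hO : IsOpen O)
    (h : ∀ K, IsCompact K → K ⊆ O → ∀ x, SmoothCov2 x → (∀ p, p ∉ K → x p = 0) →
      Tendsto (fun n => Ln n x) atTop (𝓝 0)) {p : M} (hp : p ∈ O) : BoundedNear g κ Ln p := by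
  have : LocallyCompactSpace M := Manifold.locallyCompact_of_finiteDimensional (𝓡 4)
  obtain ⟨K, hK, hpK, hKO⟩ := exists_compact_subset hO hp
  obtain ⟨Ψ, h1, h2, h3, K', hK', hKO', h4⟩ := exists_dominating (g := g) hK hO hKO hκ
  obtain ⟨B, hB⟩ := (h K' hK' hKO' Ψ h1.1 h4).bddAbove_range
  refine ⟨Ψ, h1, h2, ⟨B, fun n => hB ⟨n, rfl⟩⟩, ?_⟩
  filter_upwards [isOpen_interior.mem_nhds hpK] with q hq using h3 q (interior_subset hq)

end Concentration

/-! ### The velocity of the curve in a chart -/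

section VelocityCovector

variable {M : Type*} [TopologicalSpace M] [ChartedSpace E4 M] [IsManifold (𝓡 4) ∞ M]
  {e : OpenPartialHomeomorph M E4} (g : LorentzMetric M)

theorem sum_metricMatrix_mul_christoffel (he : e ∈ atlas E4 M) {y : E4} (hy : y ∈ e.target)
    (l j k : Fin 4) : ∑ i, metricMatrix g e y l i * christoffel g e i j k y
      = (1 / 2) * (pd j (cov2Comp g.val e l k) y + pd k (cov2Comp g.val e l j) y
        - pd l (cov2Comp g.val e j k) y) := by
  set B : Fin 4 → ℝ := fun m => pd j (cov2Comp g.val e m k) y + pd k (cov2Comp g.val e m j) y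
    - pd m (cov2Comp g.val e j k) y with hB
  calc ∑ i, metricMatrix g e y l i * christoffel g e i j k y
      = ∑ i, ∑ m, (1 / 2) * ((metricMatrix g e y l i * invMetric g e y i m) * B m) := by
        refine Finset.sum_congr rfl fun i _ => ?_
        rw [christoffel, Finset.mul_sum, Finset.mul_sum]
        exact Finset.sum_congr rfl fun m _ => by ring
    _ = ∑ m, (1 / 2) * ((if l = m then 1 else 0) * B m) := by
        rw [Finset.sum_comm]
        refine Finset.sum_congr rfl fun m _ => ?_
        rw [← sum_mul_invMetric g he hy l m, Finset.sum_mul, Finset.mul_sum]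
    _ = _ := by simp [hB]

/-- The algebra behind the compatibility of the Levi-Civita connection with the metric, for the
velocity `u` of a curve of unit speed, with `D k i j` in the role of `∂_k g_{ij}` and `a` in the
role of `du/ds`. -/
theorem sum_lowered_acceleration {G : Fin 4 → Fin 4 → ℝ} {D Γ : Fin 4 → Fin 4 → Fin 4 → ℝ}
    {u a : Fin 4 → ℝ} (hG : ∀ i j, G i j = G j i)
    (hΓ : ∀ l j k, ∑ i, G l i * Γ i j k = (1 / 2) * (D j l k + D k l j - D l j k))
    (hunit : ∑ i, ((∑ j, ((∑ k, D k i j * u k) * u j + G i j * a j)) * u i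
      + (∑ j, G i j * u j) * a i) = 0) :
    ∑ i, (∑ j, ((∑ k, D k i j * u k) * u j + G i j * a j)) * u i
      = ∑ i, (∑ k, ∑ j, Γ i j k * (u k * u j)) * ∑ j, G i j * u j := by
  set A := ∑ j, ∑ k, ∑ l, D j l k * (u j * u k * u l) with hA
  set Y := ∑ i, (∑ j, G i j * u j) * a i with hY
  have hX : ∑ i, (∑ j, ((∑ k, D k i j * u k) * u j + G i j * a j)) * u i = A + Y := by
    have h1 : ∑ i, (∑ j, (∑ k, D k i j * u k) * u j) * u i = A := by
      simp only [hA, Finset.sum_mul]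
      calc ∑ i, ∑ j, ∑ k, D k i j * u k * u j * u i
          = ∑ i, ∑ k, ∑ j, D k i j * u k * u j * u i :=
            Finset.sum_congr rfl fun i _ => Finset.sum_comm
        _ = ∑ k, ∑ i, ∑ j, D k i j * u k * u j * u i := Finset.sum_comm
        _ = ∑ k, ∑ j, ∑ i, D k i j * u k * u j * u i :=
            Finset.sum_congr rfl fun k _ => Finset.sum_comm
        _ = _ := Finset.sum_congr rfl fun j _ => Finset.sum_congr rfl fun k _ =>
            Finset.sum_congr rfl fun l _ => by ring
    have h2 : ∑ i, (∑ j, G i j * a j) * u i = Y := by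
      simp only [hY, Finset.sum_mul]
      rw [Finset.sum_comm]
      exact Finset.sum_congr rfl fun i _ => Finset.sum_congr rfl fun j _ => by rw [hG]; ring
    rw [← h1, ← h2, ← Finset.sum_add_distrib]
    exact Finset.sum_congr rfl fun i _ => by rw [Finset.sum_add_distrib, add_mul]
  have e1 : ∑ j, ∑ k, ∑ l, D k l j * (u j * u k * u l) = A := by
    rw [Finset.sum_comm]
    exact Finset.sum_congr rfl fun j _ => Finset.sum_congr rfl fun k _ =>
      Finset.sum_congr rfl fun l _ => by ring
  have e2 : ∑ j, ∑ k, ∑ l, D l j k * (u j * u k * u l) = A := by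
    calc ∑ j, ∑ k, ∑ l, D l j k * (u j * u k * u l)
        = ∑ j, ∑ l, ∑ k, D l j k * (u j * u k * u l) :=
          Finset.sum_congr rfl fun i _ => Finset.sum_comm
      _ = ∑ l, ∑ j, ∑ k, D l j k * (u j * u k * u l) := Finset.sum_comm
      _ = ∑ l, ∑ k, ∑ j, D l j k * (u j * u k * u l) :=
          Finset.sum_congr rfl fun i _ => Finset.sum_comm
      _ = _ := Finset.sum_congr rfl fun j _ => Finset.sum_congr rfl fun k _ =>
          Finset.sum_congr rfl fun l _ => by ring
  have hR : ∑ i, (∑ k, ∑ j, Γ i j k * (u k * u j)) * ∑ j, G i j * u j = (1 / 2) * A := by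
    calc ∑ i, (∑ k, ∑ j, Γ i j k * (u k * u j)) * ∑ j, G i j * u j
        = ∑ i, ∑ k, ∑ j, ∑ l, u j * u k * u l * (G l i * Γ i j k) := by
          refine Finset.sum_congr rfl fun i _ => ?_
          rw [Finset.sum_mul]
          refine Finset.sum_congr rfl fun k _ => ?_
          rw [Finset.sum_mul]
          refine Finset.sum_congr rfl fun j _ => ?_
          rw [Finset.mul_sum]
          exact Finset.sum_congr rfl fun l _ => by rw [hG i l]; ring
      _ = ∑ k, ∑ j, ∑ l, ∑ i, u j * u k * u l * (G l i * Γ i j k) := by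
          rw [Finset.sum_comm]
          refine Finset.sum_congr rfl fun k _ => ?_
          rw [Finset.sum_comm]
          exact Finset.sum_congr rfl fun j _ => Finset.sum_comm
      _ = ∑ j, ∑ k, ∑ l, ((1 / 2) * (D j l k * (u j * u k * u l))
            + (1 / 2) * (D k l j * (u j * u k * u l))
            - (1 / 2) * (D l j k * (u j * u k * u l))) := by
          rw [Finset.sum_comm]
          refine Finset.sum_congr rfl fun j _ => Finset.sum_congr rfl fun k _ =>
            Finset.sum_congr rfl fun l _ => ?_
          rw [← Finset.mul_sum, hΓ]
          ring
      _ = (1 / 2) * A := by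
          simp only [Finset.sum_add_distrib, Finset.sum_sub_distrib, ← Finset.mul_sum, e1, e2]
          rw [← hA]
          ring
  rw [Finset.sum_add_distrib, hX] at hunit
  rw [hX, hR]
  linarith

/-- The components of the covector `g_{ij} u^j` along a curve in the model space. -/
def lowerVel (e : OpenPartialHomeomorph M E4) (c : ℝ → E4) (i : Fin 4) (s : ℝ) : ℝ :=
  ∑ j, metricMatrix g e (c s) i j * vel c j s

variable {g} {c : ℝ → E4} {s : ℝ}

theorem contDiffOn_lowerVel (he : e ∈ atlas E4 M) (hc : ContDiff ℝ ∞ c) (i : Fin 4) :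
    ContDiffOn ℝ ∞ (lowerVel g e c i) (c ⁻¹' e.target) :=
  ContDiffOn.sum fun j _ => ((contDiffOn_metricMatrix g he i j).comp hc.contDiffOn
    fun _ hs => hs).mul (contDiff_vel hc j).contDiffOn

theorem hasDerivAt_lowerVel (he : e ∈ atlas E4 M) (hc : ContDiff ℝ ∞ c) (hs : c s ∈ e.target)
    (i : Fin 4) : HasDerivAt (lowerVel g e c i) (∑ j,
      ((∑ k, pd k (cov2Comp g.val e i j) (c s) * vel c k s) * vel c j s
        + metricMatrix g e (c s) i j * deriv (vel c j) s)) s := by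
  refine HasDerivAt.fun_sum fun j _ => HasDerivAt.mul ?_ ?_
  · exact hasDerivAt_comp_curve (((g.smooth e he i j).contDiffAt
      (e.open_target.mem_nhds hs)).differentiableAt (by simp)) (hc.differentiable (by simp) s)
  · exact ((contDiff_vel hc j).differentiable (by simp) s).hasDerivAt

/-- The covector `g_{ij} u^j` of a curve of unit speed changes, in the direction of the curve, only
by parallel transport. -/
theorem sum_deriv_lowerVel (he : e ∈ atlas E4 M) (hc : ContDiff ℝ ∞ c) (hs : c s ∈ e.target)
    {A : Set ℝ} (hA : UniqueDiffWithinAt ℝ A s) (hsA : s ∈ A)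
    (hunit : ∀ t ∈ A, ∑ i, lowerVel g e c i t * vel c i t = 1) :
    ∑ i, deriv (lowerVel g e c i) s * vel c i s
      = ∑ i, (∑ k, ∑ j, christoffel g e i j k (c s) * (vel c k s * vel c j s))
        * lowerVel g e c i s := by
  have h1 := fun i => hasDerivAt_lowerVel (g := g) he hc hs i
  have h2 : HasDerivAt (fun t => ∑ i, lowerVel g e c i t * vel c i t) _ s :=
    HasDerivAt.fun_sum fun i _ => (h1 i).mul
      ((contDiff_vel hc i).differentiable (by simp) s).hasDerivAt
  have h3 : HasDerivWithinAt (fun t => ∑ i, lowerVel g e c i t * vel c i t) 0 A s :=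
    (hasDerivWithinAt_const s A (1 : ℝ)).congr hunit (hunit s hsA)
  have h4 := hA.eq_deriv _ h2.hasDerivWithinAt h3
  simp only [(h1 _).deriv]
  exact sum_lowered_acceleration (fun i j => metricMatrix_symm g (c s) i j)
    (fun l j k => sum_metricMatrix_mul_christoffel g he hs l j k) h4

theorem sum_mixedComp_mul_lowerVel {F : CovTensor M} (hF : ∀ p v w, F p v w = -F p w v)
    (he : e ∈ atlas E4 M) (hs : c s ∈ e.target) :
    ∑ i, (∑ k, mixedComp g F e i k (c s) * vel c k s) * lowerVel g e c i s = 0 := by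
  set f : Fin 4 → Fin 4 → ℝ := fun l k => cov2Comp F e l k (c s) with hf
  have hanti : ∀ l k, f l k = -f k l := fun l k => hF _ _ _
  set u := fun i => vel c i s with hu
  have h1 : ∑ i, (∑ k, mixedComp g F e i k (c s) * u k) * lowerVel g e c i s
      = ∑ j, ∑ k, f j k * (u j * u k) := by
    calc ∑ i, (∑ k, mixedComp g F e i k (c s) * u k) * lowerVel g e c i s
        = ∑ i, ∑ k, ∑ l, ∑ j, (metricMatrix g e (c s) j i * invMetric g e (c s) i l)
            * (f l k * (u j * u k)) := by
          refine Finset.sum_congr rfl fun i _ => ?_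
          rw [Finset.sum_mul]
          refine Finset.sum_congr rfl fun k _ => ?_
          rw [mixedComp, lowerVel, mul_assoc, Finset.sum_mul]
          refine Finset.sum_congr rfl fun l _ => ?_
          rw [Finset.mul_sum, Finset.mul_sum]
          refine Finset.sum_congr rfl fun j _ => ?_
          rw [metricMatrix_symm g _ i j]
          ring
      _ = ∑ k, ∑ l, ∑ j, (if j = l then 1 else 0) * (f l k * (u j * u k)) := by
          rw [Finset.sum_comm]
          refine Finset.sum_congr rfl fun k _ => ?_
          rw [Finset.sum_comm]
          refine Finset.sum_congr rfl fun l _ => ?_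
          rw [Finset.sum_comm]
          refine Finset.sum_congr rfl fun j _ => ?_
          rw [← sum_mul_invMetric g he hs j l, Finset.sum_mul]
      _ = ∑ j, ∑ k, f j k * (u j * u k) := by
          rw [Finset.sum_comm]
          refine Finset.sum_congr rfl fun l _ => Finset.sum_congr rfl fun k _ => by simp
  rw [h1]
  have h2 : ∑ j, ∑ k, f j k * (u j * u k) = -∑ j, ∑ k, f j k * (u j * u k) := by
    conv_lhs => rw [Finset.sum_comm]
    rw [← Finset.sum_neg_distrib]
    refine Finset.sum_congr rfl fun j _ => ?_
    rw [← Finset.sum_neg_distrib]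
    exact Finset.sum_congr rfl fun k _ => by rw [hanti k j]; ring
  linarith

end VelocityCovector

/-! ### Matter carried by the curve, near one of its points -/

section CurveMatter

variable {M : Type*} [TopologicalSpace M] [ChartedSpace E4 M] [IsManifold (𝓡 4) ∞ M]
  [T2Space M] [SecondCountableTopology M] {e : OpenPartialHomeomorph M E4} {g : LorentzMetric M}
  {γ : ℝ → M} {I : Set ℝ} {F : CovTensor M} {κ : ℝ} {L : CovTensor M → ℝ} {N : CovField M → ℝ}
  {s0 δ : ℝ} {I' : Set ℝ} {O : Set M} {c : ℝ → E4} {ℓ : Fin 4 → ℝ} {S : ℝ → ℝ}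

/-- The pair of distributions vanishes off the set `Z`. -/
def VanishesOff (Z : Set M) (L : CovTensor M → ℝ) (N : CovField M → ℝ) : Prop :=
  ∀ K, IsCompact K → K ⊆ Zᶜ → ∀ x w, SmoothCov2 x → SmoothCov w →
    (∀ p, p ∉ K → x p = 0) → (∀ p, p ∉ K → w p = 0) → L x = 0 ∧ N w = 0

theorem CurveChart.vel_eq (h : CurveChart g γ I e s0 δ I' O c ℓ S) (he : e ∈ atlas E4 M) {s : ℝ}
    (hs : s ∈ Ioo (s0 - δ) (s0 + δ)) (i : Fin 4) :
    vel c i s = chartD e (γ s) (velocity γ s) i := by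
  have h1 := hasDerivAt_chart_curve he (h.mdiff s hs) (h.source s hs)
  have h2 : HasDerivAt c (chartD e (γ s) (velocity γ s)) s := by
    refine h1.congr_of_eventuallyEq ?_
    filter_upwards [isOpen_Ioo.mem_nhds hs] with t ht using (h.coord t ht).symm
  exact ((EuclideanSpace.proj (𝕜 := ℝ) i : E4 →L[ℝ] ℝ).hasFDerivAt.comp_hasDerivAt s h2).deriv

theorem CurveChart.mem_target (h : CurveChart g γ I e s0 δ I' O c ℓ S) {s : ℝ}
    (hs : s ∈ Ioo (s0 - δ) (s0 + δ)) : c s ∈ e.target := by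
  rw [← h.coord s hs]
  exact e.map_source (h.source s hs)

theorem CurveChart.sum_lowerVel (h : CurveChart g γ I e s0 δ I' O c ℓ S) (he : e ∈ atlas E4 M)
    {s : ℝ} (hs : s ∈ I' ∩ Ioo (s0 - δ) (s0 + δ)) : ∑ i, lowerVel g e c i s * vel c i s = 1 := by
  rw [← h.curve.unit_speed s hs.1]
  refine Eq.trans ?_ (metric_eq_sum g he (h.source s hs.2) (velocity γ s) (velocity γ s)).symm
  simp only [lowerVel, ← h.vel_eq he hs.2, h.coord s hs.2, Finset.sum_mul]
  exact Finset.sum_congr rfl fun i _ => Finset.sum_congr rfl fun j _ => by ring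

theorem CurveChart.interior_nonempty (h : CurveChart g γ I e s0 δ I' O c ℓ S) :
    (interior (I' ∩ Ioo (s0 - δ) (s0 + δ))).Nonempty := by
  obtain ⟨t, ht, hne⟩ := h.curve.nontrivial.exists_ne s0
  have hδ := h.pos
  rcases lt_or_gt_of_ne hne with hlt | hgt
  · have hsub : Ioo (max t (s0 - δ)) s0 ⊆ I' ∩ Ioo (s0 - δ) (s0 + δ) := fun x hx =>
      ⟨h.curve.interval.out ht h.mem ⟨(le_max_left _ _).trans hx.1.le, hx.2.le⟩,
        (le_max_right _ _).trans_lt hx.1, by linarith [hx.2]⟩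
    have hm : max t (s0 - δ) < s0 := max_lt hlt (by linarith)
    exact (nonempty_Ioo.2 hm).mono (interior_maximal hsub isOpen_Ioo)
  · have hsub : Ioo s0 (min t (s0 + δ)) ⊆ I' ∩ Ioo (s0 - δ) (s0 + δ) := fun x hx =>
      ⟨h.curve.interval.out h.mem ht ⟨hx.1.le, hx.2.le.trans (min_le_left _ _)⟩,
        by linarith [hx.1], hx.2.trans_le (min_le_right _ _)⟩
    have hm : s0 < min t (s0 + δ) := lt_min hgt (by linarith)
    exact (nonempty_Ioo.2 hm).mono (interior_maximal hsub isOpen_Ioo)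

theorem CurveChart.convex (h : CurveChart g γ I e s0 δ I' O c ℓ S) :
    Convex ℝ (I' ∩ Ioo (s0 - δ) (s0 + δ)) :=
  (h.curve.interval.inter ordConnected_Ioo).convex

/-- The components of matter carried by the curve are distributions of order zero carried by the
curve. -/
theorem CurveChart.isCurveFunctional (h : CurveChart g γ I e s0 δ I' O c ℓ S)
    (he : e ∈ atlas E4 M) (hκ : 0 ≤ κ) (hm : IsMatter g F κ L N) (hoff : VanishesOff (γ '' I) L N)
    (i j : Fin 4) :
    IsCurveFunctional (e.target ∩ e.symm ⁻¹' O) (c '' (I' ∩ Ioo (s0 - δ) (s0 + δ)))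
      (fun φ => L (elemTensor e i j φ)) ∧
    IsCurveFunctional (e.target ∩ e.symm ⁻¹' O) (c '' (I' ∩ Ioo (s0 - δ) (s0 + δ)))
      (fun φ => N (elemCov e i φ)) := by
  have hmono : ∀ {φ}, IsTestFun (e.target ∩ e.symm ⁻¹' O) φ → IsTestFun e.target φ := fun hφ =>
    hφ.mono inter_subset_left
  have hsupp : ∀ φ, IsTestFun (e.target ∩ e.symm ⁻¹' O) φ →
      Disjoint (tsupport φ) (c '' (I' ∩ Ioo (s0 - δ) (s0 + δ))) →
      L (elemTensor e i j φ) = 0 ∧ N (elemCov e i φ) = 0 := by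
    intro φ hφ hd
    refine hoff _ (isCompact_symm_image_tsupport (hmono hφ)) ?_ _ _
      (isTestCov2_elemTensor he i j (hmono hφ)).1 (isTestCov_elemCov he i (hmono hφ)).1
      (fun p hp => ?_) fun p hp => ?_
    · rintro _ ⟨y, hy, rfl⟩ hyγ
      obtain ⟨s, hs, hsδ, -, hcs⟩ := h.exists_param (hφ.subset hy).1 (hφ.subset hy).2 hyγ
      exact hd.notMem_of_mem_left hy ⟨s, ⟨hs, hsδ⟩, hcs⟩
    · refine ContinuousLinearMap.ext fun v => ContinuousLinearMap.ext fun w => ?_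
      refine (elemTensor_apply i j p v w).trans ?_
      rw [chartExt_eq_zero hp, zero_mul]
      rfl
    · refine ContinuousLinearMap.ext fun v => ?_
      refine (elemCov_apply i p v).trans ?_
      rw [chartExt_eq_zero hp, zero_mul]
      rfl
  have hbound := fun K hK hKe => hm.exists_bound hκ he (K := K) hK hKe i j
  constructor
  · refine IsLocalMeasure.isCurveFunctional ⟨fun φ ψ hφ hψ => hm.elem_add he i j (hmono hφ)
      (hmono hψ), fun r φ hφ => hm.elem_const_mul he i j r (hmono hφ), fun K hK hKΩ => ?_,
      fun φ hφ hd => (hsupp φ hφ hd).1⟩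
    obtain ⟨B, hB⟩ := hbound K hK (hKΩ.trans inter_subset_left)
    exact ⟨B, fun φ hφ hφK ε hε => (hB φ (hmono hφ) hφK ε hε).1⟩
  · refine IsLocalMeasure.isCurveFunctional ⟨fun φ ψ hφ hψ => hm.vec_elem_add he i (hmono hφ)
      (hmono hψ), fun r φ hφ => hm.vec_elem_const_mul he i r (hmono hφ), fun K hK hKΩ => ?_,
      fun φ hφ hd => (hsupp φ hφ hd).2⟩
    obtain ⟨B, hB⟩ := hbound K hK (hKΩ.trans inter_subset_left)
    exact ⟨B, fun φ hφ hφK ε hε => (hB φ (hmono hφ) hφK ε hε).2⟩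

end CurveMatter

theorem setIntegral_eq_of_eqOn_inter {f h : ℝ → ℝ} {A B : Set ℝ} (hA : MeasurableSet A)
    (hB : MeasurableSet B) (hfh : ∀ s ∈ A ∩ B, f s = h s) (hf : ∀ s ∈ B, s ∉ A → f s = 0)
    (hh : ∀ s ∈ A, s ∉ B → h s = 0) : ∫ s in B, f s = ∫ s in A, h s := by
  rw [setIntegral_eq_of_subset_of_forall_sdiff_eq_zero hB (inter_subset_right (s := A))
      fun s hs => hf s hs.1 fun hn => hs.2 ⟨hn, hs.1⟩,
    setIntegral_eq_of_subset_of_forall_sdiff_eq_zero hA (inter_subset_left (t := B))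
      fun s hs => hh s hs.1 fun hn => hs.2 ⟨hs.1, hn⟩]
  exact setIntegral_congr_fun (hA.inter hB) hfh

section LocalForm

variable {M : Type*} [TopologicalSpace M] [ChartedSpace E4 M] [IsManifold (𝓡 4) ∞ M]
  [T2Space M] [SecondCountableTopology M] {e : OpenPartialHomeomorph M E4} {g : LorentzMetric M}
  {γ : ℝ → M} {I : Set ℝ} {F : CovTensor M} {κ : ℝ} {L : CovTensor M → ℝ} {N : CovField M → ℝ}
  {s0 δ : ℝ} {I' : Set ℝ} {O : Set M} {c : ℝ → E4} {ℓ : Fin 4 → ℝ} {S : ℝ → ℝ}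

/-- The action of `u^a u^b δ_γ`, in coordinates, on a test field supported near `γ s0`. -/
theorem CurveChart.tensorDelta_eq_sum (h : CurveChart g γ I e s0 δ I' O c ℓ S) (he : e ∈ atlas E4 M)
    {δ' : ℝ} (hδ' : δ' < δ) {V : Set E4}
    (hV : ∀ s ∈ Ioo (s0 - δ) (s0 + δ), c s ∈ V → s ∈ Ioo (s0 - δ') (s0 + δ'))
    (hVI : ∀ s ∈ Ioo (s0 - δ) (s0 + δ), c s ∈ V → s ∈ I') {K : Set M} (hK : IsCompact K)
    (hKO : K ⊆ O) (hKV : K ⊆ e ⁻¹' V) {x : CovTensor M} (hx : SmoothCov2 x)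
    (hx0 : ∀ p, p ∉ K → x p = 0) :
    tensorDelta γ I x = ∑ i, ∑ j, ∫ s in Ioo (s0 - δ') (s0 + δ'),
      extComp e (cov2Comp x e i j) (c s) * (vel c i s * vel c j s) := by
  have hKe := hKO.trans h.nhd_sub
  have hφ := fun i j => isTestFun_extComp hK hKe (hx e he i j) fun y _ hyK => by
    rw [cov2Comp, hx0 _ hyK]; rfl
  have hsub : Ioo (s0 - δ') (s0 + δ') ⊆ Ioo (s0 - δ) (s0 + δ) :=
    Ioo_subset_Ioo (by linarith) (by linarith)
  have hint : ∀ i j, Integrable (fun s => extComp e (cov2Comp x e i j) (c s)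
      * (vel c i s * vel c j s)) (volume.restrict (Ioo (s0 - δ') (s0 + δ'))) := by
    intro i j
    have h1 : Continuous fun s => extComp e (cov2Comp x e i j) (c s) * (vel c i s * vel c j s) :=
      ((hφ i j).1.smooth.continuous.comp h.smooth.continuous).mul
        ((contDiff_vel h.smooth i).continuous.mul (contDiff_vel h.smooth j).continuous)
    exact h1.integrableOn_Icc.mono_set Ioo_subset_Icc_self
  rw [h.tensorDelta_eq, tensorDelta]
  simp only [← integral_finsetSum _ fun j _ => hint _ j]
  rw [← integral_finsetSum _ fun i _ => integrable_finsetSum _ fun j _ => hint i j]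
  refine (setIntegral_eq_of_eqOn_inter h.curve.interval.measurableSet measurableSet_Ioo ?_ ?_
    ?_).symm
  · intro s hs
    have hse := h.source s (hsub hs.2)
    conv_rhs => rw [eq_sum_elemTensor he fun p hp => hx0 p fun hn => hp (hKe hn)]
    have key : ∀ (f : Fin 4 → Fin 4 → E4 →L[ℝ] E4 →L[ℝ] ℝ) (v : E4), (∑ i, ∑ j, f i j) v v
        = ∑ i, ∑ j, f i j v v := fun f v => by simp only [_root_.sum_apply]
    simp only [Finset.sum_apply]
    refine Eq.trans ?_ (key _ (velocity γ s)).symm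
    refine Finset.sum_congr rfl fun i _ => Finset.sum_congr rfl fun j _ => ?_
    refine Eq.trans ?_ (elemTensor_apply i j (γ s) _ _).symm
    rw [chartExt_of_mem hse, h.coord s (hsub hs.2), h.vel_eq he (hsub hs.2),
      h.vel_eq he (hsub hs.2)]
  · intro s hs hsI
    refine Finset.sum_eq_zero fun i _ => Finset.sum_eq_zero fun j _ => ?_
    by_contra hn
    obtain ⟨p, hp, hpc⟩ := (hφ i j).2 (subset_tsupport _ (left_ne_zero_of_mul hn))
    exact hsI (hVI s (hsub hs) (by rw [← hpc]; exact hKV hp))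
  · intro s hs hsδ
    rw [hx0 (γ s) fun hn => hsδ ?_]
    · rfl
    · have h1 := h.mem_Ioo s hs (hKO hn)
      exact hV s h1 (by rw [← h.coord s h1]; exact hKV hn)

theorem CurveChart.vecDelta_eq_sum (h : CurveChart g γ I e s0 δ I' O c ℓ S) (he : e ∈ atlas E4 M)
    {δ' : ℝ} (hδ' : δ' < δ) {V : Set E4}
    (hV : ∀ s ∈ Ioo (s0 - δ) (s0 + δ), c s ∈ V → s ∈ Ioo (s0 - δ') (s0 + δ'))
    (hVI : ∀ s ∈ Ioo (s0 - δ) (s0 + δ), c s ∈ V → s ∈ I') {K : Set M} (hK : IsCompact K)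
    (hKO : K ⊆ O) (hKV : K ⊆ e ⁻¹' V) {w : CovField M} (hw : SmoothCov w)
    (hw0 : ∀ p, p ∉ K → w p = 0) :
    vecDelta γ I w = ∑ i, ∫ s in Ioo (s0 - δ') (s0 + δ'),
      extComp e (covComp w e i) (c s) * vel c i s := by
  have hKe := hKO.trans h.nhd_sub
  have hφ := fun i => isTestFun_extComp hK hKe (hw e he i) fun y _ hyK => by
    rw [covComp, hw0 _ hyK]; rfl
  have hsub : Ioo (s0 - δ') (s0 + δ') ⊆ Ioo (s0 - δ) (s0 + δ) :=
    Ioo_subset_Ioo (by linarith) (by linarith)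
  have hint : ∀ i, Integrable (fun s => extComp e (covComp w e i) (c s) * vel c i s)
      (volume.restrict (Ioo (s0 - δ') (s0 + δ'))) := by
    intro i
    have h1 : Continuous fun s => extComp e (covComp w e i) (c s) * vel c i s :=
      ((hφ i).1.smooth.continuous.comp h.smooth.continuous).mul
        (contDiff_vel h.smooth i).continuous
    exact h1.integrableOn_Icc.mono_set Ioo_subset_Icc_self
  rw [h.vecDelta_eq, vecDelta, ← integral_finsetSum _ fun i _ => hint i]
  refine (setIntegral_eq_of_eqOn_inter h.curve.interval.measurableSet measurableSet_Ioo ?_ ?_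
    ?_).symm
  · intro s hs
    have hse := h.source s (hsub hs.2)
    conv_rhs => rw [eq_sum_elemCov he fun p hp => hw0 p fun hn => hp (hKe hn)]
    have key : ∀ (f : Fin 4 → E4 →L[ℝ] ℝ) (v : E4), (∑ i, f i) v = ∑ i, f i v :=
      fun f v => by simp only [_root_.sum_apply]
    simp only [Finset.sum_apply]
    refine Eq.trans ?_ (key _ (velocity γ s)).symm
    refine Finset.sum_congr rfl fun i _ => ?_
    refine Eq.trans ?_ (elemCov_apply i (γ s) _).symm
    rw [chartExt_of_mem hse, h.coord s (hsub hs.2), h.vel_eq he (hsub hs.2)]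
  · intro s hs hsI
    refine Finset.sum_eq_zero fun i _ => ?_
    by_contra hn
    obtain ⟨p, hp, hpc⟩ := (hφ i).2 (subset_tsupport _ (left_ne_zero_of_mul hn))
    exact hsI (hVI s (hsub hs) (by rw [← hpc]; exact hKV hp))
  · intro s hs hsδ
    rw [hw0 (γ s) fun hn => hsδ ?_]
    · rfl
    · have h1 := h.mem_Ioo s hs (hKO hn)
      exact hV s h1 (by rw [← h.coord s h1]; exact hKV hn)

theorem CurveChart.deriv_curveCoord (h : CurveChart g γ I e s0 δ I' O c ℓ S) (i : Fin 4) :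
    deriv (curveCoord γ e i) s0 = vel c i s0 ∧
      deriv (deriv (curveCoord γ e i)) s0 = deriv (vel c i) s0 := by
  have hs0 : s0 ∈ Ioo (s0 - δ) (s0 + δ) := ⟨by linarith [h.pos], by linarith [h.pos]⟩
  have h1 : curveCoord γ e i =ᶠ[𝓝 s0] fun s => c s i := by
    filter_upwards [isOpen_Ioo.mem_nhds hs0] with s hs
    rw [← h.coord s hs]
    rfl
  exact ⟨h1.deriv_eq, h1.deriv.deriv_eq⟩

/-- On test fields supported in `V`, matter is `(m u^a u^b δ_γ, q u^a δ_γ)`. -/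
def IsPointMatter (γ : ℝ → M) (I : Set ℝ) (L : CovTensor M → ℝ) (N : CovField M → ℝ) (V : Set M)
    (m q : ℝ) : Prop :=
  ∀ K, IsCompact K → K ⊆ V → ∀ x w, SmoothCov2 x → SmoothCov w →
    (∀ p, p ∉ K → x p = 0) → (∀ p, p ∉ K → w p = 0) →
    L x = m * tensorDelta γ I x ∧ N w = q * vecDelta γ I w

/-- Near each point of the curve, matter carried by the curve is that of a point particle, which
satisfies the Lorentz force law. -/
theorem exists_isPointMatter (hγ : IsTimelikeCurve g γ I) (hs0 : s0 ∈ I) (hF : SmoothCov2 F)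
    (hFanti : ∀ p v w, F p v w = -F p w v) (hκ : 0 ≤ κ) (hm : IsMatter g F κ L N)
    (hoff : VanishesOff (γ '' I) L N) (he : e ∈ atlas E4 M) (hse : γ s0 ∈ e.source) :
    ∃ V, IsOpen V ∧ γ s0 ∈ V ∧ ∃ m q : ℝ, IsPointMatter γ I L N V m q ∧
      ∀ i, m * (deriv (deriv (curveCoord γ e i)) s0
          + ∑ j, ∑ k, christoffel g e i j k (e (γ s0)) * deriv (curveCoord γ e j) s0
            * deriv (curveCoord γ e k) s0)
        = q * ∑ k, mixedComp g F e i k (e (γ s0)) * deriv (curveCoord γ e k) s0 := by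
  obtain ⟨δ, I', O, c, ℓ, S, h⟩ := exists_curveChart hγ hs0 he hse
  have hs0δ : s0 ∈ Ioo (s0 - δ) (s0 + δ) := ⟨by linarith [h.pos], by linarith [h.pos]⟩
  have hy0 : e (γ s0) = c s0 := h.coord s0 hs0δ
  set Ω := e.target ∩ e.symm ⁻¹' O with hΩ
  have hΩo : IsOpen Ω := e.isOpen_inter_preimage_symm h.isOpen
  have hcΩ : c s0 ∈ Ω := by
    refine ⟨h.mem_target hs0δ, ?_⟩
    rw [mem_preimage, ← hy0, e.left_inv hse]
    exact h.mem_nhd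
  set A := I' ∩ Ioo (s0 - δ) (s0 + δ) with hA
  have hτ : ContDiff ℝ ∞ fun y => S (affine ℓ (c s0) y) :=
    h.smooth_param.comp (contDiff_affine ℓ (c s0))
  have hmono : ∀ {φ}, IsTestFun Ω φ → IsTestFun e.target φ := fun hφ => hφ.mono inter_subset_left
  obtain ⟨δ', hδ'0, V, hVo, hcV, m, q, hform, hδ', hV, hlor, hend⟩ := curve_structure
    (L := fun i j φ => L (elemTensor e i j φ)) (N := fun i φ => N (elemCov e i φ))
    (w := lowerVel g e c) hΩo h.smooth hτ h.pos hcΩ (fun s hs => h.param s hs)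
    (inter_subset_right (s := I'))
    (fun i j k => (contDiffOn_christoffel g he i j k).mono inter_subset_left)
    (fun i k => (contDiffOn_mixedComp g hF he i k).mono inter_subset_left)
    (fun i => (contDiffOn_lowerVel he h.smooth i).mono fun s hs => hs.1)
    (fun s hs _ => h.sum_lowerVel he hs)
    (fun s hs hsΩ => sum_deriv_lowerVel he h.smooth hsΩ.1 (uniqueDiffOn_convex h.convex h.interior_nonempty s hs) hs
      fun t ht => h.sum_lowerVel he ht)
    (fun s _ hsΩ => sum_mixedComp_mul_lowerVel hFanti he hsΩ.1)
    (fun i j => (h.isCurveFunctional he hκ hm hoff i j).1)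
    (fun i => (h.isCurveFunctional he hκ hm hoff i i).2)
    (fun i j φ hφ => hm.elemTensor_symm he i j (hmono hφ))
    (fun φ hφ i => hm.force e he φ (hmono hφ) i) (fun φ hφ => hm.charge e he φ (hmono hφ))
  -- either `s0` is an interior parameter, or mass and charge vanish
  obtain ⟨W, hWo, hcW, hW⟩ : ∃ W, IsOpen W ∧ c s0 ∈ W ∧ ((m = 0 ∧ q = 0) ∨
      ∀ s ∈ Ioo (s0 - δ) (s0 + δ), c s ∈ W → s ∈ I') := by
    by_cases ha : ∃ a ∈ I', a < s0
    · by_cases hb : ∃ b ∈ I', s0 < b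
      · obtain ⟨a, ha, has⟩ := ha
        obtain ⟨b, hb, hbs⟩ := hb
        refine ⟨(fun y => S (affine ℓ (c s0) y)) ⁻¹' Ioo a b, isOpen_Ioo.preimage hτ.continuous,
          ?_, Or.inr fun s hs hsW => ?_⟩
        · rw [mem_preimage, h.param s0 hs0δ]
          exact ⟨has, hbs⟩
        · rw [mem_preimage, h.param s hs] at hsW
          exact h.curve.interval.out ha hb ⟨hsW.1.le, hsW.2.le⟩
      · push Not at hb
        exact ⟨univ, isOpen_univ, mem_univ _, Or.inl (hend (Or.inl fun s hs => hb s hs.1))⟩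
    · push Not at ha
      exact ⟨univ, isOpen_univ, mem_univ _, Or.inl (hend (Or.inr fun s hs => ha s hs.1))⟩
  have hopen : IsOpen (e.source ∩ e ⁻¹' (V ∩ W)) := e.isOpen_inter_preimage (hVo.inter hWo)
  refine ⟨O ∩ (e.source ∩ e ⁻¹' (V ∩ W)), h.isOpen.inter hopen,
    ⟨h.mem_nhd, hse, by rw [mem_preimage, hy0]; exact ⟨hcV, hcW⟩⟩, m, q, ?_, fun i => ?_⟩
  · intro K hK hKV x w hx hw hx0 hw0
    have hKe : K ⊆ e.source := fun p hp => (hKV hp).2.1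
    have himg : e '' K ⊆ Ω ∩ V := by
      rintro _ ⟨p, hp, rfl⟩
      refine ⟨⟨e.map_source (hKe hp), ?_⟩, (hKV hp).2.2.1⟩
      rw [mem_preimage, e.left_inv (hKe hp)]
      exact (hKV hp).1
    have hφ := fun i j => isTestFun_extComp hK hKe (hx e he i j) fun y _ hyK => by
      rw [cov2Comp, hx0 _ hyK]; rfl
    have hψ := fun i => isTestFun_extComp hK hKe (hw e he i) fun y _ hyK => by
      rw [covComp, hw0 _ hyK]; rfl
    have hLx : L x = m * ∑ i, ∑ j, ∫ s in Ioo (s0 - δ') (s0 + δ'),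
        extComp e (cov2Comp x e i j) (c s) * (vel c i s * vel c j s) := by
      conv_lhs => rw [eq_sum_elemTensor he fun p hp => hx0 p fun hn => hp (hKe hn)]
      rw [hm.sum _ fun i _ => IsTestCov2.sum _ fun j _ => isTestCov2_elemTensor he i j (hφ i j).1,
        Finset.mul_sum]
      refine Finset.sum_congr rfl fun i _ => ?_
      rw [hm.sum _ fun j _ => isTestCov2_elemTensor he i j (hφ i j).1, Finset.mul_sum]
      refine Finset.sum_congr rfl fun j _ => ?_
      have hsub := (hφ i j).2.trans himg
      exact (hform _ ⟨(hφ i j).1.smooth, (hφ i j).1.compact, fun y hy => (hsub hy).1⟩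
        fun y hy => (hsub hy).2).1 i j
    have hNw : N w = q * ∑ i, ∫ s in Ioo (s0 - δ') (s0 + δ'),
        extComp e (covComp w e i) (c s) * vel c i s := by
      conv_lhs => rw [eq_sum_elemCov he fun p hp => hw0 p fun hn => hp (hKe hn)]
      rw [hm.vec_sum _ fun i _ => isTestCov_elemCov he i (hψ i).1, Finset.mul_sum]
      refine Finset.sum_congr rfl fun i _ => ?_
      have hsub := (hψ i).2.trans himg
      exact (hform _ ⟨(hψ i).1.smooth, (hψ i).1.compact, fun y hy => (hsub hy).1⟩
        fun y hy => (hsub hy).2).2 i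
    rcases hW with ⟨rfl, rfl⟩ | hW
    · rw [hLx, hNw]
      simp only [zero_mul, and_self]
    · have h1 : ∀ s ∈ Ioo (s0 - δ) (s0 + δ), c s ∈ V ∩ W → s ∈ Ioo (s0 - δ') (s0 + δ') :=
        fun s hs hc => hV s hs hc.1
      have h2 : ∀ s ∈ Ioo (s0 - δ) (s0 + δ), c s ∈ V ∩ W → s ∈ I' := fun s hs hc => hW s hs hc.2
      have hKO : K ⊆ O := fun p hp => (hKV hp).1
      have hKV' : K ⊆ e ⁻¹' (V ∩ W) := fun p hp => (hKV hp).2.2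
      rw [hLx, hNw, h.tensorDelta_eq_sum he hδ' h1 h2 hK hKO hKV' hx hx0,
        h.vecDelta_eq_sum he hδ' h1 h2 hK hKO hKV' hw hw0]
      exact ⟨rfl, rfl⟩
  · have h1 : ∑ j, ∑ k, christoffel g e i j k (c s0) * vel c j s0 * vel c k s0
        = ∑ k, ∑ j, christoffel g e i j k (c s0) * (vel c k s0 * vel c j s0) := by
      rw [Finset.sum_comm]
      exact Finset.sum_congr rfl fun k _ => Finset.sum_congr rfl fun j _ => by ring
    rw [hy0, (h.deriv_curveCoord i).2]
    simp only [(h.deriv_curveCoord _).1]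
    rw [h1]
    exact hlor i

end LocalForm

/-! ### Test fields that detect the curve near one of its points -/

section Detection

variable {M : Type*} [TopologicalSpace M] [ChartedSpace E4 M] [IsManifold (𝓡 4) ∞ M]
  [T2Space M] [SecondCountableTopology M] {e : OpenPartialHomeomorph M E4} {g : LorentzMetric M}
  {γ : ℝ → M} {I : Set ℝ} {F : CovTensor M} {κ : ℝ} {L : CovTensor M → ℝ} {N : CovField M → ℝ}
  {s0 δ : ℝ} {I' : Set ℝ} {O : Set M} {c : ℝ → E4} {ℓ : Fin 4 → ℝ} {S : ℝ → ℝ}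

theorem setIntegral_pos_of_convex {A : Set ℝ} (hA : Convex ℝ A) (hAi : (interior A).Nonempty)
    (hAb : Bornology.IsBounded A) {f : ℝ → ℝ} (hf : Continuous f) (h0 : ∀ s ∈ A, 0 ≤ f s)
    {s0 : ℝ} (hs0 : s0 ∈ A) (hpos : 0 < f s0) : 0 < ∫ s in A, f s := by
  have hAm : MeasurableSet A := hA.ordConnected.measurableSet
  have hint : IntegrableOn f A :=
    (hf.continuousOn.integrableOn_compact hAb.isCompact_closure).mono_set subset_closure
  rw [setIntegral_pos_iff_support_of_nonneg_ae
    ((ae_restrict_iff' hAm).2 (Eventually.of_forall h0)) hint]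
  have hcl : s0 ∈ closure (interior A) := by
    rw [hA.closure_interior_eq_closure_of_nonempty_interior hAi]
    exact subset_closure hs0
  have hU : IsOpen {s | 0 < f s} := isOpen_lt continuous_const hf
  obtain ⟨t, ht⟩ := mem_closure_iff_nhds.1 hcl _ (hU.mem_nhds hpos)
  refine lt_of_lt_of_le ((hU.inter isOpen_interior).measure_pos volume ⟨t, ht⟩) (measure_mono ?_)
  exact fun s hs => ⟨(ne_of_gt hs.1 : f s ≠ 0), interior_subset hs.2⟩

/-- Near each point of the curve there are a covector field `w = ψ ℓ` and a tensor field
`x = ψ ℓ ⊗ ℓ`, with `ℓ` close to the velocity of the curve, on which the distributions carried by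
the curve take positive and almost equal values. -/
theorem exists_detecting_fields (hγ : IsTimelikeCurve g γ I) (hs0 : s0 ∈ I) (he : e ∈ atlas E4 M)
    (hse : γ s0 ∈ e.source) {V : Set M} (hV : IsOpen V) (hsV : γ s0 ∈ V) {ε : ℝ} (hε : 0 < ε)
    (hε1 : ε < 1) :
    ∃ (ℓ : Fin 4 → ℝ) (ψ : E4 → ℝ), IsTestFun e.target ψ ∧ (∀ y, 0 ≤ ψ y) ∧
      e.symm '' tsupport ψ ⊆ V ∧
      (∀ y ∈ e.target, ψ y ≠ 0 → (1 - ε) ^ 2 < bilin (invMetric g e y) ℓ ℓ) ∧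
      0 < tensorDelta γ I (covSq e ℓ ψ) ∧
      0 < vecDelta γ I (elemCovSum e fun i y => ℓ i * ψ y) ∧
      tensorDelta γ I (covSq e ℓ ψ)
        ≤ (1 + ε) * vecDelta γ I (elemCovSum e fun i y => ℓ i * ψ y) := by
  obtain ⟨δ, I', O, c, ℓ₀, S, h⟩ := exists_curveChart hγ hs0 he hse
  have hs0δ : s0 ∈ Ioo (s0 - δ) (s0 + δ) := ⟨by linarith [h.pos], by linarith [h.pos]⟩
  have hy0 : e (γ s0) = c s0 := h.coord s0 hs0δ
  set u : E4 := velocity γ s0 with hu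
  set ℓ : Fin 4 → ℝ := fun i => g.val (γ s0) u (chartDinv e (γ s0) (stdVec i)) with hℓ
  have hℓt : bilin (invMetric g e (c s0)) ℓ ℓ = 1 := by
    rw [← hy0]
    exact (bilin_lower g he hse u).trans (hγ.unit_speed s0 hs0)
  set k : ℝ → ℝ := fun s => ∑ i, ℓ i * vel c i s with hk
  have hkc : Continuous k := continuous_finsetSum _ fun i _ =>
    continuous_const.mul (contDiff_vel h.smooth i).continuous
  have hk0 : k s0 = 1 := by
    simp only [hk, h.vel_eq he hs0δ]
    exact (sum_apply_chartDinv_mul he hse (g.val (γ s0) u) u).trans (hγ.unit_speed s0 hs0)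
  -- where to put the support of the cut-off function
  have hτ : Continuous fun y => S (affine ℓ₀ (c s0) y) :=
    h.smooth_param.continuous.comp (contDiff_affine ℓ₀ (c s0)).continuous
  have hbil : ContinuousOn (fun y => bilin (invMetric g e y) ℓ ℓ) e.target := by
    unfold bilin
    exact continuousOn_finsetSum _ fun i _ => continuousOn_finsetSum _ fun j _ =>
      (contDiffOn_invMetric g he i j).continuousOn.mul continuousOn_const
  have hD : IsOpen ((e.target ∩ e.symm ⁻¹' (V ∩ O)) ∩
      ((e.target ∩ (fun y => bilin (invMetric g e y) ℓ ℓ) ⁻¹' Ioi ((1 - ε) ^ 2)) ∩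
      (fun y => k (S (affine ℓ₀ (c s0) y))) ⁻¹' Ioo 0 (1 + ε))) :=
    (e.isOpen_inter_preimage_symm (hV.inter h.isOpen)).inter
      ((hbil.isOpen_inter_preimage e.open_target isOpen_Ioi).inter
        (isOpen_Ioo.preimage (hkc.comp hτ)))
  obtain ⟨ψ, hψ, hψ0, -, W, -, hKW, hW1⟩ := exists_testFun_eq_one (K := {c s0})
    isCompact_singleton hD (by
      rw [singleton_subset_iff]
      refine ⟨⟨h.mem_target hs0δ, ?_⟩, ⟨h.mem_target hs0δ, ?_⟩, ?_⟩
      · rw [mem_preimage, ← hy0, e.left_inv hse]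
        exact ⟨hsV, h.mem_nhd⟩
      · rw [mem_preimage, hℓt, mem_Ioi]
        nlinarith
      · rw [mem_preimage, h.param s0 hs0δ, hk0]
        exact ⟨one_pos, by linarith⟩)
  have hψt : IsTestFun e.target ψ := hψ.mono fun y hy => hy.1.1
  set A := I' ∩ Ioo (s0 - δ) (s0 + δ) with hA
  have hAm : MeasurableSet A := h.convex.ordConnected.measurableSet
  have hAb : Bornology.IsBounded A := (Metric.isBounded_Ioo _ _).subset inter_subset_right
  have hs0A : s0 ∈ A := ⟨h.mem, hs0δ⟩
  have hψc : Continuous fun s => ψ (c s) := hψ.smooth.continuous.comp h.smooth.continuous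
  have hψ1 : ψ (c s0) = 1 := hW1 _ (hKW rfl)
  have hkψ : ∀ s ∈ A, ψ (c s) ≠ 0 → 0 < k s ∧ k s < 1 + ε := by
    intro s hs hn
    have h1 := (hψ.subset (subset_tsupport _ hn)).2.2
    rw [mem_preimage, h.param s hs.2] at h1
    exact h1
  have hcov : ∀ s ∈ A, chartCov e (γ s) ℓ (velocity γ s) = k s := by
    intro s hs
    refine (chartCov_apply _ _ _).trans ?_
    simp only [hk, h.vel_eq he hs.2]
  have hoffA : ∀ s ∈ I', s ∉ A → chartExt e ψ (γ s) = 0 := by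
    intro s hs hsA
    refine chartExt_eq_zero fun hn => hsA ⟨hs, h.mem_Ioo s hs ?_⟩
    obtain ⟨y, hy, hys⟩ := hn
    rw [← hys]
    exact (hψ.subset hy).1.2.2
  have hext : ∀ s ∈ A, chartExt e ψ (γ s) = ψ (c s) := fun s hs => by
    rw [chartExt_of_mem (h.source s hs.2), h.coord s hs.2]
  have hI'm : MeasurableSet I' := h.curve.interval.measurableSet
  have hten : tensorDelta γ I (covSq e ℓ ψ) = ∫ s in A, ψ (c s) * (k s * k s) := by
    rw [h.tensorDelta_eq, tensorDelta]
    refine (setIntegral_eq_of_eqOn_inter hI'm hAm (fun s hs => ?_) (fun s hs hn =>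
      absurd hs.1 hn) fun s hs hsA => ?_).symm
    · refine Eq.trans ?_ (covSq_apply ℓ ψ (γ s) _ _).symm
      rw [hext s hs.2, ← hcov s hs.2]
    · refine (covSq_apply ℓ ψ (γ s) _ _).trans ?_
      rw [hoffA s hs hsA, zero_mul]
  have hvec : vecDelta γ I (elemCovSum e fun i y => ℓ i * ψ y) = ∫ s in A, ψ (c s) * k s := by
    rw [h.vecDelta_eq, vecDelta]
    refine (setIntegral_eq_of_eqOn_inter hI'm hAm (fun s hs => ?_) (fun s hs hn =>
      absurd hs.1 hn) fun s hs hsA => ?_).symm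
    · rw [elemCovSum_apply_of_mem (h.source s hs.2.2), h.coord s hs.2.2, hk, Finset.mul_sum]
      refine Finset.sum_congr rfl fun i _ => ?_
      refine Eq.trans ?_ (congrArg (ℓ i * ψ (c s) * ·) (h.vel_eq he hs.2.2 i))
      ring
    · by_cases hss : γ s ∈ e.source
      · have h1 := hoffA s hs hsA
        rw [chartExt_of_mem hss] at h1
        rw [elemCovSum_apply_of_mem hss]
        simp only [h1, mul_zero, zero_mul, Finset.sum_const_zero]
      · rw [elemCovSum_of_notMem hss]
        rfl
  have hc2 : Continuous fun s => ψ (c s) * (k s * k s) := hψc.mul (hkc.mul hkc)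
  have hc1 : Continuous fun s => ψ (c s) * k s := hψc.mul hkc
  have hnn : ∀ s ∈ A, 0 ≤ ψ (c s) * k s := by
    intro s hs
    by_cases hn : ψ (c s) = 0
    · rw [hn, zero_mul]
    · exact mul_nonneg (hψ0 _) (hkψ s hs hn).1.le
  have hint : ∀ {f : ℝ → ℝ}, Continuous f → IntegrableOn f A := fun hf =>
    (hf.continuousOn.integrableOn_compact hAb.isCompact_closure).mono_set subset_closure
  refine ⟨ℓ, ψ, hψt, hψ0, ?_, fun y _ hy => (hψ.subset (subset_tsupport _ hy)).2.1.2, ?_, ?_, ?_⟩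
  · rintro _ ⟨y, hy, rfl⟩
    exact (hψ.subset hy).1.2.1
  · rw [hten]
    refine setIntegral_pos_of_convex h.convex h.interior_nonempty hAb hc2
      (fun s _ => mul_nonneg (hψ0 _) (mul_self_nonneg _)) hs0A ?_
    rw [hψ1, hk0]
    norm_num
  · rw [hvec]
    refine setIntegral_pos_of_convex h.convex h.interior_nonempty hAb hc1 hnn hs0A ?_
    rw [hψ1, hk0]
    norm_num
  · rw [hten, hvec, ← integral_const_mul]
    refine setIntegral_mono_on (hint hc2) ((hint hc1).const_mul _) hAm fun s hs => ?_
    by_cases hn : ψ (c s) = 0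
    · rw [hn]
      simp
    · rw [← mul_assoc, mul_comm (1 + ε)]
      exact mul_le_mul_of_nonneg_left (hkψ s hs hn).2.le (hnn s hs)

theorem isTestCov_detecting (he : e ∈ atlas E4 M) {ψ : E4 → ℝ} (hψ : IsTestFun e.target ψ)
    (ℓ : Fin 4 → ℝ) : IsTestCov (elemCovSum e fun i y => ℓ i * ψ y) :=
  isTestCov_elemCovSum he fun i => hψ.const_mul (ℓ i)

theorem elemCovSum_const_mul_of_chartExt_eq_zero {p : M} {ψ : E4 → ℝ} (h : chartExt e ψ p = 0)
    (ℓ : Fin 4 → ℝ) : elemCovSum e (fun i y => ℓ i * ψ y) p = 0 := by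
  by_cases hp : p ∈ e.source
  · rw [chartExt_of_mem hp] at h
    refine ContinuousLinearMap.ext fun v => ?_
    refine (elemCovSum_apply_of_mem hp _ v).trans ?_
    simp only [h, mul_zero, zero_mul, Finset.sum_const_zero]
    rfl
  · exact elemCovSum_of_notMem hp _

theorem IsPointMatter.unique (hγ : IsTimelikeCurve g γ I) (hs0 : s0 ∈ I) {V V' : Set M}
    (hV : IsOpen V) (hV' : IsOpen V') (hsV : γ s0 ∈ V) (hsV' : γ s0 ∈ V') {m q m' q' : ℝ}
    (h : IsPointMatter γ I L N V m q) (h' : IsPointMatter γ I L N V' m' q') :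
    m = m' ∧ q = q' := by
  have he := chart_mem_atlas E4 (γ s0)
  obtain ⟨ℓ, ψ, hψ, -, hψV, -, ht, hv, -⟩ := exists_detecting_fields hγ hs0 he
    (mem_chart_source E4 (γ s0)) (hV.inter hV') ⟨hsV, hsV'⟩ (ε := 1 / 2) (by norm_num) (by norm_num)
  have hK := isCompact_symm_image_tsupport hψ
  have hx := (isTestCov2_covSq he ℓ hψ).1
  have hw := (isTestCov_detecting he hψ ℓ).1
  have hx0 : ∀ p, p ∉ (chartAt E4 (γ s0)).symm '' tsupport ψ →
      covSq (chartAt E4 (γ s0)) ℓ ψ p = 0 := fun p hp =>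
    covSq_of_chartExt_eq_zero ℓ (chartExt_eq_zero hp)
  have hw0 : ∀ p, p ∉ (chartAt E4 (γ s0)).symm '' tsupport ψ →
      elemCovSum (chartAt E4 (γ s0)) (fun i y => ℓ i * ψ y) p = 0 := fun p hp =>
    elemCovSum_const_mul_of_chartExt_eq_zero (chartExt_eq_zero hp) ℓ
  obtain ⟨h1, h2⟩ := h _ hK (hψV.trans inter_subset_left) _ _ hx hw hx0 hw0
  obtain ⟨h3, h4⟩ := h' _ hK (hψV.trans inter_subset_right) _ _ hx hw hx0 hw0
  exact ⟨mul_right_cancel₀ ht.ne' (h1.symm.trans h3), mul_right_cancel₀ hv.ne' (h2.symm.trans h4)⟩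

/-! ### Mass and charge are constant along the curve -/

theorem continuousOn_cov2_velocity (hγ : IsTimelikeCurve g γ I) {x : CovTensor M}
    (hx : SmoothCov2 x) : ContinuousOn (fun s => x (γ s) (velocity γ s) (velocity γ s)) I := by
  intro s0 hs0
  have he := chart_mem_atlas E4 (γ s0)
  have hse := mem_chart_source E4 (γ s0)
  set e := chartAt E4 (γ s0)
  obtain ⟨δ, I', O, c, ℓ, S, h⟩ := exists_curveChart hγ hs0 he hse
  have hs0δ : s0 ∈ Ioo (s0 - δ) (s0 + δ) := ⟨by linarith [h.pos], by linarith [h.pos]⟩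
  refine ContinuousAt.continuousWithinAt (ContinuousAt.congr (f := fun s => ∑ i, ∑ j,
    cov2Comp x e i j (c s) * (vel c i s * vel c j s)) ?_ ?_)
  · refine tendsto_finsetSum _ fun i _ => tendsto_finsetSum _ fun j _ => ContinuousAt.mul ?_
      ((contDiff_vel h.smooth i).continuous.mul (contDiff_vel h.smooth j).continuous).continuousAt
    exact ContinuousAt.comp (f := c) ((hx e he i j).continuousOn.continuousAt
      (e.open_target.mem_nhds (h.mem_target hs0δ))) h.smooth.continuous.continuousAt
  · filter_upwards [isOpen_Ioo.mem_nhds hs0δ] with s hs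
    refine Eq.trans ?_ (cov2_apply_eq_sum he (h.source s hs) x _ _).symm
    simp only [h.vel_eq he hs, h.coord s hs]

theorem continuousOn_cov_velocity (hγ : IsTimelikeCurve g γ I) {w : CovField M}
    (hw : SmoothCov w) : ContinuousOn (fun s => w (γ s) (velocity γ s)) I := by
  intro s0 hs0
  have he := chart_mem_atlas E4 (γ s0)
  have hse := mem_chart_source E4 (γ s0)
  set e := chartAt E4 (γ s0)
  obtain ⟨δ, I', O, c, ℓ, S, h⟩ := exists_curveChart hγ hs0 he hse
  have hs0δ : s0 ∈ Ioo (s0 - δ) (s0 + δ) := ⟨by linarith [h.pos], by linarith [h.pos]⟩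
  refine ContinuousAt.continuousWithinAt (ContinuousAt.congr (f := fun s => ∑ i,
    covComp w e i (c s) * vel c i s) ?_ ?_)
  · refine tendsto_finsetSum _ fun i _ => ContinuousAt.mul ?_
      (contDiff_vel h.smooth i).continuous.continuousAt
    exact ContinuousAt.comp (f := c) ((hw e he i).continuousOn.continuousAt
      (e.open_target.mem_nhds (h.mem_target hs0δ))) h.smooth.continuous.continuousAt
  · filter_upwards [isOpen_Ioo.mem_nhds hs0δ] with s hs
    refine Eq.trans ?_ (pairing_eq_sum_dcoord he (h.source s hs) (velocity γ s) w).symm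
    refine Finset.sum_congr rfl fun i _ => ?_
    rw [h.coord s hs]
    exact congrArg (covComp w e i (c s) * ·) (h.vel_eq he hs i)

theorem IsTimelikeCurve.integrableOn (hγ : IsTimelikeCurve g γ I) {f : ℝ → ℝ}
    (hf : ContinuousOn f I) {K : Set M} (hK : IsCompact K) (h0 : ∀ s, γ s ∉ K → f s = 0) :
    IntegrableOn f I := by
  refine IntegrableOn.of_forall_sdiff_eq_zero
    ((hf.mono inter_subset_left).integrableOn_compact (hγ.proper K hK))
    hγ.interval.measurableSet fun s hs => h0 s fun hn => hs.2 ⟨hs.1, hn⟩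

theorem tensorDelta_add (hγ : IsTimelikeCurve g γ I) {x y : CovTensor M} (hx : IsTestCov2 x)
    (hy : IsTestCov2 y) : tensorDelta γ I (x + y) = tensorDelta γ I x + tensorDelta γ I y := by
  have hint : ∀ {x : CovTensor M}, IsTestCov2 x →
      IntegrableOn (fun s => x (γ s) (velocity γ s) (velocity γ s)) I := by
    rintro x ⟨hxs, K, hK, hx0⟩
    exact hγ.integrableOn (continuousOn_cov2_velocity hγ hxs) hK fun s hs => by rw [hx0 _ hs]; rfl
  exact integral_add (hint hx) (hint hy)

theorem vecDelta_add (hγ : IsTimelikeCurve g γ I) {w z : CovField M} (hw : IsTestCov w)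
    (hz : IsTestCov z) : vecDelta γ I (w + z) = vecDelta γ I w + vecDelta γ I z := by
  have hint : ∀ {w : CovField M}, IsTestCov w →
      IntegrableOn (fun s => w (γ s) (velocity γ s)) I := by
    rintro w ⟨hws, K, hK, hw0⟩
    exact hγ.integrableOn (continuousOn_cov_velocity hγ hws) hK fun s hs => by rw [hw0 _ hs]; rfl
  exact integral_add (hint hw) (hint hz)

end Detection

section Global

variable {M : Type*} [TopologicalSpace M] [ChartedSpace E4 M] [IsManifold (𝓡 4) ∞ M]
  [T2Space M] [SecondCountableTopology M] {e : OpenPartialHomeomorph M E4} {g : LorentzMetric M}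
  {γ : ℝ → M} {I : Set ℝ} {F : CovTensor M} {κ : ℝ} {L : CovTensor M → ℝ} {N : CovField M → ℝ}

/-- The contraction of a covector field `ψ ℓ` with a current is controlled by that of `ψ ℓ ⊗ ℓ` with
the energy-momentum tensor. -/
theorem EnergyAt.abs_pairing_le (he : e ∈ atlas E4 M) {ℓ : Fin 4 → ℝ} {ψ : E4 → ℝ}
    (hψ0 : ∀ y, 0 ≤ ψ y) {r : ℝ}
    (hℓ : ∀ y ∈ e.target, ψ y ≠ 0 → r ^ 2 < bilin (invMetric g e y) ℓ ℓ) {p : M}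
    {T : (TangentSpace (𝓡 4) p →L[ℝ] ℝ) →L[ℝ] (TangentSpace (𝓡 4) p →L[ℝ] ℝ) →L[ℝ] ℝ}
    {J : TangentSpace (𝓡 4) p} (h : EnergyAt g κ p T J) :
    r * |elemCovSum e (fun i y => ℓ i * ψ y) p J| ≤ κ * contract T (covSq e ℓ ψ p) := by
  by_cases hp : chartExt e ψ p = 0
  · rw [elemCovSum_const_mul_of_chartExt_eq_zero hp, covSq_of_chartExt_eq_zero ℓ hp,
      contract_zero_right]
    refine le_of_eq ?_
    rw [mul_zero]
    refine mul_eq_zero_of_right r (abs_eq_zero.2 ?_)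
    rfl
  have hps : p ∈ e.source := by_contra fun hn => hp (chartExt_of_notMem hn)
  rw [chartExt_of_mem hps] at hp
  have ht := hℓ _ (e.map_source hps) hp
  have hE := h.energyMatrix g he hps
  have h1 := hE.sqrt_mul_abs_le ((sq_nonneg r).trans_lt ht)
  have h2 : r ≤ Real.sqrt (bilin (invMetric g e (e p)) ℓ ℓ) := Real.le_sqrt_of_sq_le ht.le
  rw [contract_covSq he hps, elemCovSum_apply_of_mem hps]
  have h3 : ∑ i, ℓ i * ψ (e p) * dcoord e p i J = ψ (e p) * ∑ i, ℓ i * dcoord e p i J := by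
    rw [Finset.mul_sum]
    exact Finset.sum_congr rfl fun i _ => by ring
  rw [h3, abs_mul, abs_of_nonneg (hψ0 _), mul_left_comm, mul_left_comm κ]
  refine mul_le_mul_of_nonneg_left ?_ (hψ0 _)
  exact (mul_le_mul_of_nonneg_right h2 (abs_nonneg _)).trans h1

/-- Matter carried by the curve is that of a charged particle: its mass is nonnegative, its charge
is bounded by its mass, and it satisfies the Lorentz force law. -/
theorem IsMatter.exists_mass_charge (hγ : IsTimelikeCurve g γ I) (hF : SmoothCov2 F)
    (hFanti : ∀ p v w, F p v w = -F p w v) (hκ : 0 ≤ κ) (hm : IsMatter g F κ L N)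
    (hoff : VanishesOff (γ '' I) L N) :
    ∃ m q : ℝ, 0 ≤ m ∧ |q| ≤ κ * m ∧ (∀ x, IsTestCov2 x → L x = m * tensorDelta γ I x) ∧
      (∀ w, IsTestCov w → N w = q * vecDelta γ I w) ∧
      ∀ e ∈ atlas E4 M, ∀ s ∈ I, γ s ∈ e.source → ∀ i,
        m * (deriv (deriv (curveCoord γ e i)) s
          + ∑ j, ∑ k, christoffel g e i j k (e (γ s)) * deriv (curveCoord γ e j) s
            * deriv (curveCoord γ e k) s)
        = q * ∑ k, mixedComp g F e i k (e (γ s)) * deriv (curveCoord γ e k) s := by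
  have hloc : ∀ s : I, ∃ V, IsOpen V ∧ γ s ∈ V ∧ ∃ m q : ℝ, IsPointMatter γ I L N V m q := by
    intro s
    obtain ⟨V, hV, hsV, m, q, h, -⟩ := exists_isPointMatter hγ s.2 hF hFanti hκ hm hoff
      (chart_mem_atlas E4 (γ s)) (mem_chart_source E4 (γ s))
    exact ⟨V, hV, hsV, m, q, h⟩
  choose V hV hsV m q hmq using hloc
  obtain ⟨s0, hs0⟩ := hγ.nontrivial.nonempty
  have hconn : PreconnectedSpace I :=
    isPreconnected_iff_preconnectedSpace.1 hγ.interval.isPreconnected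
  have hγc : Continuous fun s : I => γ s := continuousOn_iff_continuous_domRestrict.1 hγ.continuousOn
  have hconst : IsLocallyConstant fun s : I => (m s, q s) := by
    rw [IsLocallyConstant.iff_eventually_eq]
    intro s
    filter_upwards [hγc.continuousAt.preimage_mem_nhds ((hV s).mem_nhds (hsV s))] with t ht
    obtain ⟨h1, h2⟩ := (hmq t).unique hγ t.2 (hV t) (hV s) (hsV t) ht (hmq s)
    exact Prod.ext h1 h2
  have hall : ∀ s : I, IsPointMatter γ I L N (V s) (m ⟨s0, hs0⟩) (q ⟨s0, hs0⟩) := by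
    intro s
    have h1 := hconst.apply_eq_of_preconnectedSpace s ⟨s0, hs0⟩
    rw [Prod.mk.injEq] at h1
    rw [← h1.1, ← h1.2]
    exact hmq s
  set m0 := m ⟨s0, hs0⟩ with hm0
  set q0 := q ⟨s0, hs0⟩ with hq0
  have hO : IsOpen (γ '' I)ᶜ := by
    have := hγ.isClosed_image isClosed_univ
    rw [inter_univ] at this
    exact this.isOpen_compl
  have hV' : ∀ p : M, ∃ U, IsOpen U ∧ p ∈ U ∧ IsPointMatter γ I L N U m0 q0 := by
    intro p
    by_cases hp : p ∈ γ '' I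
    · obtain ⟨s, hs, rfl⟩ := hp
      exact ⟨V ⟨s, hs⟩, hV _, hsV ⟨s, hs⟩, hall ⟨s, hs⟩⟩
    · refine ⟨_, hO, hp, fun K hK hKO x w hx hw hx0 hw0 => ?_⟩
      obtain ⟨h1, h2⟩ := hoff K hK hKO x w hx hw hx0 hw0
      have h3 : tensorDelta γ I x = 0 := by
        refine setIntegral_eq_zero_of_forall_eq_zero fun s hs => ?_
        rw [hx0 _ fun hn => hKO hn ⟨s, hs, rfl⟩]
        rfl
      have h4 : vecDelta γ I w = 0 := by
        refine setIntegral_eq_zero_of_forall_eq_zero fun s hs => ?_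
        rw [hw0 _ fun hn => hKO hn ⟨s, hs, rfl⟩]
        rfl
      rw [h1, h2, h3, h4, mul_zero, mul_zero]
      exact ⟨rfl, rfl⟩
  have hzero2 : tensorDelta γ I (0 : CovTensor M) = 0 :=
    setIntegral_eq_zero_of_forall_eq_zero fun s _ => rfl
  have hzero1 : vecDelta γ I (0 : CovField M) = 0 :=
    setIntegral_eq_zero_of_forall_eq_zero fun s _ => rfl
  have hL : ∀ x, IsTestCov2 x → L x = m0 * tensorDelta γ I x := by
    refine IsTestCov2.local_induction (by rw [hm.zero, hzero2, mul_zero]) ?_ fun p => ?_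
    · intro x y hx hy h1 h2
      rw [hm.add x y hx hy, h1, h2, tensorDelta_add hγ hx hy, mul_add]
    · obtain ⟨U, hU, hpU, h⟩ := hV' p
      exact ⟨U, hU, hpU, fun x hx K hK hKU hx0 =>
        (h K hK hKU x 0 hx IsTestCov.zero.1 hx0 fun _ _ => rfl).1⟩
  have hN : ∀ w, IsTestCov w → N w = q0 * vecDelta γ I w := by
    refine IsTestCov.local_induction (by rw [hm.vec_zero, hzero1, mul_zero]) ?_ fun p => ?_
    · intro x y hx hy h1 h2
      rw [hm.vec_add x y hx hy, h1, h2, vecDelta_add hγ hx hy, mul_add]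
    · obtain ⟨U, hU, hpU, h⟩ := hV' p
      exact ⟨U, hU, hpU, fun w hw K hK hKU hw0 =>
        (h K hK hKU 0 w IsTestCov2.zero.1 hw (fun _ _ => rfl) hw0).2⟩
  have hle : ∀ ε : ℝ, 0 < ε → ε < 1 → 0 ≤ m0 ∧ (1 - ε) * |q0| ≤ κ * m0 * (1 + ε) := by
    intro ε hε hε1
    have he := chart_mem_atlas E4 (γ s0)
    obtain ⟨ℓ, ψ, hψ, hψ0, -, hℓ, ht, hv, htv⟩ := exists_detecting_fields hγ hs0 he
      (mem_chart_source E4 (γ s0)) isOpen_univ (mem_univ _) hε hε1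
    set x := covSq (chartAt E4 (γ s0)) ℓ ψ with hx
    set w := Spacetime.elemCovSum (chartAt E4 (γ s0)) (fun i y => ℓ i * ψ y) with hw
    have hxt : IsTestCov2 x := isTestCov2_covSq he ℓ hψ
    have hwt : IsTestCov w := isTestCov_detecting he hψ ℓ
    have h1 : 0 ≤ L x := hm.nonneg hxt (nonnegField_covSq he hψ0 fun y hy hn =>
      (sq_nonneg _).trans_lt (hℓ y hy hn))
    rw [hL x hxt] at h1
    have hm0' : 0 ≤ m0 := nonneg_of_mul_nonneg_left h1 ht
    have h2 : (1 - ε) * |N w| ≤ κ * L x := by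
      have h3 := hm.le (κ • x) ((1 - ε) • w) (hxt.const_smul κ) (hwt.const_smul _)
        fun p T J hTJ => by
          rw [Pi.smul_apply, Pi.smul_apply, contract_smul_right]
          refine le_of_eq_of_le ?_ (hTJ.abs_pairing_le he hψ0 hℓ)
          refine (abs_mul (1 - ε) (w p J)).trans ?_
          rw [abs_of_nonneg (sub_nonneg.2 hε1.le)]
      rwa [hm.smul _ _ hxt, hm.vec_smul _ _ hwt, abs_mul, abs_of_nonneg (sub_nonneg.2 hε1.le)]
        at h3
    rw [hL x hxt, hN w hwt, abs_mul, abs_of_pos hv] at h2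
    refine ⟨hm0', le_of_mul_le_mul_right ?_ hv⟩
    calc (1 - ε) * |q0| * vecDelta γ I w = (1 - ε) * (|q0| * vecDelta γ I w) := by ring
      _ ≤ κ * (m0 * tensorDelta γ I x) := h2
      _ = κ * m0 * tensorDelta γ I x := by ring
      _ ≤ κ * m0 * ((1 + ε) * vecDelta γ I w) :=
        mul_le_mul_of_nonneg_left htv (mul_nonneg hκ hm0')
      _ = κ * m0 * (1 + ε) * vecDelta γ I w := by ring
  refine ⟨m0, q0, (hle (1 / 2) (by norm_num) (by norm_num)).1, ?_, hL, hN, ?_⟩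
  · have h1 : Tendsto (fun ε : ℝ => (1 - ε) * |q0|) (𝓝[>] 0) (𝓝 ((1 - 0) * |q0|)) :=
      (Continuous.tendsto (by fun_prop) 0).mono_left nhdsWithin_le_nhds
    have h2 : Tendsto (fun ε : ℝ => κ * m0 * (1 + ε)) (𝓝[>] 0) (𝓝 (κ * m0 * (1 + 0))) :=
      (Continuous.tendsto (by fun_prop) 0).mono_left nhdsWithin_le_nhds
    have h3 := le_of_tendsto_of_tendsto h1 h2 (by
      filter_upwards [Ioo_mem_nhdsGT (zero_lt_one' ℝ)] with ε hε using (hle ε hε.1 hε.2).2)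
    simpa using h3
  · intro e he s hs hse i
    obtain ⟨U, hU, hsU, m', q', h, hlor⟩ := exists_isPointMatter hγ hs hF hFanti hκ hm hoff he hse
    obtain ⟨h1, h2⟩ := (hall ⟨s, hs⟩).unique hγ hs (hV _) hU (hsV ⟨s, hs⟩) hsU h
    rw [h1, h2]
    exact hlor i

/-! ### Convergence -/

/-- Matter that concentrates on the curve, and whose action on some test field is normalized,
converges along a subsequence to the matter of a charged particle. -/
theorem exists_subseq_tendsto (hγ : IsTimelikeCurve g γ I) (hF : SmoothCov2 F)
    (hFanti : ∀ p v w, F p v w = -F p w v) (hκ : 0 ≤ κ) {Ln : ℕ → CovTensor M → ℝ}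
    {Nn : ℕ → CovField M → ℝ} (hm : ∀ n, IsMatter g F κ (Ln n) (Nn n))
    (hoff : ∀ K, IsCompact K → K ⊆ (γ '' I)ᶜ → ∀ x w, SmoothCov2 x → SmoothCov w →
      (∀ p, p ∉ K → x p = 0) → (∀ p, p ∉ K → w p = 0) →
      Tendsto (fun n => Ln n x) atTop (𝓝 0) ∧ Tendsto (fun n => Nn n w) atTop (𝓝 0))
    {Φ : CovTensor M} (hΦ : IsTestCov2 Φ) (hone : ∀ n, Ln n Φ = 1)
    (hb : ∀ p, BoundedNear g κ Ln p) :
    ∃ φ : ℕ → ℕ, ∃ m q : ℝ, 0 < m ∧ |q| ≤ κ * m ∧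
      (∀ x, IsTestCov2 x → Tendsto (fun n => Ln (φ n) x) atTop (𝓝 (m * tensorDelta γ I x))) ∧
      (∀ w, IsTestCov w → Tendsto (fun n => Nn (φ n) w) atTop (𝓝 (q * vecDelta γ I w))) ∧
      ∀ e ∈ atlas E4 M, ∀ s ∈ I, γ s ∈ e.source → ∀ i,
        m * (deriv (deriv (curveCoord γ e i)) s
          + ∑ j, ∑ k, christoffel g e i j k (e (γ s)) * deriv (curveCoord γ e j) s
            * deriv (curveCoord γ e k) s)
        = q * ∑ k, mixedComp g F e i k (e (γ s)) * deriv (curveCoord γ e k) s := by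
  have hbL : ∀ x, IsTestCov2 x → ∃ B, ∀ n, Ln n x ∈ Icc (-B) B := by
    rintro x ⟨hx, K, hK, hx0⟩
    obtain ⟨B, hB⟩ := exists_tensor_bound hm hK (fun p _ => hb p) hx hx0
    exact ⟨B, fun n => abs_le.1 (hB n)⟩
  have hbN : ∀ w, IsTestCov w → ∃ B, ∀ n, Nn n w ∈ Icc (-B) B := by
    rintro w ⟨hw, K, hK, hw0⟩
    obtain ⟨B, hB⟩ := exists_bound_of_boundedNear hm hK (fun p _ => hb p) IsTestCov2.zero.1
      (fun _ _ => rfl) hw hw0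
    exact ⟨B, fun n => abs_le.1 (hB n).2⟩
  -- a subsequence along which the charge converges
  obtain ⟨s0, hs0⟩ := hγ.nontrivial.nonempty
  have he := chart_mem_atlas E4 (γ s0)
  obtain ⟨ℓ, ψ, hψ, -, -, -, -, hv, -⟩ := exists_detecting_fields hγ hs0 he
    (mem_chart_source E4 (γ s0)) isOpen_univ (mem_univ _) (ε := 1 / 2) (by norm_num) (by norm_num)
  have hw0t := isTestCov_detecting he hψ ℓ
  set w0 := elemCovSum (chartAt E4 (γ s0)) (fun i y => ℓ i * ψ y) with hw0
  obtain ⟨B0, hB0⟩ := hbN w0 hw0t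
  obtain ⟨a, -, φ, hφ, ha⟩ := isCompact_Icc.tendsto_subseq hB0
  -- the limit along an ultrafilter is determined by `Φ` and `w0`
  have key : ∀ U : Ultrafilter ℕ, (U : Filter ℕ) ≤ atTop → ∃ m q : ℝ, 0 ≤ m ∧ |q| ≤ κ * m ∧
      m * tensorDelta γ I Φ = 1 ∧ q * vecDelta γ I w0 = a ∧
      (∀ x, IsTestCov2 x → Tendsto (fun n => Ln (φ n) x) U (𝓝 (m * tensorDelta γ I x))) ∧
      (∀ w, IsTestCov w → Tendsto (fun n => Nn (φ n) w) U (𝓝 (q * vecDelta γ I w))) ∧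
      ∀ e ∈ atlas E4 M, ∀ s ∈ I, γ s ∈ e.source → ∀ i,
        m * (deriv (deriv (curveCoord γ e i)) s
          + ∑ j, ∑ k, christoffel g e i j k (e (γ s)) * deriv (curveCoord γ e j) s
            * deriv (curveCoord γ e k) s)
        = q * ∑ k, mixedComp g F e i k (e (γ s)) * deriv (curveCoord γ e k) s := by
    intro U hU
    have hφU : Tendsto φ U atTop := hφ.tendsto_atTop.mono_left hU
    have hLlim : ∀ x, ∃ b, IsTestCov2 x → Tendsto (fun n => Ln (φ n) x) U (𝓝 b) := by
      intro x
      by_cases hx : IsTestCov2 x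
      · obtain ⟨B, hB⟩ := hbL x hx
        obtain ⟨b, -, hb⟩ := isCompact_Icc.ultrafilter_le_nhds' (U.map fun n => Ln (φ n) x)
          (Ultrafilter.mem_map.2 (univ_mem' fun n => hB (φ n)))
        exact ⟨b, fun _ => hb⟩
      · exact ⟨0, fun h => absurd h hx⟩
    have hNlim : ∀ w, ∃ b, IsTestCov w → Tendsto (fun n => Nn (φ n) w) U (𝓝 b) := by
      intro w
      by_cases hw : IsTestCov w
      · obtain ⟨B, hB⟩ := hbN w hw
        obtain ⟨b, -, hb⟩ := isCompact_Icc.ultrafilter_le_nhds' (U.map fun n => Nn (φ n) w)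
          (Ultrafilter.mem_map.2 (univ_mem' fun n => hB (φ n)))
        exact ⟨b, fun _ => hb⟩
      · exact ⟨0, fun h => absurd h hw⟩
    choose L hL using hLlim
    choose N hN using hNlim
    have hmU : IsMatter g F κ L N := IsMatter.of_tendsto (fun n => hm (φ n)) hF hL hN
    have hoffU : VanishesOff (γ '' I) L N := by
      intro K hK hKO x w hx hw hx0 hw0
      obtain ⟨h1, h2⟩ := hoff K hK hKO x w hx hw hx0 hw0
      exact ⟨tendsto_nhds_unique (hL x ⟨hx, K, hK, hx0⟩) (h1.comp hφU),
        tendsto_nhds_unique (hN w ⟨hw, K, hK, hw0⟩) (h2.comp hφU)⟩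
    obtain ⟨m, q, hm0, hq, hLm, hNq, hlor⟩ := hmU.exists_mass_charge hγ hF hFanti hκ hoffU
    refine ⟨m, q, hm0, hq, ?_, ?_, fun x hx => ?_, fun w hw => ?_, hlor⟩
    · rw [← hLm Φ hΦ]
      refine tendsto_nhds_unique (hL Φ hΦ) ?_
      simp only [hone]
      exact tendsto_const_nhds
    · rw [← hNq w0 hw0t]
      exact tendsto_nhds_unique (hN w0 hw0t) (ha.mono_left hU)
    · rw [← hLm x hx]
      exact hL x hx
    · rw [← hNq w hw]
      exact hN w hw
  obtain ⟨m, q, hm0, hq, hmΦ, hqw, -, -, hlor⟩ := key (Ultrafilter.of atTop) (Ultrafilter.of_le _)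
  have hΦ0 : tensorDelta γ I Φ ≠ 0 := right_ne_zero_of_mul (a := m) (by rw [hmΦ]; exact one_ne_zero)
  have hmpos : 0 < m := lt_of_le_of_ne hm0 (Ne.symm (left_ne_zero_of_mul
    (b := tensorDelta γ I Φ) (by rw [hmΦ]; exact one_ne_zero)))
  have huniq : ∀ U : Ultrafilter ℕ, (U : Filter ℕ) ≤ atTop →
      (∀ x, IsTestCov2 x → Tendsto (fun n => Ln (φ n) x) U (𝓝 (m * tensorDelta γ I x))) ∧
      ∀ w, IsTestCov w → Tendsto (fun n => Nn (φ n) w) U (𝓝 (q * vecDelta γ I w)) := by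
    intro U hU
    obtain ⟨m', q', -, -, hmΦ', hqw', hL, hN, -⟩ := key U hU
    have h1 : m' = m := mul_right_cancel₀ hΦ0 (hmΦ'.trans hmΦ.symm)
    have h2 : q' = q := mul_right_cancel₀ hv.ne' (hqw'.trans hqw.symm)
    rw [h1] at hL
    rw [h2] at hN
    exact ⟨hL, hN⟩
  exact ⟨φ, m, q, hmpos, hq,
    fun x hx => (tendsto_iff_ultrafilter _ _ _).2 fun U hU => (huniq U hU).1 x hx,
    fun w hw => (tendsto_iff_ultrafilter _ _ _).2 fun U hU => (huniq U hU).2 w hw, hlor⟩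

end Global

end Spacetime

end

theorem theorem3 {M : Type*} [TopologicalSpace M] [T2Space M] [SecondCountableTopology M]
    [ConnectedSpace M] [ChartedSpace Spacetime.E4 M] [IsManifold (𝓡 4) ∞ M]
    [MeasurableSpace M] [BorelSpace M]
    (g : Spacetime.LorentzMetric M)
    (F : Spacetime.CovTensor M) (hF : Spacetime.SmoothCov2 F)
    (hFanti : ∀ p v w, F p v w = -F p w v)
    (γ : ℝ → M) (I : Set ℝ) (hγ : Spacetime.IsTimelikeCurve g γ I)
    (C : Set (Spacetime.ContraTensor M × Spacetime.VecField M))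
    (hsmooth : ∀ P ∈ C, Spacetime.SmoothContra2 P.1 ∧ Spacetime.SmoothVec P.2)
    (hdec : ∀ P ∈ C, ∀ p, Spacetime.DominantAt g p (P.1 p))
    (hdiv : ∀ P ∈ C, Spacetime.IsDivFree g P.2)
    (hforce : ∀ P ∈ C, Spacetime.SatisfiesForceLaw g F P.1 P.2)
    (κ : ℝ) (hκ : 0 ≤ κ) (hbound : Spacetime.BoundsChargeToMass g κ C)
    (htrack : Spacetime.Tracks g (Prod.fst '' C) γ I) :
    ∃ κ' : ℝ, |κ'| ≤ κ ∧
      (∃ S : ℕ → Spacetime.ContraTensor M × Spacetime.VecField M,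
        (∀ n, ∃ c : ℝ, 0 < c ∧ ∃ P ∈ C, S n = c • P) ∧
        Spacetime.ConvergesToCharge g S κ' γ I) ∧
      Spacetime.IsLorentzForceCurve g F κ' γ I := by
  obtain ⟨Q, hQ, hm, hoff, s0, hs0, Φ, hΦ, hone, hb0⟩ :=
    Spacetime.exists_concentrating_sequence hγ hF hκ hsmooth hdec hdiv hforce hbound htrack
  have hO : IsOpen (γ '' I)ᶜ := by
    have := hγ.isClosed_image isClosed_univ
    rw [inter_univ] at this
    exact this.isOpen_compl
  have hb := hγ.boundedNear_everywhere hF hκ hm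
    (fun p hp => Spacetime.boundedNear_of_tendsto hκ hO (fun K hK hKO x hx hx0 =>
      (hoff K hK hKO x 0 hx Spacetime.IsTestCov.zero.1 hx0 fun _ _ => rfl).1) hp) hs0 hb0
  obtain ⟨φ, m, q, hm0, hq, hL, hN, hlor⟩ :=
    Spacetime.exists_subseq_tendsto hγ hF hFanti hκ hm hoff hΦ hone hb
  refine ⟨q / m, ?_, ⟨fun n => m⁻¹ • Q (φ n), fun n => ?_, fun x hx => ?_, fun w hw => ?_⟩, ?_⟩
  · rwa [abs_div, abs_of_pos hm0, div_le_iff₀ hm0]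
  · obtain ⟨c, hc, P, hP, hQP⟩ := hQ (φ n)
    exact ⟨m⁻¹ * c, mul_pos (inv_pos.2 hm0) hc, P, hP, by
      change m⁻¹ • Q (φ n) = _
      rw [hQP]
      exact Prod.ext (funext fun p => smul_smul m⁻¹ c (P.1 p))
        (funext fun p => smul_smul m⁻¹ c (P.2 p))⟩
  · have h1 := (hL x hx).const_mul m⁻¹
    rw [inv_mul_cancel_left₀ hm0.ne'] at h1
    exact h1.congr fun n => (Spacetime.tensorAction_smul_left g (Q (φ n)).1 m⁻¹ x).symm
  · have h1 := (hN w hw).const_mul m⁻¹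
    rw [← mul_assoc, inv_mul_eq_div] at h1
    exact h1.congr fun n => (Spacetime.vecAction_smul_left g (Q (φ n)).2 m⁻¹ w).symm
  · intro e he s hs hse i
    rw [div_mul_eq_mul_div, ← hlor e he s hs hse i, mul_div_cancel_left₀ _ hm0.ne']
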